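/- Let $d_k(n)$ be the number of ways of writing $n$ as an ordered product of $k$ positive integers, and let $\Delta_k(x,h)$ be the error term in the general additive divisor problem, $$\Delta_k(x,h)=\sum_{n\le x}d_k(n)d_k(n+h)-\int_0^x\mathfrak S_k(u,h)\,du,\qquad \mathfrak S_k(u,h)=\sum_{q=1}^\infty\frac{c_q(h)}{q^2}\,Q_k(u,q)^2 ,$$ where $c_q(h)=\sum_{d\mid(h,q)}d\,\mu(q/d)$ is Ramanujan's sum and $$Q_k(u,q)=q\,\operatorname*{Res}_{s=1}\Bigl(\frac{u^{s-1}}{\varphi(q)}\sum_{n=1}^\infty\frac{d_k(n)c_q(n)}{n^{s}}\Bigr)$$ (the Dirichlet series being continued analytically from $\Re s>1$), so that the subtracted main term has the form $xP_{2k-2}(\log x;h)$ with a polynomial $P_{2k-2}(\,\cdot\,;h)$ of degree $2k-2$ whose coefficients depend on $k$ and $h$. For $\varepsilon>0$ put $$G_k(M;T)=\sup_{\substack{M\le x\le 2M\\ 1\le t\le M^{1+\varepsilon}/T}}\Bigl|\sum_{h\le t}\Delta_k(x,h)\Bigr| .$$ Let $k\ge 3$ be a fixed integer, and let $a_k\ge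 0$, $b_k\ge 1$ and $c>0$ be constants such that, for every sufficiently small $\varepsilon>0$, $$G_k(M;T)\ll_{k,\varepsilon}T^{a_k+\varepsilon}M^{b_k+\varepsilon}\qquad (T^{1+\varepsilon}\le M\le c\,T^{k/2},\ T\ge T_0(\varepsilon)).$$ Then, for every $\varepsilon>0$ and all sufficiently large $T$, $$\int_0^T|\zeta(\tfrac12+it)|^{2k}\,dt\ll_{k,\varepsilon}T^{1+\varepsilon}\Bigl(1+T^{a_k+\frac k2(b_k-1)}\Bigr).$$ The implied constants may also depend on $a_k$, $b_k$, $c$. -/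

import Mathlib

open scoped ENNReal

noncomputable section

namespace AdditiveDivisor

/-- The divisor function `d_k(n)`: the number of ways of writing `n` as an ordered product of
`k` positive integers, i.e. the `k`-fold Dirichlet convolution power of the constant function
`1`. -/
def dk (k n : ℕ) : ℕ := (ArithmeticFunction.zeta ^ k) n

/-- Ramanujan's sum `c_q(h) = ∑_{d ∣ (h, q)} d μ(q / d)`, for `q, h ≥ 1`. -/
def ramanujanSum (q h : ℕ) : ℤ :=
  ∑ d ∈ (Nat.gcd h q).divisors, (d : ℤ) * ArithmeticFunction.moebius (q / d)

/-- The factor `g_k(s, e)` for which `∑_{n ≥ 1} d_k(e n) n^{-s} = ζ(s)^k g_k(s, e)` when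
`Re s > 1`; it is the product over the primes `p ∣ e`, with `p^α` exactly dividing `e`, of
`(1 - p^{-s})^k ∑_{j ≥ 0} d_k(p^{α + j}) p^{-j s}`, and this converges for `Re s > 0`. -/
def localFactor (k : ℕ) (s : ℂ) (e : ℕ) : ℂ :=
  ∏ p ∈ e.primeFactors,
    (1 - (p : ℂ) ^ (-s)) ^ k *
      ∑' j : ℕ, (dk k (p ^ (e.factorization p + j)) : ℂ) * (p : ℂ) ^ (-((j : ℂ) * s))

/-- The analytic continuation to `Re s > 0`, `s ≠ 1`, of
`φ(q)⁻¹ ∑_{n ≥ 1} d_k(n) c_q(n) n^{-s}`, the mean over the `a` coprime to `q` of the series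
`∑_{n ≥ 1} d_k(n) e(a n / q) n^{-s}`; all of these have the same polar part at `s = 1`. -/
def twistedSeries (k q : ℕ) (s : ℂ) : ℂ :=
  riemannZeta s ^ k *
    ((∑ e ∈ q.divisors,
        (ArithmeticFunction.moebius (q / e) : ℂ) * (e : ℂ) ^ (1 - s) * localFactor k s e) /
      (Nat.totient q : ℂ))

/-- `Q_k(x, q) = q · Res_{s = 1} (twistedSeries k q s · x^{s - 1})`, a real polynomial in `log x`
for `x > 0`. The only singularity of the function in `Re s > 0` is the pole at `s = 1`, so the
residue is the integral over a circle about `1`, divided by `2πi`. -/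
def Qk (k : ℕ) (x : ℝ) (q : ℕ) : ℝ :=
  (q : ℝ) *
    ((2 * (Real.pi : ℂ) * Complex.I)⁻¹ *
      (∮ s in C(1, 1 / 2), twistedSeries k q s * (x : ℂ) ^ (s - 1))).re

/-- The singular series `∑_{q ≥ 1} c_q(h) q⁻² Q_k(x, q)²`. -/
def singularSeries (k : ℕ) (x : ℝ) (h : ℕ) : ℝ :=
  ∑' q : ℕ+, (ramanujanSum q h : ℝ) / ((q : ℕ) : ℝ) ^ 2 * Qk k x q ^ 2

/-- The main term `x P_{2k-2}(log x; h)` for the sum of `d_k(n) d_k(n + h)` over `n ≤ x`: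
the integral of the singular series over `[0, x]`. -/
def mainTerm (k : ℕ) (x : ℝ) (h : ℕ) : ℝ :=
  ∫ u in (0 : ℝ)..x, singularSeries k u h

/-- The error term `Δ_k(x, h) = ∑_{n ≤ x} d_k(n) d_k(n + h) - x P_{2k-2}(log x; h)`. -/
def Delta (k : ℕ) (x : ℝ) (h : ℕ) : ℝ :=
  (∑ n ∈ Finset.Icc 1 ⌊x⌋₊, (dk k n : ℝ) * (dk k (n + h) : ℝ)) - mainTerm k x h

/-- `G_k(M; T)`, the supremum of `|∑_{h ≤ t} Δ_k(x, h)|` over `M ≤ x ≤ 2M` and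
`1 ≤ t ≤ M^{1+ε} / T`, as an extended nonnegative real. -/
def G (k : ℕ) (ε M T : ℝ) : ℝ≥0∞ :=
  ⨆ x ∈ Set.Icc M (2 * M), ⨆ t ∈ Set.Icc 1 (M ^ (1 + ε) / T),
    ENNReal.ofReal |∑ h ∈ Finset.Icc 1 ⌊t⌋₊, Delta k x h|

end AdditiveDivisor

end

section

open Complex Filter Topology MeasureTheory Set

namespace AdditiveDivisor

/-! ### Divisor functions -/

/-! Put s = 1/2 + it and weight ζ(z)^k on the critical line by the kernel e^{(z-s)y + (z-s)²}; the
normalised integral is `critB k y t`. As a function of y it is a Fourier transform, and its integral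
over all y is ζ(s)^k (`integral_critB`). Moving the line to Re z = 2 gives `critB` = `dirichletD` -
`polarD` (`critB_eq`): a smoothed Dirichlet polynomial with n of size about e^y, minus the residue
at 1.

The integral over y can be confined to [0, Y]. For y ≤ 0 everything is bounded, and for very large y
a line far to the left makes `critB` small. In between, the functional equation replaces `critB` by
a Gaussian average of the Dirichlet series of ζ^k cut off at e^Y
(`exists_enorm_critB_le_cutoffZeta`), and that series is itself the integral of `dirichletD` over y
≤ Y. This works once e^{2Y} exceeds T^k by a small power of T. The moment over [T, 2T] is then
bounded, up to logarithms, by T plus the Gaussian mean squares `meanSq k y τ` with 0 ≤ y ≤ Y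
(`exists_moment_le_meanSq`).

Let D and P be the two parts of `critB`. Since P decays like a Gaussian in t and `critB` is small
for bounded t, the cross term of `critB` and P is bounded, and the mean square of `critB` is at most
that of D minus that of P, plus O(1) (`exists_meanSq_le_sub`). Parseval with a Gaussian weight turns
the mean square of D into a diagonal, which is harmless, and a sum of d_k(n) d_k(n+h) F(n,h) over
shifts h up to about e^y τ^{δ-1}, with F a smooth weight. Partial summation in n produces a main
term with the singular series and an error with `Delta`. A second partial summation, in h, leaves
only the sums of `Delta` over h ≤ j, which are bounded by `G` (`abs_sum_errorPart_le`).

In the main term, summation of c_q(h) against a smooth weight kills every q except q = 1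
(`exists_abs_sum_singularSeries_sub_le`), so it is essentially the double integral of Q_k(x,1)²
F(x,h). On the other side, P is the Mellin transform of the density Q_k(x,1) x^{-1/2} times the same
Gaussian, so the same Parseval formula writes its mean square as an energy. Positivity and
monotonicity of Q_k(x,1) for large x show that this energy is at least the main term, up to O(1)
(`exists_le_integral_polarD_sq`). The main term therefore cancels, and this one-sided inequality
replaces any asymptotic evaluation.

With e^y at most τ^{k/2}, the hypothesis on `G` gives mean squares of size τ^{1+ε}(1 +
τ^{a+(k/2)(b-1)}). The hypothesis stops at length cτ^{k/2} while the length needed is slightly above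
T^{k/2}, so the weight has width τ = T^σ with σ slightly larger than 1. Lengths near τ, below the
range of the hypothesis, are handled trivially (`exists_meanSq_le_of_short`). -/

lemma dk_zero_right (k : ℕ) : dk k 0 = 0 := by simp [dk]

lemma dk_succ (k n : ℕ) : dk (k + 1) n = ∑ d ∈ n.divisors, dk k d := by
  simp only [dk, pow_succ, ArithmeticFunction.mul_zeta_apply]

lemma dk_le_card_divisors_pow (k n : ℕ) : dk k n ≤ n.divisors.card ^ k := by
  induction k generalizing n with
  | zero => simp only [dk, pow_zero, ArithmeticFunction.one_apply]; split_ifs <;> simp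
  | succ k ih =>
    rw [dk_succ, pow_succ']
    calc ∑ d ∈ n.divisors, dk k d ≤ ∑ d ∈ n.divisors, n.divisors.card ^ k := by
          refine Finset.sum_le_sum fun d hd => (ih d).trans ?_
          exact Nat.pow_le_pow_left (Finset.card_le_card
            (Nat.divisors_subset_of_dvd (Nat.pos_of_mem_divisors hd |>.ne' |> fun _ =>
              (Nat.mem_divisors.1 hd).2) (Nat.dvd_of_mem_divisors hd))) k
      _ = _ := by simp

/-- Both sides factor over primes. If p^ε ≥ 2 then a + 1 ≤ 2^a ≤ p^{aε}, so such primes cost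
nothing. Each of the fewer than P remaining primes costs at most c, because 1 + aε log 2 ≤ 2^{aε}
and c is at least both 1 and 1/(ε log 2). -/
lemma card_divisors_le_rpow {ε : ℝ} (hε : 0 < ε) :
    ∃ C : ℝ, 1 ≤ C ∧ ∀ n : ℕ, (n.divisors.card : ℝ) ≤ C * (n : ℝ) ^ ε := by
  obtain ⟨P, hP⟩ := exists_nat_gt ((2 : ℝ) ^ (1 / ε))
  set c : ℝ := max 1 (1 / (ε * Real.log 2)) with hc
  have hl2 : 0 < Real.log 2 := Real.log_pos (by norm_num)
  have hc1 : 1 ≤ c := le_max_left _ _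
  refine ⟨c ^ P, one_le_pow₀ hc1, fun n => ?_⟩
  rcases eq_or_ne n 0 with rfl | hn
  · simp [Real.zero_rpow hε.ne']
  have key : ∀ p ∈ n.primeFactors, ((n.factorization p + 1 : ℕ) : ℝ) ≤
      (if p < P then c else 1) * ((p : ℝ) ^ n.factorization p) ^ ε := by
    intro p hp
    have hpp := Nat.prime_of_mem_primeFactors hp
    set a := n.factorization p
    have hp2 : (2 : ℝ) ≤ p := by exact_mod_cast hpp.two_le
    have e1 : ((p : ℝ) ^ a) ^ ε = ((p : ℝ) ^ ε) ^ a := by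
      rw [← Real.rpow_natCast, ← Real.rpow_natCast, ← Real.rpow_mul (by positivity),
        ← Real.rpow_mul (by positivity), mul_comm]
    rw [e1]
    split_ifs with hlt
    · have h1 : 1 + (a : ℝ) * (ε * Real.log 2) ≤ ((p : ℝ) ^ ε) ^ a := by
        calc 1 + (a : ℝ) * (ε * Real.log 2) ≤ Real.exp (a * (ε * Real.log 2)) := by
              rw [add_comm]; exact Real.add_one_le_exp _
          _ = ((2 : ℝ) ^ ε) ^ a := by
              rw [Real.exp_nat_mul, Real.rpow_def_of_pos (by norm_num), mul_comm ε]
          _ ≤ _ := by gcongr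
      have h2 : 1 ≤ c * (ε * Real.log 2) := by
        have : 1 / (ε * Real.log 2) ≤ c := le_max_right _ _
        rwa [div_le_iff₀ (by positivity)] at this
      push_cast
      have ha : (0 : ℝ) ≤ a := by positivity
      nlinarith [mul_le_mul_of_nonneg_left h1 (by linarith : (0 : ℝ) ≤ c),
        mul_le_mul_of_nonneg_left h2 ha]
    · have h1 : (2 : ℝ) ≤ (p : ℝ) ^ ε := by
        have : (2 : ℝ) ^ (1 / ε) ≤ p := hP.le.trans (by exact_mod_cast not_lt.1 hlt)
        calc (2 : ℝ) = ((2 : ℝ) ^ (1 / ε)) ^ ε := by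
              rw [← Real.rpow_mul (by norm_num)]; field_simp; simp
          _ ≤ _ := by gcongr
      rw [one_mul]
      calc ((a + 1 : ℕ) : ℝ) ≤ (2 : ℝ) ^ a := by exact_mod_cast Nat.lt_two_pow_self
        _ ≤ _ := by gcongr
  rw [Nat.card_divisors hn]
  push_cast
  calc ∏ p ∈ n.primeFactors, ((n.factorization p : ℝ) + 1)
      ≤ ∏ p ∈ n.primeFactors, (if p < P then c else 1) * ((p : ℝ) ^ n.factorization p) ^ ε :=
        Finset.prod_le_prod (fun _ _ => by positivity)
          (fun p hp => by exact_mod_cast key p hp)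
    _ = (∏ p ∈ n.primeFactors, (if p < P then c else 1)) * (n : ℝ) ^ ε := by
        rw [Finset.prod_mul_distrib, Real.finsetProd_rpow _ _ (fun _ _ => by positivity)]
        congr 2
        conv_rhs => rw [← Nat.prod_factorization_pow_eq_self hn]
        rw [Finsupp.prod, Nat.support_factorization]; push_cast; rfl
    _ ≤ _ := by
        gcongr
        rw [Finset.prod_ite]
        simp only [Finset.prod_const, one_pow, mul_one]
        refine pow_le_pow_right₀ hc1 ?_
        calc _ ≤ (Finset.range P).card := Finset.card_le_card (fun p hp => by
              simp only [Finset.mem_filter] at hp; simpa using hp.2)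
          _ = P := by simp

lemma dk_le_rpow (k : ℕ) {ε : ℝ} (hε : 0 < ε) :
    ∃ C : ℝ, 1 ≤ C ∧ ∀ n : ℕ, (dk k n : ℝ) ≤ C * (n : ℝ) ^ ε := by
  have hk : (0 : ℝ) < k + 1 := by positivity
  obtain ⟨C, hC, h⟩ := card_divisors_le_rpow (div_pos hε hk)
  refine ⟨C ^ k, one_le_pow₀ hC, fun n => ?_⟩
  rcases eq_or_ne n 0 with rfl | hn
  · simp [dk_zero_right, Real.zero_rpow hε.ne']
  have hn1 : (1 : ℝ) ≤ n := by exact_mod_cast Nat.one_le_iff_ne_zero.2 hn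
  calc (dk k n : ℝ) ≤ (n.divisors.card : ℝ) ^ k := by exact_mod_cast dk_le_card_divisors_pow k n
    _ ≤ (C * (n : ℝ) ^ (ε / (k + 1))) ^ k := by gcongr; exact h n
    _ = C ^ k * (n : ℝ) ^ (ε / (k + 1) * k) := by
        rw [mul_pow, ← Real.rpow_natCast ((n : ℝ) ^ (ε / (k + 1))), ← Real.rpow_mul (by positivity)]
    _ ≤ _ := by
        gcongr
        rw [div_mul_eq_mul_div, div_le_iff₀ hk]; nlinarith

lemma dk_prime_pow_le (k : ℕ) {p : ℕ} (hp : p.Prime) (i : ℕ) : dk k (p ^ i) ≤ (i + 1) ^ k := by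
  simpa [Nat.divisors_prime_pow hp] using dk_le_card_divisors_pow k (p ^ i)

lemma LSeriesHasSum_dk (k : ℕ) {s : ℂ} (hs : 1 < s.re) :
    LSeriesHasSum (fun n => (dk k n : ℂ)) s (riemannZeta s ^ k) := by
  induction k with
  | zero =>
    have h : LSeries.term (fun n => (dk 0 n : ℂ)) s = fun n => if n = 1 then 1 else 0 := by
      have : (fun n => (dk 0 n : ℂ)) = LSeries.delta := by
        ext n; simp [dk, ArithmeticFunction.one_apply, LSeries.delta]
      rw [this]; ext n; exact LSeries.term_delta s n
    rw [LSeriesHasSum, h, pow_zero]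
    exact hasSum_ite_eq 1 1
  | succ k ih =>
    have h := ih.convolution (ArithmeticFunction.LSeriesHasSum_zeta hs)
    rw [← pow_succ] at h
    convert h using 1
    ext n
    rw [LSeries.convolution_def]
    simp only [dk, pow_succ, ArithmeticFunction.mul_apply]
    push_cast
    rfl

lemma summable_dk_mul_rpow (k : ℕ) {σ : ℝ} (hσ : 1 < σ) :
    Summable fun n : ℕ => (dk k n : ℝ) * (n : ℝ) ^ (-σ) := by
  obtain ⟨C, hC, h⟩ := dk_le_rpow k (ε := (σ - 1) / 2) (by linarith)
  have hs : Summable fun n : ℕ => C * (n : ℝ) ^ (-((σ + 1) / 2)) :=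
    (Real.summable_nat_rpow.2 (by linarith)).mul_left C
  refine Summable.of_nonneg_of_le (fun n => by positivity) (fun n => ?_) hs
  rcases eq_or_ne n 0 with rfl | hn
  · rw [dk_zero_right]; simp; positivity
  have hn1 : (0 : ℝ) < n := by exact_mod_cast Nat.pos_of_ne_zero hn
  calc (dk k n : ℝ) * (n : ℝ) ^ (-σ) ≤ C * (n : ℝ) ^ ((σ - 1) / 2) * (n : ℝ) ^ (-σ) := by
        gcongr; exact h n
    _ = _ := by rw [mul_assoc, ← Real.rpow_add hn1]; congr 2; ring

/-! ### The local factors and the polynomials `Q_k` -/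

/-- The bound is independent of p and of s in the half-plane, which gives uniform convergence. The
dependence on the exponent a is split off through a + j + 1 ≤ (a+1)(j+1). -/
lemma norm_localTerm_le (k a : ℕ) {p : ℕ} (hp : p.Prime) {s : ℂ} (hs : 1 / 4 < s.re) (j : ℕ) :
    ‖(dk k (p ^ (a + j)) : ℂ) * (p : ℂ) ^ (-((j : ℂ) * s))‖ ≤ ((a : ℝ) + 1) ^ k * (((j : ℝ) + 1) ^ k * ((2 : ℝ) ^ (-(1 / 4) : ℝ)) ^ j) := by
  have hp0 : (0 : ℝ) < p := by exact_mod_cast hp.pos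
  have hp2 : (2 : ℝ) ≤ p := by exact_mod_cast hp.two_le
  rw [norm_mul, ← ofReal_natCast p, norm_cpow_eq_rpow_re_of_pos hp0, ← mul_assoc,
    norm_natCast]
  have h1 : (dk k (p ^ (a + j)) : ℝ) ≤ ((a : ℝ) + 1) ^ k * ((j : ℝ) + 1) ^ k := by
    calc (dk k (p ^ (a + j)) : ℝ) ≤ (((a + j : ℕ) : ℝ) + 1) ^ k := by
          exact_mod_cast dk_prime_pow_le k hp (a + j)
      _ ≤ (((a : ℝ) + 1) * ((j : ℝ) + 1)) ^ k := by
          gcongr; push_cast; nlinarith [(Nat.cast_nonneg a : (0 : ℝ) ≤ a), (Nat.cast_nonneg j : (0 : ℝ) ≤ j),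
            mul_nonneg (Nat.cast_nonneg a : (0 : ℝ) ≤ a) (Nat.cast_nonneg j : (0 : ℝ) ≤ j)]
      _ = _ := mul_pow _ _ _
  have h2 : (p : ℝ) ^ (-((j : ℂ) * s)).re ≤ ((2 : ℝ) ^ (-(1 / 4) : ℝ)) ^ j := by
    have : (-((j : ℂ) * s)).re = -(s.re * j) := by simp [mul_comm]
    rw [this, ← Real.rpow_natCast, ← Real.rpow_mul (by norm_num)]
    calc (p : ℝ) ^ (-(s.re * j)) ≤ (2 : ℝ) ^ (-(s.re * j)) :=
          Real.rpow_le_rpow_of_nonpos (by norm_num) hp2 (by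
            have : (0 : ℝ) ≤ s.re * j := by positivity
            linarith)
      _ ≤ _ := by
          apply Real.rpow_le_rpow_of_exponent_le (by norm_num)
          have : (1 / 4 : ℝ) * j ≤ s.re * j := by gcongr
          linarith
  gcongr

lemma summable_add_one_pow_mul_geometric (k : ℕ) {ρ : ℝ} (h0 : 0 < ρ) (h1 : ρ < 1) :
    Summable fun j : ℕ => ((j : ℝ) + 1) ^ k * ρ ^ j := by
  have hr : ‖ρ‖ < 1 := by rwa [Real.norm_of_nonneg h0.le]
  have h0' : Summable fun j : ℕ => (j : ℝ) ^ k * ρ ^ j :=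
    summable_pow_mul_geometric_of_norm_lt_one k hr
  have h : Summable fun j : ℕ => ((j + 1 : ℕ) : ℝ) ^ k * ρ ^ (j + 1) :=
    h0'.comp_injective (add_left_injective 1)
  have e : (fun j : ℕ => ((j : ℝ) + 1) ^ k * ρ ^ j) =
      fun j : ℕ => ρ⁻¹ * (((j + 1 : ℕ) : ℝ) ^ k * ρ ^ (j + 1)) := by
    ext j
    have e : ρ ^ j = ρ⁻¹ * ρ ^ (j + 1) := by
      rw [pow_succ, mul_comm, mul_assoc, mul_inv_cancel₀ h0.ne', mul_one]
    rw [e, Nat.cast_add, Nat.cast_one, mul_left_comm]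
  rw [e]
  exact h.mul_left _

lemma summable_localTerm_bound (k a : ℕ) :
    Summable fun j : ℕ =>
      ((a : ℝ) + 1) ^ k * (((j : ℝ) + 1) ^ k * ((2 : ℝ) ^ (-(1 / 4) : ℝ)) ^ j) :=
  (summable_add_one_pow_mul_geometric k (Real.rpow_pos_of_pos two_pos _)
    (Real.rpow_lt_one_of_one_lt_of_neg one_lt_two (by norm_num))).mul_left _

lemma differentiableOn_localFactor (k e : ℕ) :
    DifferentiableOn ℂ (fun s => localFactor k s e) {s | 1 / 4 < s.re} := by
  have hopen : IsOpen {s : ℂ | 1 / 4 < s.re} := isOpen_lt continuous_const continuous_re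
  unfold localFactor
  refine DifferentiableOn.fun_finsetProd fun p hp => ?_
  have hpp := Nat.prime_of_mem_primeFactors hp
  have hp0 : (p : ℂ) ≠ 0 := by exact_mod_cast hpp.ne_zero
  refine DifferentiableOn.mul ?_ ?_
  · refine DifferentiableOn.pow (DifferentiableOn.sub (differentiableOn_const _) ?_) k
    exact fun s _ => ((differentiableAt_id.neg).const_cpow (Or.inl hp0)).differentiableWithinAt
  · refine differentiableOn_tsum_of_summable_norm
      (summable_localTerm_bound k (e.factorization p)) (fun j => ?_) hopen
      (fun j s hs => norm_localTerm_le k _ hpp hs j)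
    refine DifferentiableOn.mul (differentiableOn_const _) ?_
    exact fun s _ => (((differentiableAt_id.const_mul (j : ℂ)).neg).const_cpow
      (Or.inl hp0)).differentiableWithinAt

/-- Each prime contributes at most 2^k S (a+1)^k. As a + 1 ≥ 2, the constant 2^k S is absorbed by a
further power (a+1)^L, so the product is at most a fixed power of the number of divisors of e. -/
lemma exists_norm_localFactor_le (k : ℕ) {η : ℝ} (hη : 0 < η) :
    ∃ C : ℝ, 1 ≤ C ∧ ∀ e : ℕ, e ≠ 0 → ∀ s : ℂ, 1 / 4 < s.re →
      ‖localFactor k s e‖ ≤ C * (e : ℝ) ^ η := by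
  set S : ℝ := ∑' j : ℕ, (((j : ℝ) + 1) ^ k * ((2 : ℝ) ^ (-(1 / 4) : ℝ)) ^ j) with hS
  have hsum : Summable fun j : ℕ => (((j : ℝ) + 1) ^ k * ((2 : ℝ) ^ (-(1 / 4) : ℝ)) ^ j) := by
    simpa using summable_localTerm_bound k 0
  have hS0 : 0 ≤ S := tsum_nonneg fun j => by positivity
  obtain ⟨L, hL⟩ := pow_unbounded_of_one_lt ((2 : ℝ) ^ k * S) (one_lt_two)
  obtain ⟨C, hC, hd⟩ := card_divisors_le_rpow (ε := η / (L + k + 1)) (by positivity)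
  refine ⟨C ^ (L + k), one_le_pow₀ hC, fun e he s hs => ?_⟩
  have he1 : (1 : ℝ) ≤ e := by exact_mod_cast Nat.one_le_iff_ne_zero.2 he
  have hfac : ∀ p ∈ e.primeFactors, ‖(1 - (p : ℂ) ^ (-s)) ^ k *
      ∑' j : ℕ, (dk k (p ^ (e.factorization p + j)) : ℂ) * (p : ℂ) ^ (-((j : ℂ) * s))‖ ≤
      ((e.factorization p : ℝ) + 1) ^ (L + k) := by
    intro p hp
    have hpp := Nat.prime_of_mem_primeFactors hp
    have ha : 1 ≤ e.factorization p :=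
      (hpp.dvd_iff_one_le_factorization he).1 (Nat.dvd_of_mem_primeFactors hp)
    set a := e.factorization p
    have hp0 : (0 : ℝ) < p := by exact_mod_cast hpp.pos
    have hp1 : (1 : ℝ) ≤ p := by exact_mod_cast hpp.one_lt.le
    rw [norm_mul, norm_pow]
    have h1 : ‖1 - (p : ℂ) ^ (-s)‖ ≤ 2 := by
      calc ‖1 - (p : ℂ) ^ (-s)‖ ≤ ‖(1 : ℂ)‖ + ‖(p : ℂ) ^ (-s)‖ := norm_sub_le _ _
        _ ≤ 1 + 1 := by
            gcongr
            · simp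
            · rw [← ofReal_natCast p, norm_cpow_eq_rpow_re_of_pos hp0]
              exact Real.rpow_le_one_of_one_le_of_nonpos hp1 (by simp; linarith)
        _ = 2 := by norm_num
    have h2 : ‖∑' j : ℕ, (dk k (p ^ (a + j)) : ℂ) * (p : ℂ) ^ (-((j : ℂ) * s))‖ ≤
        ((a : ℝ) + 1) ^ k * S := by
      rw [hS, ← tsum_mul_left]
      exact tsum_of_norm_bounded (summable_localTerm_bound k a).hasSum
        (fun j => norm_localTerm_le k a hpp hs j)
    have ha' : (2 : ℝ) ≤ (a : ℝ) + 1 := by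
      have : (1 : ℝ) ≤ a := by exact_mod_cast ha
      linarith
    calc ‖1 - (p : ℂ) ^ (-s)‖ ^ k * _ ≤ 2 ^ k * (((a : ℝ) + 1) ^ k * S) := by gcongr
      _ = (2 ^ k * S) * ((a : ℝ) + 1) ^ k := by ring
      _ ≤ 2 ^ L * ((a : ℝ) + 1) ^ k := by gcongr
      _ ≤ ((a : ℝ) + 1) ^ L * ((a : ℝ) + 1) ^ k := by gcongr
      _ = _ := by rw [pow_add]
  calc ‖localFactor k s e‖ ≤ ∏ p ∈ e.primeFactors, ((e.factorization p : ℝ) + 1) ^ (L + k) := by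
        rw [localFactor, norm_prod]
        exact Finset.prod_le_prod (fun _ _ => norm_nonneg _) hfac
    _ = (e.divisors.card : ℝ) ^ (L + k) := by
        rw [Finset.prod_pow, Nat.card_divisors he]; push_cast; rfl
    _ ≤ (C * (e : ℝ) ^ (η / (L + k + 1))) ^ (L + k) := by gcongr; exact hd e
    _ = C ^ (L + k) * (e : ℝ) ^ (η / (L + k + 1) * (L + k)) := by
        rw [mul_pow, ← Real.rpow_natCast ((e : ℝ) ^ _), ← Real.rpow_mul (by positivity)]
        push_cast; rfl
    _ ≤ _ := by
        gcongr
        rw [div_mul_eq_mul_div, div_le_iff₀ (by positivity)]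
        nlinarith

lemma differentiableOn_twistedSeries (k q : ℕ) :
    DifferentiableOn ℂ (fun s => twistedSeries k q s) {s | 1 / 4 < s.re ∧ s ≠ 1} := by
  unfold twistedSeries
  refine DifferentiableOn.mul (DifferentiableOn.pow (fun s hs =>
    (differentiableAt_riemannZeta hs.2).differentiableWithinAt) k) (DifferentiableOn.div_const ?_ _)
  refine DifferentiableOn.fun_sum fun e he => ?_
  have he0 : (e : ℂ) ≠ 0 := by exact_mod_cast (Nat.pos_of_mem_divisors he).ne'
  refine DifferentiableOn.mul (DifferentiableOn.mul (differentiableOn_const _) ?_)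
    ((differentiableOn_localFactor k e).mono fun s hs => hs.1)
  exact fun s _ => (((differentiableAt_id.const_sub 1)).const_cpow
      (Or.inl he0)).differentiableWithinAt

lemma isOpen_residueDomain : IsOpen {s : ℂ | 1 / 4 < s.re ∧ s ≠ 1} :=
  (isOpen_lt continuous_const continuous_re).inter isOpen_ne

lemma mem_residueDomain {s : ℂ} (h0 : s ≠ 1) (h : ‖s - 1‖ ≤ 1 / 2) :
    s ∈ {s : ℂ | 1 / 4 < s.re ∧ s ≠ 1} := by
  refine ⟨?_, h0⟩
  have := (abs_re_le_norm (s - 1)).trans h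
  simp [abs_le] at this
  linarith [this.1]

/-- The circle in a residue at `1` may be shrunk. -/
lemma circleIntegral_eq_half {f : ℂ → ℂ} (hf : DifferentiableOn ℂ f {s | 1 / 4 < s.re ∧ s ≠ 1})
    {r : ℝ} (hr : 0 < r) (hr2 : r ≤ 1 / 2) :
    (∮ s in C(1, 1 / 2), f s) = ∮ s in C(1, r), f s := by
  refine circleIntegral_eq_of_differentiable_on_annulus_off_countable hr hr2 countable_empty ?_ ?_
  · refine hf.continuousOn.mono fun s hs => mem_residueDomain ?_ ?_
    · rintro rfl; exact hs.2 (by simpa using hr)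
    · simpa [dist_eq_norm] using hs.1
  · intro s hs
    have : s ∈ {s : ℂ | 1 / 4 < s.re ∧ s ≠ 1} := by
      refine mem_residueDomain ?_ ?_
      · rintro rfl; exact hs.1.2 (by simpa using hr.le)
      · rw [← dist_eq_norm]; exact (show dist s 1 < 1 / 2 from hs.1.1).le
    exact (hf s this).differentiableAt (isOpen_residueDomain.mem_nhds this)

/-- Gauss's identity with φ(d) ∣ φ(q). It bounds the factor q/φ(q) in `Qk` by the number of
divisors. -/
lemma self_le_totient_mul_card_divisors {q : ℕ} (hq : q ≠ 0) :
    q ≤ q.totient * q.divisors.card := by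
  calc q = ∑ d ∈ q.divisors, d.totient := (Nat.sum_totient q).symm
    _ ≤ ∑ d ∈ q.divisors, q.totient := Finset.sum_le_sum fun d hd =>
        Nat.le_of_dvd (Nat.totient_pos.2 (Nat.pos_of_ne_zero hq))
          (Nat.totient_dvd_of_dvd (Nat.dvd_of_mem_divisors hd))
    _ = _ := by simp [mul_comm]

lemma exists_riemannZeta_circle_bound {r : ℝ} (hr : 0 < r) :
    ∃ Z : ℝ, 1 ≤ Z ∧ ∀ s : ℂ, ‖s - 1‖ = r → ‖riemannZeta s‖ ≤ Z := by
  have hc : ContinuousOn (fun s => riemannZeta s) (Metric.sphere (1 : ℂ) r) := fun s hs =>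
    (differentiableAt_riemannZeta (by
      rintro rfl; simp at hs; linarith)).continuousAt.continuousWithinAt
  obtain ⟨Z, hZ⟩ := (isCompact_sphere (1 : ℂ) r).exists_bound_of_continuousOn hc
  exact ⟨max 1 Z, le_max_left _ _, fun s hs => (hZ s (by simpa [dist_eq_norm] using hs)).trans
    (le_max_right _ _)⟩

/-- The circle of the residue is shrunk to a radius r ≤ η/4, on which x^{s-1} costs at most the r-th
power of max(x, 1/x). Four factors q^r arise: from the number of terms, from e^{1-s}, from the local
factor and from q/φ(q). -/
lemma exists_Qk_bound (k : ℕ) {η : ℝ} (hη : 0 < η) :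
    ∃ C : ℝ, 1 ≤ C ∧ ∀ q : ℕ, q ≠ 0 → ∀ x : ℝ, 0 < x →
      |Qk k x q| ≤ C * (q : ℝ) ^ η * (max x x⁻¹) ^ η := by
  obtain ⟨r, hr, hrη, hr2⟩ : ∃ r : ℝ, 0 < r ∧ r ≤ η / 4 ∧ r ≤ 1 / 2 :=
    ⟨min (η / 4) (1 / 2), by positivity, min_le_left _ _, min_le_right _ _⟩
  obtain ⟨Z, hZ1, hZ⟩ := exists_riemannZeta_circle_bound hr
  obtain ⟨A, hA1, hA⟩ := exists_norm_localFactor_le k hr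
  obtain ⟨D, hD1, hD⟩ := card_divisors_le_rpow hr
  refine ⟨Z ^ k * D * D * A, ?_, fun q hq x hx => ?_⟩
  · have : 1 ≤ Z ^ k := one_le_pow₀ hZ1
    nlinarith [mul_le_mul this hD1 zero_le_one (by linarith), mul_le_mul (mul_le_mul this hD1 zero_le_one (by linarith)) hD1 zero_le_one (by positivity),
      mul_le_mul (mul_le_mul (mul_le_mul this hD1 zero_le_one (by linarith)) hD1 zero_le_one (by positivity)) hA1 zero_le_one (by positivity)]
  have hq0 : (0 : ℝ) < q := by exact_mod_cast Nat.pos_of_ne_zero hq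
  have hq1 : (1 : ℝ) ≤ q := by exact_mod_cast Nat.one_le_iff_ne_zero.2 hq
  have hφ : (0 : ℝ) < q.totient := by exact_mod_cast Nat.totient_pos.2 (Nat.pos_of_ne_zero hq)
  set X := max x x⁻¹ with hX
  have hX1 : 1 ≤ X := by
    rcases le_total 1 x with h | h
    · exact h.trans (le_max_left _ _)
    · exact (one_le_inv_iff₀.2 ⟨hx, h⟩).trans (le_max_right _ _)
  have hpt : ∀ s ∈ Metric.sphere (1 : ℂ) r, ‖twistedSeries k q s * (x : ℂ) ^ (s - 1)‖ ≤
      Z ^ k * (D * (q : ℝ) ^ r * ((q : ℝ) ^ r * (A * (q : ℝ) ^ r)) / q.totient) * X ^ r := by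
    intro s hs
    have hs' : ‖s - 1‖ = r := by simpa [dist_eq_norm] using hs
    have hre := (abs_re_le_norm (s - 1)).trans hs'.le
    simp only [sub_re, one_re, abs_le] at hre
    rw [norm_mul, twistedSeries, norm_mul, norm_pow, norm_div, norm_natCast]
    have hx1 : ‖(x : ℂ) ^ (s - 1)‖ ≤ X ^ r := by
      rw [norm_cpow_eq_rpow_re_of_pos hx]
      rcases le_total 1 x with h | h
      · calc x ^ (s - 1).re ≤ x ^ r := Real.rpow_le_rpow_of_exponent_le h (by simpa using hre.2)
          _ ≤ X ^ r := by gcongr; exact le_max_left _ _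
      · calc x ^ (s - 1).re ≤ x ^ (-r) :=
              Real.rpow_le_rpow_of_exponent_ge hx h (by simpa using hre.1)
          _ = x⁻¹ ^ r := by rw [Real.rpow_neg hx.le, Real.inv_rpow hx.le]
          _ ≤ X ^ r := by gcongr; exact le_max_right _ _
    have hsum : ‖∑ e ∈ q.divisors, (ArithmeticFunction.moebius (q / e) : ℂ) * (e : ℂ) ^ (1 - s) *
        localFactor k s e‖ ≤ D * (q : ℝ) ^ r * ((q : ℝ) ^ r * (A * (q : ℝ) ^ r)) := by
      calc _ ≤ ∑ e ∈ q.divisors, ((q : ℝ) ^ r * (A * (q : ℝ) ^ r)) := by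
            refine norm_sum_le_of_le _ fun e he => ?_
            have he0 : e ≠ 0 := (Nat.pos_of_mem_divisors he).ne'
            have he1 : (1 : ℝ) ≤ e := by exact_mod_cast Nat.one_le_iff_ne_zero.2 he0
            have heq : (e : ℝ) ≤ q := by
              exact_mod_cast Nat.le_of_dvd (Nat.pos_of_ne_zero hq) (Nat.dvd_of_mem_divisors he)
            rw [norm_mul, norm_mul, ← ofReal_natCast e,
              norm_cpow_eq_rpow_re_of_pos (by linarith)]
            have hμ : ‖((ArithmeticFunction.moebius (q / e) : ℤ) : ℂ)‖ ≤ 1 := by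
              rw [norm_intCast]; exact_mod_cast ArithmeticFunction.abs_moebius_le_one
            have h1 : (e : ℝ) ^ (1 - s).re ≤ (q : ℝ) ^ r := by
              calc (e : ℝ) ^ (1 - s).re ≤ (e : ℝ) ^ r :=
                    Real.rpow_le_rpow_of_exponent_le he1 (by simp; linarith)
                _ ≤ _ := by gcongr
            have h2 : ‖localFactor k s e‖ ≤ A * (q : ℝ) ^ r :=
              (hA e he0 s (by linarith)).trans (by gcongr)
            calc _ ≤ 1 * (q : ℝ) ^ r * (A * (q : ℝ) ^ r) := by gcongr
              _ = _ := by ring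
        _ = (q.divisors.card : ℝ) * ((q : ℝ) ^ r * (A * (q : ℝ) ^ r)) := by simp
        _ ≤ _ := by gcongr; exact hD q
    have hzz : ‖riemannZeta s‖ ^ k ≤ Z ^ k := by gcongr; exact hZ s hs'
    gcongr
  have hint := circleIntegral.norm_integral_le_of_norm_le_const hr.le hpt
  have hdiff : DifferentiableOn ℂ (fun s => twistedSeries k q s * (x : ℂ) ^ (s - 1))
      {s | 1 / 4 < s.re ∧ s ≠ 1} :=
    (differentiableOn_twistedSeries k q).mul fun s _ =>
      ((differentiableAt_id.sub_const 1).const_cpow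
        (Or.inl (by exact_mod_cast hx.ne'))).differentiableWithinAt
  rw [Qk, abs_mul, abs_of_pos hq0, circleIntegral_eq_half hdiff hr hr2]
  have h3 : ‖(2 * (Real.pi : ℂ) * I)⁻¹‖ = (2 * Real.pi)⁻¹ := by
    simp [abs_of_pos Real.pi_pos]
  calc (q : ℝ) * |_| ≤ q * ((2 * Real.pi)⁻¹ * (2 * Real.pi * r * (Z ^ k * (D * (q : ℝ) ^ r * ((q : ℝ) ^ r * (A * (q : ℝ) ^ r)) / q.totient) * X ^ r))) := by
        gcongr
        refine (abs_re_le_norm _).trans ?_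
        rw [norm_mul, h3]
        gcongr
    _ = r * ((Z ^ k * D * A) * ((q : ℝ) / q.totient) * (((q : ℝ) ^ r * (q : ℝ) ^ r) * (q : ℝ) ^ r) * X ^ r) := by
        have := Real.pi_pos
        field_simp
    _ ≤ 1 * ((Z ^ k * D * A) * (D * (q : ℝ) ^ r) * (((q : ℝ) ^ r * (q : ℝ) ^ r) * (q : ℝ) ^ r) * X ^ r) := by
        gcongr
        · linarith
        · rw [div_le_iff₀ hφ]
          calc (q : ℝ) ≤ q.totient * q.divisors.card := by
                exact_mod_cast self_le_totient_mul_card_divisors hq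
            _ ≤ q.totient * (D * (q : ℝ) ^ r) := by gcongr; exact hD q
            _ = _ := mul_comm _ _
    _ = (Z ^ k * D * D * A) * (q : ℝ) ^ (r + r + r + r) * X ^ r := by
        rw [Real.rpow_add hq0, Real.rpow_add hq0, Real.rpow_add hq0]; ring
    _ ≤ _ := by
        gcongr <;> linarith

/-! ### The polynomial `Q_k(x, 1)` and the singular series -/

lemma twistedSeries_one (k : ℕ) (s : ℂ) : twistedSeries k 1 s = riemannZeta s ^ k := by
  simp [twistedSeries, localFactor]

lemma continuous_twistedSeries_circleMap (k q : ℕ) :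
    Continuous fun θ : ℝ => twistedSeries k q (circleMap 1 (1 / 2) θ) := by
  rw [continuous_iff_continuousAt]
  intro θ
  have hm : circleMap 1 (1 / 2) θ ∈ {s : ℂ | 1 / 4 < s.re ∧ s ≠ 1} := by
    refine mem_residueDomain (circleMap_ne_center (by norm_num)) ?_
    rw [← dist_eq_norm]
    exact (circleMap_mem_sphere (1 : ℂ) (by norm_num : (0 : ℝ) ≤ 1 / 2) θ).le
  exact ContinuousAt.comp (f := fun θ : ℝ => circleMap 1 (1 / 2) θ) (g := twistedSeries k q)
    ((differentiableOn_twistedSeries k q).continuousOn.continuousAt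
    (isOpen_residueDomain.mem_nhds hm)) (continuous_circleMap 1 (1 / 2)).continuousAt

/-- `Q_k(x, q)` before taking the real part, as a function of `log x`. -/
noncomputable def residueLog (k q : ℕ) (L : ℝ) : ℂ :=
  (2 * (Real.pi : ℂ) * I)⁻¹ * ∮ s in C(1, 1 / 2), twistedSeries k q s * exp (L * (s - 1))

lemma Qk_eq_residueLog (k q : ℕ) {x : ℝ} (hx : 0 < x) :
    Qk k x q = q * (residueLog k q (Real.log x)).re := by
  have : ∀ s : ℂ, (x : ℂ) ^ (s - 1) = exp ((Real.log x : ℝ) * (s - 1)) := fun s => by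
    rw [cpow_def_of_ne_zero (by exact_mod_cast hx.ne'), ofReal_log hx.le]
  simp only [Qk, residueLog, this]

lemma continuous_residueLog (k q : ℕ) : Continuous (residueLog k q) := by
  unfold residueLog circleIntegral
  refine continuous_const.mul (intervalIntegral.continuous_parametric_intervalIntegral_of_continuous'
    ?_ _ _)
  simp only [deriv_circleMap, smul_eq_mul, Function.uncurry_def]
  refine Continuous.mul (by fun_prop) (Continuous.mul ?_ (by fun_prop))
  exact (continuous_twistedSeries_circleMap k q).comp continuous_snd

lemma continuousOn_Qk (k q : ℕ) : ContinuousOn (fun x => Qk k x q) (Ioi 0) := by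
  refine ContinuousOn.congr (f := fun x => (q : ℝ) * (residueLog k q (Real.log x)).re) ?_
    (fun x hx => Qk_eq_residueLog k q hx)
  refine continuousOn_const.mul (continuous_re.comp_continuousOn
    ((continuous_residueLog k q).comp_continuousOn ?_))
  exact Real.continuousOn_log.mono fun x hx => (ne_of_gt hx)

/-- The circle and ζ are both symmetric under complex conjugation. Hence the real part in `Qk k x 1`
loses nothing, and `polarD` can be expressed exactly through `Qk`. -/
lemma conj_residueLog_one (k : ℕ) (L : ℝ) :
    (starRingEnd ℂ) (residueLog k 1 L) = residueLog k 1 L := by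
  set g : ℝ → ℂ := fun θ => (circleMap 0 (1 / 2) θ) *
    (riemannZeta (circleMap 1 (1 / 2) θ) ^ k * exp (L * (circleMap 1 (1 / 2) θ - 1))) with hg
  have e : residueLog k 1 L = (2 * (Real.pi : ℂ))⁻¹ * ∫ θ in (0 : ℝ)..2 * Real.pi, g θ := by
    rw [residueLog, circleIntegral]
    simp only [deriv_circleMap, smul_eq_mul, twistedSeries_one]
    rw [mul_inv, mul_assoc, ← intervalIntegral.integral_const_mul]
    congr 2
    ext θ
    simp only [hg]
    field_simp
  have hcm : ∀ c : ℝ, ∀ θ : ℝ, (starRingEnd ℂ) (circleMap c (1 / 2) θ) = circleMap c (1 / 2) (-θ) := by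
    intro c θ
    simp [circleMap, ← exp_conj, map_ofNat (starRingEnd ℂ) 2]
  have hconj : ∀ θ, (starRingEnd ℂ) (g θ) = g (-θ) := by
    intro θ
    simp only [hg, map_mul, map_pow, ← riemannZeta_conj, ← exp_conj, map_sub, conj_ofReal, map_one]
    have h1 := hcm 1 θ
    have h0 := hcm 0 θ
    simp only [ofReal_one, ofReal_zero] at h1 h0
    rw [h1, h0]
  have hper : Function.Periodic g (2 * Real.pi) := fun θ => by
    simp only [hg, periodic_circleMap 0 (1 / 2) θ, periodic_circleMap 1 (1 / 2) θ]
  have hint : (starRingEnd ℂ) (∫ θ in (0 : ℝ)..2 * Real.pi, g θ) =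
      ∫ θ in (0 : ℝ)..2 * Real.pi, g θ := by
    have h1 : (starRingEnd ℂ) (∫ θ in (0 : ℝ)..2 * Real.pi, g θ) =
        ∫ θ in (0 : ℝ)..2 * Real.pi, g (-θ) := by
      rw [intervalIntegral.integral_of_le (by positivity),
        intervalIntegral.integral_of_le (by positivity), ← integral_conj]
      simp only [hconj]
    rw [h1, intervalIntegral.integral_comp_neg]
    have := hper.intervalIntegral_add_eq (-(2 * Real.pi)) 0
    simpa using this
  rw [e, map_mul, hint, map_inv₀, map_mul, conj_ofReal, map_ofNat (starRingEnd ℂ) 2]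

lemma residueLog_one_eq_ofReal (k : ℕ) {x : ℝ} (hx : 0 < x) :
    residueLog k 1 (Real.log x) = (Qk k x 1 : ℂ) := by
  rw [Qk_eq_residueLog k 1 hx, Nat.cast_one, one_mul]
  exact (conj_eq_iff_re.1 (conj_residueLog_one k _)).symm

/-- `riemannZeta₁` is the entire function (s-1)ζ(s), with value 1 at s = 1. The residue is 1/(k-1)!
times the (k-1)-st derivative at 1 of its k-th power times e^{L(s-1)}; in Leibniz's formula the term
with all derivatives on the exponential is the leading one. -/
lemma exists_polynomial_Qk_one {k : ℕ} (hk : 1 ≤ k) :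
    ∃ R : Polynomial ℝ, R.degree < (k - 1 : ℕ) ∧ ∀ x : ℝ, 0 < x →
      Qk k x 1 = (Polynomial.C (1 / ((k - 1).factorial : ℝ)) * Polynomial.X ^ (k - 1) + R).eval
        (Real.log x) := by
  obtain ⟨n, rfl⟩ : ∃ n, k = n + 1 := ⟨k - 1, by omega⟩
  simp only [Nat.add_sub_cancel]
  set G : ℂ → ℂ := fun s => riemannZeta₁ s ^ (n + 1) with hG
  have hGd : Differentiable ℂ G := differentiable_riemannZeta₁.pow _
  set R : Polynomial ℝ := ∑ i ∈ Finset.range n, Polynomial.C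
    ((1 / (n.factorial : ℝ)) * (n.choose (i + 1) * (iteratedDeriv (i + 1) G 1).re)) *
      Polynomial.X ^ (n - (i + 1)) with hR
  refine ⟨R, ?_, fun x hx => ?_⟩
  · refine (Polynomial.degree_sum_le _ _).trans_lt ?_
    rw [Finset.sup_lt_iff (by exact WithBot.bot_lt_coe n)]
    intro i hi
    have hi' := Finset.mem_range.1 hi
    refine (Polynomial.degree_C_mul_X_pow_le _ _).trans_lt ?_
    exact_mod_cast (by omega : n - (i + 1) < n)
  set L := Real.log x
  have hexp : ∀ j : ℕ, iteratedDeriv j (fun s : ℂ => exp (L * (s - 1))) 1 = (L : ℂ) ^ j := by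
    intro j
    have h : (fun s : ℂ => exp (L * (s - 1))) = fun s => exp (-L) * exp (L * s) := by
      ext s; rw [← exp_add]; congr 1; ring
    rw [h, iteratedDeriv_const_mul_field, iteratedDeriv_cexp_const_mul]
    simp only [mul_one]
    rw [mul_left_comm, ← exp_add]; simp
  have h1 : residueLog (n + 1) 1 L = (1 / (n.factorial : ℂ)) *
      iteratedDeriv n (fun s => G s * exp (L * (s - 1))) 1 := by
    have hd : Differentiable ℂ (fun s => G s * exp (L * (s - 1))) := by fun_prop
    have h := (hd.differentiableOn (s := Metric.closedBall 1 (1 / 2))).circleIntegral_one_div_sub_center_pow_smul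
      (by norm_num) n
    rw [residueLog]
    have hc : (∮ s in C(1, 1 / 2), twistedSeries (n + 1) 1 s * exp (L * (s - 1))) =
        ∮ z in C(1, 1 / 2), (1 / (z - 1) ^ (n + 1)) • (fun s => G s * exp (L * (s - 1))) z := by
      refine circleIntegral.integral_congr (by norm_num) fun s hs => ?_
      have hs1 : s ≠ 1 := by rintro rfl; simp at hs
      simp only [twistedSeries_one, hG, riemannZeta_eq_inv_sub_mul hs1, mul_pow, smul_eq_mul]
      rw [inv_pow, one_div]; ring
    rw [hc, h, smul_eq_mul]
    have := Real.pi_ne_zero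
    field_simp
  have hcd : ContDiff ℂ n G := hGd.contDiff
  have h2 : iteratedDeriv n (fun s => G s * exp (L * (s - 1))) 1 =
      ∑ i ∈ Finset.range (n + 1), n.choose i * iteratedDeriv i G 1 * (L : ℂ) ^ (n - i) := by
    rw [iteratedDeriv_fun_mul hcd.contDiffAt (by fun_prop)]
    simp only [hexp]
  have h3 := (Qk_eq_residueLog (n + 1) 1 hx)
  rw [Nat.cast_one, one_mul] at h3
  have hG1 : G 1 = 1 := by simp [hG]
  rw [h3, h1, h2, Finset.sum_range_succ']
  simp only [Polynomial.eval_add, hR, Polynomial.eval_finsetSum, Polynomial.eval_mul,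
    Polynomial.eval_C, Polynomial.eval_pow, Polynomial.eval_X]
  rw [mul_add, add_re, add_comm, iteratedDeriv_zero, hG1]
  congr 1
  · have : (1 / (n.factorial : ℂ) * ((n.choose 0 : ℂ) * 1 * (L : ℂ) ^ (n - 0))) =
      ((1 / (n.factorial : ℝ) * L ^ n : ℝ) : ℂ) := by push_cast; simp
    rw [this, ofReal_re]
  · rw [Finset.mul_sum, re_sum]
    refine Finset.sum_congr rfl fun i _ => ?_
    have : (1 / (n.factorial : ℂ) * ((n.choose (i + 1) : ℂ) * iteratedDeriv (i + 1) G 1 * (L : ℂ) ^ (n - (i + 1)))) =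
      ((1 / (n.factorial : ℝ) * n.choose (i + 1) * L ^ (n - (i + 1)) : ℝ) : ℂ) * iteratedDeriv (i + 1) G 1 := by
      push_cast; ring
    rw [this, re_ofReal_mul]
    ring

/-- The polynomial and its derivative have positive leading coefficients. For k ≥ 3 the derivative
still has positive degree, so both tend to infinity. Monotonicity is what permits comparing
Q_k(x,1)² with Q_k(x,1) Q_k(x+h,1) in the lower bound for the polar part. -/
lemma exists_Qk_one_mono {k : ℕ} (hk : 3 ≤ k) :
    ∃ x₀ : ℝ, 1 ≤ x₀ ∧ (∀ x, x₀ ≤ x → 0 ≤ Qk k x 1) ∧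
      ∀ x y, x₀ ≤ x → x ≤ y → Qk k x 1 ≤ Qk k y 1 := by
  obtain ⟨R, hR, hQ⟩ := exists_polynomial_Qk_one (k := k) (by omega)
  set P := Polynomial.C (1 / ((k - 1).factorial : ℝ)) * Polynomial.X ^ (k - 1) + R with hP
  have hc : (1 / ((k - 1).factorial : ℝ)) ≠ 0 := by positivity
  have hlt : R.degree < (Polynomial.C (1 / ((k - 1).factorial : ℝ)) * Polynomial.X ^ (k - 1)).degree := by
    rwa [Polynomial.degree_C_mul_X_pow _ hc]
  have hdeg : P.degree = (k - 1 : ℕ) := by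
    rw [hP, add_comm, Polynomial.degree_add_eq_right_of_degree_lt hlt, Polynomial.degree_C_mul_X_pow _ hc]
  have hnat : P.natDegree = k - 1 := Polynomial.natDegree_eq_of_degree_eq_some hdeg
  have hlead : P.leadingCoeff = 1 / ((k - 1).factorial : ℝ) := by
    rw [hP, add_comm, Polynomial.leadingCoeff_add_of_degree_lt hlt]; simp
  have hl0 : 0 < P.leadingCoeff := by rw [hlead]; positivity
  have t1 := P.tendsto_atTop_of_leadingCoeff_nonneg
    (by rw [hdeg]; exact_mod_cast (by omega : 0 < k - 1)) hl0.le
  have hdn : P.derivative.degree = (k - 2 : ℕ) := by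
    rw [Polynomial.degree_derivative (by omega), hnat]; rfl
  have t2 := P.derivative.tendsto_atTop_of_leadingCoeff_nonneg
    (by rw [hdn]; exact_mod_cast (by omega : 0 < k - 2)) (by
      rw [Polynomial.leadingCoeff_derivative]; positivity)
  obtain ⟨L, hL⟩ := eventually_atTop.1 ((t1.eventually_ge_atTop 0).and (t2.eventually_ge_atTop 0))
  have hmono : MonotoneOn (fun x => P.eval x) (Ici L) := by
    refine monotoneOn_of_deriv_nonneg (convex_Ici L) P.continuous.continuousOn
      P.differentiable.differentiableOn fun x hx => ?_
    rw [Polynomial.deriv]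
    rw [interior_Ici] at hx
    exact (hL x hx.le).2
  refine ⟨Real.exp (max L 0), Real.one_le_exp (le_max_right _ _), fun x hx => ?_, fun x y hx hxy => ?_⟩
  · have hx0 : 0 < x := (Real.exp_pos _).trans_le hx
    rw [hQ x hx0]
    exact (hL _ ((le_max_left _ _).trans ((Real.le_log_iff_exp_le hx0).2 hx))).1
  · have hx0 : 0 < x := (Real.exp_pos _).trans_le hx
    have hy0 : 0 < y := hx0.trans_le hxy
    have hLx : L ≤ Real.log x := (le_max_left _ _).trans ((Real.le_log_iff_exp_le hx0).2 hx)
    have hxy' := Real.log_le_log hx0 hxy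
    rw [hQ x hx0, hQ y hy0]
    exact hmono hLx (hLx.trans hxy') hxy'

/-- Crude, but uniform in q, which suffices for convergence and continuity of the singular series at
a fixed shift. -/
lemma abs_ramanujanSum_le (q : ℕ) {h : ℕ} (hh : h ≠ 0) : |(ramanujanSum q h : ℝ)| ≤ (h : ℝ) ^ 2 := by
  rw [ramanujanSum]
  push_cast
  have hg : 0 < Nat.gcd h q := Nat.gcd_pos_of_pos_left _ (Nat.pos_of_ne_zero hh)
  have hgh : Nat.gcd h q ≤ h := Nat.gcd_le_left _ (Nat.pos_of_ne_zero hh)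
  calc |∑ d ∈ (Nat.gcd h q).divisors, (d : ℝ) * (ArithmeticFunction.moebius (q / d) : ℝ)|
      ≤ ∑ d ∈ (Nat.gcd h q).divisors, (h : ℝ) := by
        refine (Finset.abs_sum_le_sum_abs _ _).trans (Finset.sum_le_sum fun d hd => ?_)
        rw [abs_mul, Nat.abs_cast]
        have h1 : (d : ℝ) ≤ h := by
          exact_mod_cast (Nat.le_of_dvd hg (Nat.dvd_of_mem_divisors hd)).trans hgh
        have h2 : |(ArithmeticFunction.moebius (q / d) : ℝ)| ≤ 1 := by
          exact_mod_cast ArithmeticFunction.abs_moebius_le_one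
        nlinarith [abs_nonneg (ArithmeticFunction.moebius (q / d) : ℝ), (Nat.cast_nonneg d : (0 : ℝ) ≤ d)]
    _ = (Nat.gcd h q).divisors.card * (h : ℝ) := by simp
    _ ≤ (h : ℝ) * h := by
        gcongr
        exact_mod_cast (Nat.card_divisors_le_self _).trans hgh
    _ = _ := by ring

lemma summable_pnat_rpow {p : ℝ} (hp : p < -1) : Summable fun q : ℕ+ => ((q : ℕ) : ℝ) ^ p :=
  (Real.summable_nat_rpow.2 hp).comp_injective PNat.coe_injective

/-- A summable majorant for the terms of the singular series. -/
lemma exists_singularSeries_term_bound (k : ℕ) {η : ℝ} (hη : 0 < η) :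
    ∃ C : ℝ, 1 ≤ C ∧ ∀ h : ℕ, h ≠ 0 → ∀ x : ℝ, 0 < x → ∀ q : ℕ+,
      ‖(ramanujanSum q h : ℝ) / ((q : ℕ) : ℝ) ^ 2 * Qk k x q ^ 2‖ ≤
        (C * (h : ℝ) ^ 2 * (max x x⁻¹) ^ (2 * η)) * ((q : ℕ) : ℝ) ^ (2 * η - 2) := by
  obtain ⟨C, hC, hQ⟩ := exists_Qk_bound k hη
  refine ⟨C ^ 2, one_le_pow₀ hC, fun h hh x hx q => ?_⟩
  have hq : (0 : ℝ) < (q : ℕ) := by exact_mod_cast q.pos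
  have hX : 0 < max x x⁻¹ := hx.trans_le (le_max_left _ _)
  rw [norm_mul, norm_div, Real.norm_eq_abs, norm_pow, norm_pow, Real.norm_eq_abs, Real.norm_eq_abs,
    abs_of_pos hq]
  calc |(ramanujanSum q h : ℝ)| / ((q : ℕ) : ℝ) ^ 2 * |Qk k x q| ^ 2 ≤
      (h : ℝ) ^ 2 / ((q : ℕ) : ℝ) ^ 2 * (C * ((q : ℕ) : ℝ) ^ η * (max x x⁻¹) ^ η) ^ 2 := by
        gcongr
        · exact abs_ramanujanSum_le _ hh
        · exact hQ q q.ne_zero x hx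
    _ = _ := by
        rw [mul_pow, mul_pow, Real.rpow_sub hq, ← Real.rpow_natCast (((q : ℕ) : ℝ) ^ η),
          ← Real.rpow_mul hq.le, ← Real.rpow_natCast (max x x⁻¹ ^ η), ← Real.rpow_mul hX.le]
        norm_num
        rw [mul_comm η 2]
        ring

lemma summable_singularSeries (k : ℕ) {x : ℝ} (hx : 0 < x) {h : ℕ} (hh : h ≠ 0) :
    Summable fun q : ℕ+ => (ramanujanSum q h : ℝ) / ((q : ℕ) : ℝ) ^ 2 * Qk k x q ^ 2 := by
  obtain ⟨C, _, hb⟩ := exists_singularSeries_term_bound k (η := 1 / 4) (by norm_num)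
  exact Summable.of_norm_bounded ((summable_pnat_rpow (by norm_num)).mul_left _) (hb h hh x hx)

lemma exists_singularSeries_bound (k : ℕ) :
    ∃ C : ℝ, 1 ≤ C ∧ ∀ h : ℕ, h ≠ 0 → ∀ x : ℝ, 0 < x →
      |singularSeries k x h| ≤ C * (h : ℝ) ^ 2 * (max x x⁻¹) ^ (1 / 2 : ℝ) := by
  obtain ⟨C, hC, hb⟩ := exists_singularSeries_term_bound k (η := 1 / 4) (by norm_num)
  set S := ∑' q : ℕ+, ((q : ℕ) : ℝ) ^ (2 * (1 / 4 : ℝ) - 2)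
  refine ⟨C * max 1 S, by nlinarith [le_max_left 1 S], fun h hh x hx => ?_⟩
  have h1 := tsum_of_norm_bounded
    ((summable_pnat_rpow (p := 2 * (1 / 4) - 2) (by norm_num)).mul_left
      (C * (h : ℝ) ^ 2 * (max x x⁻¹) ^ (2 * (1 / 4) : ℝ))).hasSum (hb h hh x hx)
  rw [tsum_mul_left] at h1
  rw [singularSeries, ← Real.norm_eq_abs]
  refine h1.trans ?_
  have hX : 0 < max x x⁻¹ := hx.trans_le (le_max_left _ _)
  calc _ ≤ (C * (h : ℝ) ^ 2 * (max x x⁻¹) ^ (2 * (1 / 4) : ℝ)) * max 1 S := by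
        gcongr; exact le_max_right _ _
    _ = _ := by norm_num; ring

lemma continuousOn_singularSeries (k : ℕ) {h : ℕ} (hh : h ≠ 0) :
    ContinuousOn (fun x => singularSeries k x h) (Ioi 0) := by
  obtain ⟨C, hC, hb⟩ := exists_singularSeries_term_bound k (η := 1 / 4) (by norm_num)
  intro x hx
  have hx : 0 < x := hx
  have hsub : ContinuousOn (fun x => singularSeries k x h) (Ioo (x / 2) (2 * x)) := by
    unfold singularSeries
    refine continuousOn_tsum (u := fun q : ℕ+ => (C * (h : ℝ) ^ 2 *
      (max (2 * x) (2 / x)) ^ (2 * (1 / 4) : ℝ)) * ((q : ℕ) : ℝ) ^ (2 * (1 / 4 : ℝ) - 2)) (fun q => ?_)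
      ((summable_pnat_rpow (by norm_num)).mul_left _) (fun q y hy => ?_)
    · refine continuousOn_const.mul (((continuousOn_Qk k q).mono fun y hy => ?_).pow 2)
      exact (by linarith [hy.1] : (0 : ℝ) < y)
    · have hy0 : 0 < y := by linarith [hy.1]
      refine (hb h hh y hy0 q).trans ?_
      have hX : 0 < max y y⁻¹ := hy0.trans_le (le_max_left _ _)
      gcongr
      · exact hy.2.le
      · rw [inv_le_comm₀ hy0 (by positivity), inv_div]; exact hy.1.le
  exact (hsub.continuousAt (Ioo_mem_nhds (by linarith) (by linarith))).continuousWithinAt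

/-- The majorant x^{1/2} + x^{-1/2} is integrable at 0, so that the main term may be integrated from
0. -/
lemma intervalIntegrable_singularSeries (k : ℕ) {h : ℕ} (hh : h ≠ 0) {a b : ℝ} (ha : 0 ≤ a)
    (hb : 0 ≤ b) : IntervalIntegrable (fun x => singularSeries k x h) volume a b := by
  obtain ⟨C, hC, hB⟩ := exists_singularSeries_bound k
  have h0 : ∀ b : ℝ, 0 ≤ b → IntervalIntegrable (fun x => singularSeries k x h) volume 0 b := by
    intro b hb
    have hg : IntervalIntegrable (fun x : ℝ => C * (h : ℝ) ^ 2 * (x ^ (1 / 2 : ℝ) + x ^ (-(1 / 2) : ℝ)))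
        volume 0 b :=
      ((intervalIntegral.intervalIntegrable_rpow' (by norm_num)).add
        (intervalIntegral.intervalIntegrable_rpow' (by norm_num))).const_mul _
    rw [intervalIntegrable_iff_integrableOn_Ioc_of_le hb] at hg ⊢
    refine Integrable.mono' hg (((continuousOn_singularSeries k hh).mono fun x hx => hx.1).aestronglyMeasurable
      measurableSet_Ioc) ?_
    refine (ae_restrict_mem measurableSet_Ioc).mono fun x hx => ?_
    have hx0 : 0 < x := hx.1
    refine (hB h hh x hx0).trans ?_
    gcongr
    rcases le_total x x⁻¹ with h1 | h1
    · rw [max_eq_right h1, Real.inv_rpow hx0.le, ← Real.rpow_neg hx0.le]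
      have : 0 ≤ x ^ (1 / 2 : ℝ) := by positivity
      linarith
    · rw [max_eq_left h1]
      have : 0 ≤ x ^ (-(1 / 2) : ℝ) := by positivity
      linarith
  exact (h0 a ha).symm.trans (h0 b hb)

lemma hasDerivAt_mainTerm (k : ℕ) {h : ℕ} (hh : h ≠ 0) {x : ℝ} (hx : 0 < x) :
    HasDerivAt (fun x => mainTerm k x h) (singularSeries k x h) x :=
  intervalIntegral.integral_hasDerivAt_right (intervalIntegrable_singularSeries k hh le_rfl hx.le)
    ((continuousOn_singularSeries k hh).stronglyMeasurableAtFilter isOpen_Ioi x hx)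
    ((continuousOn_singularSeries k hh).continuousAt (Ioi_mem_nhds hx))

/-! ### Growth of the zeta function in vertical strips -/

lemma norm_cos_le_cosh (a b : ℝ) : ‖cos (a + b * I)‖ ≤ Real.cosh b := by
  have h : cos (a + b * I) = ((Real.cos a * Real.cosh b : ℝ) : ℂ) +
      ((-(Real.sin a * Real.sinh b) : ℝ) : ℂ) * I := by
    rw [cos_add, cos_mul_I, sin_mul_I]; push_cast; ring
  refine abs_le_of_sq_le_sq' ?_ (Real.cosh_pos b).le |>.2
  rw [h, Complex.sq_norm, normSq_add_mul_I]
  nlinarith [Real.sin_sq_add_cos_sq a, Real.cosh_sq b, sq_nonneg (Real.sin a)]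

lemma norm_cos_le_exp (z : ℂ) : ‖cos z‖ ≤ Real.exp |z.im| := by
  have h := norm_cos_le_cosh z.re z.im
  rw [re_add_im] at h
  refine h.trans ?_
  rw [← Real.cosh_abs, Real.cosh_eq]
  have : Real.exp (-|z.im|) ≤ Real.exp |z.im| := Real.exp_le_exp.2 (by linarith [abs_nonneg z.im])
  linarith

lemma norm_sin_le_exp (z : ℂ) : ‖sin z‖ ≤ Real.exp |z.im| := by
  have h := norm_cos_le_exp (Real.pi / 2 - z)
  rw [cos_pi_div_two_sub] at h
  have : ((Real.pi / 2 : ℂ)).im = 0 := by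
    rw [show (Real.pi / 2 : ℂ) = ((Real.pi / 2 : ℝ) : ℂ) by push_cast; rfl, ofReal_im]
  rw [sub_im, this, zero_sub, abs_neg] at h
  exact h

lemma norm_Gamma_le {s : ℂ} (hs : 0 < s.re) : ‖Gamma s‖ ≤ Real.Gamma s.re := by
  rw [Gamma_eq_integral hs, GammaIntegral, Real.Gamma_eq_integral hs]
  refine norm_integral_le_of_norm_le (Real.GammaIntegral_convergent hs) ?_
  refine (ae_restrict_mem measurableSet_Ioi).mono fun x hx => ?_
  have hx : 0 < x := hx
  rw [norm_mul, norm_cpow_eq_rpow_re_of_pos hx, norm_real, Real.norm_of_nonneg (Real.exp_pos _).le]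
  simp

lemma exists_norm_Gamma_le {a : ℝ} (ha : 0 < a) (b : ℝ) :
    ∃ C : ℝ, 1 ≤ C ∧ ∀ s : ℂ, a ≤ s.re → s.re ≤ b → ‖Gamma s‖ ≤ C := by
  have hc : ContinuousOn Real.Gamma (Icc a b) :=
    Real.differentiableOn_Gamma_Ioi.continuousOn.mono fun x hx => ha.trans_le hx.1
  obtain ⟨C, hC⟩ := isCompact_Icc.exists_bound_of_continuousOn hc
  refine ⟨max 1 C, le_max_left _ _, fun s h1 h2 => ?_⟩
  exact (norm_Gamma_le (ha.trans_le h1)).trans ((le_abs_self _).trans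
    ((hC s.re ⟨h1, h2⟩).trans (le_max_right _ _)))

/-- This function is an everywhere convergent Mellin transform. The power of t in the integrand is
dominated by the sum of its values at the two edges of the strip, the one for t ≤ 1 and the other
for t ≥ 1. -/
lemma exists_norm_completedRiemannZeta₀_le (a b : ℝ) :
    ∃ C : ℝ, 1 ≤ C ∧ ∀ s : ℂ, a ≤ s.re → s.re ≤ b → ‖completedRiemannZeta₀ s‖ ≤ C := by
  set P := HurwitzZeta.hurwitzEvenFEPair 0
  have hconv : ∀ s : ℂ, MellinConvergent P.f_modif s := fun s =>
    (P.isStrongFEPair_toStrongFEPair.hasMellin s).1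
  have ha := (hconv ((a / 2 : ℝ) : ℂ)).norm
  have hb := (hconv ((b / 2 : ℝ) : ℂ)).norm
  set J := ∫ t in Ioi (0 : ℝ), (‖(t : ℂ) ^ (((a / 2 : ℝ) : ℂ) - 1) • P.f_modif t‖ +
    ‖(t : ℂ) ^ (((b / 2 : ℝ) : ℂ) - 1) • P.f_modif t‖) with hJ
  refine ⟨max 1 J, le_max_left _ _, fun s h1 h2 => ?_⟩
  have : ‖P.Λ₀ (s / 2)‖ ≤ J := by
    rw [WeakFEPair.Λ₀, mellin]
    refine norm_integral_le_of_norm_le (ha.add hb) ?_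
    refine (ae_restrict_mem measurableSet_Ioi).mono fun t ht => ?_
    have ht : 0 < t := ht
    simp only [norm_smul, norm_cpow_eq_rpow_re_of_pos ht, ← add_mul]
    gcongr
    have e : (s / 2 - 1).re = s.re / 2 - 1 := by
      rw [sub_re, show s / 2 = s / ((2 : ℝ) : ℂ) by norm_num, div_ofReal_re]; simp
    have e1 : (((a / 2 : ℝ) : ℂ) - 1).re = a / 2 - 1 := by simp
    have e2 : (((b / 2 : ℝ) : ℂ) - 1).re = b / 2 - 1 := by simp
    rw [e, e1, e2]
    rcases le_total 1 t with h | h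
    · have := Real.rpow_le_rpow_of_exponent_le h (by linarith : s.re / 2 - 1 ≤ b / 2 - 1)
      linarith [Real.rpow_nonneg ht.le (a / 2 - 1)]
    · have := Real.rpow_le_rpow_of_exponent_ge ht h (by linarith : a / 2 - 1 ≤ s.re / 2 - 1)
      linarith [Real.rpow_nonneg ht.le (b / 2 - 1)]
  have e : ‖completedRiemannZeta₀ s‖ = ‖P.Λ₀ (s / 2)‖ / 2 := by
    rw [completedRiemannZeta₀, HurwitzZeta.completedHurwitzZetaEven₀, norm_div]; simp [P]
  rw [e]
  linarith [norm_nonneg (P.Λ₀ (s / 2)), le_max_right 1 J]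

/-- Reflection formula. Γ(1-z) is rewritten as Γ(2-z)/(1-z) because Re(1-z) may be 0, whereas
Re(2-z) ≥ 1, where Γ is bounded on strips. -/
lemma exists_norm_inv_Gamma_le (a : ℝ) :
    ∃ C : ℝ, 1 ≤ C ∧ ∀ z : ℂ, a ≤ z.re → z.re ≤ 1 → 1 / 2 ≤ |z.im| →
      ‖(Gamma z)⁻¹‖ ≤ C * Real.exp (Real.pi * |z.im|) := by
  obtain ⟨C, hC, h⟩ := exists_norm_Gamma_le one_pos (2 - a)
  refine ⟨2 * C, by linarith, fun z h1 h2 h3 => ?_⟩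
  have hz1 : 1 - z ≠ 0 := by
    intro h0
    have : (1 - z).im = 0 := by rw [h0]; rfl
    simp at this
    rw [this] at h3; norm_num at h3
  have e : (Gamma z)⁻¹ = Gamma (2 - z) / (1 - z) * sin (Real.pi * z) / Real.pi := by
    have hr := Gamma_mul_Gamma_one_sub z
    have hg : Gamma (2 - z) = (1 - z) * Gamma (1 - z) := by
      rw [show 2 - z = (1 - z) + 1 by ring, Gamma_add_one _ hz1]
    have hs : sin (Real.pi * z) ≠ 0 := by
      intro h0
      rw [sin_eq_zero_iff] at h0
      obtain ⟨n, hn⟩ := h0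
      have : z = n := by
        have hp : (Real.pi : ℂ) ≠ 0 := by exact_mod_cast Real.pi_ne_zero
        field_simp at hn
        exact hn
      rw [this] at h3
      simp at h3
      norm_num at h3
    have hp : (Real.pi : ℂ) ≠ 0 := by exact_mod_cast Real.pi_ne_zero
    have hgz : Gamma z ≠ 0 := by
      intro h0; rw [h0, zero_mul] at hr
      exact (div_ne_zero hp hs) hr.symm
    rw [hg, mul_div_cancel_left₀ _ hz1]
    rw [eq_div_iff hs] at hr
    generalize sin (Real.pi * z) = w at *
    field_simp
    linear_combination -hr
  rw [e, norm_div, norm_mul, norm_div]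
  have b1 : ‖Gamma (2 - z)‖ ≤ C := h _ (by simp; linarith) (by simp; linarith)
  have b2 : 1 / 2 ≤ ‖1 - z‖ := by
    refine h3.trans ?_
    have := abs_im_le_norm (1 - z)
    simpa using this
  have b3 : ‖sin (Real.pi * z)‖ ≤ Real.exp (Real.pi * |z.im|) := by
    have := norm_sin_le_exp (Real.pi * z)
    rwa [im_ofReal_mul, abs_mul, abs_of_pos Real.pi_pos] at this
  have b4 : 1 ≤ ‖(Real.pi : ℂ)‖ := by
    rw [norm_real, Real.norm_of_nonneg Real.pi_pos.le]; linarith [Real.pi_gt_three]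
  have b5 : ‖Gamma (2 - z)‖ / ‖1 - z‖ ≤ 2 * C := by
    rw [div_le_iff₀ (by linarith)]; nlinarith [norm_nonneg (1 - z)]
  calc _ ≤ (2 * C) * Real.exp (Real.pi * |z.im|) / 1 := by gcongr
    _ = _ := by rw [div_one]

/-- Exponential growth is far from sharp but enough: the kernel decays like e^{-u²}, and the bound
only justifies moving lines of integration. -/
lemma exists_norm_riemannZeta_le (a : ℝ) :
    ∃ C : ℝ, 1 ≤ C ∧ ∀ s : ℂ, a ≤ s.re → s.re ≤ 2 → 1 ≤ |s.im| →
      ‖riemannZeta s‖ ≤ C * Real.exp (2 * |s.im|) := by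
  obtain ⟨A, hA, h1⟩ := exists_norm_completedRiemannZeta₀_le a 2
  obtain ⟨B, hB, h2⟩ := exists_norm_inv_Gamma_le (a / 2)
  have hp1 : (1 : ℝ) ≤ Real.pi := by linarith [Real.pi_gt_three]
  refine ⟨(A + 2) * (Real.pi * B), by nlinarith [mul_le_mul hp1 hB zero_le_one (by linarith)], fun s ha hb hi => ?_⟩
  have hs0 : s ≠ 0 := by rintro rfl; simp at hi; norm_num at hi
  have e2 : (s / 2).re = s.re / 2 := by
      rw [show s / 2 = s / ((2 : ℝ) : ℂ) by norm_num, div_ofReal_re]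
  have e3 : (s / 2).im = s.im / 2 := by
      rw [show s / 2 = s / ((2 : ℝ) : ℂ) by norm_num, div_ofReal_im]
  have n1 : 1 ≤ ‖s‖ := hi.trans (abs_im_le_norm s)
  have n2 : 1 ≤ ‖1 - s‖ := hi.trans (by simpa using abs_im_le_norm (1 - s))
  rw [riemannZeta_eq_completedRiemannZeta₀ hs0, div_eq_mul_inv, mul_inv, norm_mul, norm_mul]
  have b1 : ‖completedRiemannZeta₀ s - 1 / s - 1 / (1 - s)‖ ≤ A + 2 := by
    have i1 : ‖1 / s‖ ≤ 1 := by rw [norm_div, norm_one]; exact (div_le_one (by linarith)).2 n1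
    have i2 : ‖1 / (1 - s)‖ ≤ 1 := by rw [norm_div, norm_one]; exact (div_le_one (by linarith)).2 n2
    calc _ ≤ ‖completedRiemannZeta₀ s‖ + ‖1 / s‖ + ‖1 / (1 - s)‖ :=
          (norm_sub_le _ _).trans (by gcongr; exact norm_sub_le _ _)
      _ ≤ A + 1 + 1 := by gcongr; exact h1 s ha hb
      _ = _ := by ring
  have b2 : ‖((Real.pi : ℂ) ^ (-s / 2))⁻¹‖ ≤ Real.pi := by
    rw [← cpow_neg, norm_cpow_eq_rpow_re_of_pos Real.pi_pos]
    calc Real.pi ^ (-(-s / 2)).re ≤ Real.pi ^ (1 : ℝ) := by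
          apply Real.rpow_le_rpow_of_exponent_le hp1
          rw [show -(-s / 2) = s / 2 by ring, e2]; linarith
      _ = _ := Real.rpow_one _
  have b3 : ‖(Gamma (s / 2))⁻¹‖ ≤ B * Real.exp (2 * |s.im|) := by
    refine (h2 (s / 2) (by rw [e2]; linarith) (by rw [e2]; linarith) (by
      rw [e3, abs_div, abs_two]; linarith)).trans ?_
    refine mul_le_mul_of_nonneg_left (Real.exp_le_exp.2 ?_) (by linarith)
    rw [e3, abs_div, abs_two]
    nlinarith [Real.pi_le_four, abs_nonneg s.im]
  calc _ ≤ (A + 2) * (Real.pi * (B * Real.exp (2 * |s.im|))) := by gcongr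
    _ = _ := by ring

/-! ### The functional equation -/

/-- The factor in the functional equation `ζ (1 - s) = X(s) ζ(s)`. -/
noncomputable def feFactor (s : ℂ) : ℂ :=
  2 * (2 * Real.pi) ^ (-s) * Gamma s * cos (Real.pi * s / 2)

lemma riemannZeta_one_sub_eq {s : ℂ} (hs : 0 < s.re) (h1 : s ≠ 1) :
    riemannZeta (1 - s) = feFactor s * riemannZeta s := by
  rw [feFactor]
  refine riemannZeta_one_sub (fun n h => ?_) h1
  rw [h] at hs
  simp at hs
  linarith [(Nat.cast_nonneg n : (0 : ℝ) ≤ n)]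

lemma differentiableAt_feFactor {s : ℂ} (hs : 0 < s.re) : DifferentiableAt ℂ feFactor s := by
  unfold feFactor
  have hg : DifferentiableAt ℂ Gamma s := differentiableAt_Gamma s fun m h => by
    rw [h] at hs
    simp at hs
    linarith [(Nat.cast_nonneg m : (0 : ℝ) ≤ m)]
  have h2 : (2 * Real.pi : ℂ) ≠ 0 := by
    have : (Real.pi : ℂ) ≠ 0 := by exact_mod_cast Real.pi_ne_zero
    exact mul_ne_zero two_ne_zero this
  have h3 : DifferentiableAt ℂ (fun s : ℂ => (2 * Real.pi : ℂ) ^ (-s)) s :=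
    (differentiableAt_id.neg).const_cpow (Or.inl h2)
  fun_prop

lemma norm_two_pi_cpow_le {s : ℂ} (hs : 0 ≤ s.re) : ‖(2 * Real.pi : ℂ) ^ (-s)‖ ≤ 1 := by
  rw [show (2 * Real.pi : ℂ) = ((2 * Real.pi : ℝ) : ℂ) by push_cast; rfl,
    norm_cpow_eq_rpow_re_of_pos (by positivity)]
  exact Real.rpow_le_one_of_one_le_of_nonpos (by linarith [Real.pi_gt_three]) (by simpa using hs)

lemma exists_norm_feFactor_le {a : ℝ} (ha : 0 < a) (b : ℝ) :
    ∃ C : ℝ, 1 ≤ C ∧ ∀ s : ℂ, a ≤ s.re → s.re ≤ b →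
      ‖feFactor s‖ ≤ C * Real.exp (2 * |s.im|) := by
  obtain ⟨C, hC, h⟩ := exists_norm_Gamma_le ha b
  refine ⟨2 * C, by linarith, fun s h1 h2 => ?_⟩
  rw [feFactor, norm_mul, norm_mul, norm_mul, norm_ofNat]
  have b1 := norm_two_pi_cpow_le (s := s) (by linarith)
  have b2 := h s h1 h2
  have b3 : ‖cos (Real.pi * s / 2)‖ ≤ Real.exp (2 * |s.im|) := by
    refine (norm_cos_le_exp _).trans (Real.exp_le_exp.2 ?_)
    rw [show (Real.pi * s / 2 : ℂ) = ((Real.pi / 2 : ℝ) : ℂ) * s by push_cast; ring, im_ofReal_mul,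
      abs_mul, abs_of_pos (by positivity)]
    nlinarith [Real.pi_le_four, abs_nonneg s.im]
  calc _ ≤ 2 * 1 * C * Real.exp (2 * |s.im|) := by gcongr
    _ = _ := by ring

/-- At the point 1/2 + iu, the reflection z ↦ 1 - z is complex conjugation. -/
lemma norm_Gamma_half_sq_mul_cosh (u : ℝ) :
    ‖Gamma (1 / 2 + u * I)‖ ^ 2 * Real.cosh (Real.pi * u) = Real.pi := by
  have h := Gamma_mul_Gamma_one_sub (1 / 2 + u * I)
  have hc : (1 : ℂ) - (1 / 2 + u * I) = (starRingEnd ℂ) (1 / 2 + u * I) := by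
    simp [map_ofNat (starRingEnd ℂ) 2]; ring
  rw [hc, Gamma_conj, mul_conj] at h
  have hs : sin (Real.pi * (1 / 2 + u * I)) = (Real.cosh (Real.pi * u) : ℝ) := by
    rw [show (Real.pi * (1 / 2 + u * I) : ℂ) = Real.pi / 2 - (-(Real.pi * u) : ℂ) * I by ring,
      sin_pi_div_two_sub, cos_mul_I]
    push_cast
    rw [cosh_neg]
  rw [hs, ← ofReal_div, ofReal_inj, normSq_eq_norm_sq] at h
  rw [h, div_mul_cancel₀ _ (Real.cosh_pos _).ne']

lemma norm_Gamma_half_add_nat_le (j : ℕ) (u : ℝ) :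
    ‖Gamma (1 / 2 + j + u * I)‖ ≤ j.factorial * (1 + |u|) ^ j * ‖Gamma (1 / 2 + u * I)‖ := by
  induction j with
  | zero => simp
  | succ j ih =>
    have h0 : (1 / 2 + j + u * I : ℂ) ≠ 0 := by
      intro h
      have := congrArg re h
      simp at this
      linarith [(Nat.cast_nonneg j : (0 : ℝ) ≤ j)]
    have e : (1 / 2 + ((j + 1 : ℕ) : ℂ) + u * I) = (1 / 2 + j + u * I) + 1 := by push_cast; ring
    rw [e, Gamma_add_one _ h0, norm_mul]
    have hn : ‖(1 / 2 + j + u * I : ℂ)‖ ≤ (j + 1) * (1 + |u|) := by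
      calc ‖(1 / 2 + j + u * I : ℂ)‖ ≤ ‖(1 / 2 : ℂ)‖ + ‖(j : ℂ)‖ + ‖(u * I : ℂ)‖ := norm_add₃_le
        _ = 1 / 2 + j + |u| := by simp
        _ ≤ _ := by nlinarith [abs_nonneg u, mul_nonneg (Nat.cast_nonneg j : (0 : ℝ) ≤ j) (abs_nonneg u)]
    calc _ ≤ ((j + 1) * (1 + |u|)) * (j.factorial * (1 + |u|) ^ j * ‖Gamma (1 / 2 + u * I)‖) := by
          gcongr
      _ = _ := by rw [Nat.factorial_succ]; push_cast; ring

/-- On the lines Re s = 1/2 + j, the decay of Γ cancels the growth of the cosine exactly, by the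
reflection formula at Re s = 1/2 and j steps of the recursion. This gives the correct polynomial
order without Stirling's formula; in particular the factor is bounded on the critical line. -/
lemma exists_norm_feFactor_half_add_nat_le (j : ℕ) :
    ∃ C : ℝ, 1 ≤ C ∧ ∀ u : ℝ, ‖feFactor (1 / 2 + j + u * I)‖ ≤ C * (1 + |u|) ^ j := by
  refine ⟨4 * j.factorial, by
    have : (1 : ℝ) ≤ j.factorial := by exact_mod_cast Nat.one_le_iff_ne_zero.2 (Nat.factorial_ne_zero j)
    linarith, fun u => ?_⟩
  rw [feFactor, norm_mul, norm_mul, norm_mul, norm_ofNat]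
  have b1 := norm_two_pi_cpow_le (s := 1 / 2 + j + u * I) (by simp; positivity)
  have b2 := norm_Gamma_half_add_nat_le j u
  have b3 : ‖cos (Real.pi * (1 / 2 + j + u * I) / 2)‖ ≤ Real.cosh (Real.pi * u / 2) := by
    have := norm_cos_le_cosh (Real.pi * (1 / 2 + j) / 2) (Real.pi * u / 2)
    convert this using 3
    push_cast; ring
  have b4 : ‖Gamma (1 / 2 + u * I)‖ * Real.cosh (Real.pi * u / 2) ≤ 2 := by
    refine abs_le_of_sq_le_sq' ?_ zero_le_two |>.2
    have h1 := norm_Gamma_half_sq_mul_cosh u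
    have h2 : Real.cosh (Real.pi * u / 2) ^ 2 ≤ Real.cosh (Real.pi * u) := by
      rw [show Real.pi * u = 2 * (Real.pi * u / 2) by ring, Real.cosh_two_mul]
      rw [show (2 * (Real.pi * u / 2)) / 2 = Real.pi * u / 2 by ring]
      nlinarith [sq_nonneg (Real.sinh (Real.pi * u / 2))]
    rw [mul_pow]
    nlinarith [mul_le_mul_of_nonneg_left h2 (sq_nonneg ‖Gamma (1 / 2 + u * I)‖), Real.pi_le_four]
  calc _ ≤ 2 * 1 * (j.factorial * (1 + |u|) ^ j * ‖Gamma (1 / 2 + u * I)‖) *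
        Real.cosh (Real.pi * u / 2) := by gcongr
    _ = 2 * j.factorial * (1 + |u|) ^ j * (‖Gamma (1 / 2 + u * I)‖ * Real.cosh (Real.pi * u / 2)) := by
        ring
    _ ≤ 2 * j.factorial * (1 + |u|) ^ j * 2 := by gcongr
    _ = _ := by ring

lemma norm_riemannZeta_pow_le (k : ℕ) {s : ℂ} {σ : ℝ} (hσ : 1 < σ) (hs : σ ≤ s.re) :
    ‖riemannZeta s ^ k‖ ≤ ∑' n : ℕ, (dk k n : ℝ) * (n : ℝ) ^ (-σ) := by
  rw [← (LSeriesHasSum_dk k (hσ.trans_le hs)).tsum_eq]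
  refine tsum_of_norm_bounded (summable_dk_mul_rpow k hσ).hasSum fun n => ?_
  rcases eq_or_ne n 0 with rfl | hn
  · simp; positivity
  have hn1 : (1 : ℝ) ≤ n := by exact_mod_cast Nat.one_le_iff_ne_zero.2 hn
  rw [LSeries.term_of_ne_zero hn, norm_div, norm_natCast, ← ofReal_natCast n,
    norm_cpow_eq_rpow_re_of_pos (by linarith), Real.rpow_neg (by linarith), ← div_eq_mul_inv]
  gcongr

lemma exists_norm_riemannZeta_pow_half_sub_nat_le (k : ℕ) {m : ℕ} (hm : 1 ≤ m) :
    ∃ C : ℝ, 1 ≤ C ∧ ∀ u : ℝ, ‖riemannZeta (1 / 2 - m + u * I) ^ k‖ ≤ C * (1 + |u|) ^ (m * k) := by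
  obtain ⟨A, hA, h⟩ := exists_norm_feFactor_half_add_nat_le m
  set Z := ∑' n : ℕ, (dk k n : ℝ) * (n : ℝ) ^ (-(3 / 2 : ℝ))
  have hm' : (1 : ℝ) ≤ m := by exact_mod_cast hm
  have hAk : 1 ≤ A ^ k := one_le_pow₀ hA
  refine ⟨A ^ k * max 1 Z, by nlinarith [le_max_left 1 Z], fun u => ?_⟩
  have e : (1 / 2 - m + u * I : ℂ) = 1 - (1 / 2 + m + (-u : ℝ) * I) := by push_cast; ring
  have hre : (1 / 2 + m + (-u : ℝ) * I : ℂ).re = 1 / 2 + m := by simp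
  rw [e, riemannZeta_one_sub_eq (by rw [hre]; positivity) (fun h => by
    have := congrArg re h
    rw [hre] at this
    simp at this
    linarith), mul_pow, norm_mul, norm_pow]
  have b1 := h (-u)
  rw [abs_neg] at b1
  have b2 := norm_riemannZeta_pow_le k (s := 1 / 2 + m + (-u : ℝ) * I) (σ := 3 / 2) (by norm_num)
    (by rw [hre]; linarith)
  calc _ ≤ (A * (1 + |u|) ^ m) ^ k * max 1 Z := by
        gcongr; exact b2.trans (le_max_right _ _)
    _ = _ := by rw [mul_pow, ← pow_mul]; ring

/-! ### Moving vertical lines of integration -/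

/-- `f` tends to `0` uniformly at both ends of the strip `a ≤ Re z ≤ b`. -/
def VanishesAtEnds (f : ℂ → ℂ) (a b : ℝ) : Prop :=
  ∀ ε > 0, ∃ R₀ : ℝ, ∀ u : ℝ, R₀ ≤ |u| → ∀ x ∈ Icc a b, ‖f (x + u * I)‖ ≤ ε

/-- The difference of the truncated integrals of `f` over the lines `Re z = b` and `Re z = a`. -/
noncomputable def lineDiff (f : ℂ → ℂ) (a b R : ℝ) : ℂ :=
  (∫ u in (-R)..R, f (b + u * I)) - ∫ u in (-R)..R, f (a + u * I)

lemma tendsto_lineDiff_zero {f : ℂ → ℂ} {a b : ℝ} (hab : a ≤ b)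
    (hf : DifferentiableOn ℂ f {z | a ≤ z.re ∧ z.re ≤ b}) (hv : VanishesAtEnds f a b) :
    Tendsto (fun R => I * lineDiff f a b R) atTop (𝓝 0) := by
  rw [NormedAddCommGroup.tendsto_atTop]
  intro ε hε
  -- The summand 1 keeps the denominator positive when a = b.
  obtain ⟨R₀, hR₀⟩ := hv (ε / (4 * (b - a + 1))) (by
    have : 0 < b - a + 1 := by linarith
    positivity)
  refine ⟨max R₀ 1, fun R hR => ?_⟩
  have hR0 : 0 ≤ R := by linarith [(le_max_right R₀ 1).trans hR]
  have hR1 : R₀ ≤ R := (le_max_left _ _).trans hR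
  have h := integral_boundary_rect_eq_zero_of_differentiableOn f (⟨a, -R⟩ : ℂ) ⟨b, R⟩
    (hf.mono fun z hz => by
      have h1 := hz.1
      simp only [uIcc_of_le hab] at h1
      exact h1)
  simp only [smul_eq_mul] at h
  have hb1 : ‖∫ x in a..b, f (x + (-R : ℝ) * I)‖ ≤ ε / (4 * (b - a + 1)) * |b - a| :=
    intervalIntegral.norm_integral_le_of_norm_le_const fun x hx => by
      rw [uIoc_of_le hab] at hx
      exact hR₀ (-R) (by rwa [abs_neg, abs_of_nonneg hR0]) x ⟨hx.1.le, hx.2⟩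
  have hb2 : ‖∫ x in a..b, f (x + R * I)‖ ≤ ε / (4 * (b - a + 1)) * |b - a| :=
    intervalIntegral.norm_integral_le_of_norm_le_const fun x hx => by
      rw [uIoc_of_le hab] at hx
      exact hR₀ R (by rwa [abs_of_nonneg hR0]) x ⟨hx.1.le, hx.2⟩
  have e : I * lineDiff f a b R - 0 = (∫ x in a..b, f (x + R * I)) - ∫ x in a..b, f (x + (-R : ℝ) * I) := by
    rw [lineDiff]
    linear_combination h
  rw [e]
  calc _ ≤ ε / (4 * (b - a + 1)) * |b - a| + ε / (4 * (b - a + 1)) * |b - a| :=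
        (norm_sub_le _ _).trans (add_le_add hb2 hb1)
    _ < ε := by
        rw [abs_of_nonneg (by linarith)]
        have h1 : 0 < b - a + 1 := by linarith
        rw [← two_mul, div_mul_eq_mul_div, mul_div_assoc', div_lt_iff₀ (by positivity)]
        nlinarith

lemma add_mul_I_ne_one {c u : ℝ} (hc : c ≠ 1) : (c + u * I : ℂ) ≠ 1 := fun h => by
  have := congrArg re h; simp at this; exact hc this

lemma hasDerivAt_vertical (c u : ℝ) : HasDerivAt (fun u : ℝ => (c + u * I : ℂ)) I u := by
  have h : HasDerivAt (fun u : ℝ => (u : ℂ)) 1 u := ofRealCLM.hasDerivAt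
  simpa using (h.mul_const I).const_add (c : ℂ)

lemma norm_inv_sub_one_pow_le {c u : ℝ} (hu : 1 ≤ |u|) (n : ℕ) :
    ‖((c + u * I - 1 : ℂ) ^ (n + 1))⁻¹‖ ≤ |u|⁻¹ := by
  have h1 : |u| ≤ ‖(c + u * I - 1 : ℂ)‖ := by
    have := abs_im_le_norm (c + u * I - 1 : ℂ)
    simpa using this
  rw [norm_inv, norm_pow]
  apply inv_anti₀ (by linarith)
  calc |u| ≤ ‖(c + u * I - 1 : ℂ)‖ := h1
    _ ≤ _ := le_self_pow₀ (hu.trans h1) (by omega)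

lemma continuous_inv_sub_one_pow {c : ℝ} (hc : c ≠ 1) (n : ℕ) :
    Continuous fun u : ℝ => ((c + u * I - 1 : ℂ) ^ n)⁻¹ := by
  refine Continuous.inv₀ (by fun_prop) fun u => pow_ne_zero _ (sub_ne_zero.2 (add_mul_I_ne_one hc))

/-- The integral over the whole line does not converge absolutely, hence the symmetric truncation.
In the antiderivative the logarithm is even in u and drops out. -/
lemma integral_inv_sub_one {c : ℝ} (hc : c ≠ 1) (R : ℝ) :
    ∫ u in (-R)..R, ((c + u * I - 1 : ℂ))⁻¹ = (2 * Real.arctan (R / (c - 1)) : ℝ) := by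
  have hc' : c - 1 ≠ 0 := sub_ne_zero.2 hc
  have hd : ∀ u : ℝ, HasDerivAt (fun u : ℝ => ((Real.arctan (u / (c - 1)) : ℝ) : ℂ) -
      I / 2 * ((Real.log ((c - 1) ^ 2 + u ^ 2) : ℝ) : ℂ)) ((c + u * I - 1 : ℂ))⁻¹ u := by
    intro u
    have hpos : 0 < (c - 1) ^ 2 + u ^ 2 := by positivity
    have h1 : HasDerivAt (fun u : ℝ => Real.arctan (u / (c - 1))) (1 / (1 + (u / (c - 1)) ^ 2) * (1 / (c - 1))) u :=
      ((hasDerivAt_id u).div_const (c - 1)).arctan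
    have h2 : HasDerivAt (fun u : ℝ => Real.log ((c - 1) ^ 2 + u ^ 2)) (2 * u / ((c - 1) ^ 2 + u ^ 2)) u := by
      have := ((hasDerivAt_pow 2 u).const_add ((c - 1) ^ 2)).log hpos.ne'
      simpa using this
    have h3 := h1.ofReal_comp.sub (h2.ofReal_comp.const_mul (I / 2))
    have e1 : 1 / (1 + (u / (c - 1)) ^ 2) * (1 / (c - 1)) = (c - 1) / ((c - 1) ^ 2 + u ^ 2) := by
      field_simp
    rw [e1] at h3
    refine HasDerivAt.congr_deriv h3 ?_
    have hne2 : ((c - 1) ^ 2 + u ^ 2 : ℂ) ≠ 0 := by exact_mod_cast hpos.ne'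
    refine eq_inv_of_mul_eq_one_left ?_
    push_cast
    field_simp
    linear_combination (-u ^ 2) * I_sq
  rw [intervalIntegral.integral_eq_sub_of_hasDerivAt (fun u _ => hd u)
    (by simpa using (continuous_inv_sub_one_pow hc 1).intervalIntegrable (-R) R)]
  rw [neg_div, Real.arctan_neg]
  push_cast
  ring_nf

/-- The limits of the arctangent have opposite signs on the two sides of the pole; their difference
is the residue. -/
lemma tendsto_lineDiff_inv {a b : ℝ} (ha : a < 1) (hb : 1 < b) :
    Tendsto (fun R => I * lineDiff (fun z => ((z - 1) ^ 1)⁻¹) a b R) atTop (𝓝 (2 * Real.pi * I)) := by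
  have h1 : Tendsto (fun R : ℝ => 2 * Real.arctan (R / (b - 1))) atTop (𝓝 (2 * (Real.pi / 2))) :=
    ((tendsto_nhds_of_tendsto_nhdsWithin Real.tendsto_arctan_atTop).comp (tendsto_id.atTop_div_const (by linarith))).const_mul 2
  have h2 : Tendsto (fun R : ℝ => 2 * Real.arctan (R / (a - 1))) atTop (𝓝 (2 * (-(Real.pi / 2)))) :=
    ((tendsto_nhds_of_tendsto_nhdsWithin Real.tendsto_arctan_atBot).comp (tendsto_id.atTop_div_const_of_neg (by linarith))).const_mul 2
  have h3 : Tendsto (fun R : ℝ => (I * ((2 * Real.arctan (R / (b - 1)) - 2 * Real.arctan (R / (a - 1)) : ℝ) : ℂ)))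
      atTop (𝓝 (I * ((2 * (Real.pi / 2) - 2 * (-(Real.pi / 2)) : ℝ) : ℂ))) :=
    ((continuous_ofReal.tendsto _).comp (h1.sub h2)).const_mul I
  have e : (I * ((2 * (Real.pi / 2) - 2 * (-(Real.pi / 2)) : ℝ) : ℂ)) = 2 * Real.pi * I := by
    push_cast; ring
  rw [e] at h3
  refine h3.congr fun R => ?_
  simp only [lineDiff, pow_one]
  rw [integral_inv_sub_one hb.ne', integral_inv_sub_one ha.ne]
  push_cast; ring

lemma tendsto_integral_inv_pow {c : ℝ} (hc : c ≠ 1) (n : ℕ) :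
    Tendsto (fun R : ℝ => ∫ u in (-R)..R, ((c + u * I - 1 : ℂ) ^ (n + 2))⁻¹) atTop (𝓝 0) := by
  have hn : ((n : ℂ) + 1) ≠ 0 := by exact_mod_cast n.succ_ne_zero
  have hd : ∀ u : ℝ, HasDerivAt (fun u : ℝ => (I / (n + 1)) * ((c + u * I - 1 : ℂ) ^ (n + 1))⁻¹)
      ((c + u * I - 1 : ℂ) ^ (n + 2))⁻¹ u := by
    intro u
    have hne : (c + u * I - 1 : ℂ) ≠ 0 := sub_ne_zero.2 (add_mul_I_ne_one hc)
    have h := ((((hasDerivAt_vertical c u).sub_const 1).pow (n + 1)).inv (pow_ne_zero _ hne)).const_mul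
      (I / (n + 1))
    refine HasDerivAt.congr_deriv h ?_
    rw [Nat.add_sub_cancel]
    simp only [Pi.pow_apply]
    push_cast
    generalize (c + u * I - 1 : ℂ) = w at hne ⊢
    field_simp
    linear_combination (-(w ^ 2 * w ^ (n * 2))) * I_sq
  have he : ∀ R : ℝ, ∫ u in (-R)..R, ((c + u * I - 1 : ℂ) ^ (n + 2))⁻¹ =
      (I / (n + 1)) * ((c + R * I - 1 : ℂ) ^ (n + 1))⁻¹ -
        (I / (n + 1)) * ((c + (-R : ℝ) * I - 1 : ℂ) ^ (n + 1))⁻¹ := fun R =>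
    intervalIntegral.integral_eq_sub_of_hasDerivAt (fun u _ => hd u)
      ((continuous_inv_sub_one_pow hc (n + 2)).intervalIntegrable (-R) R)
  simp_rw [he]
  have hz : ∀ s : ℝ → ℝ, (∀ R, |s R| = |R|) →
      Tendsto (fun R : ℝ => (I / (n + 1)) * ((c + s R * I - 1 : ℂ) ^ (n + 1))⁻¹) atTop (𝓝 0) := by
    intro s hs
    rw [← mul_zero (I / ((n : ℂ) + 1))]
    refine Tendsto.const_mul _ ?_
    refine squeeze_zero_norm' ?_ tendsto_inv_atTop_zero
    filter_upwards [eventually_ge_atTop 1] with R hR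
    have h2 : |s R| = R := by rw [hs, abs_of_nonneg (by linarith)]
    have := norm_inv_sub_one_pow_le (c := c) (u := s R) (by rw [h2]; exact hR) n
    rwa [h2] at this
  simpa using (hz (fun R => R) fun R => rfl).sub (hz (fun R => -R) fun R => abs_neg R)

lemma VanishesAtEnds.inv_pow (a b : ℝ) (c : ℂ) (n : ℕ) :
    VanishesAtEnds (fun z => c * ((z - 1) ^ (n + 1))⁻¹) a b := by
  intro ε hε
  refine ⟨max 1 (‖c‖ / ε), fun u hu x _ => ?_⟩
  have h1 : 1 ≤ |u| := (le_max_left _ _).trans hu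
  have h2 : ‖c‖ / ε ≤ |u| := (le_max_right _ _).trans hu
  rw [norm_mul]
  calc ‖c‖ * ‖((x + u * I - 1 : ℂ) ^ (n + 1))⁻¹‖ ≤ ‖c‖ * |u|⁻¹ := by
        gcongr; exact norm_inv_sub_one_pow_le h1 n
    _ ≤ ε := by
        rw [← div_eq_mul_inv, div_le_iff₀ (by linarith)]
        rw [div_le_iff₀ hε] at h2
        linarith

/-- The residue theorem for a strip and a pole at `1`. -/
lemma tendsto_lineDiff_pole {a b : ℝ} (ha : a < 1) (hb : 1 < b) {r : ℝ} (hr : 0 < r) (n : ℕ) :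
    ∀ g : ℂ → ℂ, Differentiable ℂ g → VanishesAtEnds (fun z => g z * ((z - 1) ^ n)⁻¹) a b →
      Tendsto (fun R => I * lineDiff (fun z => g z * ((z - 1) ^ n)⁻¹) a b R) atTop
        (𝓝 (∮ z in C(1, r), g z * ((z - 1) ^ n)⁻¹)) := by
  induction n with
  | zero =>
    intro g hg hv
    simp only [pow_zero, inv_one, mul_one] at hv ⊢
    rw [circleIntegral_eq_zero_of_differentiable_on_off_countable hr.le countable_empty
      hg.continuous.continuousOn fun z _ => hg z]
    exact tendsto_lineDiff_zero (ha.trans hb).le hg.differentiableOn hv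
  | succ n ih =>
    intro g hg hv
    -- Writing g(z) = g(1) + (z-1)h(z) splits off the highest pole with a constant numerator and
    -- leaves a pole of order n, to which the induction hypothesis applies.
    set h := dslope g 1 with hh
    have hhd : Differentiable ℂ h := by
      have := (differentiableOn_dslope (f := g) (c := 1) (s := univ) univ_mem).2 hg.differentiableOn
      exact differentiableOn_univ.1 this
    have hdec : ∀ z : ℂ, z ≠ 1 → g z * ((z - 1) ^ (n + 1))⁻¹ =
        g 1 * ((z - 1) ^ (n + 1))⁻¹ + h z * ((z - 1) ^ n)⁻¹ := by
      intro z hz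
      have hz' : z - 1 ≠ 0 := sub_ne_zero.2 hz
      have h1 : (z - 1) * h z = g z - g 1 := by
        rw [hh, dslope_of_ne _ hz, slope_def_field]; field_simp
      rw [pow_succ]
      field_simp
      linear_combination -h1
    have hv2 : VanishesAtEnds (fun z => h z * ((z - 1) ^ n)⁻¹) a b := by
      intro ε hε
      obtain ⟨R₁, h1⟩ := hv (ε / 2) (by positivity)
      obtain ⟨R₂, h2⟩ := VanishesAtEnds.inv_pow a b (g 1) n (ε / 2) (by positivity)
      refine ⟨max 1 (max R₁ R₂), fun u hu x hx => ?_⟩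
      have hu1 : 1 ≤ |u| := (le_max_left _ _).trans hu
      have hne : (x + u * I : ℂ) ≠ 1 := fun hc => by
        have := congrArg im hc
        simp at this
        rw [this] at hu1; norm_num at hu1
      have e := hdec _ hne
      have e' : h (x + u * I) * ((x + u * I - 1) ^ n)⁻¹ = g (x + u * I) * ((x + u * I - 1) ^ (n + 1))⁻¹ -
        g 1 * ((x + u * I - 1) ^ (n + 1))⁻¹ := by rw [e]; ring
      simp only
      rw [e']
      calc _ ≤ ε / 2 + ε / 2 := (norm_sub_le _ _).trans (add_le_add
            (h1 u ((le_max_left _ _).trans ((le_max_right _ _).trans hu)) x hx)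
            (h2 u ((le_max_right _ _).trans ((le_max_right _ _).trans hu)) x hx))
        _ = ε := by ring
    have ih' := ih h hhd hv2
    have hcirc : (∮ z in C(1, r), g z * ((z - 1) ^ (n + 1))⁻¹) =
        g 1 * (∮ z in C(1, r), ((z - 1) ^ (n + 1))⁻¹) + ∮ z in C(1, r), h z * ((z - 1) ^ n)⁻¹ := by
      have hci : ∀ (p : ℂ → ℂ) (j : ℕ), Continuous p → CircleIntegrable (fun z => p z * ((z - 1) ^ j)⁻¹) 1 r := by
        intro p j hp
        refine ContinuousOn.circleIntegrable hr.le (hp.continuousOn.mul (ContinuousOn.inv₀ (by fun_prop) fun z hz => ?_))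
        refine pow_ne_zero _ (sub_ne_zero.2 ?_)
        rintro rfl
        simp at hz; linarith
      rw [← circleIntegral.integral_const_mul, ← circleIntegral.integral_add
        (hci (fun _ => g 1) _ continuous_const) (hci h n hhd.continuous)]
      refine circleIntegral.integral_congr hr.le fun z hz => hdec z ?_
      rintro rfl
      simp at hz; linarith
    have hline : ∀ R, I * lineDiff (fun z => g z * ((z - 1) ^ (n + 1))⁻¹) a b R =
        g 1 * (I * lineDiff (fun z => ((z - 1) ^ (n + 1))⁻¹) a b R) +
          I * lineDiff (fun z => h z * ((z - 1) ^ n)⁻¹) a b R := by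
      intro R
      have hl : ∀ c : ℝ, c ≠ 1 → ∫ u in (-R)..R, g (c + u * I) * ((c + u * I - 1) ^ (n + 1))⁻¹ =
          g 1 * (∫ u in (-R)..R, ((c + u * I - 1 : ℂ) ^ (n + 1))⁻¹) +
            ∫ u in (-R)..R, h (c + u * I) * ((c + u * I - 1) ^ n)⁻¹ := by
        intro c hc
        rw [← intervalIntegral.integral_const_mul, ← intervalIntegral.integral_add]
        · exact intervalIntegral.integral_congr fun u _ => hdec _ (add_mul_I_ne_one hc)
        · exact ((continuous_inv_sub_one_pow hc (n + 1)).const_mul _).intervalIntegrable _ _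
        · exact ((hhd.continuous.comp (by fun_prop)).mul
            (continuous_inv_sub_one_pow hc n)).intervalIntegrable _ _
      simp only [lineDiff]
      rw [hl b hb.ne', hl a ha.ne]
      ring
    simp_rw [hline]
    rw [hcirc]
    refine Tendsto.add (Tendsto.const_mul _ ?_) ih'
    -- Only the simple pole contributes; a higher power has a single-valued antiderivative, and both
    -- sides vanish.
    rcases Nat.eq_zero_or_pos n with rfl | hn
    · have := tendsto_lineDiff_inv ha hb
      have hc : (∮ z in C(1, r), ((z - 1 : ℂ) ^ (0 + 1))⁻¹) = 2 * Real.pi * I := by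
        simpa using circleIntegral.integral_sub_center_inv (1 : ℂ) hr.ne'
      rw [hc]
      exact this
    · obtain ⟨j, rfl⟩ : ∃ j, n = j + 1 := ⟨n - 1, by omega⟩
      have hc : (∮ z in C(1, r), ((z - 1 : ℂ) ^ (j + 1 + 1))⁻¹) = 0 := by
        have := circleIntegral.integral_sub_zpow_of_ne (n := -((j + 1 + 1 : ℕ) : ℤ)) (by omega) (1 : ℂ) 1 r
        simpa only [zpow_neg, zpow_natCast] using this
      rw [hc]
      have := ((tendsto_integral_inv_pow hb.ne' j).sub (tendsto_integral_inv_pow ha.ne j)).const_mul I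
      simpa [lineDiff] using this

/-! ### The Gaussian kernel -/

/-- The kernel `M^{z-s} e^{(z-s)^2}` with `M = e^y` and `s = 1/2 + it`. -/
noncomputable def kernelE (t y : ℝ) (z : ℂ) : ℂ :=
  exp ((z - (1 / 2 + t * I)) * y + (z - (1 / 2 + t * I)) ^ 2)

/-- The inverse Mellin transform of `e^{w^2}` in logarithmic coordinates. -/
noncomputable def gauss (u : ℝ) : ℝ := Real.exp (-u ^ 2 / 4) / (2 * √Real.pi)

lemma gauss_nonneg (u : ℝ) : 0 ≤ gauss u := by unfold gauss; positivity

lemma continuous_gauss : Continuous gauss := by unfold gauss; fun_prop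

lemma one_le_two_mul_sqrt_pi : 1 ≤ 2 * √Real.pi := by
  have : 1 ≤ √Real.pi := Real.one_le_sqrt.2 (by linarith [Real.pi_gt_three])
  linarith

/-- Completing the square. As A is free, the Gaussian in log n - y can be traded for any power of
n/e^y, in either direction. -/
lemma gauss_le (A u : ℝ) : gauss u ≤ Real.exp (A ^ 2 + A * u) := by
  unfold gauss
  calc _ ≤ Real.exp (-u ^ 2 / 4) := div_le_self (Real.exp_pos _).le one_le_two_mul_sqrt_pi
    _ ≤ _ := Real.exp_le_exp.2 (by nlinarith [sq_nonneg (u / 2 + A)])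

lemma gauss_le_one (u : ℝ) : gauss u ≤ 1 := by simpa using gauss_le 0 u

lemma differentiable_kernelE (t y : ℝ) : Differentiable ℂ (kernelE t y) := by
  unfold kernelE; fun_prop

lemma norm_kernelE (t y : ℝ) (z : ℂ) :
    ‖kernelE t y z‖ = Real.exp ((z.re - 1 / 2) * y + (z.re - 1 / 2) ^ 2 - (z.im - t) ^ 2) := by
  rw [kernelE, norm_exp]
  congr 1
  simp [pow_two]
  ring

lemma exp_abs_mul_gaussian_le (A t u : ℝ) :
    Real.exp (A * |u|) * Real.exp (-(u - t) ^ 2) ≤ Real.exp (t ^ 2 + A ^ 2) * Real.exp (-u ^ 2 / 4) := by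
  rw [← Real.exp_add, ← Real.exp_add]
  refine Real.exp_le_exp.2 ?_
  nlinarith [sq_nonneg (u - 2 * t), sq_nonneg (|u| / 2 - A), sq_abs u]

lemma integrable_exp_neg_sq_div : Integrable fun u : ℝ => Real.exp (-u ^ 2 / 4) := by
  have := integrable_exp_neg_mul_sq (b := 1 / 4) (by norm_num)
  refine this.congr (Eventually.of_forall fun u => ?_)
  simp only; congr 1; ring

lemma norm_mul_kernelE_le {f : ℂ → ℂ} {A C : ℝ} {z : ℂ}
    (hz : ‖f z‖ ≤ C * Real.exp (A * |z.im|)) (t y : ℝ) :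
    ‖f z * kernelE t y z‖ ≤ (C * Real.exp ((z.re - 1 / 2) * y + (z.re - 1 / 2) ^ 2) *
      Real.exp (t ^ 2 + A ^ 2)) * Real.exp (-z.im ^ 2 / 4) := by
  have hC : 0 ≤ C := by
    have := (norm_nonneg _).trans hz
    exact nonneg_of_mul_nonneg_left this (Real.exp_pos _)
  rw [norm_mul, norm_kernelE, sub_eq_add_neg _ ((z.im - t) ^ 2), Real.exp_add]
  calc _ ≤ (C * Real.exp (A * |z.im|)) * (Real.exp ((z.re - 1 / 2) * y + (z.re - 1 / 2) ^ 2) *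
        Real.exp (-(z.im - t) ^ 2)) := by gcongr
    _ = C * Real.exp ((z.re - 1 / 2) * y + (z.re - 1 / 2) ^ 2) *
        (Real.exp (A * |z.im|) * Real.exp (-(z.im - t) ^ 2)) := by ring
    _ ≤ C * Real.exp ((z.re - 1 / 2) * y + (z.re - 1 / 2) ^ 2) *
        (Real.exp (t ^ 2 + A ^ 2) * Real.exp (-z.im ^ 2 / 4)) := by
        exact mul_le_mul_of_nonneg_left (exp_abs_mul_gaussian_le _ _ _) (by positivity)
    _ = _ := by ring

lemma integrable_line_mul_kernelE {f : ℂ → ℂ} {σ A C : ℝ}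
    (hf : Continuous fun u : ℝ => f (σ + u * I))
    (hC : ∀ u : ℝ, ‖f (σ + u * I)‖ ≤ C * Real.exp (A * |u|)) (t y : ℝ) :
    Integrable fun u : ℝ => f (σ + u * I) * kernelE t y (σ + u * I) := by
  refine Integrable.mono' (integrable_exp_neg_sq_div.const_mul (C * Real.exp ((σ - 1 / 2) * y +
    (σ - 1 / 2) ^ 2) * Real.exp (t ^ 2 + A ^ 2))) ?_ (Eventually.of_forall fun u => ?_)
  · exact (hf.mul ((differentiable_kernelE t y).continuous.comp (by fun_prop))).aestronglyMeasurable
  · have := norm_mul_kernelE_le (f := f) (z := σ + u * I) (by simpa using hC u) t y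
    simpa using this

lemma tendsto_const_mul_exp_neg_sq (D : ℝ) :
    ∀ ε > 0, ∃ R₀ : ℝ, ∀ u : ℝ, R₀ ≤ |u| → D * Real.exp (-u ^ 2 / 4) ≤ ε := by
  intro ε hε
  have h1 : Tendsto (fun r : ℝ => D * Real.exp (-r)) atTop (𝓝 (D * 0)) :=
    (Real.tendsto_exp_neg_atTop_nhds_zero).const_mul D
  rw [mul_zero] at h1
  obtain ⟨R, hR⟩ := eventually_atTop.1 (h1.eventually (gt_mem_nhds hε))
  refine ⟨max 4 R, fun u hu => ?_⟩
  have h4 : 4 ≤ |u| := (le_max_left _ _).trans hu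
  have := hR (u ^ 2 / 4) ((le_max_right _ _).trans (hu.trans (by rw [← sq_abs]; nlinarith)))
  rw [neg_div]
  exact this.le

/-- The growth condition is imposed only for |Im z| ≥ 1, so that the strip may contain the pole at
1. -/
lemma vanishesAtEnds_mul_kernelE {f : ℂ → ℂ} {a b A C : ℝ}
    (hC : ∀ z : ℂ, a ≤ z.re → z.re ≤ b → 1 ≤ |z.im| → ‖f z‖ ≤ C * Real.exp (A * |z.im|)) (t y : ℝ) :
    VanishesAtEnds (fun z => f z * kernelE t y z) a b := by
  have hcont : ContinuousOn (fun x : ℝ => Real.exp ((x - 1 / 2) * y + (x - 1 / 2) ^ 2)) (Icc a b) := by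
    fun_prop
  obtain ⟨B, hB⟩ := isCompact_Icc.exists_bound_of_continuousOn hcont
  intro ε hε
  obtain ⟨R₀, hR⟩ := tendsto_const_mul_exp_neg_sq (|C| * B * Real.exp (t ^ 2 + A ^ 2)) ε hε
  refine ⟨max 1 R₀, fun u hu x hx => ?_⟩
  have hu1 : 1 ≤ |u| := (le_max_left _ _).trans hu
  have h1 := hC (x + u * I) (by simpa using hx.1) (by simpa using hx.2) (by simpa using hu1)
  have h2 := norm_mul_kernelE_le h1 t y
  have hBx := hB x hx
  rw [Real.norm_eq_abs, abs_of_pos (Real.exp_pos _)] at hBx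
  refine h2.trans (le_trans ?_ (hR u ((le_max_right _ _).trans hu)))
  simp only [add_re, ofReal_re, mul_re, I_re, mul_zero, ofReal_im, I_im, mul_one, sub_self,
    add_zero, add_im, mul_im, zero_add]
  gcongr
  exact le_abs_self C

/-- Moving the line of integration across a strip without poles. -/
lemma integral_line_eq {f : ℂ → ℂ} {a b A C : ℝ} (hab : a ≤ b)
    (hf : DifferentiableOn ℂ f {z | a ≤ z.re ∧ z.re ≤ b})
    (hC : ∀ z : ℂ, a ≤ z.re → z.re ≤ b → ‖f z‖ ≤ C * Real.exp (A * |z.im|)) (t y : ℝ) :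
    ∫ u : ℝ, f (a + u * I) * kernelE t y (a + u * I) =
      ∫ u : ℝ, f (b + u * I) * kernelE t y (b + u * I) := by
  have hl : ∀ c ∈ Icc a b, Integrable fun u : ℝ => f (c + u * I) * kernelE t y (c + u * I) := by
    intro c hc
    refine integrable_line_mul_kernelE (A := A) (C := C) ?_ (fun u => ?_) t y
    · refine hf.continuousOn.comp_continuous (by fun_prop) fun u => ?_
      simpa using hc
    · have := hC (c + u * I) (by simpa using hc.1) (by simpa using hc.2)
      simpa using this
  have h1 := tendsto_lineDiff_zero hab
    (hf.mul (differentiable_kernelE t y).differentiableOn)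
    (vanishesAtEnds_mul_kernelE (fun z h1 h2 _ => hC z h1 h2) t y)
  have h2 : Tendsto (fun R => I * lineDiff (fun z => f z * kernelE t y z) a b R) atTop
      (𝓝 (I * ((∫ u : ℝ, f (b + u * I) * kernelE t y (b + u * I)) -
        ∫ u : ℝ, f (a + u * I) * kernelE t y (a + u * I)))) :=
    ((intervalIntegral_tendsto_integral (hl b ⟨hab, le_rfl⟩) tendsto_neg_atTop_atBot tendsto_id).sub
      (intervalIntegral_tendsto_integral (hl a ⟨le_rfl, hab⟩) tendsto_neg_atTop_atBot tendsto_id)).const_mul I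
  have h3 := tendsto_nhds_unique h2 h1
  rw [mul_eq_zero] at h3
  exact (sub_eq_zero.1 (h3.resolve_left I_ne_zero)).symm

/-! ### The smoothed sums, their polar parts, and the integrals on the critical line -/

/-- The smoothed integral of `ζ^k` on the critical line. -/
noncomputable def critB (k : ℕ) (y t : ℝ) : ℂ :=
  (2 * Real.pi : ℂ)⁻¹ * ∫ u : ℝ, riemannZeta ((1 / 2 : ℝ) + u * I) ^ k * kernelE t y ((1 / 2 : ℝ) + u * I)

/-- The coefficients of the smoothed Dirichlet polynomial. -/
noncomputable def coefD (k : ℕ) (y : ℝ) (n : ℕ) : ℝ :=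
  dk k n * (n : ℝ) ^ (-(1 / 2) : ℝ) * gauss (Real.log n - y)

/-- The smoothed Dirichlet polynomial. -/
noncomputable def dirichletD (k : ℕ) (y t : ℝ) : ℂ :=
  ∑' n : ℕ, (coefD k y n : ℂ) * exp (-(t * Real.log n : ℝ) * I)

/-- The residue at `1`. -/
noncomputable def polarD (k : ℕ) (y t : ℝ) : ℂ :=
  (2 * (Real.pi : ℂ) * I)⁻¹ * ∮ z in C(1, 1 / 2), riemannZeta z ^ k * kernelE t y z

lemma coefD_nonneg (k : ℕ) (y : ℝ) (n : ℕ) : 0 ≤ coefD k y n := by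
  unfold coefD
  have := gauss_nonneg (Real.log n - y)
  positivity

lemma coefD_zero (k : ℕ) (y : ℝ) : coefD k y 0 = 0 := by simp [coefD, dk_zero_right]

lemma coefD_le (k : ℕ) (y A : ℝ) (n : ℕ) :
    coefD k y n ≤ Real.exp (A ^ 2 + A * y) * (dk k n * (n : ℝ) ^ (-(A + 1 / 2))) := by
  rcases eq_or_ne n 0 with rfl | hn
  · rw [coefD_zero]; positivity
  have hn0 : (0 : ℝ) < n := by exact_mod_cast Nat.pos_of_ne_zero hn
  unfold coefD
  have h := gauss_le (-A) (Real.log n - y)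
  have e : Real.exp ((-A) ^ 2 + -A * (Real.log n - y)) = Real.exp (A ^ 2 + A * y) * (n : ℝ) ^ (-A) := by
    rw [Real.rpow_def_of_pos hn0, ← Real.exp_add]; congr 1; ring
  rw [e] at h
  calc _ ≤ dk k n * (n : ℝ) ^ (-(1 / 2) : ℝ) * (Real.exp (A ^ 2 + A * y) * (n : ℝ) ^ (-A)) := by gcongr
    _ = Real.exp (A ^ 2 + A * y) * (dk k n * ((n : ℝ) ^ (-A) * (n : ℝ) ^ (-(1 / 2) : ℝ))) := by ring
    _ = _ := by rw [← Real.rpow_add hn0]; congr 3; ring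

lemma summable_coefD (k : ℕ) (y : ℝ) : Summable (coefD k y) :=
  Summable.of_nonneg_of_le (coefD_nonneg k y) (coefD_le k y 1)
    ((summable_dk_mul_rpow k (by norm_num : (1 : ℝ) < 1 + 1 / 2)).mul_left _)

lemma norm_exp_neg_mul_I (x : ℝ) : ‖exp (-(x : ℂ) * I)‖ = 1 := by
  rw [← ofReal_neg, norm_exp_ofReal_mul_I]

lemma norm_dirichletD_le_tsum (k : ℕ) (y t : ℝ) : ‖dirichletD k y t‖ ≤ ∑' n, coefD k y n := by
  refine tsum_of_norm_bounded (summable_coefD k y).hasSum fun n => ?_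
  rw [norm_mul, norm_exp_neg_mul_I, mul_one, norm_real, Real.norm_of_nonneg (coefD_nonneg k y n)]

lemma tsum_coefD_le (k : ℕ) {A : ℝ} (hA : 1 / 2 < A) :
    ∃ C : ℝ, 1 ≤ C ∧ ∀ y, ∑' n, coefD k y n ≤ C * Real.exp (A * y) := by
  set S := ∑' n : ℕ, (dk k n : ℝ) * (n : ℝ) ^ (-(A + 1 / 2))
  refine ⟨max 1 (Real.exp (A ^ 2) * S), le_max_left _ _, fun y => ?_⟩
  have hs := summable_dk_mul_rpow k (by linarith : (1 : ℝ) < A + 1 / 2)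
  calc ∑' n, coefD k y n ≤ ∑' n, Real.exp (A ^ 2 + A * y) * (dk k n * (n : ℝ) ^ (-(A + 1 / 2))) :=
        (summable_coefD k y).tsum_le_tsum (coefD_le k y A) (hs.mul_left _)
    _ = (Real.exp (A ^ 2) * S) * Real.exp (A * y) := by rw [tsum_mul_left, Real.exp_add]; ring
    _ ≤ _ := by gcongr; exact le_max_right _ _

/-- The integrand is the exponential of a quadratic polynomial in u. The value does not depend on σ,
as it must by Cauchy's theorem. -/
lemma integral_cpow_mul_kernelE (σ t y : ℝ) {n : ℕ} (hn : n ≠ 0) :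
    ∫ u : ℝ, 1 / (n : ℂ) ^ (σ + u * I : ℂ) * kernelE t y (σ + u * I) =
      2 * Real.pi * ((n : ℝ) ^ (-(1 / 2) : ℝ) * gauss (Real.log n - y) : ℝ) *
        exp (-(t * Real.log n : ℝ) * I) := by
  have hn0 : (n : ℂ) ≠ 0 := by exact_mod_cast hn
  have hnp : (0 : ℝ) < n := by exact_mod_cast Nat.pos_of_ne_zero hn
  set l := Real.log n with hl
  have hlog : Complex.log n = (l : ℂ) := by rw [hl, ofReal_log hnp.le]; simp
  set b : ℂ := σ - (1 / 2 + t * I) with hb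
  have e : ∀ u : ℝ, 1 / (n : ℂ) ^ (σ + u * I : ℂ) * kernelE t y (σ + u * I) =
      exp (-1 * (u : ℂ) ^ 2 + (I * (y - l + 2 * b)) * u + (b * y + b ^ 2 - σ * l)) := by
    intro u
    rw [cpow_def_of_ne_zero hn0, hlog, one_div, ← exp_neg, kernelE, ← exp_add]
    congr 1
    rw [hb]
    linear_combination (u : ℂ) ^ 2 * I_sq
  simp_rw [e]
  rw [integral_cexp_quadratic (by norm_num)]
  have e1 : b * y + b ^ 2 - σ * l - (I * (y - l + 2 * b)) ^ 2 / (4 * -1) =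
      ((-(l - y) ^ 2 / 4 : ℝ) : ℂ) + (((-(1 / 2) * l : ℝ) : ℂ) + (-(t * l : ℝ) * I)) := by
    rw [hb]; push_cast
    linear_combination ((y - l + 2 * (σ - (1 / 2 + t * I)) : ℂ) ^ 2 / 4) * I_sq
  rw [e1, exp_add, exp_add, ← ofReal_exp, ← ofReal_exp]
  have e2 : ((n : ℝ) ^ (-(1 / 2) : ℝ)) = Real.exp (-(1 / 2) * l) := by
    rw [Real.rpow_def_of_pos hnp, mul_comm]
  have e3 : ((Real.pi : ℂ) / - -1) ^ (1 / 2 : ℂ) = ((√Real.pi : ℝ) : ℂ) := by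
    rw [neg_neg, div_one, Real.sqrt_eq_rpow, ofReal_cpow Real.pi_pos.le]; norm_num
  rw [e2, e3, gauss]
  have hs : ((√Real.pi : ℝ) : ℂ) ≠ 0 := by
    exact_mod_cast (Real.sqrt_pos.2 Real.pi_pos).ne'
  have hs2 : (Real.pi : ℂ) = ((√Real.pi : ℝ) : ℂ) * ((√Real.pi : ℝ) : ℂ) := by
    rw [← ofReal_mul, Real.mul_self_sqrt Real.pi_pos.le]
  rw [hs2]
  push_cast
  field_simp

lemma dirichletD_eq_integral (k : ℕ) (y t : ℝ) :
    dirichletD k y t = (2 * Real.pi : ℂ)⁻¹ *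
      ∫ u : ℝ, riemannZeta ((2 : ℝ) + u * I) ^ k * kernelE t y ((2 : ℝ) + u * I) := by
  set F : ℕ → ℝ → ℂ := fun n u => LSeries.term (fun n => (dk k n : ℂ)) ((2 : ℝ) + u * I) n *
    kernelE t y ((2 : ℝ) + u * I) with hF
  have hFn : ∀ n u, n ≠ 0 → F n u = dk k n * (1 / (n : ℂ) ^ ((2 : ℝ) + u * I : ℂ) *
      kernelE t y ((2 : ℝ) + u * I)) := by
    intro n u hn
    simp only [hF, LSeries.term_of_ne_zero hn]; ring
  have hF0 : ∀ u, F 0 u = 0 := fun u => by simp [hF]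
  have hnorm : ∀ n : ℕ, ∀ u : ℝ, ‖LSeries.term (fun n => (dk k n : ℂ)) ((2 : ℝ) + u * I) n‖ ≤
      dk k n * (n : ℝ) ^ (-(2 : ℝ)) := by
    intro n u
    rcases eq_or_ne n 0 with rfl | hn
    · simp
    have hnp : (0 : ℝ) < n := by exact_mod_cast Nat.pos_of_ne_zero hn
    rw [LSeries.term_of_ne_zero hn, norm_div, Complex.norm_natCast, ← ofReal_natCast n,
      norm_cpow_eq_rpow_re_of_pos hnp, Real.rpow_neg hnp.le, div_eq_mul_inv]
    simp
  have hcont : ∀ n : ℕ, Continuous fun u : ℝ => LSeries.term (fun n => (dk k n : ℂ)) ((2 : ℝ) + u * I) n := by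
    intro n
    rcases eq_or_ne n 0 with rfl | hn
    · simp only [LSeries.term_zero]; exact continuous_const
    have hn0 : (n : ℂ) ≠ 0 := by exact_mod_cast hn
    simp only [LSeries.term_of_ne_zero hn]
    refine continuous_const.div ?_ fun u => by simp [cpow_eq_zero_iff, hn0]
    exact (by fun_prop : Continuous fun u : ℝ => ((2 : ℝ) + u * I : ℂ)).const_cpow (Or.inl hn0)
  have hint : ∀ n, Integrable (F n) := fun n =>
    integrable_line_mul_kernelE (A := 0) (C := dk k n * (n : ℝ) ^ (-(2 : ℝ)))
      (f := fun z => LSeries.term (fun n => (dk k n : ℂ)) z n) (hcont n)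
      (fun u => by simpa using hnorm n u) t y
  have hK : Integrable fun u : ℝ => kernelE t y ((2 : ℝ) + u * I) := by
    have := integrable_line_mul_kernelE (A := 0) (C := 1) (σ := 2) (f := fun _ => 1) continuous_const
      (fun u => by simp) t y
    simpa using this
  have hsumm : Summable fun n => ∫ u, ‖F n u‖ := by
    refine Summable.of_nonneg_of_le (fun n => integral_nonneg fun u => norm_nonneg _) (fun n => ?_)
      ((summable_dk_mul_rpow k (by norm_num : (1 : ℝ) < 2)).mul_right
        (∫ u : ℝ, ‖kernelE t y ((2 : ℝ) + u * I)‖))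
    rw [← integral_const_mul]
    refine integral_mono (hint n).norm (hK.norm.const_mul _) fun u => ?_
    simp only [hF, norm_mul]
    exact mul_le_mul_of_nonneg_right (hnorm n u) (norm_nonneg _)
  have h := hasSum_integral_of_summable_integral_norm hint hsumm
  have hpt : ∀ u : ℝ, ∑' n, F n u = riemannZeta ((2 : ℝ) + u * I) ^ k * kernelE t y ((2 : ℝ) + u * I) := by
    intro u
    have h1 := LSeriesHasSum_dk k (s := (2 : ℝ) + u * I) (by simp)
    exact (h1.mul_right _).tsum_eq
  simp_rw [hpt] at h
  rw [← h.tsum_eq, ← tsum_mul_left, dirichletD]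
  refine tsum_congr fun n => ?_
  rcases eq_or_ne n 0 with rfl | hn
  · simp [hF0, coefD_zero]
  · have : ∫ u, F n u = dk k n * ∫ u : ℝ, 1 / (n : ℂ) ^ ((2 : ℝ) + u * I : ℂ) *
        kernelE t y ((2 : ℝ) + u * I) := by
      rw [← integral_const_mul]
      exact integral_congr_ae (Eventually.of_forall fun u => hFn n u hn)
    rw [this, integral_cpow_mul_kernelE 2 t y hn, coefD]
    have hp : (Real.pi : ℂ) ≠ 0 := by exact_mod_cast Real.pi_ne_zero
    push_cast
    field_simp

lemma continuous_riemannZeta_pow_line (k : ℕ) {σ : ℝ} (hσ : σ ≠ 1) :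
    Continuous fun u : ℝ => riemannZeta (σ + u * I) ^ k := by
  refine Continuous.pow ?_ k
  rw [continuous_iff_continuousAt]
  intro u
  exact ContinuousAt.comp (f := fun u : ℝ => (σ + u * I : ℂ)) (g := riemannZeta)
    (differentiableAt_riemannZeta (add_mul_I_ne_one hσ)).continuousAt (by fun_prop)

lemma exists_norm_riemannZeta_pow_le (k : ℕ) (a : ℝ) :
    ∃ C : ℝ, 1 ≤ C ∧ ∀ s : ℂ, a ≤ s.re → s.re ≤ 2 → 1 ≤ |s.im| →
      ‖riemannZeta s ^ k‖ ≤ C * Real.exp ((2 * k) * |s.im|) := by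
  obtain ⟨C, hC, h⟩ := exists_norm_riemannZeta_le a
  refine ⟨C ^ k, one_le_pow₀ hC, fun s h1 h2 h3 => ?_⟩
  rw [norm_pow]
  calc ‖riemannZeta s‖ ^ k ≤ (C * Real.exp (2 * |s.im|)) ^ k := by gcongr; exact h s h1 h2 h3
    _ = _ := by rw [mul_pow, ← Real.exp_nat_mul]; ring_nf

lemma exists_norm_riemannZeta_pow_line_le (k : ℕ) {σ : ℝ} (hσ : σ ≠ 1) (hσ2 : σ ≤ 2) :
    ∃ C : ℝ, ∀ u : ℝ, ‖riemannZeta (σ + u * I) ^ k‖ ≤ C * Real.exp ((2 * k) * |u|) := by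
  obtain ⟨C, hC, h⟩ := exists_norm_riemannZeta_pow_le k σ
  obtain ⟨B, hB⟩ := (isCompact_Icc (a := (-1 : ℝ)) (b := 1)).exists_bound_of_continuousOn
    (continuous_riemannZeta_pow_line k hσ).continuousOn
  refine ⟨max C B, fun u => ?_⟩
  rcases le_total 1 |u| with hu | hu
  · have := h (σ + u * I) (by simp) (by simpa using hσ2) (by simpa using hu)
    simp only [add_im, ofReal_im, mul_im, ofReal_re, I_im, mul_one, I_re, mul_zero, add_zero, zero_add] at this
    exact this.trans (by gcongr; exact le_max_left _ _)
  · have h1 := hB u (abs_le.1 hu)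
    have h2 : 1 ≤ Real.exp ((2 * k) * |u|) := Real.one_le_exp (by positivity)
    have h3 : 0 ≤ max C B := by linarith [le_max_left C B]
    calc _ ≤ B := h1
      _ ≤ max C B * 1 := by rw [mul_one]; exact le_max_right _ _
      _ ≤ _ := by gcongr

lemma integrable_riemannZeta_pow_line (k : ℕ) {σ : ℝ} (hσ : σ ≠ 1) (hσ2 : σ ≤ 2) (t y : ℝ) :
    Integrable fun u : ℝ => riemannZeta (σ + u * I) ^ k * kernelE t y (σ + u * I) := by
  obtain ⟨C, hC⟩ := exists_norm_riemannZeta_pow_line_le k hσ hσ2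
  exact integrable_line_mul_kernelE (f := fun z => riemannZeta z ^ k)
    (continuous_riemannZeta_pow_line k hσ) hC t y

/-- Moving the line from `Re z = 2` to the critical line crosses the pole at `1`. -/
lemma critB_eq (k : ℕ) (y t : ℝ) : critB k y t = dirichletD k y t - polarD k y t := by
  -- With the entire function (z-1)ζ(z) in place of ζ, the integrand is g(z)/(z-1)^k, the form
  -- required by the residue theorem for the strip.
  set g : ℂ → ℂ := fun z => riemannZeta₁ z ^ k * kernelE t y z with hg
  have hgd : Differentiable ℂ g := (differentiable_riemannZeta₁.pow k).mul (differentiable_kernelE t y)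
  have hgz : ∀ z : ℂ, z ≠ 1 → g z * ((z - 1) ^ k)⁻¹ = riemannZeta z ^ k * kernelE t y z := by
    intro z hz
    simp only [hg]
    rw [riemannZeta_eq_inv_sub_mul hz, mul_pow, inv_pow]; ring
  have hv : VanishesAtEnds (fun z => g z * ((z - 1) ^ k)⁻¹) (1 / 2 : ℝ) (2 : ℝ) := by
    obtain ⟨C, hC, h⟩ := exists_norm_riemannZeta_pow_le k (1 / 2)
    have h1 := vanishesAtEnds_mul_kernelE (f := fun z => riemannZeta z ^ k)
      (fun z h1 h2 h3 => h z h1 h2 h3) t y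
    intro ε hε
    obtain ⟨R, hR⟩ := h1 ε hε
    refine ⟨max 1 R, fun u hu x hx => ?_⟩
    have hne : (x + u * I : ℂ) ≠ 1 := fun hc => by
      have h5 := congrArg im hc
      simp at h5
      have := (le_max_left 1 R).trans hu
      rw [h5] at this; norm_num at this
    simp only
    rw [hgz _ hne]
    exact hR u ((le_max_right _ _).trans hu) x hx
  have h1 := tendsto_lineDiff_pole (by norm_num : (1 / 2 : ℝ) < 1) (by norm_num : (1 : ℝ) < 2)
    (r := 1 / 2) (by norm_num) k g hgd hv
  have hline : ∀ R, lineDiff (fun z => g z * ((z - 1) ^ k)⁻¹) (1 / 2 : ℝ) (2 : ℝ) R =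
      lineDiff (fun z => riemannZeta z ^ k * kernelE t y z) (1 / 2 : ℝ) (2 : ℝ) R := by
    intro R
    simp only [lineDiff]
    congr 1 <;> refine intervalIntegral.integral_congr fun u _ => hgz _ (add_mul_I_ne_one (by norm_num))
  simp_rw [hline] at h1
  have h2 : Tendsto (fun R => I * lineDiff (fun z => riemannZeta z ^ k * kernelE t y z) (1 / 2 : ℝ) (2 : ℝ) R) atTop
      (𝓝 (I * ((∫ u : ℝ, riemannZeta ((2 : ℝ) + u * I) ^ k * kernelE t y ((2 : ℝ) + u * I)) -
        ∫ u : ℝ, riemannZeta ((1 / 2 : ℝ) + u * I) ^ k * kernelE t y ((1 / 2 : ℝ) + u * I)))) :=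
    ((intervalIntegral_tendsto_integral (integrable_riemannZeta_pow_line k (by norm_num) le_rfl t y)
      tendsto_neg_atTop_atBot tendsto_id).sub
      (intervalIntegral_tendsto_integral (integrable_riemannZeta_pow_line k (by norm_num) (by norm_num) t y)
        tendsto_neg_atTop_atBot tendsto_id)).const_mul I
  have h3 := tendsto_nhds_unique h2 h1
  have hcirc : (∮ z in C(1, 1 / 2), g z * ((z - 1) ^ k)⁻¹) =
      ∮ z in C(1, 1 / 2), riemannZeta z ^ k * kernelE t y z :=
    circleIntegral.integral_congr (by norm_num) fun z hz => hgz z (by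
      rintro rfl; simp at hz)
  rw [hcirc] at h3
  rw [critB, dirichletD_eq_integral, polarD, ← h3]
  have hp : (Real.pi : ℂ) ≠ 0 := by exact_mod_cast Real.pi_ne_zero
  generalize (∫ u : ℝ, riemannZeta ((2 : ℝ) + u * I) ^ k * kernelE t y ((2 : ℝ) + u * I)) = A
  generalize (∫ u : ℝ, riemannZeta ((1 / 2 : ℝ) + u * I) ^ k * kernelE t y ((1 / 2 : ℝ) + u * I)) = B
  field_simp
  ring

/-! ### Bounds for the polar part and the critical integral -/

lemma exp_neg_sub_sq_le {a r t : ℝ} (ha : |a| ≤ r) :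
    -(a - t) ^ 2 ≤ r ^ 2 + -t ^ 2 / 2 := by
  have : a ^ 2 ≤ r ^ 2 := sq_le_sq' (abs_le.1 ha).1 (abs_le.1 ha).2
  nlinarith [sq_nonneg (2 * a - t)]

lemma differentiableOn_riemannZeta_pow_mul_kernelE (k : ℕ) (t y : ℝ) :
    DifferentiableOn ℂ (fun z => riemannZeta z ^ k * kernelE t y z) {s | 1 / 4 < s.re ∧ s ≠ 1} :=
  fun z hz => (((differentiableAt_riemannZeta hz.2).pow k).mul
    (differentiable_kernelE t y z)).differentiableWithinAt

/-- On the circle |z-1| = r the imaginary part is bounded, so (z-s)² has real part at most O(1) -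
t²/2: the residue is concentrated at bounded height. The constant e² covers the bounded part of the
exponent, and a smaller r brings the growth in y ≥ 0 close to e^{y/2}. -/
lemma exists_norm_polarD_le (k : ℕ) {r : ℝ} (hr : 0 < r) (hr2 : r ≤ 1 / 2) :
    ∃ C : ℝ, 1 ≤ C ∧ ∀ y t : ℝ,
      ‖polarD k y t‖ ≤ C * Real.exp (y / 2 + r * |y|) * Real.exp (-t ^ 2 / 2) := by
  obtain ⟨Z, hZ1, hZ⟩ := exists_riemannZeta_circle_bound hr
  refine ⟨Z ^ k * Real.exp 2, ?_, fun y t => ?_⟩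
  · have h1 : 1 ≤ Z ^ k := one_le_pow₀ hZ1
    have h2 : 1 ≤ Real.exp 2 := Real.one_le_exp (by norm_num)
    nlinarith
  have h3 : ‖(2 * (Real.pi : ℂ) * I)⁻¹‖ = (2 * Real.pi)⁻¹ := by
    simp [abs_of_pos Real.pi_pos]
  have hpt : ∀ z ∈ Metric.sphere (1 : ℂ) r, ‖riemannZeta z ^ k * kernelE t y z‖ ≤
      Z ^ k * Real.exp 2 * Real.exp (y / 2 + r * |y|) * Real.exp (-t ^ 2 / 2) := by
    intro z hz
    have hz' : ‖z - 1‖ = r := by simpa [dist_eq_norm] using hz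
    have hre : |z.re - 1| ≤ r := by simpa [hz'] using abs_re_le_norm (z - 1)
    have him : |z.im| ≤ r := by simpa [hz'] using abs_im_le_norm (z - 1)
    rw [norm_mul, norm_pow, norm_kernelE, mul_assoc, mul_assoc, ← Real.exp_add, ← Real.exp_add]
    have e1 := exp_neg_sub_sq_le (t := t) him
    have e2 : (z.re - 1) * y ≤ r * |y| := by
      calc _ ≤ |(z.re - 1) * y| := le_abs_self _
        _ = |z.re - 1| * |y| := abs_mul _ _
        _ ≤ _ := by gcongr
    have e3 := abs_le.1 hre
    gcongr
    · exact hZ z hz'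
    · nlinarith
  rw [polarD, circleIntegral_eq_half (differentiableOn_riemannZeta_pow_mul_kernelE k t y) hr hr2,
    norm_mul, h3]
  have := circleIntegral.norm_integral_le_of_norm_le_const hr.le hpt
  have hp := Real.pi_pos
  calc _ ≤ (2 * Real.pi)⁻¹ * (2 * Real.pi * r * (Z ^ k * Real.exp 2 * Real.exp (y / 2 + r * |y|) *
        Real.exp (-t ^ 2 / 2))) := by gcongr
    _ = r * (Z ^ k * Real.exp 2 * Real.exp (y / 2 + r * |y|) * Real.exp (-t ^ 2 / 2)) := by field_simp
    _ ≤ 1 * (Z ^ k * Real.exp 2 * Real.exp (y / 2 + r * |y|) * Real.exp (-t ^ 2 / 2)) := by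
      gcongr; linarith
    _ = _ := one_mul _

lemma critB_eq_line (k m : ℕ) (y t : ℝ) :
    critB k y t = (2 * Real.pi : ℂ)⁻¹ * ∫ u : ℝ, riemannZeta ((1 / 2 - m : ℝ) + u * I) ^ k *
      kernelE t y ((1 / 2 - m : ℝ) + u * I) := by
  have hm : (1 / 2 - m : ℝ) ≤ 1 / 2 := by have := Nat.cast_nonneg (α := ℝ) m; linarith
  have hne : ∀ z : ℂ, z.re ≤ 1 / 2 → z ≠ 1 := by
    rintro z hz rfl; norm_num at hz
  have hd : DifferentiableOn ℂ (fun z => riemannZeta z ^ k)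
      {z | (1 / 2 - m : ℝ) ≤ z.re ∧ z.re ≤ 1 / 2} := fun z hz =>
    ((differentiableAt_riemannZeta (hne z hz.2)).pow k).differentiableWithinAt
  obtain ⟨C, hC, h⟩ := exists_norm_riemannZeta_pow_le k (1 / 2 - m)
  have hK : IsCompact ((Icc (1 / 2 - m : ℝ) (1 / 2)) ×ℂ (Icc (-1 : ℝ) 1)) :=
    isCompact_Icc.reProdIm isCompact_Icc
  obtain ⟨B, hB⟩ := hK.exists_bound_of_continuousOn (f := fun z => riemannZeta z ^ k)
    (hd.continuousOn.mono fun z hz => (mem_reProdIm.1 hz).1)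
  have hbd : ∀ z : ℂ, (1 / 2 - m : ℝ) ≤ z.re → z.re ≤ (1 / 2 : ℝ) →
      ‖riemannZeta z ^ k‖ ≤ max C B * Real.exp ((2 * k) * |z.im|) := by
    intro z h1 h2
    rcases le_total 1 |z.im| with hu | hu
    · exact (h z h1 (by linarith) hu).trans (by gcongr; exact le_max_left _ _)
    · have h3 := hB z (mem_reProdIm.2 ⟨⟨h1, h2⟩, abs_le.1 hu⟩)
      have h4 : 1 ≤ Real.exp ((2 * k) * |z.im|) := Real.one_le_exp (by positivity)
      have h5 : 0 ≤ max C B := by linarith [le_max_left C B]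
      calc _ ≤ B := h3
        _ ≤ max C B * 1 := by rw [mul_one]; exact le_max_right _ _
        _ ≤ _ := by gcongr
  rw [critB, integral_line_eq hm hd hbd t y]

lemma integrable_one_add_abs_pow_mul_exp (n : ℕ) :
    Integrable fun v : ℝ => (1 + |v|) ^ n * Real.exp (-v ^ 2) := by
  have h1 : Integrable fun v : ℝ => Real.exp ((n : ℝ) ^ 2 + (n : ℝ)) * Real.exp (-v ^ 2 / 4) :=
    integrable_exp_neg_sq_div.const_mul _
  refine h1.mono' (by fun_prop) (Eventually.of_forall fun v => ?_)
  rw [Real.norm_of_nonneg (by positivity), ← Real.exp_add]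
  have h2 : (1 + |v|) ^ n ≤ Real.exp (n * |v|) := by
    rw [Real.exp_nat_mul]
    gcongr
    rw [add_comm]; exact Real.add_one_le_exp _
  calc _ ≤ Real.exp (n * |v|) * Real.exp (-v ^ 2) := by gcongr
    _ = Real.exp (n * |v| + -v ^ 2) := (Real.exp_add _ _).symm
    _ ≤ _ := by
      refine Real.exp_le_exp.2 ?_
      nlinarith [sq_nonneg (|v| / 2 - n), sq_abs v, Nat.cast_nonneg (α := ℝ) n]

/-- There is no pole to the left of the critical line. On Re z = 1/2 - m the kernel supplies
e^{-my}, and the functional equation costs (1+|u|)^{mk}, which the Gaussian transfers from u to t.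
-/
lemma exists_norm_critB_le (k : ℕ) {m : ℕ} (hm : 1 ≤ m) :
    ∃ C : ℝ, 1 ≤ C ∧ ∀ y t : ℝ, ‖critB k y t‖ ≤ C * Real.exp (-(m * y)) * (1 + |t|) ^ (m * k) := by
  obtain ⟨C, hC, h⟩ := exists_norm_riemannZeta_pow_half_sub_nat_le k hm
  set J := ∫ v : ℝ, (1 + |v|) ^ (m * k) * Real.exp (-v ^ 2)
  refine ⟨max 1 (C * Real.exp (m ^ 2) * J), le_max_left _ _, fun y t => ?_⟩
  rw [critB_eq_line k m, norm_mul]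
  have hp : ‖(2 * Real.pi : ℂ)⁻¹‖ ≤ 1 := by
    simp only [norm_inv, norm_mul, norm_real, RCLike.norm_ofNat, Real.norm_eq_abs, abs_of_pos Real.pi_pos]
    exact inv_le_one_of_one_le₀ (by linarith [Real.pi_gt_three])
  have hg : Integrable fun v : ℝ => (C * Real.exp (m ^ 2) * Real.exp (-(m * y)) * (1 + |t|) ^ (m * k)) *
      ((1 + |v|) ^ (m * k) * Real.exp (-v ^ 2)) := (integrable_one_add_abs_pow_mul_exp _).const_mul _
  have hI : ‖∫ u : ℝ, riemannZeta ((1 / 2 - m : ℝ) + u * I) ^ k *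
      kernelE t y ((1 / 2 - m : ℝ) + u * I)‖ ≤
      (C * Real.exp (m ^ 2) * Real.exp (-(m * y)) * (1 + |t|) ^ (m * k)) * J := by
    rw [← integral_const_mul, ← integral_sub_right_eq_self (fun v : ℝ => (C * Real.exp (m ^ 2) *
      Real.exp (-(m * y)) * (1 + |t|) ^ (m * k)) * ((1 + |v|) ^ (m * k) * Real.exp (-v ^ 2))) t]
    refine norm_integral_le_of_norm_le (hg.comp_sub_right t) (Eventually.of_forall fun u => ?_)
    have h1 := h u
    have e : ((1 / 2 : ℂ) - m + u * I) = (((1 / 2 - m : ℝ) : ℂ) + u * I) := by push_cast; ring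
    rw [e] at h1
    rw [norm_mul, norm_kernelE]
    simp only [add_re, ofReal_re, mul_re, I_re, mul_zero, ofReal_im, I_im, mul_one, sub_self,
      add_zero, add_im, mul_im, zero_add]
    have h2 : 1 + |u| ≤ (1 + |t|) * (1 + |u - t|) := by
      have : |u| ≤ |u - t| + |t| := by simpa using abs_add_le (u - t) t
      nlinarith [abs_nonneg (u - t), abs_nonneg t]
    have h3 : Real.exp ((1 / 2 - m - 1 / 2) * y + (1 / 2 - (m : ℝ) - 1 / 2) ^ 2 - (u - t) ^ 2) =
        Real.exp (m ^ 2) * Real.exp (-(m * y)) * Real.exp (-(u - t) ^ 2) := by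
      rw [← Real.exp_add, ← Real.exp_add]; congr 1; ring
    rw [h3]
    calc _ ≤ (C * ((1 + |t|) * (1 + |u - t|)) ^ (m * k)) *
          (Real.exp (m ^ 2) * Real.exp (-(m * y)) * Real.exp (-(u - t) ^ 2)) := by
          gcongr
          exact h1.trans (by gcongr)
      _ = _ := by rw [mul_pow]; ring
  calc _ ≤ 1 * ((C * Real.exp (m ^ 2) * Real.exp (-(m * y)) * (1 + |t|) ^ (m * k)) * J) := by gcongr
    _ = (C * Real.exp (m ^ 2) * J) * Real.exp (-(m * y)) * (1 + |t|) ^ (m * k) := by ring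
    _ ≤ _ := by gcongr; exact le_max_right _ _

/-! ### Continuity -/

lemma continuous_critB (k : ℕ) : Continuous fun p : ℝ × ℝ => critB k p.1 p.2 := by
  refine continuous_const.mul ?_
  rw [continuous_iff_continuousAt]
  rintro ⟨y₀, t₀⟩
  obtain ⟨C, hC⟩ := exists_norm_riemannZeta_pow_line_le k (σ := 1 / 2) (by norm_num) (by norm_num)
  have hC0 : 0 ≤ C := by
    have := (norm_nonneg _).trans (hC 0); simpa using this
  have hb : ∀ᶠ p : ℝ × ℝ in 𝓝 (y₀, t₀), |p.2| < |t₀| + 1 := by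
    have : Continuous fun p : ℝ × ℝ => |p.2| := by fun_prop
    exact this.continuousAt.eventually (gt_mem_nhds (by simp))
  refine continuousAt_of_dominated (bound := fun u => (C * Real.exp ((|t₀| + 1) ^ 2 + (2 * k) ^ 2)) *
    Real.exp (-u ^ 2 / 4)) (Eventually.of_forall fun p => ?_) ?_
    (integrable_exp_neg_sq_div.const_mul _) (Eventually.of_forall fun u => ?_)
  · exact (integrable_riemannZeta_pow_line k (by norm_num) (by norm_num) p.2 p.1).aestronglyMeasurable
  · filter_upwards [hb] with p hp
    refine Eventually.of_forall fun u => ?_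
    have h1 := norm_mul_kernelE_le (f := fun z => riemannZeta z ^ k) (z := (1 / 2 : ℝ) + u * I)
      (A := 2 * k) (C := C) (by simpa using hC u) p.2 p.1
    refine h1.trans ?_
    simp only [add_re, ofReal_re, mul_re, I_re, mul_zero, ofReal_im, I_im, mul_one, sub_self,
      add_zero, add_im, mul_im, zero_add, zero_mul, Real.exp_zero, ne_eq, OfNat.ofNat_ne_zero,
      not_false_eq_true, zero_pow]
    have : p.2 ^ 2 ≤ (|t₀| + 1) ^ 2 := by rw [← sq_abs]; gcongr
    gcongr
  · refine Continuous.continuousAt ?_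
    unfold kernelE
    fun_prop

lemma continuous_polarD (k : ℕ) : Continuous fun p : ℝ × ℝ => polarD k p.1 p.2 := by
  unfold polarD circleIntegral
  refine continuous_const.mul (intervalIntegral.continuous_parametric_intervalIntegral_of_continuous'
    ?_ _ _)
  simp only [deriv_circleMap, smul_eq_mul, Function.uncurry_def, kernelE]
  have h := (continuous_twistedSeries_circleMap k 1)
  simp only [twistedSeries_one] at h
  refine Continuous.mul (by fun_prop) (Continuous.mul ?_ (by fun_prop))
  exact h.comp continuous_snd

lemma continuous_dirichletD (k : ℕ) : Continuous fun p : ℝ × ℝ => dirichletD k p.1 p.2 := by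
  have : (fun p : ℝ × ℝ => dirichletD k p.1 p.2) = fun p => critB k p.1 p.2 + polarD k p.1 p.2 := by
    ext p; rw [critB_eq]; ring
  rw [this]
  exact (continuous_critB k).add (continuous_polarD k)

/-! ### The polar part as a Mellin transform -/

lemma integral_exp_mul_gauss (w : ℂ) (y : ℝ) :
    ∫ v : ℝ, exp (w * v) * gauss (v - y) = exp (w * y + w ^ 2) := by
  have e : ∀ v : ℝ, exp (w * v) * gauss (v - y) =
      (2 * √Real.pi : ℂ)⁻¹ * exp (-(1 / 4) * (v : ℂ) ^ 2 + (w + y / 2) * v + (-(y : ℂ) ^ 2 / 4)) := by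
    intro v
    rw [gauss, ofReal_div, ofReal_exp, mul_div_assoc', ← exp_add, div_eq_mul_inv, mul_comm]
    congr 1
    · push_cast; ring
    · congr 1; push_cast; ring
  simp_rw [e]
  rw [integral_const_mul, integral_cexp_quadratic (by norm_num)]
  have e1 : ((Real.pi : ℂ) / - -(1 / 4)) ^ (1 / 2 : ℂ) = 2 * ((√Real.pi : ℝ) : ℂ) := by
    have : ((Real.pi : ℂ) / - -(1 / 4)) = ((2 ^ 2 * Real.pi : ℝ) : ℂ) := by push_cast; ring
    rw [this, show (1 / 2 : ℂ) = ((1 / 2 : ℝ) : ℂ) by push_cast; ring,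
      ← ofReal_cpow (by positivity), ← Real.sqrt_eq_rpow, Real.sqrt_mul (by positivity),
      Real.sqrt_sq (by norm_num)]
    push_cast; ring
  have hs : ((√Real.pi : ℝ) : ℂ) ≠ 0 := by
    exact_mod_cast (Real.sqrt_pos.2 Real.pi_pos).ne'
  rw [e1, inv_mul_cancel_left₀ (by simpa using hs)]
  congr 1; ring

lemma integrable_exp_abs_mul_gauss (A y : ℝ) :
    Integrable fun v : ℝ => Real.exp (A * |v|) * gauss (v - y) := by
  have h1 : Integrable fun v : ℝ => Real.exp (A * |y| + (2 * A) ^ 2) * Real.exp (-((v - y) / √2) ^ 2 / 4) :=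
    (((integrable_exp_neg_sq_div).comp_div (by positivity)).comp_sub_right y).const_mul _
  have := continuous_gauss
  refine h1.mono' (by fun_prop) (Eventually.of_forall fun v => ?_)
  rw [Real.norm_of_nonneg (mul_nonneg (Real.exp_pos _).le (gauss_nonneg _)), ← Real.exp_add, gauss,
    mul_div_assoc', ← Real.exp_add]
  refine (div_le_self (Real.exp_pos _).le one_le_two_mul_sqrt_pi).trans (Real.exp_le_exp.2 ?_)
  rw [div_pow, Real.sq_sqrt (by norm_num)]
  rcases le_total 0 A with hA | hA
  · have : |v| ≤ |v - y| + |y| := by simpa using abs_add_le (v - y) y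
    nlinarith [sq_nonneg (|v - y| - 4 * A), sq_abs (v - y), mul_le_mul_of_nonneg_left this hA]
  · have : |y| ≤ |v| + |v - y| := by
      have := abs_sub_abs_le_abs_sub y v
      rw [abs_sub_comm] at this; linarith
    nlinarith [sq_nonneg (|v - y| + 4 * A), sq_abs (v - y), mul_le_mul_of_nonpos_left this hA]

/-- On the circle the kernel is replaced by the Gaussian integral it equals, and the two
integrations are interchanged. This exhibits the polar part as the continuous analogue of the
Dirichlet polynomial, with d_k(n) replaced by its mean density Q_k(x,1). -/
lemma polarD_eq_integral_residueLog (k : ℕ) (y t : ℝ) :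
    polarD k y t = ∫ v : ℝ, residueLog k 1 v * (Real.exp (v / 2) * gauss (v - y) : ℝ) *
      exp (-(t * v : ℝ) * I) := by
  set c : ℝ → ℂ := fun θ => circleMap 1 (1 / 2) θ with hc
  set g : ℝ → ℂ := fun θ => (2 * (Real.pi : ℂ) * I)⁻¹ * (circleMap 0 (1 / 2) θ * I *
    riemannZeta (c θ) ^ k) with hg
  have hz := continuous_twistedSeries_circleMap k 1
  simp only [twistedSeries_one] at hz
  have hgc : Continuous g := by simp only [hg]; fun_prop
  have hcc : Continuous c := continuous_circleMap 1 (1 / 2)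
  set F : ℝ → ℝ → ℂ := fun θ v => g θ * (exp ((c θ - (1 / 2 + t * I)) * v) * gauss (v - y)) with hF
  have e1 : polarD k y t = ∫ θ in (0 : ℝ)..2 * Real.pi, ∫ v : ℝ, F θ v := by
    rw [polarD, circleIntegral, ← intervalIntegral.integral_const_mul]
    refine intervalIntegral.integral_congr fun θ _ => ?_
    simp only [hF, integral_const_mul, integral_exp_mul_gauss, deriv_circleMap, hg, kernelE, smul_eq_mul, hc]
    ring_nf
  have hint : Integrable (Function.uncurry F) ((volume.restrict (Set.uIoc 0 (2 * Real.pi))).prod volume) := by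
    have h1 : Integrable (fun θ => ‖g θ‖) (volume.restrict (Set.uIoc 0 (2 * Real.pi))) := by
      have := (hgc.norm.intervalIntegrable (μ := volume) 0 (2 * Real.pi))
      exact intervalIntegrable_iff.1 this
    have h2 := h1.mul_prod (integrable_exp_abs_mul_gauss 1 y)
    have hgau := continuous_gauss
    refine h2.mono' ?_ (Eventually.of_forall fun p => ?_)
    · refine Continuous.aestronglyMeasurable ?_
      simp only [Function.uncurry_def, hF]
      have h5 : Continuous fun p : ℝ × ℝ => ((gauss (p.2 - y) : ℝ) : ℂ) := by fun_prop
      fun_prop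
    · simp only [Function.uncurry, hF, norm_mul, norm_real, Real.norm_of_nonneg (gauss_nonneg _), one_mul]
      gcongr
      · exact gauss_nonneg _
      rw [norm_exp]
      refine Real.exp_le_exp.2 ?_
      have h6 : ‖c p.1 - 1‖ = 1 / 2 := by
        have := circleMap_mem_sphere (1 : ℂ) (by norm_num : (0 : ℝ) ≤ 1 / 2) p.1
        exact mem_sphere_iff_norm.1 this
      have h7 : |(c p.1).re - 1| ≤ 1 / 2 := by simpa [h6] using abs_re_le_norm (c p.1 - 1)
      have h8 : |(c p.1).re - 1 / 2| ≤ 1 := by rw [abs_le] at *; constructor <;> linarith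
      calc _ = ((c p.1).re - 1 / 2) * p.2 := by simp
        _ ≤ |((c p.1).re - 1 / 2) * p.2| := le_abs_self _
        _ = |(c p.1).re - 1 / 2| * |p.2| := abs_mul _ _
        _ ≤ 1 * |p.2| := by gcongr
        _ = _ := one_mul _
  rw [e1, intervalIntegral_integral_swap hint]
  refine integral_congr_ae (Eventually.of_forall fun v => ?_)
  simp only [residueLog, circleIntegral, twistedSeries_one, deriv_circleMap, smul_eq_mul]
  rw [mul_assoc, mul_assoc, ← intervalIntegral.integral_mul_const, ← intervalIntegral.integral_const_mul]
  refine intervalIntegral.integral_congr fun θ _ => ?_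
  simp only [hF, hg]
  have : exp ((c θ - (1 / 2 + t * I)) * v) =
      exp (v * (c θ - 1)) * (exp (v / 2 : ℝ) * exp (-(t * v : ℝ) * I)) := by
    rw [← exp_add, ← exp_add]; congr 1; push_cast; ring
  rw [this]; push_cast; ring

/-- The Mellin density of the polar part. -/
noncomputable def polarDensity (k : ℕ) (y x : ℝ) : ℝ :=
  Qk k x 1 * (x ^ (-(1 / 2) : ℝ) * gauss (Real.log x - y))

lemma polarD_eq_integral (k : ℕ) (y t : ℝ) :
    polarD k y t = ∫ x in Ioi (0 : ℝ), (polarDensity k y x : ℂ) * exp (-(t * Real.log x : ℝ) * I) := by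
  have h := integral_image_eq_integral_abs_deriv_smul (s := univ) (f := Real.exp) (f' := Real.exp)
    MeasurableSet.univ (fun x _ => (Real.hasDerivAt_exp x).hasDerivWithinAt) Real.exp_injective.injOn
    (fun x => (polarDensity k y x : ℂ) * exp (-(t * Real.log x : ℝ) * I))
  rw [image_univ, Real.range_exp] at h
  rw [h, polarD_eq_integral_residueLog, setIntegral_univ]
  refine integral_congr_ae (Eventually.of_forall fun v => ?_)
  simp only [polarDensity, abs_of_pos (Real.exp_pos v), Real.log_exp, real_smul]
  have h1 := residueLog_one_eq_ofReal k (Real.exp_pos v)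
  rw [Real.log_exp] at h1
  have h2 : Real.exp v * Real.exp v ^ (-(1 / 2) : ℝ) = Real.exp (v / 2) := by
    rw [← Real.exp_mul, ← Real.exp_add]; congr 1; ring
  rw [h1, ← h2]
  push_cast; ring

/-! ### Fourier inversion -/

/-- For y ≥ 0 the line Re z = -1/2 gives decay e^{-y}. For y ≤ 0 the Dirichlet polynomial is O(e^y),
and the residue on a circle of radius 1/4 is O(e^{y/4}), which determines the rate. -/
lemma exists_norm_critB_le_exp (k : ℕ) (t : ℝ) :
    ∃ C : ℝ, ∀ y, ‖critB k y t‖ ≤ C * Real.exp (-(1 / 4) * |y|) := by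
  obtain ⟨C₁, hC₁, h₁⟩ := exists_norm_critB_le k (le_refl 1)
  obtain ⟨C₂, hC₂, h₂⟩ := tsum_coefD_le k (A := 1) (by norm_num)
  obtain ⟨C₃, hC₃, h₃⟩ := exists_norm_polarD_le k (r := 1 / 4) (by norm_num) (by norm_num)
  have hp : 0 ≤ C₁ * (1 + |t|) ^ (1 * k) := by positivity
  refine ⟨C₁ * (1 + |t|) ^ (1 * k) + (C₂ + C₃), fun y => ?_⟩
  rcases le_total 0 y with hy | hy
  · calc _ ≤ C₁ * Real.exp (-((1 : ℕ) * y)) * (1 + |t|) ^ (1 * k) := h₁ y t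
      _ = C₁ * (1 + |t|) ^ (1 * k) * Real.exp (-y) := by push_cast; ring_nf
      _ ≤ _ := by
        rw [abs_of_nonneg hy]
        gcongr
        · linarith
        · linarith
  · rw [critB_eq]
    have e1 := (norm_dirichletD_le_tsum k y t).trans (h₂ y)
    have e2 := h₃ y t
    rw [abs_of_nonpos hy] at *
    have e3 : Real.exp (-t ^ 2 / 2) ≤ 1 := Real.exp_le_one_iff.2 (by nlinarith [sq_nonneg t])
    have e4 : Real.exp (1 * y) ≤ Real.exp (-(1 / 4) * -y) := Real.exp_le_exp.2 (by linarith)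
    have e5 : y / 2 + 1 / 4 * -y = -(1 / 4) * -y := by ring
    rw [e5] at e2
    calc _ ≤ C₂ * Real.exp (1 * y) + C₃ * Real.exp (-(1 / 4) * -y) * Real.exp (-t ^ 2 / 2) :=
          (norm_sub_le _ _).trans (add_le_add e1 e2)
      _ ≤ C₂ * Real.exp (-(1 / 4) * -y) + C₃ * Real.exp (-(1 / 4) * -y) * 1 := by gcongr
      _ ≤ _ := by nlinarith [mul_nonneg hp (Real.exp_pos (-(1 / 4) * -y)).le]

lemma integrable_exp_neg_mul_abs {a : ℝ} (ha : 0 < a) : Integrable fun y : ℝ => Real.exp (-a * |y|) := by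
  rw [← integrableOn_univ, ← Iic_union_Ioi (a := 0)]
  refine IntegrableOn.union ?_ ?_
  · refine (integrableOn_exp_mul_Iic ha 0).congr_fun (fun y hy => ?_) measurableSet_Iic
    simp only [abs_of_nonpos (mem_Iic.1 hy)]; congr 1; ring
  · refine (integrableOn_exp_mul_Ioi (neg_neg_of_pos ha) 0).congr_fun (fun y hy => ?_) measurableSet_Ioi
    simp only [abs_of_pos (mem_Ioi.1 hy)]

lemma integrable_critB (k : ℕ) (t : ℝ) : Integrable fun y => critB k y t := by
  obtain ⟨C, hC⟩ := exists_norm_critB_le_exp k t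
  have h : Continuous fun y : ℝ => critB k y t :=
    (continuous_critB k).comp (f := fun y : ℝ => (y, t)) (Continuous.prodMk_left t)
  have hg : Integrable fun y : ℝ => C * Real.exp (-(1 / 4) * |y|) :=
    (integrable_exp_neg_mul_abs (by norm_num)).const_mul C
  refine Integrable.mono' hg h.aestronglyMeasurable (Eventually.of_forall fun y => ?_)
  exact hC y

/-- With z = s + iv the kernel is e^{ivy - v²}, so `critB` in the variable y is a Fourier transform
of v ↦ ζ(s+iv)^k e^{-v²}. The assertion is Fourier inversion at v = 0. -/
lemma integral_critB (k : ℕ) (t : ℝ) :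
    ∫ y, critB k y t = riemannZeta (1 / 2 + t * I) ^ k := by
  set f : ℝ → ℂ := fun v => riemannZeta ((1 / 2 : ℝ) + (v + t : ℝ) * I) ^ k * exp (-(v : ℂ) ^ 2) with hf
  have hk : ∀ y v : ℝ, riemannZeta ((1 / 2 : ℝ) + (v + t : ℝ) * I) ^ k *
      kernelE t y ((1 / 2 : ℝ) + (v + t : ℝ) * I) = exp ((v * y : ℝ) * I) * f v := by
    intro y v
    simp only [hf, kernelE]
    rw [mul_left_comm, ← exp_add]
    congr 2
    push_cast
    linear_combination (v : ℂ) ^ 2 * I_sq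
  have hcont : Continuous f := by
    have := (continuous_riemannZeta_pow_line k (σ := 1 / 2) (by norm_num)).comp
      (by fun_prop : Continuous fun v : ℝ => v + t)
    exact this.mul (by fun_prop)
  have hint : Integrable f := by
    have := (integrable_riemannZeta_pow_line k (σ := 1 / 2) (by norm_num) (by norm_num) t 0).comp_add_right t
    refine this.congr (Eventually.of_forall fun v => ?_)
    simpa using hk 0 v
  have hB : ∀ w : ℝ, FourierTransform.fourier f w = 2 * Real.pi * critB k (-(2 * Real.pi) * w) t := by
    intro w
    rw [Real.fourier_real_eq_integral_exp_smul, critB, ← integral_add_right_eq_self (fun u : ℝ =>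
      riemannZeta ((1 / 2 : ℝ) + u * I) ^ k * kernelE t (-(2 * Real.pi) * w) ((1 / 2 : ℝ) + u * I)) t]
    simp_rw [hk]
    have hp : (2 * Real.pi : ℂ) ≠ 0 := by simp
    rw [mul_inv_cancel_left₀ hp]
    refine integral_congr_ae (Eventually.of_forall fun v => ?_)
    simp only [smul_eq_mul]
    congr 3
    ring_nf
  have hpi : -(2 * Real.pi) ≠ 0 := by simp
  have hfi : Integrable (FourierTransform.fourier f) := by
    have : Integrable fun w : ℝ => (2 * Real.pi : ℂ) * critB k (-(2 * Real.pi) * w) t :=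
      ((integrable_critB k t).comp_mul_left' hpi).const_mul _
    exact this.congr (Eventually.of_forall fun w => (hB w).symm)
  have h := hint.fourierInv_fourier_eq hfi (v := 0) hcont.continuousAt
  rw [Real.fourierInv_eq'] at h
  simp only [inner_zero_right, mul_zero, ofReal_zero, zero_mul, exp_zero, one_smul, hB] at h
  rw [integral_const_mul, Measure.integral_comp_mul_left (fun y => critB k y t)] at h
  have hf0 : f 0 = riemannZeta (1 / 2 + t * I) ^ k := by simp [hf]
  rw [hf0] at h
  rw [← h, abs_inv, abs_neg, abs_of_pos (by positivity), real_smul]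
  have hp : (Real.pi : ℂ) ≠ 0 := by exact_mod_cast Real.pi_ne_zero
  push_cast
  field_simp

/-! ### The smooth cut-off -/

/-- The smooth cut-off at `n ≈ e^Y`. -/
noncomputable def cutoff (Y : ℝ) (n : ℕ) : ℝ := ∫ y in Iic Y, gauss (Real.log n - y)

lemma integrable_gauss_sub (a : ℝ) : Integrable fun y => gauss (a - y) := by
  have h := (integrable_exp_abs_mul_gauss 0 0).comp_sub_left a
  simpa using h

lemma integral_gauss_sub (a : ℝ) : ∫ y, gauss (a - y) = 1 := by
  have h := integral_exp_mul_gauss 0 0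
  simp only [zero_mul, exp_zero, one_mul, sub_zero] at h
  rw [integral_complex_ofReal] at h
  rw [integral_sub_left_eq_self gauss _ a]
  have : ((∫ v : ℝ, gauss v : ℝ) : ℂ) = 1 := by rw [h]; simp
  exact_mod_cast this

lemma cutoff_nonneg (Y : ℝ) (n : ℕ) : 0 ≤ cutoff Y n := integral_nonneg fun _ => gauss_nonneg _

lemma one_sub_cutoff (Y : ℝ) (n : ℕ) : 1 - cutoff Y n = ∫ y in Ioi Y, gauss (Real.log n - y) := by
  rw [cutoff, ← integral_gauss_sub (Real.log n), ← compl_Iic,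
    ← integral_add_compl measurableSet_Iic (integrable_gauss_sub (Real.log n)) (s := Iic Y)]
  ring

/-- By `gauss_le` with a free exponent, the cut-off is smaller than any power of e^Y/n beyond e^Y;
`one_sub_cutoff_le` is the mirror statement below e^Y. -/
lemma cutoff_le {A : ℝ} (hA : 0 < A) (Y : ℝ) {n : ℕ} (hn : n ≠ 0) :
    cutoff Y n ≤ Real.exp (A ^ 2) / A * Real.exp (A * Y) * (n : ℝ) ^ (-A) := by
  have hn0 : (0 : ℝ) < n := by exact_mod_cast Nat.pos_of_ne_zero hn
  have hi := (integrableOn_exp_mul_Iic hA Y).const_mul (Real.exp (A ^ 2) * (n : ℝ) ^ (-A))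
  calc cutoff Y n ≤ ∫ y in Iic Y, Real.exp (A ^ 2) * (n : ℝ) ^ (-A) * Real.exp (A * y) := by
        refine integral_mono (integrable_gauss_sub _).integrableOn hi fun y => ?_
        refine (gauss_le (-A) _).trans_eq ?_
        rw [Real.rpow_def_of_pos hn0, ← Real.exp_add, ← Real.exp_add]; congr 1; ring
    _ = _ := by rw [integral_const_mul, integral_exp_mul_Iic hA]; ring

lemma one_sub_cutoff_le {A : ℝ} (hA : 0 < A) (Y : ℝ) {n : ℕ} (hn : n ≠ 0) :
    1 - cutoff Y n ≤ Real.exp (A ^ 2) / A * Real.exp (-(A * Y)) * (n : ℝ) ^ A := by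
  have hn0 : (0 : ℝ) < n := by exact_mod_cast Nat.pos_of_ne_zero hn
  have hA' : -A < 0 := by linarith
  have hi := (integrableOn_exp_mul_Ioi hA' Y).const_mul (Real.exp (A ^ 2) * (n : ℝ) ^ A)
  rw [one_sub_cutoff]
  calc _ ≤ ∫ y in Ioi Y, Real.exp (A ^ 2) * (n : ℝ) ^ A * Real.exp (-A * y) := by
        refine integral_mono (integrable_gauss_sub _).integrableOn hi fun y => ?_
        refine (gauss_le A _).trans_eq ?_
        rw [Real.rpow_def_of_pos hn0, ← Real.exp_add, ← Real.exp_add]; congr 1; ring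
    _ = _ := by
      rw [integral_const_mul, integral_exp_mul_Ioi hA']
      have : -A * Y = -(A * Y) := by ring
      rw [this]; field_simp

lemma one_sub_cutoff_nonneg (Y : ℝ) (n : ℕ) : 0 ≤ 1 - cutoff Y n := by
  rw [one_sub_cutoff]; exact integral_nonneg fun _ => gauss_nonneg _

/-- The Dirichlet series of `ζ^k` with a smooth cut-off. -/
noncomputable def cutoffZeta (k : ℕ) (Y : ℝ) (w : ℂ) : ℂ :=
  ∑' n : ℕ, ((dk k n * cutoff Y n : ℝ) : ℂ) * (n : ℂ) ^ (-w)

lemma norm_natCast_cpow_neg {n : ℕ} (hn : n ≠ 0) (w : ℂ) : ‖(n : ℂ) ^ (-w)‖ = (n : ℝ) ^ (-w.re) := by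
  have hnp : (0 : ℝ) < n := by exact_mod_cast Nat.pos_of_ne_zero hn
  rw [← ofReal_natCast n, norm_cpow_eq_rpow_re_of_pos hnp]; simp

lemma norm_cutoffZeta_term_le (k : ℕ) (Y : ℝ) {w : ℂ} (hw : 0 ≤ w.re) (n : ℕ) :
    ‖((dk k n * cutoff Y n : ℝ) : ℂ) * (n : ℂ) ^ (-w)‖ ≤ dk k n * cutoff Y n := by
  rcases eq_or_ne n 0 with rfl | hn
  · simp [dk_zero_right]
  have h0 : 0 ≤ dk k n * cutoff Y n := mul_nonneg (Nat.cast_nonneg _) (cutoff_nonneg _ _)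
  rw [norm_mul, norm_natCast_cpow_neg hn, norm_real, Real.norm_of_nonneg h0]
  refine mul_le_of_le_one_right h0 ?_
  exact Real.rpow_le_one_of_one_le_of_nonpos (by exact_mod_cast Nat.pos_of_ne_zero hn) (by linarith)

lemma summable_dk_mul_cutoff (k : ℕ) (Y : ℝ) : Summable fun n => (dk k n : ℝ) * cutoff Y n := by
  refine Summable.of_nonneg_of_le (fun n => mul_nonneg (Nat.cast_nonneg _) (cutoff_nonneg _ _)) (fun n => ?_)
    ((summable_dk_mul_rpow k (by norm_num : (1 : ℝ) < 2)).mul_left (Real.exp (2 ^ 2) / 2 * Real.exp (2 * Y)))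
  rcases eq_or_ne n 0 with rfl | hn
  · simp [dk_zero_right]
  calc _ ≤ dk k n * (Real.exp (2 ^ 2) / 2 * Real.exp (2 * Y) * (n : ℝ) ^ (-2 : ℝ)) := by
        gcongr; exact cutoff_le (by norm_num) Y hn
    _ = _ := by ring

lemma norm_cutoffZeta_le (k : ℕ) (Y : ℝ) {w : ℂ} (hw : 0 ≤ w.re) :
    ‖cutoffZeta k Y w‖ ≤ ∑' n, (dk k n : ℝ) * cutoff Y n :=
  tsum_of_norm_bounded (summable_dk_mul_cutoff k Y).hasSum (norm_cutoffZeta_term_le k Y hw)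

lemma differentiableOn_cutoffZeta (k : ℕ) (Y : ℝ) : DifferentiableOn ℂ (cutoffZeta k Y) {w | 0 < w.re} := by
  refine differentiableOn_tsum_of_summable_norm (summable_dk_mul_cutoff k Y) (fun n => ?_)
    (isOpen_lt continuous_const continuous_re) (fun n w hw => norm_cutoffZeta_term_le k Y (le_of_lt hw) n)
  rcases eq_or_ne n 0 with rfl | hn
  · simp [dk_zero_right]
  · have hn0 : (n : ℂ) ≠ 0 := by exact_mod_cast hn
    exact (Differentiable.const_mul (fun w => (differentiableAt_id.neg.const_cpow (Or.inl hn0))) _).differentiableOn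

/-- The exponent A = m - 1 leaves n^{A-(1/2+m)} = n^{-3/2}, which still sums against d_k, while the
whole saving e^{-(m-1)Y} is kept. -/
lemma exists_norm_riemannZeta_pow_sub_cutoffZeta_le (k : ℕ) {m : ℕ} (hm : 2 ≤ m) :
    ∃ C : ℝ, 1 ≤ C ∧ ∀ Y : ℝ, ∀ w : ℂ, w.re = 1 / 2 + m →
      ‖riemannZeta w ^ k - cutoffZeta k Y w‖ ≤ C * Real.exp (-((m - 1) * Y)) := by
  set A : ℝ := m - 1 with hA
  have hm' : (2 : ℝ) ≤ m := by exact_mod_cast hm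
  have hA0 : 0 < A := by linarith
  set Z := ∑' n : ℕ, (dk k n : ℝ) * (n : ℝ) ^ (-(3 / 2) : ℝ)
  refine ⟨max 1 (Real.exp (A ^ 2) / A * Z), le_max_left _ _, fun Y w hw => ?_⟩
  have h1 : HasSum (fun n : ℕ => (dk k n : ℂ) * (n : ℂ) ^ (-w)) (riemannZeta w ^ k) := by
    refine (LSeriesHasSum_dk k (s := w) (by rw [hw]; linarith)).congr_fun fun n => ?_
    rcases eq_or_ne n 0 with rfl | hn
    · simp [dk_zero_right]
    · rw [LSeries.term_of_ne_zero hn, cpow_neg, div_eq_mul_inv]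
  have h2 : HasSum (fun n : ℕ => ((dk k n * cutoff Y n : ℝ) : ℂ) * (n : ℂ) ^ (-w)) (cutoffZeta k Y w) :=
    (Summable.of_norm_bounded (summable_dk_mul_cutoff k Y)
      (norm_cutoffZeta_term_le k Y (by rw [hw]; linarith))).hasSum
  rw [← (h1.sub h2).tsum_eq]
  have hs := (summable_dk_mul_rpow k (by norm_num : (1 : ℝ) < 3 / 2)).mul_left
    (Real.exp (A ^ 2) / A * Real.exp (-(A * Y)))
  refine (tsum_of_norm_bounded hs.hasSum fun n => ?_).trans ?_
  · rcases eq_or_ne n 0 with rfl | hn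
    · simp [dk_zero_right]
    have hnp : (0 : ℝ) < n := by exact_mod_cast Nat.pos_of_ne_zero hn
    have e : (dk k n : ℂ) * (n : ℂ) ^ (-w) - ((dk k n * cutoff Y n : ℝ) : ℂ) * (n : ℂ) ^ (-w) =
        ((dk k n * (1 - cutoff Y n) : ℝ) : ℂ) * (n : ℂ) ^ (-w) := by push_cast; ring
    have h0 : 0 ≤ dk k n * (1 - cutoff Y n) := mul_nonneg (Nat.cast_nonneg _) (one_sub_cutoff_nonneg _ _)
    rw [e, norm_mul, norm_natCast_cpow_neg hn, norm_real, Real.norm_of_nonneg h0, hw]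
    calc _ ≤ dk k n * (Real.exp (A ^ 2) / A * Real.exp (-(A * Y)) * (n : ℝ) ^ A) * (n : ℝ) ^ (-(1 / 2 + m : ℝ)) := by
          gcongr; exact one_sub_cutoff_le hA0 Y hn
      _ = Real.exp (A ^ 2) / A * Real.exp (-(A * Y)) * (dk k n * ((n : ℝ) ^ A * (n : ℝ) ^ (-(1 / 2 + m : ℝ)))) := by ring
      _ = _ := by rw [← Real.rpow_add hnp]; congr 3; rw [hA]; ring
  · rw [tsum_mul_left]
    calc _ = Real.exp (A ^ 2) / A * Z * Real.exp (-(A * Y)) := by ring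
      _ ≤ _ := by gcongr; exact le_max_right _ _

/-- The functional equation turns the critical integral into an integral of the cut-off series, up
to an error that is small for large `y` and `Y`. -/
lemma exists_enorm_critB_le_cutoffZeta (k : ℕ) {m : ℕ} (hm : 2 ≤ m) :
    ∃ C : ℝ, 1 ≤ C ∧ ∀ Y y t : ℝ, ‖critB k y t‖ₑ ≤
      ENNReal.ofReal C * (∫⁻ u : ℝ, ‖cutoffZeta k Y (1 / 2 - u * I)‖ₑ * ENNReal.ofReal (Real.exp (-(u - t) ^ 2))) +
      ENNReal.ofReal (C * Real.exp (-((m - 1) * Y)) * Real.exp (-(m * y)) * (1 + |t|) ^ (m * k)) := by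
  obtain ⟨X₀, hX₀, h₀⟩ := exists_norm_feFactor_half_add_nat_le 0
  obtain ⟨X₁, hX₁, h₁⟩ := exists_norm_feFactor_half_add_nat_le m
  obtain ⟨X₂, hX₂, h₂⟩ := exists_norm_feFactor_le (a := 1 / 2) (by norm_num) (1 / 2 + m)
  obtain ⟨R, hR, hRb⟩ := exists_norm_riemannZeta_pow_sub_cutoffZeta_le k hm
  have hm1 : 1 ≤ m := by omega
  have hm' : (2 : ℝ) ≤ m := by exact_mod_cast hm
  set J := ∫ v : ℝ, (1 + |v|) ^ (m * k) * Real.exp (-v ^ 2)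
  refine ⟨max (X₀ ^ k) (X₁ ^ k * R * Real.exp (m ^ 2) * J), (one_le_pow₀ hX₀).trans (le_max_left _ _), ?_⟩
  intro Y y t
  -- After the functional equation, ζ^k on Re z = 1/2 - m is split into the cut-off series f and its
  -- complement g. The part f is holomorphic for Re z < 1 and is moved back to the critical line,
  -- where the factor of the functional equation is bounded. The part g stays on the far line, where
  -- the Dirichlet series converges absolutely and its tail is small.
  set f : ℂ → ℂ := fun z => feFactor (1 - z) ^ k * cutoffZeta k Y (1 - z) with hf
  set g : ℂ → ℂ := fun z => feFactor (1 - z) ^ k * (riemannZeta (1 - z) ^ k - cutoffZeta k Y (1 - z)) with hg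
  set B := ∑' n, (dk k n : ℝ) * cutoff Y n
  have hfd : DifferentiableOn ℂ f {z | z.re < 1} := by
    have hmaps : MapsTo (fun z : ℂ => 1 - z) {z | z.re < 1} {w | 0 < w.re} := fun z hz => by
      simpa using hz
    refine DifferentiableOn.mul (DifferentiableOn.pow ?_ k) ?_
    · exact DifferentiableOn.comp (g := feFactor) (fun w hw => (differentiableAt_feFactor hw).differentiableWithinAt)
        (by fun_prop) hmaps
    · exact DifferentiableOn.comp (g := cutoffZeta k Y) (differentiableOn_cutoffZeta k Y) (by fun_prop) hmaps
  have hfb : ∀ z : ℂ, (1 / 2 - m : ℝ) ≤ z.re → z.re ≤ (1 / 2 : ℝ) →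
      ‖f z‖ ≤ (X₂ ^ k * B) * Real.exp ((2 * k) * |z.im|) := by
    intro z h1 h2
    have h3 := h₂ (1 - z) (by simp; linarith) (by simp; linarith)
    have h4 := norm_cutoffZeta_le k Y (w := 1 - z) (by simp; linarith)
    simp only [sub_im, one_im, zero_sub, abs_neg] at h3
    simp only [hf, norm_mul, norm_pow]
    calc _ ≤ (X₂ * Real.exp (2 * |z.im|)) ^ k * B := by gcongr
      _ = _ := by rw [mul_pow, ← Real.exp_nat_mul]; ring_nf
  have hm2 : (1 / 2 - m : ℝ) ≤ 1 / 2 := by linarith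
  have hshift := integral_line_eq hm2 (hfd.mono fun z hz => by
    have := hz.2; exact (show z.re < 1 by linarith)) hfb t y
  have hzeta : ∀ u : ℝ, riemannZeta ((1 / 2 - m : ℝ) + u * I) ^ k =
      f ((1 / 2 - m : ℝ) + u * I) + g ((1 / 2 - m : ℝ) + u * I) := by
    intro u
    set z : ℂ := (1 / 2 - m : ℝ) + u * I with hz
    have hre : z.re = 1 / 2 - m := by simp [hz]
    have := riemannZeta_one_sub_eq (s := 1 - z) (by simp [hre]; linarith) (by
      intro h; have := congrArg re h; simp [hre] at this; linarith)
    rw [sub_sub_cancel] at this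
    simp only [hf, hg]
    rw [this, mul_pow]; ring
  have hfi : Integrable fun u : ℝ => f ((1 / 2 - m : ℝ) + u * I) * kernelE t y ((1 / 2 - m : ℝ) + u * I) := by
    refine integrable_line_mul_kernelE (A := 2 * k) (C := X₂ ^ k * B) ?_ (fun u => ?_) t y
    · refine hfd.continuousOn.comp_continuous (by fun_prop) fun u => ?_
      simp; linarith
    · have := hfb ((1 / 2 - m : ℝ) + u * I) (by simp) (by simp)
      simpa using this
  have hzi := integrable_riemannZeta_pow_line k (σ := 1 / 2 - m) (by linarith) (by linarith) t y
  have hgb : ∀ u : ℝ, ‖g ((1 / 2 - m : ℝ) + u * I) * kernelE t y ((1 / 2 - m : ℝ) + u * I)‖ ≤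
      (X₁ ^ k * R * Real.exp (m ^ 2) * Real.exp (-((m - 1) * Y)) * Real.exp (-(m * y)) * (1 + |t|) ^ (m * k)) *
      ((1 + |u - t|) ^ (m * k) * Real.exp (-(u - t) ^ 2)) := by
    intro u
    have e : (1 : ℂ) - ((1 / 2 - m : ℝ) + u * I) = 1 / 2 + m + (-u : ℝ) * I := by push_cast; ring
    have h3 := h₁ (-u)
    have h4 := hRb Y (1 / 2 + m + (-u : ℝ) * I) (by simp)
    have h2 : 1 + |u| ≤ (1 + |t|) * (1 + |u - t|) := by
      have : |u| ≤ |u - t| + |t| := by simpa using abs_add_le (u - t) t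
      nlinarith [abs_nonneg (u - t), abs_nonneg t]
    rw [norm_mul, norm_kernelE]
    simp only [hg, e, norm_mul, norm_pow]
    simp only [add_re, ofReal_re, mul_re, I_re, mul_zero, ofReal_im, I_im, mul_one, sub_self,
      add_zero, add_im, mul_im, zero_add]
    have h5 : Real.exp ((1 / 2 - m - 1 / 2) * y + (1 / 2 - (m : ℝ) - 1 / 2) ^ 2 - (u - t) ^ 2) =
        Real.exp (m ^ 2) * Real.exp (-(m * y)) * Real.exp (-(u - t) ^ 2) := by
      rw [← Real.exp_add, ← Real.exp_add]; congr 1; ring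
    rw [h5]
    rw [abs_neg] at h3
    calc _ ≤ (X₁ * ((1 + |t|) * (1 + |u - t|)) ^ m) ^ k * (R * Real.exp (-((m - 1) * Y))) *
          (Real.exp (m ^ 2) * Real.exp (-(m * y)) * Real.exp (-(u - t) ^ 2)) := by
          gcongr
          exact h3.trans (by gcongr)
      _ = _ := by rw [mul_pow, ← pow_mul, mul_pow]; ring
  have hJi : Integrable fun u : ℝ => (X₁ ^ k * R * Real.exp (m ^ 2) * Real.exp (-((m - 1) * Y)) * Real.exp (-(m * y)) * (1 + |t|) ^ (m * k)) *
      ((1 + |u - t|) ^ (m * k) * Real.exp (-(u - t) ^ 2)) :=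
    ((integrable_one_add_abs_pow_mul_exp (m * k)).comp_sub_right t).const_mul _
  have hgI : ‖∫ u : ℝ, g ((1 / 2 - m : ℝ) + u * I) * kernelE t y ((1 / 2 - m : ℝ) + u * I)‖ ≤
      (X₁ ^ k * R * Real.exp (m ^ 2) * Real.exp (-((m - 1) * Y)) * Real.exp (-(m * y)) * (1 + |t|) ^ (m * k)) * J := by
    refine (norm_integral_le_of_norm_le hJi (Eventually.of_forall hgb)).trans_eq ?_
    rw [integral_const_mul, integral_sub_right_eq_self (fun v : ℝ => (1 + |v|) ^ (m * k) * Real.exp (-v ^ 2))]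
  have hp : ‖(2 * Real.pi : ℂ)⁻¹‖ₑ ≤ 1 := by
    rw [← ofReal_norm, ENNReal.ofReal_le_one]
    simp only [norm_inv, norm_mul, norm_real, RCLike.norm_ofNat, Real.norm_eq_abs, abs_of_pos Real.pi_pos]
    exact inv_le_one_of_one_le₀ (by linarith [Real.pi_gt_three])
  have hsplit : ∫ u : ℝ, riemannZeta ((1 / 2 - m : ℝ) + u * I) ^ k * kernelE t y ((1 / 2 - m : ℝ) + u * I) =
      (∫ u : ℝ, f ((1 / 2 : ℝ) + u * I) * kernelE t y ((1 / 2 : ℝ) + u * I)) +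
      ∫ u : ℝ, g ((1 / 2 - m : ℝ) + u * I) * kernelE t y ((1 / 2 - m : ℝ) + u * I) := by
    rw [← hshift, ← integral_add hfi]
    · refine integral_congr_ae (Eventually.of_forall fun u => ?_)
      simp only; rw [hzeta u]; ring
    · refine (hzi.sub hfi).congr (Eventually.of_forall fun u => ?_)
      simp only [Pi.sub_apply]; rw [hzeta u]; ring
  rw [critB_eq_line k m, hsplit, enorm_mul]
  refine (mul_le_of_le_one_left zero_le hp).trans ((enorm_add_le _ _).trans (add_le_add ?_ ?_))
  · refine (enorm_integral_le_lintegral_enorm _).trans ?_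
    rw [← lintegral_const_mul' _ _ ENNReal.ofReal_ne_top]
    refine lintegral_mono fun u => ?_
    have e : (1 : ℂ) - ((1 / 2 : ℝ) + u * I) = 1 / 2 - u * I := by push_cast; ring
    have e2 : (1 / 2 - u * I : ℂ) = 1 / 2 + (0 : ℕ) + (-u : ℝ) * I := by push_cast; ring
    have h3 := h₀ (-u)
    rw [← e2, pow_zero, mul_one] at h3
    simp only [hf, e, enorm_mul, enorm_pow]
    rw [mul_assoc]
    gcongr
    · rw [← ofReal_norm, ← ENNReal.ofReal_pow (norm_nonneg _)]
      refine ENNReal.ofReal_le_ofReal ((pow_le_pow_left₀ (norm_nonneg _) h3 k).trans (le_max_left _ _))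
    · rw [← ofReal_norm, norm_kernelE]
      refine ENNReal.ofReal_le_ofReal (Real.exp_le_exp.2 ?_)
      simp
  · rw [← ofReal_norm]
    refine ENNReal.ofReal_le_ofReal (hgI.trans ?_)
    calc _ = (X₁ ^ k * R * Real.exp (m ^ 2) * J) * Real.exp (-((m - 1) * Y)) * Real.exp (-(m * y)) * (1 + |t|) ^ (m * k) := by ring
      _ ≤ _ := by gcongr; exact le_max_right _ _

/-! ### Reduction of the moment to mean squares of the critical integral -/

lemma lintegral_mul_sq_le {α : Type*} [MeasurableSpace α] {μ : Measure α} {f g : α → ℝ≥0∞}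
    (hf : AEMeasurable f μ) (hg : Measurable g) :
    (∫⁻ a, f a * g a ∂μ) ^ 2 ≤ (∫⁻ a, g a ∂μ) * ∫⁻ a, f a ^ 2 * g a ∂μ := by
  have h := ENNReal.lintegral_mul_le_Lp_mul_Lq (μ.withDensity g) Real.HolderConjugate.two_two
    (hf.mono_ac (withDensity_absolutelyContinuous μ g)) (aemeasurable_const (b := (1 : ℝ≥0∞)))
  simp only [Pi.mul_apply, mul_one, ENNReal.one_rpow] at h
  have e1 : ∀ F : α → ℝ≥0∞, AEMeasurable F μ → ∫⁻ a, F a ∂μ.withDensity g = ∫⁻ a, F a * g a ∂μ := by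
    intro F hF
    rw [lintegral_withDensity_eq_lintegral_mul₀ hg.aemeasurable hF]
    simp [mul_comm]
  rw [e1 f hf, e1 _ aemeasurable_const, e1 _ (hf.pow_const _)] at h
  simp only [one_mul, ENNReal.rpow_two] at h
  calc _ ≤ ((∫⁻ a, f a ^ 2 * g a ∂μ) ^ (1 / 2 : ℝ) * (∫⁻ a, g a ∂μ) ^ (1 / 2 : ℝ)) ^ 2 := by gcongr
    _ = _ := by
      rw [mul_pow, ← ENNReal.rpow_natCast, ← ENNReal.rpow_natCast, ← ENNReal.rpow_mul, ← ENNReal.rpow_mul]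
      norm_num [mul_comm]

lemma conj_dirichletD (k : ℕ) (y t : ℝ) : (starRingEnd ℂ) (dirichletD k y t) = dirichletD k y (-t) := by
  rw [dirichletD, dirichletD, conj_tsum]
  refine tsum_congr fun n => ?_
  rw [map_mul, conj_ofReal, ← exp_conj]
  congr 2
  rw [map_mul, map_neg, conj_ofReal, conj_I]
  push_cast; ring

lemma enorm_dirichletD_neg (k : ℕ) (y t : ℝ) : ‖dirichletD k y (-t)‖ₑ = ‖dirichletD k y t‖ₑ := by
  rw [← conj_dirichletD, ← ofReal_norm, ← ofReal_norm, RCLike.norm_conj]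

lemma lintegral_Iic_exp_mul_le {a : ℝ} (ha : 0 < a) (C : ℝ) (c : ℝ) :
    ∫⁻ y in Iic c, ENNReal.ofReal (C * Real.exp (a * y)) = ENNReal.ofReal (C * (Real.exp (a * c) / a)) := by
  rcases le_total 0 C with hC | hC
  · rw [← ofReal_integral_eq_lintegral_ofReal ((integrableOn_exp_mul_Iic ha c).const_mul C)
      (Eventually.of_forall fun y => by positivity), integral_const_mul, integral_exp_mul_Iic ha]
  · have : ∀ y, ENNReal.ofReal (C * Real.exp (a * y)) = 0 := fun y =>
      ENNReal.ofReal_of_nonpos (mul_nonpos_of_nonpos_of_nonneg hC (Real.exp_pos _).le)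
    simp only [this, lintegral_zero]
    rw [ENNReal.ofReal_of_nonpos (mul_nonpos_of_nonpos_of_nonneg hC (by positivity))]

lemma lintegral_Ioi_exp_mul_le (C : ℝ) (hC : 0 ≤ C) {a : ℝ} (ha : 0 < a) (c : ℝ) :
    ∫⁻ y in Ioi c, ENNReal.ofReal (C * Real.exp (-(a * y))) = ENNReal.ofReal (C * (Real.exp (-(a * c)) / a)) := by
  have ha' : -a < 0 := by linarith
  have h : ∀ y, -(a * y) = -a * y := fun y => by ring
  simp_rw [h]
  rw [← ofReal_integral_eq_lintegral_ofReal ((integrableOn_exp_mul_Ioi ha' c).const_mul C)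
      (Eventually.of_forall fun y => by positivity), integral_const_mul, integral_exp_mul_Ioi ha', neg_div_neg_eq]

/-- The cut-off is an integral of Gaussians over y ≤ Y, so on the critical line the cut-off series
is the integral of `dirichletD` over y ≤ Y. The range y ≤ 0 contributes O(1), and the sign of the
height is immaterial because the coefficients are real. -/
lemma exists_enorm_cutoffZeta_half_le (k : ℕ) :
    ∃ C : ℝ, 1 ≤ C ∧ ∀ Y u : ℝ, ‖cutoffZeta k Y (1 / 2 - u * I)‖ₑ ≤
      ENNReal.ofReal C + ∫⁻ y in Icc 0 Y, ‖dirichletD k y u‖ₑ := by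
  obtain ⟨C, hC, h⟩ := tsum_coefD_le k (A := 1) (by norm_num)
  refine ⟨C, hC, fun Y u => ?_⟩
  have hterm : ∀ n : ℕ, ((dk k n * cutoff Y n : ℝ) : ℂ) * (n : ℂ) ^ (-(1 / 2 - u * I)) =
      ∫ y in Iic Y, (coefD k y n : ℂ) * exp (-((-u) * Real.log n : ℝ) * I) := by
    intro n
    rcases eq_or_ne n 0 with rfl | hn
    · simp [dk_zero_right, coefD_zero]
    have hnp : (0 : ℝ) < n := by exact_mod_cast Nat.pos_of_ne_zero hn
    have hn0 : (n : ℂ) ≠ 0 := by exact_mod_cast hn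
    rw [integral_mul_const, integral_complex_ofReal]
    simp only [coefD]
    rw [integral_const_mul, ← cutoff]
    have hlog : Complex.log n = (Real.log n : ℝ) := by rw [ofReal_log hnp.le]; simp
    have : (n : ℂ) ^ (-(1 / 2 - u * I)) = (((n : ℝ) ^ (-(1 / 2) : ℝ) : ℝ) : ℂ) * exp (-((-u) * Real.log n : ℝ) * I) := by
      rw [Real.rpow_def_of_pos hnp, ofReal_exp, ← exp_add, cpow_def_of_ne_zero hn0, hlog]
      congr 1; push_cast; ring
    rw [this]; push_cast; ring
  have hint : ∀ n, Integrable (fun y => (coefD k y n : ℂ) * exp (-((-u) * Real.log n : ℝ) * I)) (volume.restrict (Iic Y)) := by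
    intro n
    refine Integrable.mul_const ?_ _
    exact (((integrable_gauss_sub (Real.log n)).const_mul _).ofReal).integrableOn
  have hnorm : ∀ n, ∫ y in Iic Y, ‖(coefD k y n : ℂ) * exp (-((-u) * Real.log n : ℝ) * I)‖ =
      dk k n * (n : ℝ) ^ (-(1 / 2) : ℝ) * cutoff Y n := by
    intro n
    simp only [norm_mul, norm_exp_neg_mul_I, mul_one, norm_real, Real.norm_of_nonneg (coefD_nonneg _ _ _)]
    simp only [coefD]
    rw [integral_const_mul, ← cutoff]
  have hs : Summable fun n => ∫ y in Iic Y, ‖(coefD k y n : ℂ) * exp (-((-u) * Real.log n : ℝ) * I)‖ := by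
    simp only [hnorm]
    refine Summable.of_nonneg_of_le (fun n => mul_nonneg (by positivity) (cutoff_nonneg _ _)) (fun n => ?_)
      (summable_dk_mul_cutoff k Y)
    rcases eq_or_ne n 0 with rfl | hn
    · simp [dk_zero_right]
    have : (n : ℝ) ^ (-(1 / 2) : ℝ) ≤ 1 :=
      Real.rpow_le_one_of_one_le_of_nonpos (by exact_mod_cast Nat.pos_of_ne_zero hn) (by norm_num)
    exact mul_le_mul_of_nonneg_right (mul_le_of_le_one_right (Nat.cast_nonneg _) this) (cutoff_nonneg _ _)
  have e : cutoffZeta k Y (1 / 2 - u * I) = ∫ y in Iic Y, dirichletD k y (-u) := by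
    rw [cutoffZeta, tsum_congr hterm]
    exact integral_tsum_of_summable_integral_norm hint hs
  rw [e]
  refine (enorm_integral_le_lintegral_enorm _).trans ?_
  simp only [enorm_dirichletD_neg]
  have hsub : Iic Y ⊆ Iic 0 ∪ Icc 0 Y := fun y hy => by
    rcases le_total y 0 with h0 | h0
    · exact Or.inl h0
    · exact Or.inr ⟨h0, hy⟩
  refine (lintegral_mono_set hsub).trans ((lintegral_union_le _ _ _).trans ?_)
  gcongr
  calc _ ≤ ∫⁻ y in Iic 0, ENNReal.ofReal (C * Real.exp (1 * y)) := by
        refine lintegral_mono fun y => ?_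
        rw [← ofReal_norm]
        exact ENNReal.ofReal_le_ofReal ((norm_dirichletD_le_tsum k y u).trans (h y))
    _ = _ := by rw [lintegral_Iic_exp_mul_le one_pos]; simp

lemma exists_lintegral_critB_Iic_le (k : ℕ) :
    ∃ C : ℝ, 1 ≤ C ∧ ∀ t, ∫⁻ y in Iic 0, ‖critB k y t‖ₑ ≤ ENNReal.ofReal C := by
  obtain ⟨C₂, hC₂, h₂⟩ := tsum_coefD_le k (A := 1) (by norm_num)
  obtain ⟨C₃, hC₃, h₃⟩ := exists_norm_polarD_le k (r := 1 / 4) (by norm_num) (by norm_num)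
  refine ⟨(C₂ + C₃) * 4, by linarith, fun t => ?_⟩
  calc _ ≤ ∫⁻ y in Iic 0, ENNReal.ofReal ((C₂ + C₃) * Real.exp (1 / 4 * y)) := by
        refine setLIntegral_mono' measurableSet_Iic fun y hy => ?_
        have hy' : y ≤ 0 := hy
        rw [← ofReal_norm, critB_eq]
        refine ENNReal.ofReal_le_ofReal ?_
        have e1 := (norm_dirichletD_le_tsum k y t).trans (h₂ y)
        have e2 := h₃ y t
        rw [abs_of_nonpos hy'] at e2
        have e3 : Real.exp (-t ^ 2 / 2) ≤ 1 := Real.exp_le_one_iff.2 (by nlinarith [sq_nonneg t])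
        have e4 : Real.exp (1 * y) ≤ Real.exp (1 / 4 * y) := Real.exp_le_exp.2 (by linarith)
        have e5 : y / 2 + 1 / 4 * -y = 1 / 4 * y := by ring
        rw [e5] at e2
        calc _ ≤ C₂ * Real.exp (1 * y) + C₃ * Real.exp (1 / 4 * y) * Real.exp (-t ^ 2 / 2) :=
              (norm_sub_le _ _).trans (add_le_add e1 e2)
          _ ≤ C₂ * Real.exp (1 / 4 * y) + C₃ * Real.exp (1 / 4 * y) * 1 := by gcongr
          _ = _ := by ring
    _ = _ := by
      rw [lintegral_Iic_exp_mul_le (by norm_num)]; norm_num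

lemma exists_lintegral_critB_Ioi_le (k : ℕ) :
    ∃ C : ℝ, 1 ≤ C ∧ ∀ t Z, ∫⁻ y in Ioi Z, ‖critB k y t‖ₑ ≤ ENNReal.ofReal (C * Real.exp (-Z) * (1 + |t|) ^ k) := by
  obtain ⟨C, hC, h⟩ := exists_norm_critB_le k (le_refl 1)
  refine ⟨C, hC, fun t Z => ?_⟩
  calc _ ≤ ∫⁻ y in Ioi Z, ENNReal.ofReal ((C * (1 + |t|) ^ k) * Real.exp (-(1 * y))) := by
        refine lintegral_mono fun y => ?_
        rw [← ofReal_norm]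
        refine ENNReal.ofReal_le_ofReal ((h y t).trans_eq ?_)
        simp; ring
    _ = _ := by
      rw [lintegral_Ioi_exp_mul_le _ (by positivity) one_pos]; congr 1; rw [one_mul]; ring

/-- The pointwise bound for `ζ^k` on the critical line by smoothed sums of length `e^Y`. -/
lemma exists_enorm_riemannZeta_pow_le (k : ℕ) {m : ℕ} (hm : 2 ≤ m) :
    ∃ C : ℝ, 1 ≤ C ∧ ∀ Y t : ℝ, 0 ≤ Y → Real.exp (-((2 * m - 1) * Y)) * (1 + |t|) ^ (m * k) ≤ 1 →
      ‖riemannZeta (1 / 2 + t * I) ^ k‖ₑ ≤ ENNReal.ofReal C + (∫⁻ y in Icc 0 Y, ‖critB k y t‖ₑ) +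
        ENNReal.ofReal (C * Real.log (1 + |t|)) *
          ∫⁻ u : ℝ, ‖cutoffZeta k Y (1 / 2 - u * I)‖ₑ * ENNReal.ofReal (Real.exp (-(u - t) ^ 2)) := by
  obtain ⟨C₁, hC₁, h₁⟩ := exists_lintegral_critB_Iic_le k
  obtain ⟨C₂, hC₂, h₂⟩ := exists_lintegral_critB_Ioi_le k
  obtain ⟨C₃, hC₃, h₃⟩ := exists_enorm_critB_le_cutoffZeta k hm
  have hm' : (2 : ℝ) ≤ m := by exact_mod_cast hm
  refine ⟨C₁ + C₂ + C₃ * (k + 1), by nlinarith [Nat.cast_nonneg (α := ℝ) k], fun Y t hY hs => ?_⟩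
  have hl : 0 ≤ Real.log (1 + |t|) := Real.log_nonneg (by linarith [abs_nonneg t])
  -- At y = Z the bound e^{-y}(1+|t|)^k from the line Re z = -1/2 has become O(1). The functional
  -- equation is needed only on (Y, Z], whose length is logarithmic.
  set Z := Y + k * Real.log (1 + |t|) with hZ
  have hYZ : Y ≤ Z := by rw [hZ]; have := mul_nonneg (Nat.cast_nonneg (α := ℝ) k) hl; linarith
  set J := ∫⁻ u : ℝ, ‖cutoffZeta k Y (1 / 2 - u * I)‖ₑ * ENNReal.ofReal (Real.exp (-(u - t) ^ 2)) with hJ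
  rw [← integral_critB]
  refine (enorm_integral_le_lintegral_enorm _).trans ?_
  have hcov : (univ : Set ℝ) = (Iic 0 ∪ Icc 0 Y) ∪ (Ioc Y Z ∪ Ioi Z) := by
    rw [Iic_union_Icc_eq_Iic hY, Ioc_union_Ioi_eq_Ioi hYZ, Iic_union_Ioi]
  rw [← setLIntegral_univ, hcov]
  refine (lintegral_union_le _ _ _).trans ((add_le_add (lintegral_union_le _ _ _) (lintegral_union_le _ _ _)).trans ?_)
  have hI4 : ∫⁻ y in Ioi Z, ‖critB k y t‖ₑ ≤ ENNReal.ofReal C₂ := by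
    refine (h₂ t Z).trans (ENNReal.ofReal_le_ofReal ?_)
    have h1 : (1 + |t|) ^ k = Real.exp (k * Real.log (1 + |t|)) := by
      rw [Real.exp_nat_mul, Real.exp_log (by positivity)]
    rw [h1, mul_assoc, ← Real.exp_add, hZ]
    refine mul_le_of_le_one_right (by linarith) (Real.exp_le_one_iff.2 (by linarith))
  have hI3 : ∫⁻ y in Ioc Y Z, ‖critB k y t‖ₑ ≤
      ENNReal.ofReal (C₃ * (k + 1) * Real.log (1 + |t|)) * J + ENNReal.ofReal C₃ := by
    -- Integrated over y > Y, the error of the functional equation is at most C₃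
    -- e^{-(2m-1)Y}(1+|t|)^{mk}, which is what the hypothesis `hs` controls.
    set c₁ := C₃ * Real.exp (-((m - 1) * Y)) * (1 + |t|) ^ (m * k) with hc₁
    calc _ ≤ ∫⁻ y in Ioc Y Z, (ENNReal.ofReal C₃ * J + ENNReal.ofReal (c₁ * Real.exp (-(m * y)))) := by
          refine lintegral_mono fun y => (h₃ Y y t).trans_eq ?_
          congr 2; rw [hc₁]; ring
      _ = (∫⁻ y in Ioc Y Z, ENNReal.ofReal C₃ * J) + ∫⁻ y in Ioc Y Z, ENNReal.ofReal (c₁ * Real.exp (-(m * y))) :=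
          lintegral_add_left measurable_const _
      _ ≤ _ := by
          gcongr
          · rw [setLIntegral_const, Real.volume_Ioc, mul_right_comm, ← ENNReal.ofReal_mul (by linarith)]
            refine mul_le_mul' (ENNReal.ofReal_le_ofReal ?_) le_rfl
            rw [hZ, add_sub_cancel_left, mul_assoc]
            gcongr; linarith
          · refine (lintegral_mono_set Ioc_subset_Ioi_self).trans ?_
            rw [lintegral_Ioi_exp_mul_le _ (by positivity) (by linarith)]
            refine ENNReal.ofReal_le_ofReal ?_
            rw [hc₁]
            have e : Real.exp (-((2 * m - 1) * Y)) = Real.exp (-((m - 1) * Y)) * Real.exp (-(m * Y)) := by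
              rw [← Real.exp_add]; congr 1; ring
            rw [e] at hs
            calc _ ≤ C₃ * Real.exp (-((m - 1) * Y)) * (1 + |t|) ^ (m * k) * (Real.exp (-(m * Y))) := by
                  gcongr
                  exact div_le_self (Real.exp_pos _).le (by linarith)
              _ = C₃ * (Real.exp (-((m - 1) * Y)) * Real.exp (-(m * Y)) * (1 + |t|) ^ (m * k)) := by ring
              _ ≤ C₃ * 1 := by gcongr
              _ = C₃ := mul_one _
  calc _ ≤ (ENNReal.ofReal C₁ + ∫⁻ y in Icc 0 Y, ‖critB k y t‖ₑ) +
        ((ENNReal.ofReal (C₃ * (k + 1) * Real.log (1 + |t|)) * J + ENNReal.ofReal C₃) + ENNReal.ofReal C₂) := by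
        gcongr; exact h₁ t
    _ = ENNReal.ofReal (C₁ + C₂ + C₃) + (∫⁻ y in Icc 0 Y, ‖critB k y t‖ₑ) +
        ENNReal.ofReal (C₃ * (k + 1) * Real.log (1 + |t|)) * J := by
        rw [ENNReal.ofReal_add (by linarith) (by linarith), ENNReal.ofReal_add (by linarith) (by linarith)]
        ring
    _ ≤ _ := by
        have := Nat.cast_nonneg (α := ℝ) k
        gcongr
        · nlinarith
        · linarith

/-- The mean square of the critical integral with a Gaussian weight. -/
noncomputable def meanSq (k : ℕ) (y τ : ℝ) : ℝ≥0∞ :=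
  ∫⁻ t, ‖critB k y t‖ₑ ^ 2 * ENNReal.ofReal (Real.exp (-(t / τ) ^ 2))

lemma enn_add_sq_le (a b : ℝ≥0∞) : (a + b) ^ 2 ≤ 4 * (a ^ 2 + b ^ 2) := by
  have h : ∀ a b : ℝ≥0∞, a ≤ b → (a + b) ^ 2 ≤ 4 * (a ^ 2 + b ^ 2) := fun a b hab =>
    calc (a + b) ^ 2 ≤ (b + b) ^ 2 := by gcongr
      _ = 4 * b ^ 2 := by ring
      _ ≤ _ := by gcongr; exact le_add_self
  rcases le_total a b with hab | hab
  · exact h a b hab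
  · have := h b a hab
    rwa [add_comm b a, add_comm (b ^ 2)] at this

lemma setLIntegral_sq_le {f : ℝ → ℝ≥0∞} (hf : Measurable f) {Y : ℝ} :
    (∫⁻ y in Icc 0 Y, f y) ^ 2 ≤ ENNReal.ofReal Y * ∫⁻ y in Icc 0 Y, f y ^ 2 := by
  have h := lintegral_mul_sq_le (μ := volume.restrict (Icc 0 Y)) hf.aemeasurable
    (measurable_const (a := (1 : ℝ≥0∞)))
  simpa using h

lemma lintegral_exp_neg_mul_sub_sq {b : ℝ} (hb : 0 < b) (t : ℝ) :
    ∫⁻ u, ENNReal.ofReal (Real.exp (-b * (u - t) ^ 2)) = ENNReal.ofReal √(Real.pi / b) := by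
  rw [← integral_gaussian, ← integral_sub_right_eq_self _ t,
    ofReal_integral_eq_lintegral_ofReal ((integrable_exp_neg_mul_sq hb).comp_sub_right t)
      (Eventually.of_forall fun u => (Real.exp_pos _).le)]

lemma lintegral_exp_neg_mul_sub_sq_le {b : ℝ} (hb : 1 / 2 ≤ b) (t : ℝ) :
    ∫⁻ u, ENNReal.ofReal (Real.exp (-b * (u - t) ^ 2)) ≤ 4 := by
  rw [lintegral_exp_neg_mul_sub_sq (by linarith)]
  have : √(Real.pi / b) ≤ 4 := by
    refine Real.sqrt_le_iff.2 ⟨by norm_num, ?_⟩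
    rw [div_le_iff₀ (by linarith)]
    nlinarith [Real.pi_lt_four]
  calc _ ≤ ENNReal.ofReal 4 := ENNReal.ofReal_le_ofReal this
    _ = 4 := by simp

lemma setLIntegral_critB_sq_le (k : ℕ) (y : ℝ) {T τ : ℝ} (hT : 0 < T) (hτ : T ≤ τ) :
    ∫⁻ t in Icc T (2 * T), ‖critB k y t‖ₑ ^ 2 ≤ ENNReal.ofReal (Real.exp 4) * meanSq k y τ := by
  rw [meanSq, ← lintegral_const_mul' _ _ ENNReal.ofReal_ne_top]
  refine le_trans (setLIntegral_mono' measurableSet_Icc fun t ht => ?_) (setLIntegral_le_lintegral _ _)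
  rw [mul_left_comm, ← ENNReal.ofReal_mul (Real.exp_pos _).le, ← Real.exp_add]
  refine le_mul_of_one_le_right zero_le ?_
  rw [ENNReal.one_le_ofReal]
  refine Real.one_le_exp ?_
  have : t / τ ≤ 2 := by rw [div_le_iff₀ (by linarith)]; linarith [ht.2]
  have h0 : 0 ≤ t / τ := div_nonneg (by linarith [ht.1]) (by linarith)
  nlinarith

/-- Half of the narrow Gaussian pays for u far from t. The constant 8 is 2(t/τ)², since t ≤ 2T ≤ 2τ.
-/
lemma exp_neg_sub_sq_le_weight {u t T τ : ℝ} (hT : 2 ≤ T) (hτ : T ≤ τ) (h1 : T ≤ t) (h2 : t ≤ 2 * T) :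
    Real.exp (-1 * (u - t) ^ 2) ≤
      Real.exp 8 * Real.exp (-(u / τ) ^ 2) * Real.exp (-(1 / 2) * (u - t) ^ 2) := by
  rw [← Real.exp_add, ← Real.exp_add]
  refine Real.exp_le_exp.2 ?_
  have hτ0 : 0 < τ := by linarith
  have e : (u / τ) ^ 2 ≤ 2 * ((u - t) / τ) ^ 2 + 2 * (t / τ) ^ 2 := by
    have : u / τ = (u - t) / τ + t / τ := by ring
    rw [this]; nlinarith [sq_nonneg ((u - t) / τ - t / τ)]
  have e1 : (t / τ) ^ 2 ≤ 4 := by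
    have : t / τ ≤ 2 := by rw [div_le_iff₀ hτ0]; linarith
    have h0 : 0 ≤ t / τ := div_nonneg (by linarith) hτ0.le
    nlinarith
  have e2 : 2 * ((u - t) / τ) ^ 2 ≤ 1 / 2 * (u - t) ^ 2 := by
    rw [div_pow, mul_div_assoc', div_le_iff₀ (by positivity)]
    have : 4 ≤ τ ^ 2 := by nlinarith
    nlinarith [sq_nonneg (u - t), mul_le_mul_of_nonneg_left this (sq_nonneg (u - t))]
  nlinarith

/-- `dirichletD` is `critB` plus the polar part. The latter lives at bounded height, while u is tied
to t ≥ T; the condition 2Y ≤ T²/4 makes its decay in u outweigh its size e^y. -/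
lemma exists_lintegral_dirichletD_sq_le (k : ℕ) :
    ∃ C : ℝ, 1 ≤ C ∧ ∀ T τ Y y : ℝ, 2 ≤ T → T ≤ τ → 0 ≤ y → y ≤ Y → 2 * Y ≤ T ^ 2 / 4 →
      ∫⁻ u, ‖dirichletD k y u‖ₑ ^ 2 * (∫⁻ t in Icc T (2 * T), ENNReal.ofReal (Real.exp (-1 * (u - t) ^ 2))) ≤
        ENNReal.ofReal C * (ENNReal.ofReal T + meanSq k y τ) := by
  obtain ⟨C, hC, h⟩ := exists_norm_polarD_le k (r := 1 / 2) (by norm_num) le_rfl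
  refine ⟨16 * Real.exp 8 + 16 * C ^ 2, by nlinarith [Real.exp_pos 8], fun T τ Y y hT hτ hy hyY hY => ?_⟩
  set ω : ℝ → ℝ≥0∞ := fun u => ∫⁻ t in Icc T (2 * T), ENNReal.ofReal (Real.exp (-1 * (u - t) ^ 2)) with hω
  have hωm : Measurable ω := by
    refine Measurable.lintegral_prod_right' (f := fun p : ℝ × ℝ => ENNReal.ofReal (Real.exp (-1 * (p.1 - p.2) ^ 2))) ?_
    fun_prop
  have hBm : Measurable fun u => ‖critB k y u‖ₑ ^ 2 := by
    have : Continuous fun u : ℝ => critB k y u :=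
      (continuous_critB k).comp (f := fun u : ℝ => (y, u)) (Continuous.prodMk_right y)
    exact this.enorm.measurable.pow_const 2
  have hB : ∫⁻ u, ‖critB k y u‖ₑ ^ 2 * ω u ≤ ENNReal.ofReal (4 * Real.exp 8) * meanSq k y τ := by
    rw [meanSq, ← lintegral_const_mul' _ _ ENNReal.ofReal_ne_top]
    refine lintegral_mono fun u => ?_
    rw [mul_left_comm]
    gcongr
    calc ω u ≤ ∫⁻ t in Icc T (2 * T), ENNReal.ofReal (Real.exp 8 * Real.exp (-(u / τ) ^ 2)) *
          ENNReal.ofReal (Real.exp (-(1 / 2) * (t - u) ^ 2)) := by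
          refine setLIntegral_mono' measurableSet_Icc fun t ht => ?_
          rw [← ENNReal.ofReal_mul (by positivity)]
          refine ENNReal.ofReal_le_ofReal ((exp_neg_sub_sq_le_weight hT hτ ht.1 ht.2).trans_eq ?_)
          congr 2; ring
      _ = ENNReal.ofReal (Real.exp 8 * Real.exp (-(u / τ) ^ 2)) *
          ∫⁻ t in Icc T (2 * T), ENNReal.ofReal (Real.exp (-(1 / 2) * (t - u) ^ 2)) :=
          lintegral_const_mul' _ _ ENNReal.ofReal_ne_top
      _ ≤ ENNReal.ofReal (Real.exp 8 * Real.exp (-(u / τ) ^ 2)) * 4 := by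
          gcongr
          exact (setLIntegral_le_lintegral _ _).trans (lintegral_exp_neg_mul_sub_sq_le le_rfl u)
      _ = _ := by
          rw [show (4 : ℝ≥0∞) = ENNReal.ofReal 4 by simp, ← ENNReal.ofReal_mul (by positivity),
            ← ENNReal.ofReal_mul (by positivity)]
          congr 1; ring
  have hP : ∫⁻ u, ‖polarD k y u‖ₑ ^ 2 * ω u ≤ ENNReal.ofReal (4 * C ^ 2) * ENNReal.ofReal T := by
    have hpt : ∀ u, ‖polarD k y u‖ₑ ^ 2 * ω u ≤ ∫⁻ t in Icc T (2 * T),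
        ENNReal.ofReal (C ^ 2) * ENNReal.ofReal (Real.exp (-(1 / 2) * (u - t) ^ 2)) := by
      intro u
      have h1 := h y u
      rw [abs_of_nonneg hy] at h1
      have h2 : ‖polarD k y u‖ₑ ^ 2 ≤ ENNReal.ofReal (C ^ 2 * Real.exp (2 * y - u ^ 2)) := by
        rw [← ofReal_norm, ← ENNReal.ofReal_pow (norm_nonneg _)]
        refine ENNReal.ofReal_le_ofReal ((pow_le_pow_left₀ (norm_nonneg _) h1 2).trans_eq ?_)
        rw [mul_assoc, ← Real.exp_add, mul_pow, ← Real.exp_nat_mul]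
        congr 2; push_cast; ring
      calc _ ≤ ENNReal.ofReal (C ^ 2 * Real.exp (2 * y - u ^ 2)) * ω u := by gcongr
        _ = ∫⁻ t in Icc T (2 * T), ENNReal.ofReal (C ^ 2 * Real.exp (2 * y - u ^ 2)) *
            ENNReal.ofReal (Real.exp (-1 * (u - t) ^ 2)) := (lintegral_const_mul' _ _ ENNReal.ofReal_ne_top).symm
        _ ≤ _ := by
          refine setLIntegral_mono' measurableSet_Icc fun t ht => ?_
          rw [← ENNReal.ofReal_mul (by positivity), ← ENNReal.ofReal_mul (by positivity), mul_assoc, ← Real.exp_add]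
          refine ENNReal.ofReal_le_ofReal (mul_le_mul_of_nonneg_left (Real.exp_le_exp.2 ?_) (by positivity))
          -- The minimum over u of u² + (u-t)²/2 is t²/3, attained at u = t/3, and this exceeds T²/4
          -- ≥ 2y.
          have : T ^ 2 ≤ t ^ 2 := by have := ht.1; gcongr
          nlinarith [sq_nonneg (3 * u - t)]
    refine (lintegral_mono hpt).trans ?_
    rw [lintegral_lintegral_swap (by fun_prop)]
    calc _ ≤ ∫⁻ _ in Icc T (2 * T), ENNReal.ofReal (C ^ 2) * 4 := by
          refine lintegral_mono fun t => ?_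
          simp only
          rw [lintegral_const_mul' _ _ ENNReal.ofReal_ne_top]
          gcongr
          exact lintegral_exp_neg_mul_sub_sq_le le_rfl t
      _ = _ := by
          rw [setLIntegral_const, Real.volume_Icc, mul_comm 4, ENNReal.ofReal_mul (by positivity)]
          simp; ring_nf
  calc _ ≤ ∫⁻ u, (4 * (‖critB k y u‖ₑ ^ 2 * ω u) + 4 * (‖polarD k y u‖ₑ ^ 2 * ω u)) := by
        refine lintegral_mono fun u => ?_
        have e : dirichletD k y u = critB k y u + polarD k y u := by rw [critB_eq]; ring
        have : ‖dirichletD k y u‖ₑ ^ 2 ≤ 4 * (‖critB k y u‖ₑ ^ 2 + ‖polarD k y u‖ₑ ^ 2) := by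
          rw [e]; exact (pow_le_pow_left₀ zero_le (enorm_add_le _ _) 2).trans (enn_add_sq_le _ _)
        calc _ ≤ 4 * (‖critB k y u‖ₑ ^ 2 + ‖polarD k y u‖ₑ ^ 2) * ω u := by gcongr
          _ = _ := by ring
    _ = 4 * (∫⁻ u, ‖critB k y u‖ₑ ^ 2 * ω u) + 4 * ∫⁻ u, ‖polarD k y u‖ₑ ^ 2 * ω u := by
        rw [lintegral_add_left (f := fun u => 4 * (‖critB k y u‖ₑ ^ 2 * ω u)) ((hBm.mul hωm).const_mul 4), lintegral_const_mul' _ _ (by simp),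
          lintegral_const_mul' _ _ (by simp)]
    _ ≤ 4 * (ENNReal.ofReal (4 * Real.exp 8) * meanSq k y τ) + 4 * (ENNReal.ofReal (4 * C ^ 2) * ENNReal.ofReal T) := by
        gcongr
    _ = ENNReal.ofReal (16 * Real.exp 8) * meanSq k y τ + ENNReal.ofReal (16 * C ^ 2) * ENNReal.ofReal T := by
        rw [show (4 : ℝ≥0∞) = ENNReal.ofReal 4 by simp, ← mul_assoc, ← mul_assoc, ← ENNReal.ofReal_mul (by norm_num),
          ← ENNReal.ofReal_mul (by norm_num), ← mul_assoc, ← mul_assoc]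
        norm_num
    _ ≤ _ := by
        rw [ENNReal.ofReal_add (by positivity) (by positivity), add_mul, mul_add, mul_add]
        exact add_le_add (le_add_self) (le_self_add)

set_option maxHeartbeats 1000000 in
/-- The reduction of the moment on a dyadic interval to Gaussian mean squares of the critical
integral. -/
lemma exists_moment_le_meanSq (k : ℕ) {m : ℕ} (hm : 2 ≤ m) :
    ∃ C : ℝ, 1 ≤ C ∧ ∀ (T τ Y : ℝ) (Λ : ℝ≥0∞), 2 ≤ T → T ≤ τ → 0 ≤ Y → 2 * Y ≤ T ^ 2 / 4 →
      Real.exp (-((2 * m - 1) * Y)) * (1 + 2 * T) ^ (m * k) ≤ 1 →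
      (∀ y, 0 ≤ y → y ≤ Y → meanSq k y τ ≤ Λ) →
      ∫⁻ t in Icc T (2 * T), ‖riemannZeta (1 / 2 + t * I) ^ k‖ₑ ^ 2 ≤
        ENNReal.ofReal (C * (1 + Real.log (1 + 2 * T)) ^ 2 * (1 + Y) ^ 2) * (ENNReal.ofReal T + Λ) := by
  obtain ⟨C₁, hC₁, h₁⟩ := exists_enorm_riemannZeta_pow_le k hm
  obtain ⟨C₂, hC₂, h₂⟩ := exists_enorm_cutoffZeta_half_le k
  obtain ⟨C₃, hC₃, h₃⟩ := exists_lintegral_dirichletD_sq_le k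
  set c₁ := ENNReal.ofReal C₁ with hc₁
  set c₂ := ENNReal.ofReal C₂ with hc₂
  set c₃ := ENNReal.ofReal C₃ with hc₃
  set e4 := ENNReal.ofReal (Real.exp 4) with he4
  set K : ℝ≥0∞ := 16 * c₁ ^ 2 + 16 * e4 + 16 * c₁ ^ 2 * 4 * (4 * c₂ ^ 2 * 4 + 4 * c₃) with hK
  have hKtop : K ≠ ⊤ := by finiteness
  refine ⟨max 1 K.toReal, le_max_left _ _, ?_⟩
  intro T τ Y Λ hT hτ hY hYT hm1 hΛ
  set L := Real.log (1 + 2 * T) with hL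
  have hL0 : 0 ≤ L := Real.log_nonneg (by linarith)
  set S : ℝ → ℝ≥0∞ := fun u => ENNReal.ofReal C₂ + ∫⁻ y in Icc 0 Y, ‖dirichletD k y u‖ₑ with hS
  have hDm : Measurable fun p : ℝ × ℝ => ‖dirichletD k p.1 p.2‖ₑ := (continuous_dirichletD k).enorm.measurable
  have hBm : Measurable fun p : ℝ × ℝ => ‖critB k p.1 p.2‖ₑ := (continuous_critB k).enorm.measurable
  have hSm : Measurable S := by
    have : Measurable fun u => ∫⁻ y in Icc 0 Y, ‖dirichletD k y u‖ₑ := Measurable.lintegral_prod_left' hDm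
    exact this.const_add _
  set g : ℝ → ℝ → ℝ≥0∞ := fun t u => ENNReal.ofReal (Real.exp (-1 * (u - t) ^ 2)) with hg
  have hgm : ∀ t, Measurable (g t) := fun t => by simp only [hg]; fun_prop
  have hgm2 : Measurable fun p : ℝ × ℝ => g p.1 p.2 := by simp only [hg]; fun_prop
  -- The pointwise bound is squared, and Cauchy–Schwarz is applied to the integral over y, at the
  -- cost of a factor Y, and to the Gaussian average over u, whose total mass is at most 4.
  have hpt : ∀ t ∈ Icc T (2 * T), ‖riemannZeta (1 / 2 + t * I) ^ k‖ₑ ^ 2 ≤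
      16 * c₁ ^ 2 + (16 * (ENNReal.ofReal Y * ∫⁻ y in Icc 0 Y, ‖critB k y t‖ₑ ^ 2) +
        16 * (ENNReal.ofReal (C₁ * L) ^ 2 * (4 * ∫⁻ u, S u ^ 2 * g t u))) := by
    intro t ht
    have ht0 : |t| = t := abs_of_nonneg (by linarith [ht.1])
    have h4 := h₁ Y t hY (le_trans (by
      rw [ht0]; gcongr
      · linarith [ht.1]
      · exact ht.2) hm1)
    rw [ht0] at h4
    set a := c₁
    set b := ∫⁻ y in Icc 0 Y, ‖critB k y t‖ₑ
    set c := ENNReal.ofReal (C₁ * L) * ∫⁻ u, S u * g t u with hc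
    have h5 : ‖riemannZeta (1 / 2 + t * I) ^ k‖ₑ ≤ a + b + c := by
      refine h4.trans ?_
      refine add_le_add le_rfl (mul_le_mul' (ENNReal.ofReal_le_ofReal ?_) (lintegral_mono fun u => ?_))
      · have h6 : Real.log (1 + t) ≤ L := Real.log_le_log (by linarith [ht.1]) (by linarith [ht.2])
        gcongr
      · simp only [hg, neg_one_mul]
        gcongr
        exact h₂ Y u
    have hb : b ^ 2 ≤ ENNReal.ofReal Y * ∫⁻ y in Icc 0 Y, ‖critB k y t‖ₑ ^ 2 :=
      setLIntegral_sq_le (hBm.comp (Measurable.prodMk measurable_id measurable_const))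
    have hcc : c ^ 2 ≤ ENNReal.ofReal (C₁ * L) ^ 2 * (4 * ∫⁻ u, S u ^ 2 * g t u) := by
      rw [hc, mul_pow]
      gcongr
      refine (lintegral_mul_sq_le hSm.aemeasurable (hgm t)).trans ?_
      gcongr
      exact lintegral_exp_neg_mul_sub_sq_le (by norm_num) t
    calc _ ≤ (a + b + c) ^ 2 := by gcongr
      _ ≤ 4 * ((a + b) ^ 2 + c ^ 2) := enn_add_sq_le _ _
      _ ≤ 4 * (4 * (a ^ 2 + b ^ 2) + c ^ 2) := by gcongr; exact enn_add_sq_le _ _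
      _ = 16 * a ^ 2 + (16 * b ^ 2 + 4 * c ^ 2) := by ring
      _ ≤ 16 * a ^ 2 + (16 * b ^ 2 + 16 * c ^ 2) := by gcongr; norm_num
      _ ≤ _ := by gcongr
  have hvol : volume (Icc T (2 * T)) = ENNReal.ofReal T := by rw [Real.volume_Icc]; congr 1; ring
  have hvolY : volume (Icc 0 Y) = ENNReal.ofReal Y := by rw [Real.volume_Icc, sub_zero]
  have hII : ∫⁻ t in Icc T (2 * T), ∫⁻ y in Icc 0 Y, ‖critB k y t‖ₑ ^ 2 ≤
      ENNReal.ofReal Y * (ENNReal.ofReal (Real.exp 4) * Λ) := by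
    have hm1 : Measurable fun p : ℝ × ℝ => ‖critB k p.2 p.1‖ₑ ^ 2 := (hBm.comp measurable_swap).pow_const 2
    rw [lintegral_lintegral_swap (f := fun t y => ‖critB k y t‖ₑ ^ 2) hm1.aemeasurable]
    calc _ ≤ ∫⁻ y in Icc 0 Y, ENNReal.ofReal (Real.exp 4) * Λ := by
          refine setLIntegral_mono' measurableSet_Icc fun y hy => ?_
          exact (setLIntegral_critB_sq_le k y (by linarith) hτ).trans (by gcongr; exact hΛ y hy.1 hy.2)
      _ = _ := by rw [setLIntegral_const, hvolY, mul_comm]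
  set ω : ℝ → ℝ≥0∞ := fun u => ∫⁻ t in Icc T (2 * T), g t u with hω
  have hωm : Measurable ω := by
    exact Measurable.lintegral_prod_left' hgm2
  have hωi : ∫⁻ u, ω u ≤ 4 * ENNReal.ofReal T := by
    simp only [hω]
    rw [lintegral_lintegral_swap (f := fun u t => g t u) (hgm2.comp measurable_swap).aemeasurable]
    calc _ ≤ ∫⁻ t in Icc T (2 * T), 4 := by
          refine lintegral_mono fun t => lintegral_exp_neg_mul_sub_sq_le (by norm_num) t
      _ = _ := by rw [setLIntegral_const, hvol]
  have hIII : ∫⁻ t in Icc T (2 * T), ∫⁻ u, S u ^ 2 * g t u ≤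
      4 * (c₂ ^ 2 * (4 * ENNReal.ofReal T)) +
      4 * (ENNReal.ofReal Y * (ENNReal.ofReal Y * (c₃ * (ENNReal.ofReal T + Λ)))) := by
    have hm1 : Measurable fun p : ℝ × ℝ => S p.2 ^ 2 * g p.1 p.2 := ((hSm.comp measurable_snd).pow_const 2).mul hgm2
    rw [lintegral_lintegral_swap (f := fun t u => S u ^ 2 * g t u) hm1.aemeasurable]
    have e1 : ∀ u, ∫⁻ t in Icc T (2 * T), S u ^ 2 * g t u ≤ 4 * (c₂ ^ 2 * ω u) +
        4 * (ENNReal.ofReal Y * ∫⁻ y in Icc 0 Y, ‖dirichletD k y u‖ₑ ^ 2 * ω u) := by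
      intro u
      have hd1 : Measurable fun y : ℝ => ‖dirichletD k y u‖ₑ :=
        Measurable.comp (g := fun p : ℝ × ℝ => ‖dirichletD k p.1 p.2‖ₑ) (f := fun y : ℝ => (y, u)) hDm
          measurable_prodMk_right
      have hgu : Measurable fun t : ℝ => g t u := by simp only [hg]; fun_prop
      rw [lintegral_const_mul _ hgu,
        lintegral_mul_const _ (hd1.pow_const 2)]
      calc _ ≤ (4 * (c₂ ^ 2 + ENNReal.ofReal Y * ∫⁻ y in Icc 0 Y, ‖dirichletD k y u‖ₑ ^ 2)) * ω u := by
            gcongr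
            exact (enn_add_sq_le _ _).trans (by gcongr; exact setLIntegral_sq_le hd1)
        _ = _ := by ring
    refine (lintegral_mono e1).trans ?_
    have hdd : Measurable fun p : ℝ × ℝ => ‖dirichletD k p.2 p.1‖ₑ ^ 2 * ω p.1 :=
      ((hDm.comp measurable_swap).pow_const 2).mul (hωm.comp measurable_fst)
    rw [lintegral_add_left ((hωm.const_mul _).const_mul _), lintegral_const_mul _ (hωm.const_mul _),
      lintegral_const_mul _ hωm, lintegral_const_mul' _ _ (by simp), lintegral_const_mul' _ _ ENNReal.ofReal_ne_top,
      lintegral_lintegral_swap (f := fun u y => ‖dirichletD k y u‖ₑ ^ 2 * ω u) hdd.aemeasurable]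
    gcongr
    calc _ ≤ ∫⁻ y in Icc 0 Y, c₃ * (ENNReal.ofReal T + Λ) := by
          refine setLIntegral_mono' measurableSet_Icc fun y hy => ?_
          exact (h₃ T τ Y y hT hτ hy.1 hy.2 hYT).trans (by gcongr; exact hΛ y hy.1 hy.2)
      _ = _ := by rw [setLIntegral_const, hvolY, mul_comm]
  have hSg : Measurable fun t => ∫⁻ u, S u ^ 2 * g t u :=
    Measurable.lintegral_prod_right' (f := fun p : ℝ × ℝ => S p.2 ^ 2 * g p.1 p.2)
      (((hSm.comp measurable_snd).pow_const 2).mul hgm2)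
  have hBB : Measurable fun t => ∫⁻ y in Icc 0 Y, ‖critB k y t‖ₑ ^ 2 :=
    Measurable.lintegral_prod_left' (hBm.pow_const 2)
  refine (setLIntegral_mono' measurableSet_Icc hpt).trans ?_
  rw [lintegral_add_left measurable_const, lintegral_add_left ((hBB.const_mul _).const_mul _),
    setLIntegral_const, hvol, lintegral_const_mul' _ _ (by simp), lintegral_const_mul' _ _ ENNReal.ofReal_ne_top,
    lintegral_const_mul' _ _ (by simp), lintegral_const_mul' _ _ (by simp), lintegral_const_mul' _ _ (by simp)]
  set X := ENNReal.ofReal T + Λ with hX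
  have hTX : ENNReal.ofReal T ≤ X := le_self_add
  have hΛX : Λ ≤ X := le_add_self
  have h1Y : ENNReal.ofReal Y ≤ ENNReal.ofReal (1 + Y) := ENNReal.ofReal_le_ofReal (by linarith)
  have h1 : 1 ≤ ENNReal.ofReal (1 + Y) := by rw [ENNReal.one_le_ofReal]; linarith
  have h2 : 1 ≤ ENNReal.ofReal (1 + L) := by rw [ENNReal.one_le_ofReal]; linarith
  have hLL : ENNReal.ofReal (C₁ * L) ≤ ENNReal.ofReal C₁ * ENNReal.ofReal (1 + L) := by
    rw [← ENNReal.ofReal_mul (by linarith)]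
    exact ENNReal.ofReal_le_ofReal (by gcongr; linarith)
  set q := ENNReal.ofReal (1 + Y)
  set l := ENNReal.ofReal (1 + L)
  have hql : 1 ≤ l ^ 2 * q ^ 2 := by
    calc (1 : ℝ≥0∞) = 1 ^ 2 * 1 ^ 2 := by norm_num
      _ ≤ _ := by gcongr
  have hq1 : 1 ≤ q ^ 2 := one_le_pow₀ h1
  have hl1 : 1 ≤ l ^ 2 := one_le_pow₀ h2
  calc _ ≤ 16 * c₁ ^ 2 * X + (16 * (q * (q * (e4 * X))) + 16 * ((c₁ * l) ^ 2 * (4 *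
        (4 * (c₂ ^ 2 * (4 * X)) + 4 * (q * (q * (c₃ * X))))))) := by
        gcongr
        · exact hII.trans (by gcongr)
        · exact hIII.trans (by gcongr)
    _ = 16 * c₁ ^ 2 * X * 1 + (16 * e4 * X * (1 * q ^ 2) + 16 * c₁ ^ 2 * 4 * (4 * c₂ ^ 2 * 4 * X * (l ^ 2 * 1) + 4 * c₃ * X * (l ^ 2 * q ^ 2))) := by ring
    _ ≤ 16 * c₁ ^ 2 * X * (l ^ 2 * q ^ 2) + (16 * e4 * X * (l ^ 2 * q ^ 2) + 16 * c₁ ^ 2 * 4 * (4 * c₂ ^ 2 * 4 * X * (l ^ 2 * q ^ 2) + 4 * c₃ * X * (l ^ 2 * q ^ 2))) := by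
        gcongr
    _ = K * l ^ 2 * q ^ 2 * X := by rw [hK]; ring
    _ ≤ ENNReal.ofReal (max 1 K.toReal) * l ^ 2 * q ^ 2 * X := by
        gcongr
        exact (ENNReal.le_ofReal_iff_toReal_le hKtop (by positivity)).2 (le_max_right _ _)
    _ = _ := by
        rw [ENNReal.ofReal_mul (by positivity), ENNReal.ofReal_mul (by positivity),
          ENNReal.ofReal_pow (by linarith), ENNReal.ofReal_pow (by linarith)]

/-! ### Parseval's formula with a Gaussian weight -/

lemma integral_exp_mul_gaussian_weight {τ : ℝ} (hτ : 0 < τ) (δ : ℝ) :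
    ∫ t : ℝ, exp (-(t * δ : ℝ) * I) * (Real.exp (-(t / τ) ^ 2) : ℝ) =
      (√Real.pi * τ * Real.exp (-(τ ^ 2 * δ ^ 2 / 4)) : ℝ) := by
  have hτc : (τ : ℂ) ≠ 0 := by exact_mod_cast hτ.ne'
  have e : ∀ t : ℝ, exp (-(t * δ : ℝ) * I) * (Real.exp (-(t / τ) ^ 2) : ℝ) =
      exp (-(1 / τ ^ 2 : ℝ) * (t : ℂ) ^ 2 + (-δ * I) * t + 0) := by
    intro t
    rw [ofReal_exp, ← exp_add]; congr 1; push_cast; field_simp; ring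
  simp_rw [e]
  rw [integral_cexp_quadratic (by simp only [neg_re, ofReal_re]; exact neg_neg_of_pos (by positivity))]
  have e1 : ((Real.pi : ℂ) / - -((1 / τ ^ 2 : ℝ) : ℂ)) ^ (1 / 2 : ℂ) = ((√Real.pi * τ : ℝ) : ℂ) := by
    have : ((Real.pi : ℂ) / - -((1 / τ ^ 2 : ℝ) : ℂ)) = ((Real.pi * τ ^ 2 : ℝ) : ℂ) := by push_cast; field_simp
    rw [this, show (1 / 2 : ℂ) = ((1 / 2 : ℝ) : ℂ) by push_cast; ring,
      ← ofReal_cpow (by positivity), ← Real.sqrt_eq_rpow, Real.sqrt_mul (by positivity), Real.sqrt_sq hτ.le]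
  rw [e1, ofReal_mul (√Real.pi * τ), ofReal_exp]
  congr 2
  push_cast
  field_simp
  linear_combination (δ : ℂ) ^ 2 * (τ : ℂ) ^ 2 * I_sq

lemma integrable_gaussian_weight {τ : ℝ} (hτ : 0 < τ) : Integrable fun t : ℝ => Real.exp (-(t / τ) ^ 2) := by
  refine (integrable_exp_neg_mul_sq (b := 1 / τ ^ 2) (by positivity)).congr (Eventually.of_forall fun t => ?_)
  simp only; congr 1; field_simp

/-- The mean square of the Fourier transform of a finite measure with a Gaussian weight. -/
lemma gaussian_parseval {α : Type*} [MeasurableSpace α] (μ : Measure α) [IsFiniteMeasure μ] {φ : α → ℝ}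
    (hφ : Measurable φ) {τ : ℝ} (hτ : 0 < τ) :
    ∫ t : ℝ, ‖∫ a, exp (-(t * φ a : ℝ) * I) ∂μ‖ ^ 2 * Real.exp (-(t / τ) ^ 2) =
      √Real.pi * τ * ∫ p : α × α, Real.exp (-(τ ^ 2 * (φ p.1 - φ p.2) ^ 2 / 4)) ∂(μ.prod μ) := by
  -- The square of the modulus becomes an integral over μ × μ, after which t is integrated first
  -- against the Gaussian weight.
  have hsq : ∀ t : ℝ, ((‖∫ a, exp (-(t * φ a : ℝ) * I) ∂μ‖ ^ 2 * Real.exp (-(t / τ) ^ 2) : ℝ) : ℂ) =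
      ∫ p : α × α, exp (-(t * (φ p.1 - φ p.2) : ℝ) * I) * (Real.exp (-(t / τ) ^ 2) : ℝ) ∂(μ.prod μ) := by
    intro t
    rw [integral_mul_const, ofReal_mul, ofReal_pow, ← mul_conj', ← integral_conj, ← integral_prod_mul]
    congr 1
    refine integral_congr_ae (Eventually.of_forall fun p => ?_)
    simp only [← exp_conj, ← exp_add, map_mul, map_neg, conj_ofReal, conj_I]
    congr 1; push_cast; ring
  have hint : Integrable (Function.uncurry fun (t : ℝ) (p : α × α) =>
      exp (-(t * (φ p.1 - φ p.2) : ℝ) * I) * (Real.exp (-(t / τ) ^ 2) : ℝ)) (volume.prod (μ.prod μ)) := by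
    have h1 : Integrable (fun q : ℝ × (α × α) => Real.exp (-(q.1 / τ) ^ 2) * (1 : ℝ)) (volume.prod (μ.prod μ)) :=
      (integrable_gaussian_weight hτ).mul_prod (integrable_const (1 : ℝ))
    refine h1.mono' ?_ (Eventually.of_forall fun q => ?_)
    · refine Measurable.aestronglyMeasurable ?_
      simp only [Function.uncurry_def]
      fun_prop
    · simp only [Function.uncurry, norm_mul, norm_exp_neg_mul_I, norm_real, one_mul, mul_one,
        Real.norm_of_nonneg (Real.exp_pos _).le, le_refl]
  have h : ((∫ t : ℝ, ‖∫ a, exp (-(t * φ a : ℝ) * I) ∂μ‖ ^ 2 * Real.exp (-(t / τ) ^ 2) : ℝ) : ℂ) =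
      ((√Real.pi * τ * ∫ p : α × α, Real.exp (-(τ ^ 2 * (φ p.1 - φ p.2) ^ 2 / 4)) ∂(μ.prod μ) : ℝ) : ℂ) := by
    rw [← integral_complex_ofReal]
    simp_rw [hsq]
    rw [integral_integral_swap hint]
    simp_rw [integral_exp_mul_gaussian_weight hτ]
    rw [integral_complex_ofReal, integral_const_mul]
  exact_mod_cast h

/-- The measure on `ℕ` with the coefficients of the smoothed Dirichlet polynomial as weights. -/
noncomputable def coefMeasure (k : ℕ) (y : ℝ) : Measure ℕ :=
  Measure.count.withDensity fun n => ENNReal.ofReal (coefD k y n)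

instance (k : ℕ) (y : ℝ) : IsFiniteMeasure (coefMeasure k y) := by
  refine isFiniteMeasure_withDensity ?_
  rw [lintegral_count, ← ENNReal.ofReal_tsum_of_nonneg (coefD_nonneg k y) (summable_coefD k y)]
  exact ENNReal.ofReal_ne_top

lemma coefMeasure_real_singleton (k : ℕ) (y : ℝ) (n : ℕ) : (coefMeasure k y).real {n} = coefD k y n := by
  rw [Measure.real, coefMeasure, withDensity_apply _ (measurableSet_singleton n), lintegral_singleton]
  simp [coefD_nonneg]

lemma dirichletD_eq_integral_coefMeasure (k : ℕ) (y t : ℝ) :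
    dirichletD k y t = ∫ n, exp (-(t * Real.log n : ℝ) * I) ∂coefMeasure k y := by
  rw [integral_countable (Integrable.of_bound (C := 1) (Measurable.of_discrete.aestronglyMeasurable)
    (Eventually.of_forall fun n => (norm_exp_neg_mul_I _).le))]
  simp only [coefMeasure_real_singleton, dirichletD, real_smul]

/-- The kernel of the quadratic form in Parseval's formula. -/
noncomputable def offKernel (τ : ℝ) (n m : ℕ) : ℝ :=
  Real.exp (-(τ ^ 2 * (Real.log n - Real.log m) ^ 2 / 4))

lemma offKernel_pos (τ : ℝ) (n m : ℕ) : 0 < offKernel τ n m := Real.exp_pos _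

lemma offKernel_le_one (τ : ℝ) (n m : ℕ) : offKernel τ n m ≤ 1 := Real.exp_le_one_iff.2 (by
  have := mul_nonneg (sq_nonneg τ) (sq_nonneg (Real.log n - Real.log m)); linarith)

lemma offKernel_comm (τ : ℝ) (n m : ℕ) : offKernel τ n m = offKernel τ m n := by
  unfold offKernel; congr 3; rw [← neg_sq]; congr 1; ring

lemma offKernel_self (τ : ℝ) (n : ℕ) : offKernel τ n n = 1 := by simp [offKernel]

lemma integral_dirichletD_sq (k : ℕ) (y : ℝ) {τ : ℝ} (hτ : 0 < τ) :
    ∫ t : ℝ, ‖dirichletD k y t‖ ^ 2 * Real.exp (-(t / τ) ^ 2) =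
      √Real.pi * τ * ∑' p : ℕ × ℕ, coefD k y p.1 * coefD k y p.2 * offKernel τ p.1 p.2 := by
  simp_rw [dirichletD_eq_integral_coefMeasure]
  rw [gaussian_parseval (coefMeasure k y) (φ := fun n : ℕ => Real.log n) (by fun_prop) hτ]
  congr 1
  rw [integral_countable (Integrable.of_bound (C := 1) (Measurable.of_discrete.aestronglyMeasurable) (Eventually.of_forall fun p => by
    rw [Real.norm_of_nonneg (Real.exp_pos _).le]; exact offKernel_le_one τ p.1 p.2))]
  refine tsum_congr fun p => ?_
  have : ({p} : Set (ℕ × ℕ)) = {p.1} ×ˢ {p.2} := by simp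
  rw [this, measureReal_prod_prod, coefMeasure_real_singleton, coefMeasure_real_singleton, smul_eq_mul, offKernel]

lemma summable_coefD_mul (k : ℕ) (y τ : ℝ) :
    Summable fun p : ℕ × ℕ => coefD k y p.1 * coefD k y p.2 * offKernel τ p.1 p.2 := by
  refine Summable.of_nonneg_of_le (fun p => ?_) (fun p => ?_)
    ((summable_coefD k y).mul_of_nonneg (summable_coefD k y) (coefD_nonneg k y) (coefD_nonneg k y))
  · exact mul_nonneg (mul_nonneg (coefD_nonneg _ _ _) (coefD_nonneg _ _ _)) (offKernel_pos _ _ _).le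
  · exact mul_le_of_le_one_right (mul_nonneg (coefD_nonneg _ _ _) (coefD_nonneg _ _ _)) (offKernel_le_one _ _ _)

/-- Each pair lies on the diagonal, in the window P, in the mirror image of P, or in the region
controlled by `htail`. All four majorants are nonnegative on the whole of ℕ × ℕ, so adding them
everywhere is legitimate; the mirror image accounts for the factor 2. -/
lemma tsum_le_of_diag_window {g : ℕ × ℕ → ℝ} {u : ℕ → ℝ} {W : Finset ℕ} {H : ℕ} {δ : ℝ}
    (hg : Summable g) (hg0 : ∀ p, 0 ≤ g p) (hsymm : ∀ p, g p.swap = g p) (hu : Summable u) (hu0 : ∀ n, 0 ≤ u n)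
    (hδ : 0 ≤ δ)
    (htail : ∀ n m, n < m → ¬ (n ∈ W ∧ m ≤ n + H) → g (n, m) ≤ δ * (u n * u m)) :
    ∑' p, g p ≤ ∑' n, g (n, n) + 2 * ∑ n ∈ W, ∑ h ∈ Finset.Icc 1 H, g (n, n + h) + δ * (∑' n, u n) ^ 2 := by
  classical
  set P : Finset (ℕ × ℕ) := (W ×ˢ Finset.Icc 1 H).image fun q => (q.1, q.1 + q.2) with hP
  have hPm : ∀ n m, (n, m) ∈ P ↔ n ∈ W ∧ n < m ∧ m ≤ n + H := by
    intro n m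
    simp only [hP, Finset.mem_image, Finset.mem_product, Finset.mem_Icc, Prod.mk.injEq, Prod.exists]
    constructor
    · rintro ⟨a, b, ⟨ha, hb1, hb2⟩, rfl, rfl⟩
      exact ⟨ha, by omega, by omega⟩
    · rintro ⟨h1, h2, h3⟩
      exact ⟨n, m - n, ⟨h1, by omega, by omega⟩, rfl, by omega⟩
  have hPsum : ∑ p ∈ P, g p = ∑ n ∈ W, ∑ h ∈ Finset.Icc 1 H, g (n, n + h) := by
    rw [hP, Finset.sum_image, Finset.sum_product]
    rintro ⟨a, b⟩ _ ⟨c, d⟩ _ h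
    simp only [Prod.mk.injEq] at h
    ext <;> simp <;> omega
  set f1 : ℕ × ℕ → ℝ := fun p => if p.1 = p.2 then g p else 0 with hf1
  set f2 : ℕ × ℕ → ℝ := fun p => if p ∈ P then g p else 0 with hf2
  set f3 : ℕ × ℕ → ℝ := fun p => if p.swap ∈ P then g p else 0 with hf3
  set f4 : ℕ × ℕ → ℝ := fun p => δ * (u p.1 * u p.2) with hf4
  have hs1 : HasSum f1 (∑' n, g (n, n)) := by
    have hd : Function.Injective fun n : ℕ => (n, n) := fun a b h => (Prod.mk.inj h).1
    have h1 : Summable fun n : ℕ => g (n, n) := hg.comp_injective hd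
    have h2 := (hd.hasSum_iff (f := f1) (a := ∑' n, g (n, n)) (fun p hp => by
      simp only [hf1, ite_eq_right_iff]
      intro h; exact absurd ⟨p.1, by ext <;> simp [h]⟩ hp)).1
    refine h2 ?_
    have : (f1 ∘ fun n : ℕ => (n, n)) = fun n => g (n, n) := by ext n; simp [hf1]
    rw [this]; exact h1.hasSum
  have hs2 : HasSum f2 (∑ p ∈ P, g p) := by
    have : HasSum f2 (∑ p ∈ P, f2 p) := hasSum_sum_of_ne_finset_zero (fun p hp => by simp [hf2, hp])
    have e : ∑ p ∈ P, f2 p = ∑ p ∈ P, g p := Finset.sum_congr rfl fun p hp => if_pos hp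
    rwa [e] at this
  have hs3 : HasSum f3 (∑ p ∈ P, g p) := by
    have h1 : f3 = f2 ∘ (Equiv.prodComm ℕ ℕ) := by
      ext p
      simp only [hf3, hf2, Function.comp, Equiv.prodComm_apply, hsymm]
    rw [h1]
    exact (Equiv.hasSum_iff _).2 hs2
  have hs4 : HasSum f4 (δ * (∑' n, u n) ^ 2) := by
    refine HasSum.mul_left δ ?_
    rw [sq]
    have := hu.mul_of_nonneg hu hu0 hu0
    have h2 := hu.tsum_mul_tsum hu this
    rw [h2]; exact this.hasSum
  have hle : ∀ p, g p ≤ f1 p + f2 p + f3 p + f4 p := by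
    have hn : ∀ p, 0 ≤ f1 p ∧ 0 ≤ f2 p ∧ 0 ≤ f3 p ∧ 0 ≤ f4 p := by
      intro p
      have := hg0 p
      refine ⟨?_, ?_, ?_, mul_nonneg hδ (mul_nonneg (hu0 _) (hu0 _))⟩
      · simp only [hf1]; split_ifs <;> simp [this]
      · simp only [hf2]; split_ifs <;> simp [this]
      · simp only [hf3]; split_ifs <;> simp [this]
    rintro ⟨n, m⟩
    obtain ⟨a1, a2, a3, a4⟩ := hn (n, m)
    rcases lt_trichotomy n m with h | h | h
    · by_cases hp : n ∈ W ∧ m ≤ n + H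
      · have : f2 (n, m) = g (n, m) := if_pos ((hPm n m).2 ⟨hp.1, h, hp.2⟩)
        linarith
      · have := htail n m h hp
        simp only [hf4] at a4 ⊢
        linarith
    · have : f1 (n, m) = g (n, m) := if_pos h
      linarith
    · by_cases hp : m ∈ W ∧ n ≤ m + H
      · have : f3 (n, m) = g (n, m) := if_pos ((hPm m n).2 ⟨hp.1, h, hp.2⟩)
        linarith
      · have h1 := htail m n h hp
        have h2 := hsymm (n, m)
        simp only [Prod.swap_prod_mk] at h2
        simp only [hf4] at a4 ⊢
        have : u n * u m = u m * u n := mul_comm _ _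
        rw [this]
        linarith
  have hsum := ((hs1.add hs2).add hs3).add hs4
  have := hg.tsum_le_tsum hle hsum.summable
  rw [hsum.tsum_eq, hPsum] at this
  linarith

/-! ### The tails of the quadratic form -/

lemma exists_exp_neg_rpow_le {ε : ℝ} (hε : 0 < ε) (B : ℝ) :
    ∃ C : ℝ, 1 ≤ C ∧ ∀ τ : ℝ, 1 ≤ τ → Real.exp (-(τ ^ ε / 16)) ≤ C * τ ^ (-B) := by
  obtain ⟨N, hN⟩ := exists_nat_ge (B / ε)
  have h16 : (1 : ℝ) ≤ 16 ^ N := one_le_pow₀ (by norm_num)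
  have hf : (1 : ℝ) ≤ N.factorial := by exact_mod_cast Nat.one_le_iff_ne_zero.2 (Nat.factorial_ne_zero N)
  refine ⟨16 ^ N * N.factorial, by nlinarith, fun τ hτ => ?_⟩
  have hτ0 : 0 < τ := by linarith
  have hp : 0 < τ ^ ε := Real.rpow_pos_of_pos hτ0 _
  have h1 := Real.pow_div_factorial_le_exp (τ ^ ε / 16) (by positivity) N
  have h2 : τ ^ B ≤ (τ ^ ε) ^ N := by
    rw [← Real.rpow_natCast, ← Real.rpow_mul hτ0.le]
    refine Real.rpow_le_rpow_of_exponent_le hτ ?_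
    rw [div_le_iff₀ hε] at hN; linarith
  rw [Real.exp_neg, Real.rpow_neg hτ0.le, ← div_eq_mul_inv, inv_eq_one_div,
    div_le_div_iff₀ (Real.exp_pos _) (Real.rpow_pos_of_pos hτ0 _), one_mul]
  calc τ ^ B ≤ (τ ^ ε) ^ N := h2
    _ = 16 ^ N * N.factorial * ((τ ^ ε / 16) ^ N / N.factorial) := by rw [div_pow]; field_simp
    _ ≤ _ := by gcongr

lemma gauss_mul_exp_le {A ℓ : ℝ} (hA : 0 ≤ A) (B : ℝ) (hB : 0 ≤ B) {u : ℝ} (hu : ℓ ≤ |u|) :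
    Real.exp (B * u) * gauss u ≤ Real.exp ((A + B) ^ 2) * Real.exp (-(A * ℓ)) := by
  have h1 : gauss u ≤ Real.exp (-u ^ 2 / 4) := by
    unfold gauss; exact div_le_self (Real.exp_pos _).le one_le_two_mul_sqrt_pi
  calc _ ≤ Real.exp (B * u) * Real.exp (-u ^ 2 / 4) := by gcongr
    _ = Real.exp (B * u + -u ^ 2 / 4) := (Real.exp_add _ _).symm
    _ ≤ Real.exp ((A + B) ^ 2 + -(A * ℓ)) := by
      refine Real.exp_le_exp.2 ?_
      have h2 : B * u ≤ B * |u| := mul_le_mul_of_nonneg_left (le_abs_self u) hB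
      nlinarith [sq_nonneg (|u| / 2 - (A + B)), sq_abs u, mul_le_mul_of_nonneg_left hu hA]
    _ = _ := Real.exp_add _ _

/-- Outside a window of logarithmic width ℓ, the Gaussian yields e^{-Aℓ} with A at will, and part of
it is spent on n^{-2} to keep the sum over n convergent. -/
lemma coefD_le_of_le_abs (k : ℕ) {A ℓ : ℝ} (hA : 0 ≤ A) (y : ℝ) {n : ℕ} (hn : n ≠ 0)
    (hℓ : ℓ ≤ |Real.log n - y|) :
    coefD k y n ≤ Real.exp ((A + 3 / 2) ^ 2) * Real.exp (3 / 2 * y) * Real.exp (-(A * ℓ)) *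
      (dk k n * (n : ℝ) ^ (-2 : ℝ)) := by
  have hn0 : (0 : ℝ) < n := by exact_mod_cast Nat.pos_of_ne_zero hn
  have h := gauss_mul_exp_le hA (3 / 2) (by norm_num) hℓ
  have e : (n : ℝ) ^ (-(1 / 2) : ℝ) = Real.exp (3 / 2 * y) * Real.exp (3 / 2 * (Real.log n - y)) * (n : ℝ) ^ (-2 : ℝ) := by
    rw [Real.rpow_def_of_pos hn0, Real.rpow_def_of_pos hn0, ← Real.exp_add, ← Real.exp_add]; congr 1; ring
  rw [coefD, e]
  calc _ = dk k n * (n : ℝ) ^ (-2 : ℝ) * Real.exp (3 / 2 * y) * (Real.exp (3 / 2 * (Real.log n - y)) * gauss (Real.log n - y)) := by ring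
    _ ≤ dk k n * (n : ℝ) ^ (-2 : ℝ) * Real.exp (3 / 2 * y) * (Real.exp ((A + 3 / 2) ^ 2) * Real.exp (-(A * ℓ))) := by gcongr
    _ = _ := by ring

lemma le_abs_log_sub_of_notMem {y θ : ℝ} (hθ : 1 ≤ θ) {n : ℕ} (hn : n ≠ 0)
    (h : n ∉ Finset.Ioc ⌊Real.exp y / θ⌋₊ ⌊Real.exp y * θ⌋₊) : Real.log θ ≤ |Real.log n - y| := by
  have hn0 : (0 : ℝ) < n := by exact_mod_cast Nat.pos_of_ne_zero hn
  have hθ0 : 0 < θ := by linarith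
  rw [Finset.mem_Ioc, not_and_or, not_lt, not_le] at h
  rcases h with h | h
  · have h1 : (n : ℝ) ≤ Real.exp y / θ := (Nat.le_floor_iff (by positivity)).1 h
    have h2 := Real.log_le_log hn0 h1
    rw [Real.log_div (Real.exp_pos y).ne' hθ0.ne', Real.log_exp] at h2
    rw [abs_sub_comm]
    exact le_trans (by linarith) (le_abs_self _)
  · have h1 : Real.exp y * θ < n := (Nat.floor_lt (by positivity)).1 h
    have h2 := Real.log_le_log (by positivity) h1.le
    rw [Real.log_mul (Real.exp_pos y).ne' hθ0.ne', Real.log_exp] at h2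
    exact le_trans (by linarith) (le_abs_self _)

/-- As n ≤ e^y θ, a gap of more than e^y ρ/(θτ) is a relative gap of at least s = ρ/(θ²τ) ≤ 1, hence
a logarithmic gap of at least s/2. The exponent τ²(s/2)²/4 is ρ²/(16θ⁴). -/
lemma offKernel_le_of_far {y θ τ ρ : ℝ} (hθ : 1 ≤ θ) (hτ : 0 < τ) (hρ0 : 0 ≤ ρ) (hρ : ρ ≤ τ) {n m : ℕ}
    (hn : n ≠ 0) (hn2 : n ≤ ⌊Real.exp y * θ⌋₊) (hm : n + ⌊Real.exp y / θ * ρ / τ⌋₊ < m) :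
    offKernel τ n m ≤ Real.exp (-(ρ ^ 2 / θ ^ 4 / 16)) := by
  have hn0 : (0 : ℝ) < n := by exact_mod_cast Nat.pos_of_ne_zero hn
  have hy := Real.exp_pos y
  have hθ0 : 0 < θ := by linarith
  have h1 : (n : ℝ) ≤ Real.exp y * θ := (Nat.le_floor_iff (by positivity)).1 hn2
  have h2 : Real.exp y / θ * ρ / τ < (⌊Real.exp y / θ * ρ / τ⌋₊ : ℝ) + 1 := Nat.lt_floor_add_one _
  have h3 : (n : ℝ) + ⌊Real.exp y / θ * ρ / τ⌋₊ + 1 ≤ m := by exact_mod_cast hm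
  set s := ρ / (θ ^ 2 * τ) with hs
  have hs0 : 0 ≤ s := by positivity
  have hs1 : s ≤ 1 := by
    rw [hs, div_le_one (by positivity)]
    nlinarith [one_le_pow₀ hθ (n := 2)]
  have h4 : (n : ℝ) * (1 + s) ≤ m := by
    have : (n : ℝ) * s ≤ Real.exp y / θ * ρ / τ := by
      calc (n : ℝ) * s ≤ (Real.exp y * θ) * s := by gcongr
        _ = _ := by rw [hs]; field_simp
    nlinarith
  have h5 : s / 2 ≤ Real.log m - Real.log n := by
    have h6 := Real.log_le_log (by positivity) h4
    rw [Real.log_mul hn0.ne' (by positivity)] at h6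
    have h7 := Real.le_log_one_add_of_nonneg hs0
    have h8 : s / 2 ≤ 2 * s / (s + 2) := by
      rw [div_le_div_iff₀ (by norm_num) (by positivity)]; nlinarith
    linarith
  rw [offKernel]
  refine Real.exp_le_exp.2 (neg_le_neg ?_)
  have h9 : (s / 2) ^ 2 ≤ (Real.log n - Real.log m) ^ 2 := by
    rw [← neg_sq (Real.log n - Real.log m), neg_sub]; gcongr
  calc ρ ^ 2 / θ ^ 4 / 16 = τ ^ 2 * (s / 2) ^ 2 / 4 := by rw [hs]; field_simp; ring
    _ ≤ _ := by gcongr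

/-- The quadratic form of the smoothed Dirichlet polynomial, restricted to a window. -/
lemma exists_integral_dirichletD_sq_le (k : ℕ) {ε : ℝ} (hε : 0 < ε) :
    ∃ C : ℝ, 1 ≤ C ∧ ∀ τ ρ y : ℝ, 1 ≤ τ → τ ^ ε ≤ ρ → ρ ≤ τ → 0 ≤ y → y ≤ k * Real.log τ →
      ∫ t : ℝ, ‖dirichletD k y t‖ ^ 2 * Real.exp (-(t / τ) ^ 2) ≤
        √Real.pi * τ * (∑' n, coefD k y n ^ 2 + 2 *
          ∑ n ∈ Finset.Ioc ⌊Real.exp y / τ ^ (ε / 4)⌋₊ ⌊Real.exp y * τ ^ (ε / 4)⌋₊,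
            ∑ h ∈ Finset.Icc 1 ⌊Real.exp y / τ ^ (ε / 4) * ρ / τ⌋₊,
              coefD k y n * coefD k y (n + h) * offKernel τ n (n + h)) + C := by
  obtain ⟨C₁, hC₁, h₁⟩ := exists_exp_neg_rpow_le hε (3 * k + 1)
  -- Chosen so that θ^{-A} = τ^{-(3k+1)}. The coefficients of a pair have size at most e^{3y} ≤
  -- τ^{3k}, and the remaining power cancels the factor τ in Parseval's formula.
  set A : ℝ := 4 * (3 * k + 1) / ε with hA
  have hA0 : 0 ≤ A := by positivity
  set E : ℝ := Real.exp (9 / 4) * (Real.exp ((A + 3 / 2) ^ 2) + Real.exp (9 / 4) * C₁) with hE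
  set u : ℕ → ℝ := fun n => dk k n * (n : ℝ) ^ (-2 : ℝ) with hu
  have hus : Summable u := summable_dk_mul_rpow k (by norm_num)
  have hu0 : ∀ n, 0 ≤ u n := fun n => by simp only [hu]; positivity
  refine ⟨max 1 (√Real.pi * E * (∑' n, u n) ^ 2), le_max_left _ _, fun τ ρ y hτ hρ1 hρ hy hyk => ?_⟩
  have hτ0 : 0 < τ := by linarith
  set θ := τ ^ (ε / 4) with hθ
  have hθ1 : 1 ≤ θ := Real.one_le_rpow hτ (by positivity)
  have hρ0 : 0 < ρ := lt_of_lt_of_le (Real.rpow_pos_of_pos hτ0 _) hρ1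
  have hey : Real.exp (3 * y) ≤ τ ^ (3 * k : ℝ) := by
    rw [Real.rpow_def_of_pos hτ0]; exact Real.exp_le_exp.2 (by nlinarith)
  have hcy : ∀ n, coefD k y n ≤ Real.exp (9 / 4) * Real.exp (3 / 2 * y) * u n := by
    intro n
    have := coefD_le k y (3 / 2) n
    refine this.trans_eq ?_
    rw [← Real.exp_add]; norm_num [hu]
  have h3y : Real.exp (3 / 2 * y) * Real.exp (3 / 2 * y) = Real.exp (3 * y) := by
    rw [← Real.exp_add]; congr 1; ring
  have hττ : τ ^ (3 * k : ℝ) * τ ^ (-(3 * k + 1) : ℝ) = τ⁻¹ := by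
    rw [← Real.rpow_add hτ0, ← Real.rpow_neg_one]; congr 1; ring
  have hmain := tsum_le_of_diag_window (g := fun p : ℕ × ℕ => coefD k y p.1 * coefD k y p.2 * offKernel τ p.1 p.2)
    (u := u) (W := Finset.Ioc ⌊Real.exp y / θ⌋₊ ⌊Real.exp y * θ⌋₊) (H := ⌊Real.exp y / θ * ρ / τ⌋₊) (δ := E * τ⁻¹)
    (summable_coefD_mul k y τ)
    (fun p => mul_nonneg (mul_nonneg (coefD_nonneg _ _ _) (coefD_nonneg _ _ _)) (offKernel_pos _ _ _).le)
    (fun p => by simp only [Prod.fst_swap, Prod.snd_swap]; rw [offKernel_comm τ p.2 p.1]; ring)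
    hus hu0 (by positivity) ?_
  · rw [integral_dirichletD_sq k y hτ0]
    calc _ ≤ √Real.pi * τ * (_ + _ + _) := mul_le_mul_of_nonneg_left hmain (by positivity)
      _ = √Real.pi * τ * (∑' n, coefD k y n ^ 2 + 2 *
          ∑ n ∈ Finset.Ioc ⌊Real.exp y / θ⌋₊ ⌊Real.exp y * θ⌋₊,
            ∑ h ∈ Finset.Icc 1 ⌊Real.exp y / θ * ρ / τ⌋₊,
              coefD k y n * coefD k y (n + h) * offKernel τ n (n + h)) + √Real.pi * E * (∑' n, u n) ^ 2 := by
          simp only [offKernel_self, mul_one, ← sq]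
          rw [mul_add _ _ (E * τ⁻¹ * _)]
          congr 1
          field_simp
      _ ≤ _ := by gcongr; exact le_max_right _ _
  · intro n m hnm hW
    rcases eq_or_ne n 0 with rfl | hn
    · simp only [coefD_zero, zero_mul]
      have := hu0 0; have := hu0 m; positivity
    have hc0 := coefD_nonneg k y n
    have hc1 := coefD_nonneg k y m
    have hk0 := (offKernel_pos τ n m).le
    by_cases hnW : n ∈ Finset.Ioc ⌊Real.exp y / θ⌋₊ ⌊Real.exp y * θ⌋₊
    · have hfar : n + ⌊Real.exp y / θ * ρ / τ⌋₊ < m := by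
        by_contra hcon; exact hW ⟨hnW, not_lt.1 hcon⟩
      have hK := offKernel_le_of_far hθ1 hτ0 hρ0.le hρ hn (Finset.mem_Ioc.1 hnW).2 hfar
      have hK2 : Real.exp (-(ρ ^ 2 / θ ^ 4 / 16)) ≤ C₁ * τ ^ (-(3 * k + 1) : ℝ) := by
        refine le_trans (Real.exp_le_exp.2 (neg_le_neg ?_)) (h₁ τ hτ)
        gcongr
        -- With this θ and ρ ≥ τ^ε, one has ρ²/θ⁴ ≥ τ^ε, so the kernel is smaller than any power of
        -- τ beyond the window.
        have e4 : θ ^ 4 = τ ^ ε := by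
          rw [hθ, ← Real.rpow_natCast, ← Real.rpow_mul hτ0.le]; congr 1; push_cast; ring
        rw [e4, le_div_iff₀ (Real.rpow_pos_of_pos hτ0 _), sq]
        gcongr
      calc _ ≤ (Real.exp (9 / 4) * Real.exp (3 / 2 * y) * u n) * (Real.exp (9 / 4) * Real.exp (3 / 2 * y) * u m) *
            (C₁ * τ ^ (-(3 * k + 1) : ℝ)) := by
            have := hu0 n; have := hu0 m
            gcongr
            · exact hcy n
            · exact hcy m
            · exact hK.trans hK2
        _ = Real.exp (9 / 4) * (Real.exp (9 / 4) * C₁) * (Real.exp (3 * y) * τ ^ (-(3 * k + 1) : ℝ)) * (u n * u m) := by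
            rw [← h3y]; ring
        _ ≤ E * τ⁻¹ * (u n * u m) := by
            have := hu0 n; have := hu0 m
            rw [← hττ, hE]
            gcongr
            linarith [Real.exp_pos ((A + 3 / 2) ^ 2)]
    · have hℓ := le_abs_log_sub_of_notMem hθ1 hn hnW
      have hcn := coefD_le_of_le_abs k hA0 y hn hℓ
      have hθA : Real.exp (-(A * Real.log θ)) = τ ^ (-(3 * k + 1) : ℝ) := by
        rw [hθ, Real.log_rpow hτ0, Real.rpow_def_of_pos hτ0]; congr 1; rw [hA]; field_simp
      rw [hθA] at hcn
      calc _ ≤ (Real.exp ((A + 3 / 2) ^ 2) * Real.exp (3 / 2 * y) * τ ^ (-(3 * k + 1) : ℝ) * u n) *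
            (Real.exp (9 / 4) * Real.exp (3 / 2 * y) * u m) * 1 := by
            have := hu0 n; have := hu0 m
            gcongr
            · exact hcy m
            · exact offKernel_le_one _ _ _
        _ = Real.exp (9 / 4) * Real.exp ((A + 3 / 2) ^ 2) * (Real.exp (3 * y) * τ ^ (-(3 * k + 1) : ℝ)) * (u n * u m) := by
            rw [← h3y]; ring
        _ ≤ E * τ⁻¹ * (u n * u m) := by
            have := hu0 n; have := hu0 m
            rw [← hττ, hE]
            gcongr
            have : 0 ≤ Real.exp (9 / 4) * C₁ := by positivity
            linarith

/-- This is the diagonal in Parseval's formula. One of the two Gaussians is bounded by 1, and the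
other supplies the n^{-η} needed for convergence, at the cost e^{ηy}. -/
lemma exists_tsum_coefD_sq_le (k : ℕ) {η : ℝ} (hη : 0 < η) :
    ∃ C : ℝ, 1 ≤ C ∧ ∀ y : ℝ, ∑' n, coefD k y n ^ 2 ≤ C * Real.exp (η * y) := by
  obtain ⟨D, hD, hd⟩ := dk_le_rpow k (ε := η / 4) (by positivity)
  have hs : Summable fun n : ℕ => (n : ℝ) ^ (-(1 + η / 2)) := Real.summable_nat_rpow.2 (by linarith)
  refine ⟨max 1 (Real.exp (η ^ 2) * D ^ 2 * ∑' n : ℕ, (n : ℝ) ^ (-(1 + η / 2))), le_max_left _ _, fun y => ?_⟩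
  have hle : ∀ n, coefD k y n ^ 2 ≤ Real.exp (η ^ 2) * D ^ 2 * Real.exp (η * y) * (n : ℝ) ^ (-(1 + η / 2)) := by
    intro n
    rcases eq_or_ne n 0 with rfl | hn
    · rw [coefD_zero, sq, zero_mul]; positivity
    have hn0 : (0 : ℝ) < n := by exact_mod_cast Nat.pos_of_ne_zero hn
    have hg := gauss_le (-η) (Real.log n - y)
    have hg2 : gauss (Real.log n - y) ^ 2 ≤ Real.exp (η ^ 2) * Real.exp (η * y) * (n : ℝ) ^ (-η) := by
      calc _ ≤ gauss (Real.log n - y) * 1 := by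
            rw [sq]; exact mul_le_mul_of_nonneg_left (gauss_le_one _) (gauss_nonneg _)
        _ ≤ _ := by
            rw [mul_one]
            refine hg.trans_eq ?_
            rw [Real.rpow_def_of_pos hn0, ← Real.exp_add, ← Real.exp_add]; congr 1; ring
    have hdn := hd n
    calc coefD k y n ^ 2 = (dk k n : ℝ) ^ 2 * ((n : ℝ) ^ (-(1 / 2) : ℝ)) ^ 2 * gauss (Real.log n - y) ^ 2 := by
          rw [coefD]; ring
      _ ≤ (D * (n : ℝ) ^ (η / 4)) ^ 2 * ((n : ℝ) ^ (-(1 / 2) : ℝ)) ^ 2 *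
          (Real.exp (η ^ 2) * Real.exp (η * y) * (n : ℝ) ^ (-η)) := by gcongr
      _ = Real.exp (η ^ 2) * D ^ 2 * Real.exp (η * y) *
          ((n : ℝ) ^ (η / 4) * (n : ℝ) ^ (η / 4) * ((n : ℝ) ^ (-(1 / 2) : ℝ) * (n : ℝ) ^ (-(1 / 2) : ℝ)) * (n : ℝ) ^ (-η)) := by ring
      _ = _ := by
          rw [← Real.rpow_add hn0, ← Real.rpow_add hn0, ← Real.rpow_add hn0, ← Real.rpow_add hn0]
          congr 2; ring
  have hs2 := hs.mul_left (Real.exp (η ^ 2) * D ^ 2 * Real.exp (η * y))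
  calc _ ≤ ∑' n : ℕ, Real.exp (η ^ 2) * D ^ 2 * Real.exp (η * y) * (n : ℝ) ^ (-(1 + η / 2)) :=
        (Summable.of_nonneg_of_le (fun n => sq_nonneg _) hle hs2).tsum_le_tsum hle hs2
    _ = (Real.exp (η ^ 2) * D ^ 2 * ∑' n : ℕ, (n : ℝ) ^ (-(1 + η / 2))) * Real.exp (η * y) := by rw [tsum_mul_left]; ring
    _ ≤ _ := by gcongr; exact le_max_right _ _

/-! ### Mean squares for short sums -/

lemma integrable_sq_mul_weight {f : ℝ → ℂ} (hf : Continuous f) {C : ℝ} (hC : ∀ t, ‖f t‖ ≤ C) {τ : ℝ} (hτ : 0 < τ) :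
    Integrable fun t : ℝ => ‖f t‖ ^ 2 * Real.exp (-(t / τ) ^ 2) := by
  refine ((integrable_gaussian_weight hτ).const_mul (C ^ 2)).mono' (by fun_prop) (Eventually.of_forall fun t => ?_)
  rw [Real.norm_of_nonneg (by positivity)]
  gcongr
  exact hC t

lemma continuous_dirichletD_right (k : ℕ) (y : ℝ) : Continuous fun t => dirichletD k y t :=
  (continuous_dirichletD k).comp (f := fun t : ℝ => (y, t)) (Continuous.prodMk_right y)

lemma continuous_polarD_right (k : ℕ) (y : ℝ) : Continuous fun t => polarD k y t :=
  (continuous_polarD k).comp (f := fun t : ℝ => (y, t)) (Continuous.prodMk_right y)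

lemma continuous_critB_right (k : ℕ) (y : ℝ) : Continuous fun t => critB k y t :=
  (continuous_critB k).comp (f := fun t : ℝ => (y, t)) (Continuous.prodMk_right y)

lemma exists_norm_polarD_bound (k : ℕ) (y : ℝ) : ∃ C, ∀ t, ‖polarD k y t‖ ≤ C := by
  obtain ⟨C, hC, h⟩ := exists_norm_polarD_le k (r := 1 / 2) (by norm_num) le_rfl
  refine ⟨C * Real.exp (y / 2 + 1 / 2 * |y|), fun t => (h y t).trans ?_⟩
  exact mul_le_of_le_one_right (by positivity) (Real.exp_le_one_iff.2 (by nlinarith [sq_nonneg t]))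

lemma integrable_dirichletD_sq (k : ℕ) (y : ℝ) {τ : ℝ} (hτ : 0 < τ) :
    Integrable fun t : ℝ => ‖dirichletD k y t‖ ^ 2 * Real.exp (-(t / τ) ^ 2) :=
  integrable_sq_mul_weight (continuous_dirichletD_right k y) (norm_dirichletD_le_tsum k y) hτ

lemma integrable_polarD_sq (k : ℕ) (y : ℝ) {τ : ℝ} (hτ : 0 < τ) :
    Integrable fun t : ℝ => ‖polarD k y t‖ ^ 2 * Real.exp (-(t / τ) ^ 2) :=
  integrable_sq_mul_weight (continuous_polarD_right k y) (exists_norm_polarD_bound k y).choose_spec hτ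

lemma integrable_critB_sq (k : ℕ) (y : ℝ) {τ : ℝ} (hτ : 0 < τ) :
    Integrable fun t : ℝ => ‖critB k y t‖ ^ 2 * Real.exp (-(t / τ) ^ 2) := by
  obtain ⟨C, hC⟩ := exists_norm_polarD_bound k y
  refine integrable_sq_mul_weight (continuous_critB_right k y) (C := (∑' n, coefD k y n) + C) (fun t => ?_) hτ
  rw [critB_eq]
  exact (norm_sub_le _ _).trans (add_le_add (norm_dirichletD_le_tsum k y t) (hC t))

lemma meanSq_eq (k : ℕ) (y : ℝ) {τ : ℝ} (hτ : 0 < τ) :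
    meanSq k y τ = ENNReal.ofReal (∫ t : ℝ, ‖critB k y t‖ ^ 2 * Real.exp (-(t / τ) ^ 2)) := by
  rw [ofReal_integral_eq_lintegral_ofReal (integrable_critB_sq k y hτ) (Eventually.of_forall fun t => by positivity),
    meanSq]
  refine lintegral_congr fun t => ?_
  rw [ENNReal.ofReal_mul (by positivity), ENNReal.ofReal_pow (norm_nonneg _), ofReal_norm]

lemma integrable_exp_neg_sq : Integrable fun t : ℝ => Real.exp (-t ^ 2) := by
  refine (integrable_exp_neg_mul_sq (b := 1) one_pos).congr (Eventually.of_forall fun t => ?_)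
  simp only; congr 1; ring

lemma weight_le_one (t τ : ℝ) : Real.exp (-(t / τ) ^ 2) ≤ 1 :=
  Real.exp_le_one_iff.2 (neg_nonpos.2 (sq_nonneg _))

lemma exists_integral_polarD_sq_le (k : ℕ) {r : ℝ} (hr : 0 < r) (hr2 : r ≤ 1 / 2) :
    ∃ C : ℝ, 1 ≤ C ∧ ∀ y τ : ℝ, 0 ≤ y → 0 < τ →
      ∫ t : ℝ, ‖polarD k y t‖ ^ 2 * Real.exp (-(t / τ) ^ 2) ≤ C * Real.exp ((1 + 2 * r) * y) := by
  obtain ⟨C, hC, h⟩ := exists_norm_polarD_le k hr hr2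
  set J := ∫ t : ℝ, Real.exp (-t ^ 2)
  refine ⟨max 1 (C ^ 2 * J), le_max_left _ _, fun y τ hy hτ => ?_⟩
  calc _ ≤ ∫ t : ℝ, C ^ 2 * Real.exp ((1 + 2 * r) * y) * Real.exp (-t ^ 2) := by
        refine integral_mono (integrable_polarD_sq k y hτ) (integrable_exp_neg_sq.const_mul _) fun t => ?_
        have h1 := h y t
        rw [abs_of_nonneg hy] at h1
        calc ‖polarD k y t‖ ^ 2 * Real.exp (-(t / τ) ^ 2) ≤
              (C * Real.exp (y / 2 + r * y) * Real.exp (-t ^ 2 / 2)) ^ 2 * 1 := by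
              gcongr
              exact weight_le_one _ _
          _ = C ^ 2 * Real.exp (y / 2 + r * y) ^ 2 * Real.exp (-t ^ 2 / 2) ^ 2 := by ring
          _ = _ := by
              rw [← Real.exp_nat_mul, ← Real.exp_nat_mul]; congr 3
              · push_cast; ring
              · push_cast; ring
    _ = (C ^ 2 * J) * Real.exp ((1 + 2 * r) * y) := by rw [integral_const_mul]; ring
    _ ≤ _ := by gcongr; exact le_max_right _ _

lemma coefD_le_dk_mul (k : ℕ) (y : ℝ) (n : ℕ) : coefD k y n ≤ dk k n * (n : ℝ) ^ (-(1 / 2) : ℝ) :=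
  mul_le_of_le_one_right (by positivity) (gauss_le_one _)

/-- For e^y ≤ τ^{1+3ε} no information on shifted sums is needed. Taking ρ = τ^ε, the window has at
most x₂ values of n and x₁τ^{ε-1} shifts, and each term is at most x₁^{-1} up to τ^{O(ε)}; so the
off-diagonal part is τ^{O(ε)}. The polar part is about e^y, which is admissible too. -/
lemma exists_meanSq_le_of_short (k : ℕ) {ε : ℝ} (hε : 0 < ε) (hε1 : ε ≤ 1) :
    ∃ C : ℝ, 1 ≤ C ∧ ∀ τ y : ℝ, 1 ≤ τ → 0 ≤ y → y ≤ (1 + 3 * ε) * Real.log τ → y ≤ k * Real.log τ →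
      meanSq k y τ ≤ ENNReal.ofReal (C * τ ^ (1 + 8 * ε)) := by
  obtain ⟨C₁, hC₁, h₁⟩ := exists_integral_dirichletD_sq_le k hε
  obtain ⟨C₂, hC₂, h₂⟩ := exists_tsum_coefD_sq_le k hε
  obtain ⟨C₃, hC₃, h₃⟩ := exists_integral_polarD_sq_le k (r := ε / 2) (by positivity) (by linarith)
  obtain ⟨D, hD, hd⟩ := dk_le_rpow k (ε := ε / 4) (by positivity)
  set C₀ := 2 * (√Real.pi * (C₂ + 2 * (D ^ 2 * 2)) + C₁) + 2 * C₃ with hC₀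
  have hs0 : 0 ≤ √Real.pi := Real.sqrt_nonneg _
  refine ⟨C₀, by nlinarith [mul_nonneg hs0 (by positivity : 0 ≤ C₂ + 2 * (D ^ 2 * 2))], fun τ y hτ hy hy1 hyk => ?_⟩
  have hτ0 : 0 < τ := by linarith
  have hpw : ∀ {a b : ℝ}, a ≤ b → τ ^ a ≤ τ ^ b := fun h => Real.rpow_le_rpow_of_exponent_le hτ h
  have hl : 0 ≤ Real.log τ := Real.log_nonneg hτ
  have hexp : ∀ a : ℝ, 0 ≤ a → Real.exp (a * y) ≤ τ ^ (a * (1 + 3 * ε)) := by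
    intro a ha
    rw [Real.rpow_def_of_pos hτ0]
    refine Real.exp_le_exp.2 ?_
    calc a * y ≤ a * ((1 + 3 * ε) * Real.log τ) := by gcongr
      _ = _ := by ring
  rw [meanSq_eq k y hτ0]
  refine ENNReal.ofReal_le_ofReal ?_
  have hD2 : ∫ t : ℝ, ‖dirichletD k y t‖ ^ 2 * Real.exp (-(t / τ) ^ 2) ≤
      (√Real.pi * (C₂ + 2 * (D ^ 2 * 2)) + C₁) * τ ^ (1 + 8 * ε) := by
    have hε1' : ε ≤ 1 := hε1
    have hρτ : τ ^ ε ≤ τ := by simpa using hpw hε1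
    refine (h₁ τ (τ ^ ε) y hτ le_rfl hρτ hy hyk).trans ?_
    set θ := τ ^ (ε / 4) with hθ
    have hθ1 : 1 ≤ θ := Real.one_le_rpow hτ (by positivity)
    set x₁ := Real.exp y / θ with hx₁
    set x₂ := Real.exp y * θ with hx₂
    have hx1 : 0 < x₁ := by positivity
    have hx12 : x₁ ≤ x₂ := by
      rw [hx₁, hx₂, div_le_iff₀ (by linarith), mul_assoc]
      exact le_mul_of_one_le_right (Real.exp_pos y).le (by nlinarith)
    have hx2 : x₂ ≤ τ ^ (1 + 3 * ε + ε / 4) := by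
      rw [hx₂, Real.rpow_add hτ0]; gcongr
      simpa using hexp 1 zero_le_one
    have hdiag : ∑' n, coefD k y n ^ 2 ≤ C₂ * τ ^ (8 * ε) :=
      (h₂ y).trans (by gcongr; exact (hexp ε hε.le).trans (hpw (by nlinarith)))
    have hterm : ∀ n ∈ Finset.Ioc ⌊x₁⌋₊ ⌊x₂⌋₊, ∀ h ∈ Finset.Icc 1 ⌊x₁ * τ ^ ε / τ⌋₊,
        coefD k y n * coefD k y (n + h) * offKernel τ n (n + h) ≤ D ^ 2 * 2 * τ ^ (3 * ε) * x₁⁻¹ := by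
      intro n hn h hh
      rw [Finset.mem_Ioc] at hn
      rw [Finset.mem_Icc] at hh
      have hn1 : x₁ < n := (Nat.floor_lt hx1.le).1 hn.1
      have hn2 : (n : ℝ) ≤ x₂ := (Nat.le_floor_iff (by positivity)).1 hn.2
      have hh2 : (h : ℝ) ≤ x₁ * τ ^ ε / τ := (Nat.le_floor_iff (by positivity)).1 hh.2
      have hh3 : (h : ℝ) ≤ x₂ := by
        refine hh2.trans (le_trans ?_ hx12)
        rw [mul_div_assoc]; exact mul_le_of_le_one_right hx1.le ((div_le_one hτ0).2 hρτ)
      have hn0 : (0 : ℝ) < n := hx1.trans hn1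
      have hnh : ((n + h : ℕ) : ℝ) ≤ 2 * x₂ := by push_cast; linarith
      have hnh1 : x₁ ≤ ((n + h : ℕ) : ℝ) := by push_cast; linarith [Nat.cast_nonneg (α := ℝ) h]
      have hnh0 : 0 < ((n + h : ℕ) : ℝ) := hx1.trans_le hnh1
      have hb : (2 * x₂) ^ (ε / 4) * (2 * x₂) ^ (ε / 4) ≤ 2 * τ ^ (3 * ε) := by
        rw [← Real.rpow_add (by positivity), Real.mul_rpow (by norm_num) (by positivity)]
        have e1 : (2 : ℝ) ^ (ε / 4 + ε / 4) ≤ 2 := by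
          calc (2 : ℝ) ^ (ε / 4 + ε / 4) ≤ 2 ^ (1 : ℝ) := Real.rpow_le_rpow_of_exponent_le (by norm_num) (by linarith)
            _ = 2 := Real.rpow_one 2
        have e2 : x₂ ^ (ε / 4 + ε / 4) ≤ τ ^ (3 * ε) := by
          calc _ ≤ (τ ^ (1 + 3 * ε + ε / 4)) ^ (ε / 4 + ε / 4) := by gcongr
            _ = τ ^ ((1 + 3 * ε + ε / 4) * (ε / 4 + ε / 4)) := (Real.rpow_mul hτ0.le _ _).symm
            _ ≤ _ := hpw (by nlinarith)
        gcongr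
      have hxx : x₁ ^ (-(1 / 2) : ℝ) * x₁ ^ (-(1 / 2) : ℝ) = x₁⁻¹ := by
        rw [← Real.rpow_add hx1, ← Real.rpow_neg_one]; norm_num
      have hk1 : ∀ m : ℕ, x₁ ≤ m → (m : ℝ) ≤ 2 * x₂ → coefD k y m ≤ D * (2 * x₂) ^ (ε / 4) * x₁ ^ (-(1 / 2) : ℝ) := by
        intro m hm1 hm2
        refine (coefD_le_dk_mul k y m).trans ?_
        gcongr ?_ * ?_
        · exact (hd m).trans (by gcongr)
        · exact Real.rpow_le_rpow_of_nonpos hx1 hm1 (by norm_num)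
      calc _ ≤ (D * (2 * x₂) ^ (ε / 4) * x₁ ^ (-(1 / 2) : ℝ)) * (D * (2 * x₂) ^ (ε / 4) * x₁ ^ (-(1 / 2) : ℝ)) * 1 := by
            have := coefD_nonneg k y n; have := coefD_nonneg k y (n + h); have := (offKernel_pos τ n (n + h)).le
            gcongr
            · exact hk1 n hn1.le (by linarith)
            · exact hk1 _ hnh1 hnh
            · exact offKernel_le_one _ _ _
        _ = D ^ 2 * ((2 * x₂) ^ (ε / 4) * (2 * x₂) ^ (ε / 4)) * (x₁ ^ (-(1 / 2) : ℝ) * x₁ ^ (-(1 / 2) : ℝ)) := by ring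
        _ ≤ D ^ 2 * (2 * τ ^ (3 * ε)) * x₁⁻¹ := by rw [hxx]; gcongr
        _ = _ := by ring
    have hoff : ∑ n ∈ Finset.Ioc ⌊x₁⌋₊ ⌊x₂⌋₊, ∑ h ∈ Finset.Icc 1 ⌊x₁ * τ ^ ε / τ⌋₊,
        coefD k y n * coefD k y (n + h) * offKernel τ n (n + h) ≤ D ^ 2 * 2 * τ ^ (8 * ε) := by
      calc _ ≤ ∑ n ∈ Finset.Ioc ⌊x₁⌋₊ ⌊x₂⌋₊, ∑ h ∈ Finset.Icc 1 ⌊x₁ * τ ^ ε / τ⌋₊, D ^ 2 * 2 * τ ^ (3 * ε) * x₁⁻¹ :=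
            Finset.sum_le_sum fun n hn => Finset.sum_le_sum fun h hh => hterm n hn h hh
        _ = ((⌊x₂⌋₊ - ⌊x₁⌋₊ : ℕ) : ℝ) * ((⌊x₁ * τ ^ ε / τ⌋₊ : ℝ) * (D ^ 2 * 2 * τ ^ (3 * ε) * x₁⁻¹)) := by
            simp only [Finset.sum_const, Nat.card_Ioc, Nat.card_Icc, nsmul_eq_mul, Nat.add_sub_cancel]
        _ ≤ x₂ * ((x₁ * τ ^ ε / τ) * (D ^ 2 * 2 * τ ^ (3 * ε) * x₁⁻¹)) := by
            gcongr
            · exact le_trans (by exact_mod_cast Nat.sub_le _ _) (Nat.floor_le (by positivity))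
            · exact Nat.floor_le (by positivity)
        _ = D ^ 2 * 2 * (x₂ * τ ^ ε * τ ^ (3 * ε) * τ⁻¹) := by field_simp
        _ ≤ D ^ 2 * 2 * (τ ^ (1 + 3 * ε + ε / 4) * τ ^ ε * τ ^ (3 * ε) * τ⁻¹) := by gcongr
        _ ≤ D ^ 2 * 2 * τ ^ (8 * ε) := by
            rw [← Real.rpow_neg_one, ← Real.rpow_add hτ0, ← Real.rpow_add hτ0, ← Real.rpow_add hτ0]
            gcongr ?_ * ?_
            exact hpw (by nlinarith)
    have h1τ : 1 ≤ τ ^ (1 + 8 * ε) := Real.one_le_rpow hτ (by positivity)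
    calc _ ≤ √Real.pi * τ * (C₂ * τ ^ (8 * ε) + 2 * (D ^ 2 * 2 * τ ^ (8 * ε))) + C₁ * 1 := by
          rw [mul_one]; gcongr
      _ = √Real.pi * (C₂ + 2 * (D ^ 2 * 2)) * (τ * τ ^ (8 * ε)) + C₁ * 1 := by ring
      _ = √Real.pi * (C₂ + 2 * (D ^ 2 * 2)) * τ ^ (1 + 8 * ε) + C₁ * 1 := by
          rw [Real.rpow_add hτ0, Real.rpow_one]
      _ ≤ √Real.pi * (C₂ + 2 * (D ^ 2 * 2)) * τ ^ (1 + 8 * ε) + C₁ * τ ^ (1 + 8 * ε) := by gcongr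
      _ = _ := by ring
  have hP2 : ∫ t : ℝ, ‖polarD k y t‖ ^ 2 * Real.exp (-(t / τ) ^ 2) ≤ C₃ * τ ^ (1 + 8 * ε) := by
    refine (h₃ y τ hy hτ0).trans ?_
    gcongr
    exact (hexp _ (by positivity)).trans (hpw (by nlinarith))
  calc _ ≤ ∫ t : ℝ, (2 * (‖dirichletD k y t‖ ^ 2 * Real.exp (-(t / τ) ^ 2)) +
        2 * (‖polarD k y t‖ ^ 2 * Real.exp (-(t / τ) ^ 2))) := by
        refine integral_mono (integrable_critB_sq k y hτ0) (((integrable_dirichletD_sq k y hτ0).const_mul 2).add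
          ((integrable_polarD_sq k y hτ0).const_mul 2)) fun t => ?_
        have h5 : ‖critB k y t‖ ≤ ‖dirichletD k y t‖ + ‖polarD k y t‖ := by rw [critB_eq]; exact norm_sub_le _ _
        have h6 : ‖critB k y t‖ ^ 2 ≤ 2 * ‖dirichletD k y t‖ ^ 2 + 2 * ‖polarD k y t‖ ^ 2 := by
          nlinarith [sq_nonneg (‖dirichletD k y t‖ - ‖polarD k y t‖), norm_nonneg (critB k y t)]
        nlinarith [Real.exp_pos (-(t / τ) ^ 2)]
    _ ≤ 2 * ((√Real.pi * (C₂ + 2 * (D ^ 2 * 2)) + C₁) * τ ^ (1 + 8 * ε)) + 2 * (C₃ * τ ^ (1 + 8 * ε)) := by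
        rw [integral_add ((integrable_dirichletD_sq k y hτ0).const_mul 2) ((integrable_polarD_sq k y hτ0).const_mul 2),
          integral_const_mul, integral_const_mul]
        gcongr
    _ = _ := by rw [hC₀]; ring

/-! ### The weight of a pair of integers at distance `h` -/

/-- The exponent of the weight of a pair, in logarithmic coordinates. -/
noncomputable def pairE (y τ v w : ℝ) : ℝ :=
  -(v + w) / 2 - (v - y) ^ 2 / 4 - (w - y) ^ 2 / 4 - τ ^ 2 * (w - v) ^ 2 / 4

/-- The weight of the pair `(x, x + h)`. -/
noncomputable def pairF (y τ x h : ℝ) : ℝ :=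
  (4 * Real.pi)⁻¹ * Real.exp (pairE y τ (Real.log x) (Real.log (x + h)))

/-- The logarithmic derivative of the weight in `h`. -/
noncomputable def pairB (y τ x h : ℝ) : ℝ :=
  (x + h)⁻¹ * (-1 / 2 - (Real.log (x + h) - y) / 2 - τ ^ 2 * (Real.log (x + h) - Real.log x) / 2)

/-- The logarithmic derivative of the weight in `x`. -/
noncomputable def pairA (y τ x h : ℝ) : ℝ :=
  x⁻¹ * (-1 / 2 - (Real.log x - y) / 2 + τ ^ 2 * (Real.log (x + h) - Real.log x) / 2) + pairB y τ x h

/-- The derivative of `pairA` in `h`. -/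
noncomputable def pairC (y τ x h : ℝ) : ℝ :=
  x⁻¹ * (τ ^ 2 * (x + h)⁻¹ / 2) + ((x + h)⁻¹ * (-(x + h)⁻¹ / 2 - τ ^ 2 * (x + h)⁻¹ / 2) - (x + h)⁻¹ * pairB y τ x h)

lemma pairF_pos (y τ x h : ℝ) : 0 < pairF y τ x h := by
  unfold pairF; have := Real.pi_pos; positivity

lemma hasDerivAt_pairF_left {y τ x h : ℝ} (hx : 0 < x) (hh : 0 ≤ h) :
    HasDerivAt (fun x => pairF y τ x h) (pairF y τ x h * pairA y τ x h) x := by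
  have h1 := Real.hasDerivAt_log hx.ne'
  have h2 : HasDerivAt (fun x => Real.log (x + h)) (x + h)⁻¹ x := by
    simpa using ((hasDerivAt_id x).add_const h).log (by simp only [id]; positivity)
  have h3 : HasDerivAt (fun x => pairE y τ (Real.log x) (Real.log (x + h)))
      (pairA y τ x h) x := by
    have := ((((h1.add h2).neg.div_const 2).sub (((h1.sub_const y).pow 2).div_const 4)).sub
      (((h2.sub_const y).pow 2).div_const 4)).sub ((((h2.sub h1).pow 2).const_mul (τ ^ 2)).div_const 4)
    refine (this.congr_deriv ?_)
    simp only [pairA, pairB]; push_cast; simp only [Pi.sub_apply]; ring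
  refine ((h3.exp.const_mul (4 * Real.pi)⁻¹).congr_deriv ?_)
  rw [pairF]; ring

lemma hasDerivAt_log_add {x h : ℝ} (hx : 0 < x) (hh : 0 ≤ h) :
    HasDerivAt (fun h => Real.log (x + h)) (x + h)⁻¹ h := by
  simpa using ((hasDerivAt_id h).const_add x).log (by simp only [id]; positivity)

lemma hasDerivAt_pairF_right {y τ x h : ℝ} (hx : 0 < x) (hh : 0 ≤ h) :
    HasDerivAt (fun h => pairF y τ x h) (pairF y τ x h * pairB y τ x h) h := by
  have h2 := hasDerivAt_log_add hx hh
  have h1 : HasDerivAt (fun _ : ℝ => Real.log x) 0 h := hasDerivAt_const _ _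
  have h3 : HasDerivAt (fun h => pairE y τ (Real.log x) (Real.log (x + h)))
      (pairB y τ x h) h := by
    have := ((((h1.add h2).neg.div_const 2).sub (((h1.sub_const y).pow 2).div_const 4)).sub
      (((h2.sub_const y).pow 2).div_const 4)).sub ((((h2.sub h1).pow 2).const_mul (τ ^ 2)).div_const 4)
    refine (this.congr_deriv ?_)
    simp only [pairB]; push_cast; simp only [Pi.sub_apply]; ring
  refine ((h3.exp.const_mul (4 * Real.pi)⁻¹).congr_deriv ?_)
  rw [pairF]; ring

lemma hasDerivAt_pairA {y τ x h : ℝ} (hx : 0 < x) (hh : 0 ≤ h) :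
    HasDerivAt (fun h => pairA y τ x h) (pairC y τ x h) h := by
  have h2 := hasDerivAt_log_add hx hh
  have h4 : HasDerivAt (fun h => (x + h)⁻¹) (-(x + h)⁻¹ ^ 2) h := by
    have := ((hasDerivAt_id h).const_add x).inv (by simp only [id]; positivity)
    refine this.congr_deriv ?_
    simp only [id]; field_simp
  have h5 : HasDerivAt (fun h => pairB y τ x h) _ h :=
    h4.mul ((((h2.sub_const y).div_const 2).const_sub (-1 / 2)).sub
      (((h2.sub_const (Real.log x)).const_mul (τ ^ 2)).div_const 2))
  have h6 : HasDerivAt (fun h => x⁻¹ * (-1 / 2 - (Real.log x - y) / 2 + τ ^ 2 * (Real.log (x + h) - Real.log x) / 2)) _ h :=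
    ((((h2.sub_const (Real.log x)).const_mul (τ ^ 2)).div_const 2).const_add
      (-1 / 2 - (Real.log x - y) / 2)).const_mul x⁻¹
  refine (h6.add h5).congr_deriv ?_
  simp only [pairC, pairB]
  ring

lemma hasDerivAt_pairF_mul_pairA {y τ x h : ℝ} (hx : 0 < x) (hh : 0 ≤ h) :
    HasDerivAt (fun h => pairF y τ x h * pairA y τ x h)
      (pairF y τ x h * (pairA y τ x h * pairB y τ x h + pairC y τ x h)) h := by
  refine ((hasDerivAt_pairF_right hx hh).mul (hasDerivAt_pairA hx hh)).congr_deriv ?_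
  ring

lemma coefD_mul_coefD_mul_offKernel (k : ℕ) (y τ : ℝ) {n : ℕ} (hn : n ≠ 0) (h : ℕ) :
    coefD k y n * coefD k y (n + h) * offKernel τ n (n + h) = dk k n * dk k (n + h) * pairF y τ n h := by
  have hn0 : (0 : ℝ) < n := by exact_mod_cast Nat.pos_of_ne_zero hn
  have hm0 : (0 : ℝ) < ((n + h : ℕ) : ℝ) := by push_cast; positivity
  have e : ((n + h : ℕ) : ℝ) = (n : ℝ) + h := by push_cast; ring
  set v := Real.log n with hv
  set w := Real.log ((n : ℝ) + h) with hw
  have hs : √Real.pi * √Real.pi = Real.pi := Real.mul_self_sqrt Real.pi_pos.le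
  have h4 : (4 * Real.pi)⁻¹ = (2 * √Real.pi)⁻¹ * (2 * √Real.pi)⁻¹ := by
    rw [← mul_inv]; congr 1; linear_combination -4 * hs
  have h1 : (n : ℝ) ^ (-(1 / 2) : ℝ) = Real.exp (-v / 2) := by
    rw [Real.rpow_def_of_pos hn0]; congr 1; rw [hv]; ring
  have h2 : ((n + h : ℕ) : ℝ) ^ (-(1 / 2) : ℝ) = Real.exp (-w / 2) := by
    rw [Real.rpow_def_of_pos hm0, e]; congr 1; rw [hw]; ring
  have h3 : Real.exp (pairE y τ v w) = Real.exp (-v / 2) * Real.exp (-w / 2) * Real.exp (-(v - y) ^ 2 / 4) *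
      Real.exp (-(w - y) ^ 2 / 4) * Real.exp (-(τ ^ 2 * (v - w) ^ 2 / 4)) := by
    rw [← Real.exp_add, ← Real.exp_add, ← Real.exp_add, ← Real.exp_add]; congr 1; rw [pairE]; ring
  simp only [coefD, offKernel, pairF, gauss]
  rw [h1, h2, e, ← hv, ← hw, h3, h4]
  ring

/-! ### Bounds for the weight in a window -/

/-- The window: `x` is within a factor `θ` of `e^y` and `h` is at most `x ρ / τ`. -/
structure Window (y τ ρ θ x h : ℝ) : Prop where
  one_le_tau : 1 ≤ τ
  one_le_rho : 1 ≤ ρ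
  one_le_theta : 1 ≤ θ
  rho_le : ρ ≤ τ
  pos : 0 < x
  left : Real.exp y ≤ x * θ
  right : x ≤ Real.exp y * θ
  nonneg : 0 ≤ h
  le : τ * h ≤ x * ρ

namespace Window

variable {y τ ρ θ x h : ℝ}

lemma abs_log_sub_le (H : Window y τ ρ θ x h) : |Real.log x - y| ≤ θ := by
  have hθ0 : 0 < θ := by linarith [H.one_le_theta]
  have h1 := Real.log_le_log (Real.exp_pos y) H.left
  have h2 := Real.log_le_log H.pos H.right
  rw [Real.log_exp, Real.log_mul H.pos.ne' hθ0.ne'] at h1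
  rw [Real.log_mul (Real.exp_pos y).ne' hθ0.ne', Real.log_exp] at h2
  have h3 := Real.log_le_sub_one_of_pos hθ0
  rw [abs_le]; constructor <;> linarith

lemma log_add_sub_nonneg (H : Window y τ ρ θ x h) : 0 ≤ Real.log (x + h) - Real.log x :=
  sub_nonneg.2 (Real.log_le_log H.pos (by linarith [H.nonneg]))

lemma log_add_sub_le (H : Window y τ ρ θ x h) : Real.log (x + h) - Real.log x ≤ h / x := by
  have hx := H.pos
  have hh := H.nonneg
  rw [← Real.log_div (by positivity) hx.ne']
  have := Real.log_le_sub_one_of_pos (show 0 < (x + h) / x by positivity)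
  refine this.trans_eq ?_
  field_simp; ring

lemma tau_mul_div_le (H : Window y τ ρ θ x h) : τ * (h / x) ≤ ρ := by
  rw [mul_div_assoc', div_le_iff₀ H.pos, mul_comm ρ]; exact H.le

lemma div_le_one (H : Window y τ ρ θ x h) : h / x ≤ 1 := by
  have h1 := H.tau_mul_div_le
  have h2 := H.one_le_tau
  have h3 := H.rho_le
  have h4 : 0 ≤ h / x := div_nonneg H.nonneg H.pos.le
  by_contra hc
  push Not at hc
  nlinarith

lemma tau_mul_log_le (H : Window y τ ρ θ x h) : τ * (Real.log (x + h) - Real.log x) ≤ ρ :=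
  (mul_le_mul_of_nonneg_left H.log_add_sub_le (by linarith [H.one_le_tau])).trans H.tau_mul_div_le

lemma abs_log_add_sub_le (H : Window y τ ρ θ x h) : |Real.log (x + h) - y| ≤ θ + 1 := by
  have h1 := abs_le.1 H.abs_log_sub_le
  have h2 := H.log_add_sub_nonneg
  have h3 := H.log_add_sub_le.trans H.div_le_one
  rw [abs_le]; constructor <;> linarith

lemma inv_add_le (H : Window y τ ρ θ x h) : (x + h)⁻¹ ≤ x⁻¹ :=
  inv_anti₀ H.pos (by linarith [H.nonneg])

lemma pairF_le (H : Window y τ ρ θ x h) : pairF y τ x h ≤ x⁻¹ := by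
  have hx := H.pos
  have h2 := H.log_add_sub_nonneg
  have e : x⁻¹ = Real.exp (-Real.log x) := by rw [Real.exp_neg, Real.exp_log hx]
  have hp : (4 * Real.pi)⁻¹ ≤ 1 := inv_le_one_of_one_le₀ (by linarith [Real.pi_gt_three])
  rw [pairF, e]
  calc _ ≤ 1 * Real.exp (pairE y τ (Real.log x) (Real.log (x + h))) := by gcongr
    _ ≤ _ := by
      rw [one_mul]
      refine Real.exp_le_exp.2 ?_
      unfold pairE
      have h5 : 0 ≤ τ ^ 2 * (Real.log (x + h) - Real.log x) ^ 2 / 4 := by positivity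
      nlinarith [sq_nonneg (Real.log x - y), sq_nonneg (Real.log (x + h) - y)]

lemma abs_pairB_inner_le (H : Window y τ ρ θ x h) :
    |-1 / 2 - (Real.log (x + h) - y) / 2 - τ ^ 2 * (Real.log (x + h) - Real.log x) / 2| ≤ 2 * (τ * ρ * θ) := by
  have h1 := abs_le.1 H.abs_log_add_sub_le
  have h2 := H.log_add_sub_nonneg
  have h3 := H.tau_mul_log_le
  have hτ := H.one_le_tau; have hρ := H.one_le_rho; have hθ := H.one_le_theta
  have h4 : τ ^ 2 * (Real.log (x + h) - Real.log x) ≤ τ * ρ := by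
    rw [sq, mul_assoc]; gcongr
  have h5 : 0 ≤ τ ^ 2 * (Real.log (x + h) - Real.log x) := by positivity
  have h6 : 1 ≤ τ * ρ := by nlinarith
  have h7 : θ ≤ τ * ρ * θ := by nlinarith
  have h8 : τ * ρ ≤ τ * ρ * θ := by nlinarith
  rw [abs_le]; constructor <;> linarith

/-- A unit step in h may cost a factor τρθ/x, but a window has at most xρ/τ shifts, so the total
relative variation in h is only a power of ρ and θ. -/
lemma abs_pairB_le (H : Window y τ ρ θ x h) : |pairB y τ x h| ≤ 2 * (τ * ρ * θ) * x⁻¹ := by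
  have hx := H.pos
  have hh := H.nonneg
  have hτ := H.one_le_tau; have hρ := H.one_le_rho; have hθ := H.one_le_theta
  rw [pairB, abs_mul, abs_of_pos (by positivity : 0 < (x + h)⁻¹), mul_comm]
  exact mul_le_mul H.abs_pairB_inner_le H.inv_add_le (by positivity) (by positivity)

lemma inv_sub_inv_le (H : Window y τ ρ θ x h) : x⁻¹ - (x + h)⁻¹ ≤ h / x * x⁻¹ := by
  have hx := H.pos
  have hh := H.nonneg
  have : x⁻¹ - (x + h)⁻¹ = h / x * (x + h)⁻¹ := by field_simp; ring
  rw [this]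
  exact mul_le_mul_of_nonneg_left H.inv_add_le (by positivity)

/-- The two terms with τ² nearly cancel: together they carry x^{-1} - (x+h)^{-1} ≤ h/x², and the
second factor h/x removes the remaining power of τ. The variation in x thus costs powers of ρ and θ
only, which is what makes partial summation in n affordable. -/
lemma abs_pairA_le (H : Window y τ ρ θ x h) : |pairA y τ x h| ≤ 3 * (ρ ^ 2 * θ) * x⁻¹ := by
  have hx := H.pos
  have hh := H.nonneg
  have hτ := H.one_le_tau; have hρ := H.one_le_rho; have hθ := H.one_le_theta
  set L := Real.log (x + h) - Real.log x with hL
  have hL0 : 0 ≤ L := H.log_add_sub_nonneg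
  have e : pairA y τ x h = x⁻¹ * (-1 / 2 - (Real.log x - y) / 2) +
      (x + h)⁻¹ * (-1 / 2 - (Real.log (x + h) - y) / 2) + τ ^ 2 * L / 2 * (x⁻¹ - (x + h)⁻¹) := by
    rw [pairA, pairB]; ring
  have h1 : |x⁻¹ * (-1 / 2 - (Real.log x - y) / 2)| ≤ x⁻¹ * (1 / 2 + θ / 2) := by
    rw [abs_mul, abs_of_pos (by positivity : 0 < x⁻¹)]
    have := abs_le.1 H.abs_log_sub_le
    gcongr
    rw [abs_le]; constructor <;> linarith
  have h2 : |(x + h)⁻¹ * (-1 / 2 - (Real.log (x + h) - y) / 2)| ≤ x⁻¹ * (1 / 2 + (θ + 1) / 2) := by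
    rw [abs_mul, abs_of_pos (by positivity : 0 < (x + h)⁻¹)]
    have := abs_le.1 H.abs_log_add_sub_le
    refine mul_le_mul H.inv_add_le ?_ (abs_nonneg _) (by positivity)
    rw [abs_le]; constructor <;> linarith
  have h3 : |τ ^ 2 * L / 2 * (x⁻¹ - (x + h)⁻¹)| ≤ x⁻¹ * (ρ ^ 2 / 2) := by
    have h0 : 0 ≤ x⁻¹ - (x + h)⁻¹ := sub_nonneg.2 H.inv_add_le
    rw [abs_of_nonneg (by positivity)]
    calc τ ^ 2 * L / 2 * (x⁻¹ - (x + h)⁻¹) ≤ τ ^ 2 * L / 2 * (h / x * x⁻¹) := by gcongr; exact H.inv_sub_inv_le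
      _ = x⁻¹ * ((τ * L) * (τ * (h / x)) / 2) := by ring
      _ ≤ x⁻¹ * (ρ * ρ / 2) := by
        gcongr
        · exact H.tau_mul_log_le
        · exact H.tau_mul_div_le
      _ = _ := by ring
  rw [e]
  refine (abs_add_three _ _ _).trans ((add_le_add (add_le_add h1 h2) h3).trans ?_)
  have h4 : 1 ≤ ρ ^ 2 := one_le_pow₀ hρ
  have h5 : 1 / 2 + θ / 2 + (1 / 2 + (θ + 1) / 2) + ρ ^ 2 / 2 ≤ 3 * (ρ ^ 2 * θ) := by nlinarith
  calc _ = x⁻¹ * (1 / 2 + θ / 2 + (1 / 2 + (θ + 1) / 2) + ρ ^ 2 / 2) := by ring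
    _ ≤ x⁻¹ * (3 * (ρ ^ 2 * θ)) := by gcongr
    _ = _ := by ring

lemma abs_pairC_le (H : Window y τ ρ θ x h) : |pairC y τ x h| ≤ 3 * (τ * ρ * θ) * (x⁻¹ * x⁻¹) := by
  have hx := H.pos
  have hh := H.nonneg
  have hτ := H.one_le_tau; have hρ := H.one_le_rho; have hθ := H.one_le_theta
  set L := Real.log (x + h) - Real.log x with hL
  have hL0 : 0 ≤ L := H.log_add_sub_nonneg
  have e : pairC y τ x h = τ ^ 2 / 2 * (x + h)⁻¹ * (x⁻¹ - (x + h)⁻¹) +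
      (x + h)⁻¹ * (x + h)⁻¹ * ((Real.log (x + h) - y) / 2 + τ ^ 2 * L / 2) := by
    rw [pairC, pairB]; ring
  have h1 : |τ ^ 2 / 2 * (x + h)⁻¹ * (x⁻¹ - (x + h)⁻¹)| ≤ τ * ρ / 2 * (x⁻¹ * x⁻¹) := by
    have h0 : 0 ≤ x⁻¹ - (x + h)⁻¹ := sub_nonneg.2 H.inv_add_le
    rw [abs_of_nonneg (by positivity)]
    calc _ ≤ τ ^ 2 / 2 * x⁻¹ * (h / x * x⁻¹) := by
          gcongr
          · linarith
          · exact H.inv_sub_inv_le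
      _ = τ * (τ * (h / x)) / 2 * (x⁻¹ * x⁻¹) := by ring
      _ ≤ τ * ρ / 2 * (x⁻¹ * x⁻¹) := by gcongr; exact H.tau_mul_div_le
  have h2 : |(x + h)⁻¹ * (x + h)⁻¹ * ((Real.log (x + h) - y) / 2 + τ ^ 2 * L / 2)| ≤
      x⁻¹ * x⁻¹ * ((θ + 1) / 2 + τ * ρ / 2) := by
    rw [abs_mul, abs_of_pos (by positivity : 0 < (x + h)⁻¹ * (x + h)⁻¹)]
    have h3 := abs_le.1 H.abs_log_add_sub_le
    have h4 : τ ^ 2 * L ≤ τ * ρ := by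
      rw [sq, mul_assoc]; gcongr; exact H.tau_mul_log_le
    have h5 : 0 ≤ τ ^ 2 * L := by positivity
    refine mul_le_mul (mul_le_mul H.inv_add_le H.inv_add_le (by positivity) (by positivity)) ?_ (abs_nonneg _) (by positivity)
    rw [abs_le]; constructor <;> linarith
  rw [e]
  refine (abs_add_le _ _).trans ((add_le_add h1 h2).trans ?_)
  have h6 : 1 ≤ τ * ρ := by nlinarith
  have h7 : τ * ρ / 2 + ((θ + 1) / 2 + τ * ρ / 2) ≤ 3 * (τ * ρ * θ) := by nlinarith
  calc _ = (τ * ρ / 2 + ((θ + 1) / 2 + τ * ρ / 2)) * (x⁻¹ * x⁻¹) := by ring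
    _ ≤ _ := by gcongr

lemma abs_deriv_right_le (H : Window y τ ρ θ x h) :
    |pairF y τ x h * pairB y τ x h| ≤ 2 * (τ * ρ * θ) * (x⁻¹ * x⁻¹) := by
  have hx := H.pos
  rw [abs_mul, abs_of_pos (pairF_pos y τ x h)]
  calc _ ≤ x⁻¹ * (2 * (τ * ρ * θ) * x⁻¹) :=
        mul_le_mul H.pairF_le H.abs_pairB_le (abs_nonneg _) (by positivity)
    _ = _ := by ring

lemma abs_deriv_left_le (H : Window y τ ρ θ x h) :
    |pairF y τ x h * pairA y τ x h| ≤ 3 * (ρ ^ 2 * θ) * (x⁻¹ * x⁻¹) := by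
  have hx := H.pos
  rw [abs_mul, abs_of_pos (pairF_pos y τ x h)]
  calc _ ≤ x⁻¹ * (3 * (ρ ^ 2 * θ) * x⁻¹) :=
        mul_le_mul H.pairF_le H.abs_pairA_le (abs_nonneg _) (by positivity)
    _ = _ := by ring

/-- Partial summation in h is also applied under the integral over x, to the x-derivative of the
weight; this bounds the variation of that derivative. -/
lemma abs_deriv_mixed_le (H : Window y τ ρ θ x h) :
    |pairF y τ x h * (pairA y τ x h * pairB y τ x h + pairC y τ x h)| ≤
      9 * (τ * ρ ^ 3 * θ ^ 2) * (x⁻¹ * x⁻¹ * x⁻¹) := by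
  have hx := H.pos
  have hτ := H.one_le_tau; have hρ := H.one_le_rho; have hθ := H.one_le_theta
  rw [abs_mul, abs_of_pos (pairF_pos y τ x h)]
  have h1 : |pairA y τ x h * pairB y τ x h + pairC y τ x h| ≤
      (3 * (ρ ^ 2 * θ) * x⁻¹) * (2 * (τ * ρ * θ) * x⁻¹) + 3 * (τ * ρ * θ) * (x⁻¹ * x⁻¹) := by
    refine (abs_add_le _ _).trans (add_le_add ?_ H.abs_pairC_le)
    rw [abs_mul]
    exact mul_le_mul H.abs_pairA_le H.abs_pairB_le (abs_nonneg _) (by positivity)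
  have h2 : τ * ρ * θ ≤ τ * ρ ^ 3 * θ ^ 2 := by
    have h3 : 1 ≤ ρ ^ 2 * θ := by nlinarith
    calc τ * ρ * θ = τ * ρ * θ * 1 := (mul_one _).symm
      _ ≤ τ * ρ * θ * (ρ ^ 2 * θ) := by gcongr
      _ = _ := by ring
  calc _ ≤ x⁻¹ * ((3 * (ρ ^ 2 * θ) * x⁻¹) * (2 * (τ * ρ * θ) * x⁻¹) + 3 * (τ * ρ * θ) * (x⁻¹ * x⁻¹)) :=
        mul_le_mul H.pairF_le h1 (abs_nonneg _) (by positivity)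
    _ = (6 * (τ * ρ ^ 3 * θ ^ 2) + 3 * (τ * ρ * θ)) * (x⁻¹ * x⁻¹ * x⁻¹) := by ring
    _ ≤ (6 * (τ * ρ ^ 3 * θ ^ 2) + 3 * (τ * ρ ^ 3 * θ ^ 2)) * (x⁻¹ * x⁻¹ * x⁻¹) := by gcongr
    _ = _ := by ring

end Window

/-! ### The contribution of the error term -/

lemma sum_mul_eq_partial_sums (a g : ℕ → ℝ) (J : ℕ) :
    ∑ h ∈ Finset.Icc 1 (J + 1), a h * g h = (∑ h ∈ Finset.Icc 1 (J + 1), a h) * g (J + 1) +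
      ∑ j ∈ Finset.Icc 1 J, (∑ h ∈ Finset.Icc 1 j, a h) * (g j - g (j + 1)) := by
  induction J with
  | zero => simp
  | succ J ih =>
    rw [Finset.sum_Icc_succ_top (by omega), ih, Finset.sum_Icc_succ_top (by omega : 1 ≤ J + 1 + 1) a,
      Finset.sum_Icc_succ_top (by omega : 1 ≤ J + 1) (fun j => (∑ h ∈ Finset.Icc 1 j, a h) * (g j - g (j + 1)))]
    ring

/-- Only partial sums of a enter, so that the error terms need to be small merely on average over
the shifts. -/
lemma abs_sum_mul_le_of_partial_sums {a g : ℕ → ℝ} {H : ℕ} {V B₀ B₁ : ℝ} (hV0 : 0 ≤ V) (hB₀0 : 0 ≤ B₀) (hB₁0 : 0 ≤ B₁)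
    (hV : ∀ j, 1 ≤ j → j ≤ H → |∑ h ∈ Finset.Icc 1 j, a h| ≤ V) (hB₀ : |g H| ≤ B₀)
    (hB₁ : ∀ h, 1 ≤ h → h < H → |g h - g (h + 1)| ≤ B₁) :
    |∑ h ∈ Finset.Icc 1 H, a h * g h| ≤ V * (B₀ + H * B₁) := by
  rcases H with _ | J
  · simp; positivity
  rw [sum_mul_eq_partial_sums]
  refine (abs_add_le _ _).trans ?_
  have h1 : |(∑ h ∈ Finset.Icc 1 (J + 1), a h) * g (J + 1)| ≤ V * B₀ := by
    rw [abs_mul]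
    exact mul_le_mul (hV _ (by omega) le_rfl) hB₀ (abs_nonneg _) hV0
  have h2 : |∑ j ∈ Finset.Icc 1 J, (∑ h ∈ Finset.Icc 1 j, a h) * (g j - g (j + 1))| ≤ J * (V * B₁) := by
    refine (Finset.abs_sum_le_sum_abs _ _).trans ?_
    calc _ ≤ ∑ j ∈ Finset.Icc 1 J, V * B₁ := by
          refine Finset.sum_le_sum fun j hj => ?_
          rw [Finset.mem_Icc] at hj
          rw [abs_mul]
          exact mul_le_mul (hV _ hj.1 (by omega)) (hB₁ _ hj.1 (by omega)) (abs_nonneg _) hV0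
      _ = _ := by simp
  have h3 : 0 ≤ V * B₁ := mul_nonneg hV0 hB₁0
  push_cast
  nlinarith

lemma abs_sub_le_of_hasDerivAt {f f' : ℝ → ℝ} {H B : ℝ}
    (hf : ∀ h ∈ Icc 0 H, HasDerivAt f (f' h) h) (hB : ∀ h ∈ Icc 0 H, |f' h| ≤ B) {a b : ℝ}
    (ha : a ∈ Icc 0 H) (hb : b ∈ Icc 0 H) : |f a - f b| ≤ B * |a - b| := by
  have := Convex.norm_image_sub_le_of_norm_hasDerivWithin_le (f := f) (f' := f') (s := Icc 0 H) (C := B)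
    (fun x hx => (hf x hx).hasDerivWithinAt) (fun x hx => by simpa using hB x hx) (convex_Icc 0 H) hb ha
  simpa using this

/-- Taken at M = x, the point x is the left end of the range of the supremum, and t = j is
admissible. -/
lemma G_le_imp {k : ℕ} {ε x τ R : ℝ} (hx : 0 ≤ x) (hR : 0 ≤ R) (hG : G k ε x τ ≤ ENNReal.ofReal R) {j : ℕ} (hj : 1 ≤ j)
    (hj2 : (j : ℝ) ≤ x ^ (1 + ε) / τ) : |∑ h ∈ Finset.Icc 1 j, Delta k x h| ≤ R := by
  have h1 : ENNReal.ofReal |∑ h ∈ Finset.Icc 1 ⌊(j : ℝ)⌋₊, Delta k x h| ≤ G k ε x τ := by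
    unfold G
    refine le_trans ?_ (le_iSup₂ (f := fun x' _ => ⨆ t ∈ Set.Icc 1 (x ^ (1 + ε) / τ),
      ENNReal.ofReal |∑ h ∈ Finset.Icc 1 ⌊t⌋₊, Delta k x' h|) x ⟨le_rfl, by linarith⟩)
    exact le_iSup₂ (f := fun t _ => ENNReal.ofReal |∑ h ∈ Finset.Icc 1 ⌊t⌋₊, Delta k x h|) (j : ℝ)
      ⟨by exact_mod_cast hj, hj2⟩
  rw [Nat.floor_natCast] at h1
  exact (ENNReal.ofReal_le_ofReal_iff hR).1 (h1.trans hG)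

/-- The sum `∑_{n ≤ x} d_k(n) d_k(n + h)`. -/
noncomputable def shiftedSum (k h : ℕ) (x : ℝ) : ℝ :=
  ∑ n ∈ Finset.Icc 1 ⌊x⌋₊, (dk k n : ℝ) * (dk k (n + h) : ℝ)

lemma Delta_eq (k h : ℕ) (x : ℝ) : Delta k x h = shiftedSum k h x - mainTerm k x h := rfl

lemma monotone_shiftedSum (k h : ℕ) : Monotone (shiftedSum k h) := fun x y hxy =>
  Finset.sum_le_sum_of_subset_of_nonneg (Finset.Icc_subset_Icc_right (Nat.floor_mono hxy))
    fun n _ _ => by positivity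

lemma shiftedSum_eq_sum_Icc_zero (k h : ℕ) (x : ℝ) :
    ∑ n ∈ Finset.Icc 0 ⌊x⌋₊, (dk k n : ℝ) * (dk k (n + h) : ℝ) = shiftedSum k h x := by
  rw [shiftedSum]
  refine (Finset.sum_subset (Finset.Icc_subset_Icc_left zero_le_one) fun n hn hn1 => ?_).symm
  have : n = 0 := by
    rw [Finset.mem_Icc] at hn hn1; omega
  rw [this, dk_zero_right]; simp

lemma continuousOn_mainTerm (k : ℕ) {h : ℕ} (hh : h ≠ 0) : ContinuousOn (fun x => mainTerm k x h) (Ioi 0) :=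
  fun _ hx => (hasDerivAt_mainTerm k hh hx).continuousAt.continuousWithinAt

lemma intervalIntegrable_Delta (k : ℕ) {h : ℕ} (hh : h ≠ 0) {x₁ x₂ : ℝ} (hx : 0 < x₁) (hx12 : x₁ ≤ x₂) :
    IntervalIntegrable (fun x => Delta k x h) volume x₁ x₂ := by
  simp only [Delta_eq]
  refine ((monotone_shiftedSum k h).monotoneOn _).intervalIntegrable.sub ?_
  refine ContinuousOn.intervalIntegrable ((continuousOn_mainTerm k hh).mono fun x hxx => ?_)
  rw [uIcc_of_le hx12] at hxx
  exact hx.trans_le hxx.1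

/-- Summation by parts against the main term and the error term. -/
lemma sum_dk_mul_dk_mul_eq (k : ℕ) {h : ℕ} (hh : h ≠ 0) {x₁ x₂ : ℝ} (hx : 0 < x₁) (hx12 : x₁ ≤ x₂) {f f' : ℝ → ℝ}
    (hf : ∀ x ∈ Icc x₁ x₂, HasDerivAt f (f' x) x) (hf' : ContinuousOn f' (Icc x₁ x₂)) :
    ∑ n ∈ Finset.Ioc ⌊x₁⌋₊ ⌊x₂⌋₊, (dk k n : ℝ) * (dk k (n + h) : ℝ) * f n =
      (∫ x in x₁..x₂, f x * singularSeries k x h) +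
      (f x₂ * Delta k x₂ h - f x₁ * Delta k x₁ h - ∫ x in x₁..x₂, f' x * Delta k x h) := by
  have hu : uIcc x₁ x₂ = Icc x₁ x₂ := uIcc_of_le hx12
  have hpos : ∀ x ∈ Icc x₁ x₂, 0 < x := fun x hx' => hx.trans_le hx'.1
  have hderiv : ∀ x ∈ Icc x₁ x₂, deriv f x = f' x := fun x hx' => (hf x hx').deriv
  have habel := sum_mul_eq_sub_sub_integral_mul (fun n : ℕ => (dk k n : ℝ) * (dk k (n + h) : ℝ)) hx.le hx12
    (f := f) (fun x hx' => (hf x hx').differentiableAt)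
    ((hf'.integrableOn_Icc (μ := volume)).congr_fun (fun x hx' => (hderiv x hx').symm) measurableSet_Icc)
  simp only [shiftedSum_eq_sum_Icc_zero] at habel
  have hI : ∫ t in Ioc x₁ x₂, deriv f t * shiftedSum k h t =
      (∫ x in x₁..x₂, f' x * mainTerm k x h) + ∫ x in x₁..x₂, f' x * Delta k x h := by
    rw [← intervalIntegral.integral_add, intervalIntegral.integral_of_le hx12]
    · refine setIntegral_congr_fun measurableSet_Ioc fun x hx' => ?_
      simp only [hderiv x (Ioc_subset_Icc_self hx'), Delta_eq]; ring
    · refine ContinuousOn.intervalIntegrable ?_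
      rw [hu]
      exact hf'.mul ((continuousOn_mainTerm k hh).mono hpos)
    · exact (intervalIntegrable_Delta k hh hx hx12).continuousOn_mul (by rwa [hu])
  have hparts := intervalIntegral.integral_mul_deriv_eq_deriv_mul (a := x₁) (b := x₂) (u := f) (u' := f')
    (v := fun x => mainTerm k x h) (v' := fun x => singularSeries k x h)
    (fun x hx' => hf x (hu ▸ hx')) (fun x hx' => hasDerivAt_mainTerm k hh (hpos x (hu ▸ hx')))
    (ContinuousOn.intervalIntegrable (by rwa [hu]))
    (intervalIntegrable_singularSeries k hh hx.le (hx.le.trans hx12))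
  rw [hI] at habel
  rw [hparts, Finset.sum_congr rfl (fun n _ => mul_comm _ _), habel]
  simp only [Delta_eq]
  ring

lemma continuousOn_pairF_left {y τ h : ℝ} (hh : 0 ≤ h) : ContinuousOn (fun x => pairF y τ x h) (Ioi 0) :=
  fun _ hx => (hasDerivAt_pairF_left hx hh).continuousAt.continuousWithinAt

lemma continuousOn_pairA_left {y τ h : ℝ} (hh : 0 ≤ h) : ContinuousOn (fun x => pairA y τ x h) (Ioi 0) := by
  have h1 : ContinuousOn Real.log (Ioi 0) := Real.continuousOn_log.mono fun x hx => ne_of_gt hx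
  have h2 : ContinuousOn (fun x : ℝ => Real.log (x + h)) (Ioi 0) :=
    (by fun_prop : ContinuousOn (fun x : ℝ => x + h) (Ioi 0)).log fun x hx => by
      have : 0 < x := hx
      positivity
  have h3 : ContinuousOn (fun x : ℝ => x⁻¹) (Ioi 0) := continuousOn_inv₀.mono fun x hx => ne_of_gt hx
  have h4 : ContinuousOn (fun x : ℝ => (x + h)⁻¹) (Ioi 0) :=
    (by fun_prop : ContinuousOn (fun x : ℝ => x + h) (Ioi 0)).inv₀ fun x hx => by
      have : 0 < x := hx
      positivity
  unfold pairA pairB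
  fun_prop

/-- The part of the sum over pairs that comes from the error term. -/
noncomputable def errorPart (k : ℕ) (y τ x₁ x₂ : ℝ) (h : ℕ) : ℝ :=
  pairF y τ x₂ h * Delta k x₂ h - pairF y τ x₁ h * Delta k x₁ h -
    ∫ x in x₁..x₂, pairF y τ x h * pairA y τ x h * Delta k x h

lemma sum_pairF_eq (k : ℕ) (y τ : ℝ) {h : ℕ} (hh : h ≠ 0) {x₁ x₂ : ℝ} (hx : 0 < x₁) (hx12 : x₁ ≤ x₂) :
    ∑ n ∈ Finset.Ioc ⌊x₁⌋₊ ⌊x₂⌋₊, (dk k n : ℝ) * (dk k (n + h) : ℝ) * pairF y τ n h =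
      (∫ x in x₁..x₂, pairF y τ x h * singularSeries k x h) + errorPart k y τ x₁ x₂ h := by
  have hsub : Icc x₁ x₂ ⊆ Ioi 0 := fun x hx' => hx.trans_le hx'.1
  exact sum_dk_mul_dk_mul_eq k hh hx hx12 (f := fun x => pairF y τ x h)
    (fun x hx' => hasDerivAt_pairF_left (hsub hx') (Nat.cast_nonneg h))
    (((continuousOn_pairF_left (Nat.cast_nonneg h)).mul (continuousOn_pairA_left (Nat.cast_nonneg h))).mono hsub)

/-- Partial summation in h is carried out at both end points and at every interior x. The number of
shifts satisfies τH ≤ x₁ρ, which cancels the τ in the derivatives with respect to h. The interior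
bound is of order x₁^{-2}, and integration over an interval of length at most x₂ = x₁θ² restores
x₁^{-1}. -/
lemma abs_sum_errorPart_le {k : ℕ} {y τ ρ θ V : ℝ} {H : ℕ} (hV0 : 0 ≤ V) (hρτ : ρ ≤ τ) (hρ : 1 ≤ ρ) (hθ : 1 ≤ θ)
    (hHle : τ * H ≤ Real.exp y / θ * ρ)
    (hV : ∀ x ∈ Icc (Real.exp y / θ) (Real.exp y * θ), ∀ j : ℕ, 1 ≤ j → j ≤ H → |∑ h ∈ Finset.Icc 1 j, Delta k x h| ≤ V) :
    |∑ h ∈ Finset.Icc 1 H, errorPart k y τ (Real.exp y / θ) (Real.exp y * θ) h| ≤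
      18 * (ρ ^ 4 * θ ^ 4) * V * (Real.exp y / θ)⁻¹ := by
  have hθ0 : 0 < θ := by linarith
  have hτ : 1 ≤ τ := hρ.trans hρτ
  set x₁ := Real.exp y / θ with hx₁
  set x₂ := Real.exp y * θ with hx₂
  have hx1 : 0 < x₁ := by positivity
  have hx21 : x₂ = x₁ * θ ^ 2 := by rw [hx₁, hx₂]; field_simp
  have hx12 : x₁ ≤ x₂ := by rw [hx21]; exact le_mul_of_one_le_right hx1.le (one_le_pow₀ hθ)
  have hu : uIcc x₁ x₂ = Icc x₁ x₂ := uIcc_of_le hx12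
  have hW : ∀ x ∈ Icc x₁ x₂, ∀ h ∈ Icc (0 : ℝ) H, Window y τ ρ θ x h := by
    intro x hx h hh
    have hx0 := hx1.trans_le hx.1
    refine ⟨hτ, hρ, hθ, hρτ, hx0, ?_, hx.2, hh.1, ?_⟩
    · have := hx.1; rwa [hx₁, div_le_iff₀ hθ0] at this
    · calc τ * h ≤ τ * H := by gcongr; exact hh.2
        _ ≤ x₁ * ρ := hHle
        _ ≤ x * ρ := by gcongr; exact hx.1
  have hH0 : (H : ℝ) ∈ Icc (0 : ℝ) H := ⟨Nat.cast_nonneg _, le_rfl⟩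
  have hcast : ∀ h : ℕ, h ≤ H → (h : ℝ) ∈ Icc (0 : ℝ) H := fun h hh => ⟨Nat.cast_nonneg _, by exact_mod_cast hh⟩
  have hsub1 : ∀ h : ℕ, |(h : ℝ) - ((h + 1 : ℕ) : ℝ)| = 1 := fun h => by push_cast; norm_num
  have hinv : ∀ x ∈ Icc x₁ x₂, x⁻¹ ≤ x₁⁻¹ := fun x hx => inv_anti₀ hx1 hx.1
  have hρθ : 1 ≤ ρ ^ 2 * θ := by nlinarith
  -- the values at the end points
  have hend : ∀ x ∈ Icc x₁ x₂, |∑ h ∈ Finset.Icc 1 H, Delta k x h * pairF y τ x h| ≤ 3 * (ρ ^ 2 * θ) * V * x₁⁻¹ := by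
    intro x hx
    have hx0 := hx1.trans_le hx.1
    have h1 := abs_sum_mul_le_of_partial_sums (a := fun h => Delta k x h) (g := fun h => pairF y τ x h) (H := H)
      (V := V) (B₀ := x₁⁻¹) (B₁ := 2 * (τ * ρ * θ) * (x₁⁻¹ * x₁⁻¹)) hV0 (by positivity) (by positivity) (hV x hx)
      (by rw [abs_of_pos (pairF_pos _ _ _ _)]; exact (hW x hx H hH0).pairF_le.trans (hinv x hx))
      (fun h _ hh => by
        have := abs_sub_le_of_hasDerivAt (f := fun h => pairF y τ x h) (H := H)
          (B := 2 * (τ * ρ * θ) * (x₁⁻¹ * x₁⁻¹))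
          (fun h hh => hasDerivAt_pairF_right (y := y) (τ := τ) hx0 hh.1)
          (fun h hh => (hW x hx h hh).abs_deriv_right_le.trans (by
            have := hinv x hx; gcongr)) (hcast h hh.le) (hcast (h + 1) hh)
        rwa [hsub1, mul_one] at this)
    refine h1.trans ?_
    calc V * (x₁⁻¹ + H * (2 * (τ * ρ * θ) * (x₁⁻¹ * x₁⁻¹))) =
          V * (x₁⁻¹ + 2 * (τ * H) * (ρ * θ) * (x₁⁻¹ * x₁⁻¹)) := by ring
      _ ≤ V * ((ρ ^ 2 * θ) * x₁⁻¹ + 2 * (x₁ * ρ) * (ρ * θ) * (x₁⁻¹ * x₁⁻¹)) := by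
          gcongr
          exact le_mul_of_one_le_left (by positivity) hρθ
      _ = _ := by field_simp; ring
  -- the interior
  have hmid : ∀ x ∈ Icc x₁ x₂, |∑ h ∈ Finset.Icc 1 H, Delta k x h * (pairF y τ x h * pairA y τ x h)| ≤
      12 * (ρ ^ 4 * θ ^ 2) * V * (x₁⁻¹ * x₁⁻¹) := by
    intro x hx
    have hx0 := hx1.trans_le hx.1
    have h1 := abs_sum_mul_le_of_partial_sums (a := fun h => Delta k x h)
      (g := fun h => pairF y τ x h * pairA y τ x h) (H := H)
      (V := V) (B₀ := 3 * (ρ ^ 2 * θ) * (x₁⁻¹ * x₁⁻¹)) (B₁ := 9 * (τ * ρ ^ 3 * θ ^ 2) * (x₁⁻¹ * x₁⁻¹ * x₁⁻¹))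
      hV0 (by positivity) (by positivity) (hV x hx)
      ((hW x hx H hH0).abs_deriv_left_le.trans (by have := hinv x hx; gcongr))
      (fun h _ hh => by
        have := abs_sub_le_of_hasDerivAt (f := fun h => pairF y τ x h * pairA y τ x h) (H := H)
          (B := 9 * (τ * ρ ^ 3 * θ ^ 2) * (x₁⁻¹ * x₁⁻¹ * x₁⁻¹))
          (fun h hh => hasDerivAt_pairF_mul_pairA (y := y) (τ := τ) hx0 hh.1)
          (fun h hh => (hW x hx h hh).abs_deriv_mixed_le.trans (by
            have := hinv x hx; gcongr)) (hcast h hh.le) (hcast (h + 1) hh)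
        rwa [hsub1, mul_one] at this)
    refine h1.trans ?_
    have h3 : ρ ^ 2 * θ ≤ ρ ^ 4 * θ ^ 2 := by
      calc ρ ^ 2 * θ = ρ ^ 2 * θ * 1 := (mul_one _).symm
        _ ≤ ρ ^ 2 * θ * (ρ ^ 2 * θ) := by gcongr
        _ = _ := by ring
    calc V * (3 * (ρ ^ 2 * θ) * (x₁⁻¹ * x₁⁻¹) + H * (9 * (τ * ρ ^ 3 * θ ^ 2) * (x₁⁻¹ * x₁⁻¹ * x₁⁻¹))) =
          V * (3 * (ρ ^ 2 * θ) * (x₁⁻¹ * x₁⁻¹) + (τ * H) * (9 * (ρ ^ 3 * θ ^ 2) * (x₁⁻¹ * x₁⁻¹ * x₁⁻¹))) := by ring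
      _ ≤ V * (3 * (ρ ^ 4 * θ ^ 2) * (x₁⁻¹ * x₁⁻¹) + (x₁ * ρ) * (9 * (ρ ^ 3 * θ ^ 2) * (x₁⁻¹ * x₁⁻¹ * x₁⁻¹))) := by
          gcongr
      _ = _ := by field_simp; ring
  have hint : |∑ h ∈ Finset.Icc 1 H, ∫ x in x₁..x₂, pairF y τ x h * pairA y τ x h * Delta k x h| ≤
      12 * (ρ ^ 4 * θ ^ 4) * V * x₁⁻¹ := by
    rw [← intervalIntegral.integral_finsetSum]
    · have h1 : ∀ x ∈ Set.uIoc x₁ x₂, ‖∑ h ∈ Finset.Icc 1 H, pairF y τ x h * pairA y τ x h * Delta k x h‖ ≤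
          12 * (ρ ^ 4 * θ ^ 2) * V * (x₁⁻¹ * x₁⁻¹) := by
        intro x hx
        rw [Set.uIoc_of_le hx12] at hx
        rw [Real.norm_eq_abs, Finset.sum_congr rfl fun h _ => mul_comm _ _]
        exact hmid x (Ioc_subset_Icc_self hx)
      refine (intervalIntegral.norm_integral_le_of_norm_le_const h1).trans ?_
      rw [abs_of_nonneg (by linarith)]
      calc _ ≤ 12 * (ρ ^ 4 * θ ^ 2) * V * (x₁⁻¹ * x₁⁻¹) * x₂ := by gcongr; linarith
        _ = _ := by rw [hx21]; field_simp
    · intro h hh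
      rw [Finset.mem_Icc] at hh
      refine (intervalIntegrable_Delta k (by omega) hx1 hx12).continuousOn_mul ?_
      rw [hu]
      exact ((continuousOn_pairF_left (Nat.cast_nonneg h)).mul (continuousOn_pairA_left (Nat.cast_nonneg h))).mono
        fun x hx' => hx1.trans_le hx'.1
  have hsum : ∑ h ∈ Finset.Icc 1 H, errorPart k y τ x₁ x₂ h =
      (∑ h ∈ Finset.Icc 1 H, Delta k x₂ h * pairF y τ x₂ h) - (∑ h ∈ Finset.Icc 1 H, Delta k x₁ h * pairF y τ x₁ h) -
        ∑ h ∈ Finset.Icc 1 H, ∫ x in x₁..x₂, pairF y τ x h * pairA y τ x h * Delta k x h := by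
    rw [← Finset.sum_sub_distrib, ← Finset.sum_sub_distrib]
    refine Finset.sum_congr rfl fun h _ => ?_
    rw [errorPart]; ring
  rw [hsum]
  have e1 := abs_le.1 (hend x₂ ⟨hx12, le_rfl⟩)
  have e2 := abs_le.1 (hend x₁ ⟨le_rfl, hx12⟩)
  have e3 := abs_le.1 hint
  have e4 : 3 * (ρ ^ 2 * θ) * V * x₁⁻¹ ≤ 3 * (ρ ^ 4 * θ ^ 4) * V * x₁⁻¹ := by
    have : ρ ^ 2 * θ ≤ ρ ^ 4 * θ ^ 4 := by
      calc ρ ^ 2 * θ = ρ ^ 2 * θ ^ 1 := by ring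
        _ ≤ ρ ^ 4 * θ ^ 4 := by gcongr <;> first | assumption | norm_num
    gcongr
  rw [abs_le]
  constructor <;> linarith

/-! ### The main term -/

/-- A function on `[0, H]` that is bounded by `B₀` and Lipschitz with constant `B₁`. -/
structure BoundedLipschitz (g : ℝ → ℝ) (H B₀ B₁ : ℝ) : Prop where
  le : ∀ u ∈ Icc 0 H, |g u| ≤ B₀
  lipschitz : ∀ u ∈ Icc 0 H, ∀ v ∈ Icc 0 H, |g u - g v| ≤ B₁ * |u - v|

namespace BoundedLipschitz

variable {g : ℝ → ℝ} {B₀ B₁ : ℝ}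

lemma continuousOn {H : ℝ} (hg : BoundedLipschitz g H B₀ B₁) : ContinuousOn g (Icc 0 H) := by
  have : LipschitzOnWith (Real.toNNReal B₁) g (Icc 0 H) := LipschitzOnWith.of_dist_le_mul fun u hu v hv => by
    rw [Real.dist_eq, Real.dist_eq]
    refine (hg.lipschitz u hu v hv).trans ?_
    gcongr
    exact Real.le_coe_toNNReal B₁
  exact this.continuousOn

lemma intervalIntegrable {H : ℝ} (hg : BoundedLipschitz g H B₀ B₁) {u v : ℝ} (hu : u ∈ Icc 0 H) (hv : v ∈ Icc 0 H) :
    IntervalIntegrable g volume u v :=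
  (hg.continuousOn.mono (uIcc_subset_Icc hu hv)).intervalIntegrable

/-- Comparison of a Riemann sum with step `d` with the integral. -/
lemma abs_riemannSum_sub_integral_le {H : ℕ} (hg : BoundedLipschitz g H B₀ B₁) (hB₀ : 0 ≤ B₀) (hB₁ : 0 ≤ B₁)
    (d : ℕ) :
    |d * ∑ j ∈ Finset.range (H / d), g (d * (j + 1 : ℕ)) - ∫ u in (0 : ℝ)..H, g u| ≤ d * (B₀ + H * B₁) ∨ d = 0 := by
  rcases Nat.eq_zero_or_pos d with hd | hd
  · exact Or.inr hd
  left
  set N := H / d with hN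
  have hNd : d * N ≤ H := Nat.mul_div_le H d
  have hlt : H < d * N + d := by
    have := Nat.lt_div_mul_add (a := H) hd
    rw [mul_comm d N]; exact this
  have hNd' : (d : ℝ) * N ≤ H := by exact_mod_cast hNd
  have hlt' : (H : ℝ) ≤ d * N + d := by exact_mod_cast hlt.le
  have hd0 : (0 : ℝ) < d := by exact_mod_cast hd
  have hmem : ∀ j : ℕ, j ≤ N → (d : ℝ) * j ∈ Icc (0 : ℝ) H := fun j hj => by
    refine ⟨by positivity, le_trans ?_ hNd'⟩
    gcongr
  have hsplit : ∫ u in (0 : ℝ)..H, g u =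
      (∑ j ∈ Finset.range N, ∫ u in (d * (j : ℕ) : ℝ)..(d * (j + 1 : ℕ) : ℝ), g u) + ∫ u in (d * N : ℝ)..H, g u := by
    have h1 := intervalIntegral.sum_integral_adjacent_intervals (f := g) (μ := volume) (a := fun j : ℕ => (d : ℝ) * j)
      (n := N) (fun j hj => hg.intervalIntegrable (hmem j hj.le) (hmem (j + 1) hj))
    simp only [Nat.cast_zero, mul_zero] at h1
    rw [h1, intervalIntegral.integral_add_adjacent_intervals]
    · have := hmem 0 (Nat.zero_le _)
      simp only [Nat.cast_zero, mul_zero] at this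
      exact hg.intervalIntegrable this (hmem N le_rfl)
    · exact hg.intervalIntegrable (hmem N le_rfl) ⟨Nat.cast_nonneg _, le_rfl⟩
  have hstep : ∀ j ∈ Finset.range N, |d * g (d * (j + 1 : ℕ)) - ∫ u in (d * (j : ℕ) : ℝ)..(d * (j + 1 : ℕ) : ℝ), g u| ≤
      d * (d * B₁) := by
    intro j hj
    rw [Finset.mem_range] at hj
    have hle : (d * (j : ℕ) : ℝ) ≤ d * (j + 1 : ℕ) := by push_cast; nlinarith
    have e : (d : ℝ) * g (d * (j + 1 : ℕ)) = ∫ u in (d * (j : ℕ) : ℝ)..(d * (j + 1 : ℕ) : ℝ), g (d * (j + 1 : ℕ)) := by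
      rw [intervalIntegral.integral_const, smul_eq_mul]; push_cast; ring
    rw [e, ← intervalIntegral.integral_sub intervalIntegrable_const
      (hg.intervalIntegrable (hmem j hj.le) (hmem (j + 1) hj)), ← Real.norm_eq_abs]
    refine (intervalIntegral.norm_integral_le_of_norm_le_const (C := d * B₁) fun u hu => ?_).trans_eq ?_
    · rw [uIoc_of_le hle] at hu
      have hu' : u ∈ Icc (0 : ℝ) H := ⟨(hmem j hj.le).1.trans hu.1.le, hu.2.trans (hmem (j + 1) hj).2⟩
      refine (hg.lipschitz _ (hmem (j + 1) hj) u hu').trans ?_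
      rw [mul_comm]
      gcongr
      rw [abs_of_nonneg (by linarith [hu.2])]
      have := hu.1
      push_cast at this ⊢; linarith
    · rw [abs_of_nonneg (by linarith)]; push_cast; ring
  have hrest : |∫ u in (d * N : ℝ)..H, g u| ≤ d * B₀ := by
    rw [← Real.norm_eq_abs]
    refine (intervalIntegral.norm_integral_le_of_norm_le_const (C := B₀) fun u hu => ?_).trans ?_
    · rw [uIoc_of_le hNd'] at hu
      exact hg.le u ⟨(hmem N le_rfl).1.trans hu.1.le, hu.2⟩
    · rw [abs_of_nonneg (by linarith), mul_comm]
      gcongr; linarith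
  rw [hsplit, Finset.mul_sum, ← sub_sub, ← Finset.sum_sub_distrib]
  calc _ ≤ |∑ j ∈ Finset.range N, (d * g (d * (j + 1 : ℕ)) - ∫ u in (d * (j : ℕ) : ℝ)..(d * (j + 1 : ℕ) : ℝ), g u)| +
        |∫ u in (d * N : ℝ)..H, g u| := abs_sub _ _
    _ ≤ (∑ j ∈ Finset.range N, d * (d * B₁)) + d * B₀ :=
        add_le_add ((Finset.abs_sum_le_sum_abs _ _).trans (Finset.sum_le_sum hstep)) hrest
    _ = d * N * (d * B₁) + d * B₀ := by rw [Finset.sum_const, Finset.card_range, nsmul_eq_mul]; ring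
    _ ≤ H * (d * B₁) + d * B₀ := by gcongr
    _ = _ := by ring

/-- For d ≤ H this is the Riemann sum estimate with a surplus factor (H/d)^s. For d > H the sum is
empty and the integral is bounded trivially. The saving d^{-s} over the plain estimate is what makes
the later sum over q converge. -/
lemma abs_riemannSum_sub_integral_le_rpow {H : ℕ} (hH : 1 ≤ H) (hg : BoundedLipschitz g H B₀ B₁) (hB₀ : 0 ≤ B₀)
    (hB₁ : 0 ≤ B₁) {d : ℕ} (hd : d ≠ 0) {s : ℝ} (hs0 : 0 ≤ s) (hs1 : s ≤ 1) :
    |d * ∑ j ∈ Finset.range (H / d), g (d * (j + 1 : ℕ)) - ∫ u in (0 : ℝ)..H, g u| ≤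
      (B₀ + H * B₁) * (H : ℝ) ^ s * (d : ℝ) ^ (1 - s) := by
  have hd0 : (0 : ℝ) < d := by exact_mod_cast Nat.pos_of_ne_zero hd
  have hH0 : (0 : ℝ) < H := by exact_mod_cast hH
  have e : (B₀ + H * B₁) * (H : ℝ) ^ s * (d : ℝ) ^ (1 - s) = d * (B₀ + H * B₁) * (H / d : ℝ) ^ s := by
    rw [Real.div_rpow hH0.le hd0.le, Real.rpow_sub hd0, Real.rpow_one]; field_simp
  rw [e]
  rcases le_or_gt d H with hdH | hdH
  · refine ((hg.abs_riemannSum_sub_integral_le hB₀ hB₁ d).resolve_right hd).trans ?_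
    refine le_mul_of_one_le_right (by positivity) (Real.one_le_rpow ?_ hs0)
    rw [one_le_div hd0]; exact_mod_cast hdH
  · rw [Nat.div_eq_of_lt hdH, Finset.range_zero, Finset.sum_empty, mul_zero, zero_sub, abs_neg]
    have h1 : |∫ u in (0 : ℝ)..H, g u| ≤ B₀ * H := by
      rw [← Real.norm_eq_abs]
      refine (intervalIntegral.norm_integral_le_of_norm_le_const (C := B₀) fun u hu => ?_).trans ?_
      · rw [uIoc_of_le hH0.le] at hu
        exact hg.le u ⟨hu.1.le, hu.2⟩
      · rw [sub_zero, abs_of_pos hH0]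
    have hq : (H / d : ℝ) ≤ 1 := by
      rw [div_le_one hd0]; exact_mod_cast hdH.le
    calc _ ≤ B₀ * H := h1
      _ = d * B₀ * (H / d : ℝ) ^ (1 : ℝ) := by rw [Real.rpow_one]; field_simp
      _ ≤ d * (B₀ + H * B₁) * (H / d : ℝ) ^ s := by
          gcongr ?_ * ?_
          · gcongr; linarith [mul_nonneg hH0.le hB₁]
          · exact Real.rpow_le_rpow_of_exponent_ge (by positivity) hq hs1

end BoundedLipschitz

lemma sum_Icc_filter_dvd (f : ℕ → ℝ) (H : ℕ) {d : ℕ} (hd : d ≠ 0) :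
    ∑ h ∈ (Finset.Icc 1 H).filter (d ∣ ·), f h = ∑ j ∈ Finset.range (H / d), f (d * (j + 1)) := by
  symm
  refine Finset.sum_bij (fun j _ => d * (j + 1)) ?_ ?_ ?_ fun _ _ => rfl
  · intro j hj
    rw [Finset.mem_range] at hj
    rw [Finset.mem_filter, Finset.mem_Icc]
    refine ⟨⟨Nat.mul_pos (Nat.pos_of_ne_zero hd) (Nat.succ_pos j), ?_⟩, dvd_mul_right _ _⟩
    rw [mul_comm]; exact (Nat.le_div_iff_mul_le (Nat.pos_of_ne_zero hd)).1 hj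
  · intro i _ j _ hij
    have := Nat.eq_of_mul_eq_mul_left (Nat.pos_of_ne_zero hd) hij
    omega
  · intro h hh
    rw [Finset.mem_filter, Finset.mem_Icc] at hh
    obtain ⟨⟨h1, h2⟩, m, rfl⟩ := hh
    have hm : 0 < m := Nat.pos_of_mul_pos_left h1
    refine ⟨m - 1, ?_, by rw [Nat.sub_add_cancel hm]⟩
    rw [Finset.mem_range]
    have := (Nat.le_div_iff_mul_le (Nat.pos_of_ne_zero hd)).2 ((mul_comm m d).trans_le h2)
    omega

lemma sum_ramanujanSum_mul (g : ℝ → ℝ) (H : ℕ) {q : ℕ} (hq : q ≠ 0) :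
    ∑ h ∈ Finset.Icc 1 H, (ramanujanSum q h : ℝ) * g h =
      ∑ d ∈ q.divisors, (ArithmeticFunction.moebius (q / d) : ℝ) *
        (d * ∑ j ∈ Finset.range (H / d), g (d * (j + 1 : ℕ))) := by
  have h1 : ∀ h ∈ Finset.Icc 1 H, (ramanujanSum q h : ℝ) * g h =
      ∑ d ∈ q.divisors, if d ∣ h then (ArithmeticFunction.moebius (q / d) : ℝ) * (d * g h) else 0 := by
    intro h hh
    rw [Finset.mem_Icc] at hh
    have hdiv : (Nat.gcd h q).divisors = q.divisors.filter (· ∣ h) := by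
      ext d
      simp only [Nat.mem_divisors, Finset.mem_filter, Nat.dvd_gcd_iff, ne_eq, Nat.gcd_eq_zero_iff]
      tauto
    rw [ramanujanSum, hdiv, ← Finset.sum_filter]
    push_cast
    rw [Finset.sum_mul]
    exact Finset.sum_congr rfl fun d _ => by ring
  rw [Finset.sum_congr rfl h1, Finset.sum_comm]
  refine Finset.sum_congr rfl fun d hd => ?_
  have hd0 : d ≠ 0 := (Nat.pos_of_mem_divisors hd).ne'
  rw [← Finset.sum_filter, sum_Icc_filter_dvd _ _ hd0, Finset.mul_sum, Finset.mul_sum]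
  exact Finset.sum_congr rfl fun j _ => by push_cast; ring

lemma sum_moebius_div (q : ℕ) :
    ∑ d ∈ q.divisors, (ArithmeticFunction.moebius (q / d) : ℝ) = if q = 1 then 1 else 0 := by
  rw [Nat.sum_div_divisors q (fun d => (ArithmeticFunction.moebius d : ℝ))]
  have := congrArg (fun f => f q) ArithmeticFunction.moebius_mul_coe_zeta
  simp only [ArithmeticFunction.coe_mul_zeta_apply, ArithmeticFunction.one_apply] at this
  exact_mod_cast this

/-- Opening the Ramanujan sum, each divisor d of q gives d times the sum of g over multiples of d,
which approximates one and the same integral. The coefficients μ(q/d) then add up to 1 for q = 1 and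
to 0 otherwise. -/
lemma abs_sum_ramanujanSum_mul_sub_le {g : ℝ → ℝ} {B₀ B₁ : ℝ} {H : ℕ} (hH : 1 ≤ H)
    (hg : BoundedLipschitz g H B₀ B₁) (hB₀ : 0 ≤ B₀) (hB₁ : 0 ≤ B₁) {q : ℕ} (hq : q ≠ 0) {s : ℝ}
    (hs0 : 0 ≤ s) (hs1 : s ≤ 1) :
    |∑ h ∈ Finset.Icc 1 H, (ramanujanSum q h : ℝ) * g h - (if q = 1 then 1 else 0) * ∫ u in (0 : ℝ)..H, g u| ≤
      (B₀ + H * B₁) * (H : ℝ) ^ s * (q.divisors.card * (q : ℝ) ^ (1 - s)) := by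
  rw [sum_ramanujanSum_mul g H hq, ← sum_moebius_div q, Finset.sum_mul, ← Finset.sum_sub_distrib]
  refine (Finset.abs_sum_le_sum_abs _ _).trans ?_
  calc _ ≤ ∑ d ∈ q.divisors, (B₀ + H * B₁) * (H : ℝ) ^ s * (q : ℝ) ^ (1 - s) := by
        refine Finset.sum_le_sum fun d hd => ?_
        have hd0 : d ≠ 0 := (Nat.pos_of_mem_divisors hd).ne'
        have hμ : |(ArithmeticFunction.moebius (q / d) : ℝ)| ≤ 1 := by
          exact_mod_cast ArithmeticFunction.abs_moebius_le_one
        rw [← mul_sub, abs_mul]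
        refine (mul_le_of_le_one_left (abs_nonneg _) hμ).trans
          ((hg.abs_riemannSum_sub_integral_le_rpow hH hB₀ hB₁ hd0 hs0 hs1).trans ?_)
        have : (d : ℝ) ≤ q := by exact_mod_cast Nat.divisor_le hd
        gcongr
    _ = _ := by rw [Finset.sum_const, nsmul_eq_mul]; ring

/-- Summed over the shifts, only the first term of the singular series matters. -/
lemma exists_abs_sum_singularSeries_sub_le (k : ℕ) {η : ℝ} (hη : 0 < η) (hη1 : η ≤ 1 / 4) :
    ∃ C : ℝ, 1 ≤ C ∧ ∀ (x : ℝ) (H : ℕ) (g : ℝ → ℝ) (B₀ B₁ : ℝ), 1 ≤ x → 1 ≤ H → 0 ≤ B₀ → 0 ≤ B₁ →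
      BoundedLipschitz g H B₀ B₁ →
      |∑ h ∈ Finset.Icc 1 H, g h * singularSeries k x h - Qk k x 1 ^ 2 * ∫ u in (0 : ℝ)..H, g u| ≤
        C * (x ^ (2 * η) * (H : ℝ) ^ (4 * η) * (B₀ + H * B₁)) := by
  obtain ⟨A, hA1, hA⟩ := exists_Qk_bound k hη
  obtain ⟨D, hD1, hD⟩ := card_divisors_le_rpow hη
  have hsum : Summable fun q : ℕ+ => ((q : ℕ) : ℝ) ^ (-1 - η) := summable_pnat_rpow (by linarith)
  set Z := ∑' q : ℕ+, ((q : ℕ) : ℝ) ^ (-1 - η) with hZ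
  have hZ0 : 0 ≤ Z := tsum_nonneg fun q => by positivity
  refine ⟨A ^ 2 * D * Z + 1, by nlinarith [mul_nonneg (mul_nonneg (sq_nonneg A) (by linarith : 0 ≤ D)) hZ0],
    fun x H g B₀ B₁ hx hH hB₀ hB₁ hg => ?_⟩
  have hx0 : 0 < x := by linarith
  set J := ∫ u in (0 : ℝ)..H, g u with hJ
  have hmax : max x x⁻¹ = x := max_eq_left ((inv_le_one_of_one_le₀ hx).trans hx)
  have hB : 0 ≤ B₀ + H * B₁ := by positivity
  set E : ℕ+ → ℝ := fun q => (1 : ℝ) / ((q : ℕ) : ℝ) ^ 2 * Qk k x q ^ 2 *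
    (∑ h ∈ Finset.Icc 1 H, (ramanujanSum q h : ℝ) * g h - (if (q : ℕ) = 1 then 1 else 0) * J) with hE
  have hEle : ∀ q, ‖E q‖ ≤ (A ^ 2 * D * (x ^ (2 * η) * (H : ℝ) ^ (4 * η) * (B₀ + H * B₁))) * ((q : ℕ) : ℝ) ^ (-1 - η) := by
    intro q
    have hq0 : (0 : ℝ) < (q : ℕ) := by exact_mod_cast q.pos
    -- With s = 4η the power of q is -2 + 2η + η + (1 - 4η) = -1 - η: 2η from the square of Q_k and
    -- η from the number of divisors.
    have h1 := abs_sum_ramanujanSum_mul_sub_le hH hg hB₀ hB₁ q.ne_zero (s := 4 * η) (by linarith) (by linarith)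
    have h2 := hA q q.ne_zero x hx0
    rw [hmax] at h2
    have h3 : Qk k x q ^ 2 ≤ (A * ((q : ℕ) : ℝ) ^ η * x ^ η) ^ 2 := sq_le_sq' (by linarith [abs_le.1 h2]) (abs_le.1 h2).2
    have hxx : (x ^ η) ^ 2 = x ^ (2 * η) := by
      rw [← Real.rpow_natCast, ← Real.rpow_mul hx0.le]; push_cast; rw [mul_comm]
    rw [hE, Real.norm_eq_abs, abs_mul, abs_of_nonneg (by positivity)]
    calc _ ≤ 1 / ((q : ℕ) : ℝ) ^ 2 * (A * ((q : ℕ) : ℝ) ^ η * x ^ η) ^ 2 *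
          ((B₀ + H * B₁) * (H : ℝ) ^ (4 * η) * ((D * ((q : ℕ) : ℝ) ^ η) * ((q : ℕ) : ℝ) ^ (1 - 4 * η))) := by
          gcongr
          refine h1.trans ?_
          gcongr
          exact hD q
      _ = (A ^ 2 * D * ((x ^ η) ^ 2 * (H : ℝ) ^ (4 * η) * (B₀ + H * B₁))) *
          ((((q : ℕ) : ℝ) ^ 2)⁻¹ * ((q : ℕ) : ℝ) ^ η * ((q : ℕ) : ℝ) ^ η * ((q : ℕ) : ℝ) ^ η * ((q : ℕ) : ℝ) ^ (1 - 4 * η)) := by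
          ring
      _ = _ := by
          congr 2
          · rw [hxx]
          · rw [← Real.rpow_natCast, ← Real.rpow_neg hq0.le, ← Real.rpow_add hq0, ← Real.rpow_add hq0,
              ← Real.rpow_add hq0, ← Real.rpow_add hq0]
            congr 1; push_cast; ring
  have hEs : Summable E := Summable.of_norm_bounded (hsum.mul_left _) hEle
  have hmain : HasSum (fun q : ℕ+ => ∑ h ∈ Finset.Icc 1 H, g h * ((ramanujanSum q h : ℝ) / ((q : ℕ) : ℝ) ^ 2 * Qk k x q ^ 2))
      (∑ h ∈ Finset.Icc 1 H, g h * singularSeries k x h) := by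
    refine hasSum_sum fun h hh => ?_
    rw [Finset.mem_Icc] at hh
    exact (summable_singularSeries k hx0 (by omega)).hasSum.mul_left _
  have hone : HasSum (fun q : ℕ+ => if q = 1 then Qk k x 1 ^ 2 * J else 0) (Qk k x 1 ^ 2 * J) := hasSum_ite_eq _ _
  have hEq : HasSum E (∑ h ∈ Finset.Icc 1 H, g h * singularSeries k x h - Qk k x 1 ^ 2 * J) := by
    refine (hmain.sub hone).congr_fun fun q => ?_
    rw [hE]
    by_cases hq : q = 1
    · subst hq
      simp only [PNat.one_coe, Nat.cast_one, one_pow, div_one, if_true, one_mul, mul_sub, Finset.mul_sum]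
      congr 1
      exact Finset.sum_congr rfl fun h _ => by ring
    · have hq' : (q : ℕ) ≠ 1 := fun h => hq (PNat.coe_eq_one_iff.1 h)
      simp only [hq, hq', if_false, zero_mul, sub_zero, Finset.mul_sum]
      exact Finset.sum_congr rfl fun h _ => by ring
  have hfin := tsum_of_norm_bounded (hsum.hasSum.mul_left (A ^ 2 * D * (x ^ (2 * η) * (H : ℝ) ^ (4 * η) * (B₀ + H * B₁)))) hEle
  rw [hEq.tsum_eq, Real.norm_eq_abs] at hfin
  refine hfin.trans ?_
  have : 0 ≤ x ^ (2 * η) * (H : ℝ) ^ (4 * η) * (B₀ + H * B₁) := by positivity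
  rw [← hZ]
  nlinarith

/-- Clamping the variables to x ≥ x₁ and h ≥ 0 gives a continuous function on the whole plane
without changing the integral. -/
lemma continuousOn_intervalIntegral_of_continuousOn {f : ℝ → ℝ → ℝ}
    (hf : ContinuousOn (Function.uncurry f) (Ioi 0 ×ˢ Ici 0)) {x₁ : ℝ} (hx₁ : 0 < x₁) {H : ℝ} (hH : 0 ≤ H) :
    ContinuousOn (fun x => ∫ h in (0 : ℝ)..H, f x h) (Ici x₁) := by
  have hc : Continuous (Function.uncurry fun x h => f (max x x₁) (max h 0)) := by
    have : Continuous fun p : ℝ × ℝ => ((max p.1 x₁, max p.2 0) : ℝ × ℝ) := by fun_prop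
    exact hf.comp_continuous this fun p => ⟨hx₁.trans_le (le_max_right _ _), le_max_right p.2 0⟩
  refine (intervalIntegral.continuous_parametric_intervalIntegral_of_continuous' (μ := volume) hc 0 H).continuousOn.congr
    fun x hx => ?_
  refine intervalIntegral.integral_congr fun h hh => ?_
  rw [uIcc_of_le hH] at hh
  simp only [max_eq_left hh.1, max_eq_left (show x₁ ≤ x from hx)]

lemma continuousOn_pairF (y τ : ℝ) : ContinuousOn (Function.uncurry (pairF y τ)) (Ioi 0 ×ˢ Ici 0) := by
  have h1 : ContinuousOn (fun p : ℝ × ℝ => Real.log p.1) (Ioi 0 ×ˢ Ici 0) :=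
    continuousOn_fst.log fun p hp => ne_of_gt hp.1
  have h2 : ContinuousOn (fun p : ℝ × ℝ => Real.log (p.1 + p.2)) (Ioi 0 ×ˢ Ici 0) :=
    (continuousOn_fst.add continuousOn_snd).log fun p hp => by
      have a : 0 < p.1 := hp.1
      have b : 0 ≤ p.2 := hp.2
      exact (add_pos_of_pos_of_nonneg a b).ne'
  unfold Function.uncurry pairF pairE
  fun_prop

/-- The main term, summed over the shifts and integrated. -/
lemma exists_abs_sum_integral_singularSeries_sub_le (k : ℕ) {η : ℝ} (hη : 0 < η) (hη1 : η ≤ 1 / 4) :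
    ∃ C : ℝ, 1 ≤ C ∧ ∀ (y τ ρ θ : ℝ) (H : ℕ), 1 ≤ H → 1 ≤ ρ → ρ ≤ τ → 1 ≤ θ → 1 ≤ Real.exp y / θ →
      τ * H ≤ Real.exp y / θ * ρ →
      |(∑ h ∈ Finset.Icc 1 H, ∫ x in (Real.exp y / θ)..(Real.exp y * θ), pairF y τ x h * singularSeries k x h) -
        ∫ x in (Real.exp y / θ)..(Real.exp y * θ), Qk k x 1 ^ 2 * ∫ u in (0 : ℝ)..H, pairF y τ x u| ≤
        C * (ρ ^ 2 * θ ^ 3 * (Real.exp y * θ) ^ (6 * η)) := by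
  obtain ⟨C, hC, hmain⟩ := exists_abs_sum_singularSeries_sub_le k hη hη1
  refine ⟨3 * C, by linarith, fun y τ ρ θ H hH hρ hρτ hθ hx1' hHle => ?_⟩
  have hθ0 : 0 < θ := by linarith
  have hτ : 1 ≤ τ := hρ.trans hρτ
  set x₁ := Real.exp y / θ with hx₁
  set x₂ := Real.exp y * θ with hx₂
  have hx1 : 0 < x₁ := by positivity
  have hx21 : x₂ = x₁ * θ ^ 2 := by rw [hx₁, hx₂]; field_simp
  have hx12 : x₁ ≤ x₂ := by rw [hx21]; exact le_mul_of_one_le_right hx1.le (one_le_pow₀ hθ)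
  have hx2 : 0 < x₂ := by linarith
  have hHx : (H : ℝ) ≤ x₂ := by
    have h1 : τ * H ≤ τ * x₁ := hHle.trans (by rw [mul_comm]; gcongr)
    exact (le_of_mul_le_mul_left h1 (by linarith)).trans hx12
  have hsub : Icc x₁ x₂ ⊆ Ioi 0 := fun x hx => hx1.trans_le hx.1
  have hu : uIcc x₁ x₂ = Icc x₁ x₂ := uIcc_of_le hx12
  have hint1 : ∀ h ∈ Finset.Icc 1 H, IntervalIntegrable (fun x => pairF y τ x h * singularSeries k x h) volume x₁ x₂ := by
    intro h hh
    rw [Finset.mem_Icc] at hh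
    refine (intervalIntegrable_singularSeries k (by omega) hx1.le hx2.le).continuousOn_mul ?_
    rw [hu]
    exact (continuousOn_pairF_left (Nat.cast_nonneg h)).mono hsub
  have hint2 : IntervalIntegrable (fun x => Qk k x 1 ^ 2 * ∫ u in (0 : ℝ)..H, pairF y τ x u) volume x₁ x₂ := by
    refine ContinuousOn.intervalIntegrable ?_
    rw [hu]
    exact (((continuousOn_Qk k 1).mono hsub).pow 2).mul
      ((continuousOn_intervalIntegral_of_continuousOn (continuousOn_pairF y τ) hx1 (Nat.cast_nonneg H)).mono
        fun x hx => hx.1)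
  rw [← intervalIntegral.integral_finsetSum hint1, ← intervalIntegral.integral_sub
    (by simpa only [Finset.sum_fn] using IntervalIntegrable.sum _ hint1) hint2, ← Real.norm_eq_abs]
  have hpt : ∀ x ∈ uIoc x₁ x₂, ‖∑ h ∈ Finset.Icc 1 H, pairF y τ x h * singularSeries k x h -
      Qk k x 1 ^ 2 * ∫ u in (0 : ℝ)..H, pairF y τ x u‖ ≤ C * (x₂ ^ (6 * η) * (3 * (ρ ^ 2 * θ) * x₁⁻¹)) := by
    intro x hx
    rw [uIoc_of_le hx12] at hx
    have hx0 : 0 < x := hx1.trans hx.1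
    have hW : ∀ h ∈ Icc (0 : ℝ) H, Window y τ ρ θ x h := by
      intro h hh
      refine ⟨hτ, hρ, hθ, hρτ, hx0, ?_, hx.2, hh.1, ?_⟩
      · have := hx.1.le; rwa [hx₁, div_le_iff₀ hθ0] at this
      · calc τ * h ≤ τ * H := by gcongr; exact hh.2
          _ ≤ x₁ * ρ := hHle
          _ ≤ x * ρ := by gcongr; exact hx.1.le
    have hinv : x⁻¹ ≤ x₁⁻¹ := inv_anti₀ hx1 hx.1.le
    have hBL : BoundedLipschitz (fun u => pairF y τ x u) H x₁⁻¹ (2 * (τ * ρ * θ) * (x₁⁻¹ * x₁⁻¹)) := by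
      refine ⟨fun u hu => ?_, fun u hu v hv => ?_⟩
      · rw [abs_of_pos (pairF_pos _ _ _ _)]; exact (hW u hu).pairF_le.trans hinv
      · exact abs_sub_le_of_hasDerivAt (fun h hh => hasDerivAt_pairF_right (y := y) (τ := τ) hx0 hh.1)
          (fun h hh => (hW h hh).abs_deriv_right_le.trans (by gcongr)) hu hv
    have h1 := hmain x H (fun u => pairF y τ x u) _ _ (hx1'.trans hx.1.le) hH (by positivity) (by positivity) hBL
    rw [Real.norm_eq_abs]
    refine h1.trans ?_
    have hρθ : 1 ≤ ρ ^ 2 * θ := by nlinarith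
    have hB : x₁⁻¹ + H * (2 * (τ * ρ * θ) * (x₁⁻¹ * x₁⁻¹)) ≤ 3 * (ρ ^ 2 * θ) * x₁⁻¹ := by
      calc x₁⁻¹ + H * (2 * (τ * ρ * θ) * (x₁⁻¹ * x₁⁻¹)) =
          x₁⁻¹ + 2 * (τ * H) * (ρ * θ) * (x₁⁻¹ * x₁⁻¹) := by ring
        _ ≤ (ρ ^ 2 * θ) * x₁⁻¹ + 2 * (x₁ * ρ) * (ρ * θ) * (x₁⁻¹ * x₁⁻¹) := by
          gcongr
          exact le_mul_of_one_le_left (by positivity) hρθ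
        _ = _ := by field_simp; ring
    have hp : x ^ (2 * η) * (H : ℝ) ^ (4 * η) ≤ x₂ ^ (6 * η) := by
      calc _ ≤ x₂ ^ (2 * η) * x₂ ^ (4 * η) := by gcongr; exact hx.2
        _ = _ := by rw [← Real.rpow_add hx2]; congr 1; ring
    gcongr
  refine (intervalIntegral.norm_integral_le_of_norm_le_const hpt).trans ?_
  rw [abs_of_nonneg (by linarith)]
  calc _ ≤ C * (x₂ ^ (6 * η) * (3 * (ρ ^ 2 * θ) * x₁⁻¹)) * x₂ := by gcongr; linarith
    _ = C * (x₂ ^ (6 * η) * (3 * (ρ ^ 2 * θ) * x₁⁻¹)) * (x₁ * θ ^ 2) := by rw [← hx21]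
    _ = _ := by field_simp

/-! ### The polar part -/

lemma polarDensity_mul_polarDensity (k : ℕ) (y τ : ℝ) {x h : ℝ} (hx : 0 < x) (hh : 0 ≤ h) :
    polarDensity k y x * polarDensity k y (x + h) *
        Real.exp (-(τ ^ 2 * (Real.log x - Real.log (x + h)) ^ 2 / 4)) =
      Qk k x 1 * (Qk k (x + h) 1 * pairF y τ x h) := by
  have hm0 : (0 : ℝ) < x + h := by positivity
  set v := Real.log x with hv
  set w := Real.log (x + h) with hw
  have hs : √Real.pi * √Real.pi = Real.pi := Real.mul_self_sqrt Real.pi_pos.le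
  have h4 : (4 * Real.pi)⁻¹ = (2 * √Real.pi)⁻¹ * (2 * √Real.pi)⁻¹ := by
    rw [← mul_inv]; congr 1; linear_combination -4 * hs
  have h1 : x ^ (-(1 / 2) : ℝ) = Real.exp (-v / 2) := by
    rw [Real.rpow_def_of_pos hx]; congr 1; rw [hv]; ring
  have h2 : (x + h) ^ (-(1 / 2) : ℝ) = Real.exp (-w / 2) := by
    rw [Real.rpow_def_of_pos hm0]; congr 1; rw [hw]; ring
  have h3 : Real.exp (pairE y τ v w) = Real.exp (-v / 2) * Real.exp (-w / 2) * Real.exp (-(v - y) ^ 2 / 4) *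
      Real.exp (-(w - y) ^ 2 / 4) * Real.exp (-(τ ^ 2 * (v - w) ^ 2 / 4)) := by
    rw [← Real.exp_add, ← Real.exp_add, ← Real.exp_add, ← Real.exp_add]; congr 1; rw [pairE]; ring
  simp only [polarDensity, pairF, gauss]
  rw [h1, h2, ← hv, ← hw, h3, h4]
  ring

lemma continuousOn_polarDensity (k : ℕ) (y : ℝ) : ContinuousOn (polarDensity k y) (Ioi 0) := by
  refine (continuousOn_Qk k 1).mul (ContinuousOn.mul ?_ ?_)
  · exact continuousOn_id.rpow_const fun x hx => Or.inl (ne_of_gt hx)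
  · exact continuous_gauss.comp_continuousOn ((Real.continuousOn_log.mono fun x hx => ne_of_gt hx).sub continuousOn_const)

/-- `gauss_le` is used with exponent 2 below x₀, where it yields e^{-2y}, and with exponent -3 above
x₀, where it yields an integrable power of x. Q_k(x,1) costs at most a constant times max(x, 1/x).
-/
lemma exists_abs_polarDensity_le (k : ℕ) {x₀ : ℝ} (hx₀ : 1 ≤ x₀) :
    ∃ C : ℝ, 1 ≤ C ∧ (∀ y x : ℝ, 0 < x → x ≤ x₀ → |polarDensity k y x| ≤ C * Real.exp (-2 * y)) ∧
      ∀ y x : ℝ, x₀ < x → |polarDensity k y x| ≤ C * Real.exp (3 * y) * x ^ (-(5 / 2) : ℝ) := by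
  obtain ⟨A, hA1, hA⟩ := exists_Qk_bound k one_pos
  have hbd : ∀ y x B : ℝ, 0 < x → |polarDensity k y x| ≤
      A * max x x⁻¹ * (x ^ (-(1 / 2) : ℝ) * Real.exp (B ^ 2 + B * (Real.log x - y))) := by
    intro y x B hx
    have h1 := hA 1 one_ne_zero x hx
    simp only [Nat.cast_one, mul_one, Real.rpow_one] at h1
    have h2 := gauss_nonneg (Real.log x - y)
    rw [polarDensity, abs_mul, abs_of_nonneg (mul_nonneg (by positivity) h2)]
    gcongr
    exact gauss_le B _
  have hx00 : 0 < x₀ := by linarith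
  refine ⟨A * Real.exp 9 * x₀ ^ 2 * x₀ ^ (1 / 2 : ℝ), ?_, fun y x hx hxx => ?_, fun y x hxx => ?_⟩
  · have h1 : 1 ≤ Real.exp 9 := Real.one_le_exp (by norm_num)
    have h2 : 1 ≤ x₀ ^ (1 / 2 : ℝ) := Real.one_le_rpow hx₀ (by norm_num)
    exact one_le_mul_of_one_le_of_one_le (one_le_mul_of_one_le_of_one_le (one_le_mul_of_one_le_of_one_le hA1 h1)
      (one_le_pow₀ hx₀)) h2
  · refine (hbd y x 2 hx).trans ?_
    have hmax : max x x⁻¹ ≤ x₀ ^ 2 * x⁻¹ := by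
      refine max_le ?_ (le_mul_of_one_le_left (by positivity) (one_le_pow₀ hx₀))
      rw [← div_eq_mul_inv, le_div_iff₀ hx]; nlinarith
    have he : Real.exp (2 ^ 2 + 2 * (Real.log x - y)) = Real.exp 4 * x ^ 2 * Real.exp (-2 * y) := by
      rw [show (2 : ℝ) ^ 2 + 2 * (Real.log x - y) = 4 + (Real.log x + Real.log x) + -2 * y by ring, Real.exp_add,
        Real.exp_add, Real.exp_add, Real.exp_log hx]; ring
    have hp : x⁻¹ * (x ^ (-(1 / 2) : ℝ) * x ^ 2) = x ^ (1 / 2 : ℝ) := by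
      rw [← Real.rpow_neg_one, ← Real.rpow_natCast x 2, ← Real.rpow_add hx, ← Real.rpow_add hx]; norm_num
    calc _ ≤ A * (x₀ ^ 2 * x⁻¹) * (x ^ (-(1 / 2) : ℝ) * (Real.exp 4 * x ^ 2 * Real.exp (-2 * y))) := by
          rw [he]; gcongr
      _ = A * Real.exp 4 * x₀ ^ 2 * (x⁻¹ * (x ^ (-(1 / 2) : ℝ) * x ^ 2)) * Real.exp (-2 * y) := by ring
      _ ≤ _ := by
          rw [hp]; gcongr; norm_num
  · have hx1 : 1 ≤ x := hx₀.trans hxx.le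
    have hx : 0 < x := by linarith
    refine (hbd y x (-3) hx).trans ?_
    have hmax : max x x⁻¹ = x := max_eq_left ((inv_le_one_of_one_le₀ hx1).trans hx1)
    have he : Real.exp ((-3) ^ 2 + -3 * (Real.log x - y)) = Real.exp 9 * (x ^ (-3 : ℝ)) * Real.exp (3 * y) := by
      rw [Real.rpow_def_of_pos hx, ← Real.exp_add, ← Real.exp_add]; congr 1; ring
    have hp : x * (x ^ (-(1 / 2) : ℝ) * x ^ (-3 : ℝ)) = x ^ (-(5 / 2) : ℝ) := by
      nth_rewrite 1 [← Real.rpow_one x]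
      rw [← Real.rpow_add hx, ← Real.rpow_add hx]; norm_num
    have h2 : 1 ≤ x₀ ^ 2 * x₀ ^ (1 / 2 : ℝ) :=
      one_le_mul_of_one_le_of_one_le (one_le_pow₀ hx₀) (Real.one_le_rpow hx₀ (by norm_num))
    rw [hmax, he]
    calc _ = A * Real.exp 9 * (x * (x ^ (-(1 / 2) : ℝ) * x ^ (-3 : ℝ))) * Real.exp (3 * y) := by ring
      _ = (A * Real.exp 9 * Real.exp (3 * y) * x ^ (-(5 / 2) : ℝ)) * 1 := by rw [hp]; ring
      _ ≤ (A * Real.exp 9 * Real.exp (3 * y) * x ^ (-(5 / 2) : ℝ)) * (x₀ ^ 2 * x₀ ^ (1 / 2 : ℝ)) := by gcongr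
      _ = _ := by ring

lemma integrableOn_polarDensity (k : ℕ) (y : ℝ) {x₀ : ℝ} (hx₀ : 1 ≤ x₀) :
    IntegrableOn (polarDensity k y) (Ioi x₀) := by
  obtain ⟨C, _, _, hC⟩ := exists_abs_polarDensity_le k hx₀
  refine ((integrableOn_Ioi_rpow_of_lt (show (-(5 / 2) : ℝ) < -1 by norm_num) (by linarith : 0 < x₀)).const_mul
    (C * Real.exp (3 * y))).mono' ?_ ?_
  · exact ((continuousOn_polarDensity k y).mono fun x hx => lt_trans (by linarith) hx).aestronglyMeasurable measurableSet_Ioi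
  · exact (ae_restrict_iff' measurableSet_Ioi).2 (Eventually.of_forall fun x hx => hC y x hx)

/-- The sign and monotonicity of Q_k(x,1) are known only beyond some x₀. Discarding the density on
(0, x₀] changes the polar part by O(e^{-2y}), uniformly in t. -/
lemma exists_norm_polarD_sub_le (k : ℕ) {x₀ : ℝ} (hx₀ : 1 ≤ x₀) :
    ∃ C : ℝ, 1 ≤ C ∧ ∀ y t : ℝ,
      ‖(∫ x in Ioi x₀, (polarDensity k y x : ℂ) * exp (-(t * Real.log x : ℝ) * I)) - polarD k y t‖ ≤
        C * Real.exp (-2 * y) := by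
  obtain ⟨C, hC1, hC, _⟩ := exists_abs_polarDensity_le k hx₀
  refine ⟨C * x₀, one_le_mul_of_one_le_of_one_le hC1 hx₀, fun y t => ?_⟩
  have hx00 : 0 < x₀ := by linarith
  have hcont : ContinuousOn (fun x : ℝ => (polarDensity k y x : ℂ) * exp (-(t * Real.log x : ℝ) * I)) (Ioi 0) := by
    have h1 : ContinuousOn Real.log (Ioi 0) := Real.continuousOn_log.mono fun x hx => ne_of_gt hx
    have h2 := continuousOn_polarDensity k y
    exact (continuous_ofReal.comp_continuousOn h2).mul (by fun_prop)
  have hn : ∀ x : ℝ, ‖(polarDensity k y x : ℂ) * exp (-(t * Real.log x : ℝ) * I)‖ = |polarDensity k y x| := fun x => by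
    rw [norm_mul, norm_exp_neg_mul_I, mul_one, norm_real, Real.norm_eq_abs]
  have hb : ∀ x ∈ Ioc 0 x₀, ‖(polarDensity k y x : ℂ) * exp (-(t * Real.log x : ℝ) * I)‖ ≤ C * Real.exp (-2 * y) :=
    fun x hx => (hn x).trans_le (hC y x hx.1 hx.2)
  have hi1 : IntegrableOn (fun x : ℝ => (polarDensity k y x : ℂ) * exp (-(t * Real.log x : ℝ) * I)) (Ioc 0 x₀) := by
    refine IntegrableOn.of_bound (by simp)
      ((hcont.mono fun x hx => hx.1).aestronglyMeasurable measurableSet_Ioc) (C * Real.exp (-2 * y)) ?_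
    exact (ae_restrict_iff' measurableSet_Ioc).2 (Eventually.of_forall hb)
  have hi2 : IntegrableOn (fun x : ℝ => (polarDensity k y x : ℂ) * exp (-(t * Real.log x : ℝ) * I)) (Ioi x₀) := by
    refine (integrableOn_polarDensity k y hx₀).norm.mono'
      ((hcont.mono fun x hx => lt_trans hx00 hx).aestronglyMeasurable measurableSet_Ioi) (Eventually.of_forall fun x => ?_)
    rw [hn, Real.norm_eq_abs]
  rw [polarD_eq_integral, ← Ioc_union_Ioi_eq_Ioi hx00.le, setIntegral_union (Ioc_disjoint_Ioi le_rfl) measurableSet_Ioi hi1 hi2,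
    sub_add_cancel_right, norm_neg]
  refine (norm_setIntegral_le_of_norm_le_const (by simp) hb).trans_eq ?_
  rw [Measure.real, Real.volume_Ioc, sub_zero, ENNReal.toReal_ofReal hx00.le]; ring

/-- A lower bound for the energy of a positive measure, from a pair of disjoint strips. -/
lemma two_mul_setIntegral_le_integral_prod (μ : Measure ℝ) [IsFiniteMeasure μ] {K : ℝ → ℝ → ℝ}
    (hK : Measurable (Function.uncurry K)) (hK0 : ∀ x x', 0 ≤ K x x') (hK1 : ∀ x x', K x x' ≤ 1)
    (hsymm : ∀ x x', K x x' = K x' x) (x₁ x₂ H : ℝ) :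
    2 * ∫ x in Ioc x₁ x₂, ∫ x' in Ioc x (x + H), K x x' ∂μ ∂μ ≤ ∫ p : ℝ × ℝ, K p.1 p.2 ∂(μ.prod μ) := by
  set A : Set (ℝ × ℝ) := {p | p.1 ∈ Ioc x₁ x₂ ∧ p.2 ∈ Ioc p.1 (p.1 + H)} with hA
  have hAm : MeasurableSet A := by
    have e : A = {p | x₁ < p.1} ∩ {p | p.1 ≤ x₂} ∩ {p | p.1 < p.2} ∩ {p | p.2 ≤ p.1 + H} := by
      ext p; simp only [hA, mem_ofPred_eq, mem_Ioc, mem_inter_iff]; tauto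
    rw [e]
    exact (((measurableSet_lt measurable_const measurable_fst).inter
      (measurableSet_le measurable_fst measurable_const)).inter (measurableSet_lt measurable_fst measurable_snd)).inter
      (measurableSet_le measurable_snd (measurable_fst.add_const H))
  have hKi : Integrable (fun p : ℝ × ℝ => K p.1 p.2) (μ.prod μ) :=
    Integrable.of_bound (C := 1) hK.aestronglyMeasurable (Eventually.of_forall fun p => by
      rw [Real.norm_of_nonneg (hK0 _ _)]; exact hK1 _ _)
  have hFi : Integrable (A.indicator fun p : ℝ × ℝ => K p.1 p.2) (μ.prod μ) := hKi.indicator hAm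
  have hswap : ∫ p : ℝ × ℝ, A.indicator (fun p => K p.1 p.2) p.swap ∂(μ.prod μ) =
      ∫ p : ℝ × ℝ, A.indicator (fun p => K p.1 p.2) p ∂(μ.prod μ) :=
    integral_prod_swap _
  have hone : ∫ p : ℝ × ℝ, A.indicator (fun p => K p.1 p.2) p ∂(μ.prod μ) =
      ∫ x in Ioc x₁ x₂, ∫ x' in Ioc x (x + H), K x x' ∂μ ∂μ := by
    rw [integral_prod _ hFi, ← integral_indicator measurableSet_Ioc]
    refine integral_congr_ae (Eventually.of_forall fun x => ?_)
    by_cases hx : x ∈ Ioc x₁ x₂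
    · simp only [indicator_of_mem hx]
      rw [← integral_indicator measurableSet_Ioc]
      refine integral_congr_ae (Eventually.of_forall fun x' => ?_)
      simp only [indicator_apply, hA, mem_ofPred_eq, hx, true_and]
    · simp only [indicator_of_notMem hx]
      refine integral_eq_zero_of_ae (Eventually.of_forall fun x' => ?_)
      exact indicator_of_notMem (fun h => hx h.1) _
  rw [two_mul, ← hone]
  nth_rewrite 1 [← hswap]
  have hFs : Integrable (fun p : ℝ × ℝ => A.indicator (fun p => K p.1 p.2) p.swap) (μ.prod μ) := hFi.swap
  rw [← integral_add hFs hFi]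
  refine integral_mono (hFs.add hFi) hKi fun p => ?_
  simp only [indicator_apply]
  by_cases h1 : p ∈ A <;> by_cases h2 : p.swap ∈ A <;> simp only [h1, h2, if_true, if_false]
  · exact absurd (h1.2.1.trans h2.2.1) (lt_irrefl _)
  · simp
  · rw [add_zero]; exact (hsymm _ _).le
  · simpa using hK0 p.1 p.2

/-- Truncation of the polar part changes its mean square by a bounded amount. -/
lemma exists_integral_truncated_polarD_sq_le (k : ℕ) {x₀ : ℝ} (hx₀ : 1 ≤ x₀) :
    ∃ C : ℝ, 1 ≤ C ∧ ∀ y τ : ℝ, 1 ≤ τ → Real.log τ ≤ y →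
      ∫ t : ℝ, ‖∫ x in Ioi x₀, (polarDensity k y x : ℂ) * exp (-(t * Real.log x : ℝ) * I)‖ ^ 2 *
          Real.exp (-(t / τ) ^ 2) ≤
        (∫ t : ℝ, ‖polarD k y t‖ ^ 2 * Real.exp (-(t / τ) ^ 2)) + C := by
  obtain ⟨C₁, hC₁, hsub⟩ := exists_norm_polarD_sub_le k hx₀
  obtain ⟨C₂, hC₂, hpol⟩ := exists_norm_polarD_le k (r := 1 / 2) (by norm_num) le_rfl
  set J := ∫ t : ℝ, Real.exp (-t ^ 2 / 2) with hJ
  have hJi : Integrable fun t : ℝ => Real.exp (-t ^ 2 / 2) := by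
    refine (integrable_exp_neg_mul_sq (b := 1 / 2) (by norm_num)).congr (Eventually.of_forall fun t => ?_)
    simp only; congr 1; ring
  have hJ0 : 0 ≤ J := integral_nonneg fun t => (Real.exp_pos _).le
  refine ⟨1 + (2 * C₁ * C₂ * J + C₁ ^ 2 * √Real.pi), ?_, fun y τ hτ hy => ?_⟩
  · have : 0 ≤ 2 * C₁ * C₂ * J + C₁ ^ 2 * √Real.pi := by positivity
    linarith
  have hτ0 : 0 < τ := by linarith
  have hy0 : 0 ≤ y := (Real.log_nonneg hτ).trans hy
  set P : ℝ → ℂ := fun t => ∫ x in Ioi x₀, (polarDensity k y x : ℂ) * exp (-(t * Real.log x : ℝ) * I) with hP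
  have hP' : ∀ t, ‖P t - polarD k y t‖ ≤ C₁ * Real.exp (-2 * y) := fun t => hsub y t
  have hPle : ∀ t, ‖P t‖ ^ 2 * Real.exp (-(t / τ) ^ 2) ≤ ‖polarD k y t‖ ^ 2 * Real.exp (-(t / τ) ^ 2) +
      (2 * C₁ * C₂ * Real.exp (-y) * Real.exp (-t ^ 2 / 2) + C₁ ^ 2 * Real.exp (-4 * y) * Real.exp (-(t / τ) ^ 2)) := by
    intro t
    have h1 := hP' t
    have h2 := hpol y t
    rw [abs_of_nonneg hy0] at h2
    set d := ‖polarD k y t‖ with hd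
    have hd0 : 0 ≤ d := norm_nonneg _
    have h3 : ‖P t‖ ≤ d + C₁ * Real.exp (-2 * y) := by
      calc ‖P t‖ = ‖polarD k y t + (P t - polarD k y t)‖ := by rw [add_sub_cancel]
        _ ≤ _ := (norm_add_le _ _).trans (by gcongr)
    have h4 : ‖P t‖ ^ 2 ≤ d ^ 2 + 2 * (C₁ * Real.exp (-2 * y)) * d + (C₁ * Real.exp (-2 * y)) ^ 2 := by
      have := pow_le_pow_left₀ (norm_nonneg (P t)) h3 2
      nlinarith
    have e1 : Real.exp (-2 * y) * Real.exp (y / 2 + 1 / 2 * y) = Real.exp (-y) := by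
      rw [← Real.exp_add]; congr 1; ring
    have e2 : Real.exp (-2 * y) ^ 2 = Real.exp (-4 * y) := by
      rw [← Real.exp_nat_mul]; congr 1; push_cast; ring
    have h5 : 2 * (C₁ * Real.exp (-2 * y)) * d ≤ 2 * C₁ * C₂ * Real.exp (-y) * Real.exp (-t ^ 2 / 2) := by
      calc _ ≤ 2 * (C₁ * Real.exp (-2 * y)) * (C₂ * Real.exp (y / 2 + 1 / 2 * y) * Real.exp (-t ^ 2 / 2)) := by gcongr
        _ = 2 * C₁ * C₂ * (Real.exp (-2 * y) * Real.exp (y / 2 + 1 / 2 * y)) * Real.exp (-t ^ 2 / 2) := by ring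
        _ = _ := by rw [e1]
    have hw0 := (Real.exp_pos (-(t / τ) ^ 2)).le
    have hw1 := weight_le_one t τ
    calc _ ≤ (d ^ 2 + 2 * (C₁ * Real.exp (-2 * y)) * d + (C₁ * Real.exp (-2 * y)) ^ 2) * Real.exp (-(t / τ) ^ 2) := by
          gcongr
      _ = d ^ 2 * Real.exp (-(t / τ) ^ 2) + (2 * (C₁ * Real.exp (-2 * y)) * d * Real.exp (-(t / τ) ^ 2) +
            C₁ ^ 2 * Real.exp (-4 * y) * Real.exp (-(t / τ) ^ 2)) := by rw [← e2]; ring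
      _ ≤ _ := by
          exact add_le_add le_rfl (add_le_add ((mul_le_of_le_one_right (by positivity) hw1).trans h5) le_rfl)
  have hw : ∫ t : ℝ, Real.exp (-(t / τ) ^ 2) = √Real.pi * τ := by
    have := integral_gaussian (1 / τ ^ 2)
    rw [show Real.pi / (1 / τ ^ 2) = Real.pi * τ ^ 2 by field_simp, Real.sqrt_mul Real.pi_pos.le,
      Real.sqrt_sq hτ0.le] at this
    rw [← this]
    refine integral_congr_ae (Eventually.of_forall fun t => ?_)
    simp only; congr 1; field_simp
  have hi1 : Integrable fun t : ℝ => 2 * C₁ * C₂ * Real.exp (-y) * Real.exp (-t ^ 2 / 2) := hJi.const_mul _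
  have hi2 : Integrable fun t : ℝ => C₁ ^ 2 * Real.exp (-4 * y) * Real.exp (-(t / τ) ^ 2) :=
    (integrable_gaussian_weight hτ0).const_mul _
  refine (integral_mono_of_nonneg (Eventually.of_forall fun t => by positivity)
    ((integrable_polarD_sq k y hτ0).add (hi1.add hi2)) (Eventually.of_forall hPle)).trans ?_
  have hsum := integral_add (integrable_polarD_sq k y hτ0) (hi1.add hi2)
  have hsum2 := integral_add hi1 hi2
  simp only [Pi.add_apply] at hsum hsum2 ⊢
  rw [hsum, hsum2, integral_const_mul, integral_const_mul, hw, ← hJ]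
  have hexp1 : Real.exp (-y) ≤ 1 := Real.exp_le_one_iff.2 (by linarith)
  -- The weight has total mass √π τ; the condition log τ ≤ y absorbs the factor τ.
  have hexp4 : Real.exp (-4 * y) * τ ≤ 1 := by
    calc _ ≤ Real.exp (-y) * Real.exp y := by
          gcongr
          · linarith
          · exact (Real.log_le_iff_le_exp hτ0).1 hy
      _ = 1 := by rw [← Real.exp_add]; simp
  have a1 : 2 * C₁ * C₂ * Real.exp (-y) * J ≤ 2 * C₁ * C₂ * J := by
    calc _ = 2 * C₁ * C₂ * J * Real.exp (-y) := by ring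
      _ ≤ _ := mul_le_of_le_one_right (by positivity) hexp1
  have a2 : C₁ ^ 2 * Real.exp (-4 * y) * (√Real.pi * τ) ≤ C₁ ^ 2 * √Real.pi := by
    calc _ = C₁ ^ 2 * √Real.pi * (Real.exp (-4 * y) * τ) := by ring
      _ ≤ _ := mul_le_of_le_one_right (by positivity) hexp4
  linarith
-- Pointwise, Q_k(x,1)² ≤ Q_k(x,1) Q_k(x+h,1), since Q_k(x,1) is nonnegative and nondecreasing from
-- x₀ on; the product with the weight of the pair is the product of two densities and the Parseval
-- kernel.
lemma integral_sq_mul_pairF_le {k : ℕ} {x₀ : ℝ} (hx₀ : 1 ≤ x₀) (hQ0 : ∀ x, x₀ ≤ x → 0 ≤ Qk k x 1)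
    (hQmono : ∀ x x', x₀ ≤ x → x ≤ x' → Qk k x 1 ≤ Qk k x' 1) (y τ : ℝ) {x₁ x₂ H : ℝ} (hx1 : x₀ ≤ x₁) (hx12 : x₁ ≤ x₂)
    (hH : 0 ≤ H) :
    ∫ x in x₁..x₂, Qk k x 1 ^ 2 * (∫ h in (0 : ℝ)..H, pairF y τ x h) ≤
      ∫ x in x₁..x₂, polarDensity k y x * ∫ h in (0 : ℝ)..H, polarDensity k y (x + h) *
        Real.exp (-(τ ^ 2 * (Real.log x - Real.log (x + h)) ^ 2 / 4)) := by
  have hx10 : 0 < x₁ := by linarith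
  have e : ∀ x ∈ uIcc x₁ x₂, polarDensity k y x * (∫ h in (0 : ℝ)..H, polarDensity k y (x + h) *
        Real.exp (-(τ ^ 2 * (Real.log x - Real.log (x + h)) ^ 2 / 4))) =
      Qk k x 1 * ∫ h in (0 : ℝ)..H, Qk k (x + h) 1 * pairF y τ x h := by
    intro x hx
    rw [uIcc_of_le hx12] at hx
    rw [← intervalIntegral.integral_const_mul, ← intervalIntegral.integral_const_mul]
    refine intervalIntegral.integral_congr fun h hh => ?_
    rw [uIcc_of_le hH] at hh
    simp only [← mul_assoc]
    rw [polarDensity_mul_polarDensity k y τ (hx10.trans_le hx.1) hh.1, ← mul_assoc]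
  rw [intervalIntegral.integral_congr e]
  have hsub0 : Icc x₁ x₂ ⊆ Ioi 0 := fun x hx => hx10.trans_le hx.1
  have hQadd : ContinuousOn (fun p : ℝ × ℝ => Qk k (p.1 + p.2) 1) (Ioi 0 ×ˢ Ici 0) :=
    (continuousOn_Qk k 1).comp (continuousOn_fst.add continuousOn_snd) fun p hp => by
      have a : 0 < p.1 := hp.1
      have b : 0 ≤ p.2 := hp.2
      exact add_pos_of_pos_of_nonneg a b
  have hpair := continuousOn_pairF y τ
  have hfub : ContinuousOn (Function.uncurry fun x h => Qk k (x + h) 1 * pairF y τ x h) (Ioi 0 ×ˢ Ici 0) :=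
    hQadd.mul hpair
  refine intervalIntegral.integral_mono_on hx12 ?_ ?_ fun x hx => ?_
  · refine ContinuousOn.intervalIntegrable ?_
    rw [uIcc_of_le hx12]
    exact (((continuousOn_Qk k 1).mono hsub0).pow 2).mul
      ((continuousOn_intervalIntegral_of_continuousOn hpair hx10 hH).mono fun x hx => hx.1)
  · refine ContinuousOn.intervalIntegrable ?_
    rw [uIcc_of_le hx12]
    exact ((continuousOn_Qk k 1).mono hsub0).mul
      ((continuousOn_intervalIntegral_of_continuousOn hfub hx10 hH).mono fun x hx => hx.1)
  · have hxx : 0 < x := hsub0 hx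
    have hQx := hQ0 x (hx1.trans hx.1)
    have hc1 : ContinuousOn (fun h => pairF y τ x h) (uIcc 0 H) := fun h hh => by
      rw [uIcc_of_le hH] at hh
      exact (hasDerivAt_pairF_right hxx hh.1).continuousAt.continuousWithinAt
    have hc2 : ContinuousOn (fun h => Qk k (x + h) 1) (uIcc 0 H) := by
      refine (continuousOn_Qk k 1).comp (by fun_prop) fun h hh => ?_
      rw [uIcc_of_le hH] at hh
      exact add_pos_of_pos_of_nonneg hxx hh.1
    rw [pow_two, mul_assoc, ← intervalIntegral.integral_const_mul]
    refine mul_le_mul_of_nonneg_left (intervalIntegral.integral_mono_on hH ?_ ?_ fun h hh => ?_) hQx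
    · exact hc1.intervalIntegrable.const_mul _
    · exact (hc2.mul hc1).intervalIntegrable
    · exact mul_le_mul_of_nonneg_right (hQmono x (x + h) (hx1.trans hx.1) (by linarith [hh.1])) (pairF_pos _ _ _ _).le

/-- The mean square of the polar part is at least the main term. -/
lemma exists_le_integral_polarD_sq {k : ℕ} (hk : 3 ≤ k) :
    ∃ C x₀ : ℝ, 1 ≤ C ∧ 1 ≤ x₀ ∧ ∀ y τ x₁ x₂ H : ℝ, 1 ≤ τ → Real.log τ ≤ y → x₀ ≤ x₁ → x₁ ≤ x₂ → 0 ≤ H →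
      2 * (√Real.pi * τ * ∫ x in x₁..x₂, Qk k x 1 ^ 2 * ∫ h in (0 : ℝ)..H, pairF y τ x h) ≤
        (∫ t : ℝ, ‖polarD k y t‖ ^ 2 * Real.exp (-(t / τ) ^ 2)) + C := by
  obtain ⟨x₀, hx₀, hQ0, hQmono⟩ := exists_Qk_one_mono hk
  obtain ⟨C, hC, htrunc⟩ := exists_integral_truncated_polarD_sq_le k hx₀
  refine ⟨C, x₀, hC, hx₀, fun y τ x₁ x₂ H hτ hy hx1 hx12 hH => ?_⟩
  have hτ0 : 0 < τ := by linarith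
  have hx00 : 0 < x₀ := by linarith
  set q := polarDensity k y with hq
  have hqi : IntegrableOn q (Ioi x₀) := integrableOn_polarDensity k y hx₀
  have hq0 : ∀ x ∈ Ioi x₀, 0 ≤ q x := fun x hx =>
    mul_nonneg (hQ0 x (le_of_lt hx)) (mul_nonneg (Real.rpow_nonneg (hx00.le.trans (le_of_lt hx)) _) (gauss_nonneg _))
  have hqm : AEMeasurable (fun x => ENNReal.ofReal (q x)) (volume.restrict (Ioi x₀)) :=
    hqi.aestronglyMeasurable.aemeasurable.ennreal_ofReal
  -- Beyond x₀ the density is nonnegative, so the truncated polar part is the Fourier transform of a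
  -- finite positive measure in log x. Its mean square is an energy with a positive kernel, and
  -- restricting to pairs at distance at most H gives a lower bound.
  set μ := (volume.restrict (Ioi x₀)).withDensity fun x => ENNReal.ofReal (q x) with hμ
  have hfin : IsFiniteMeasure μ := isFiniteMeasure_withDensity_ofReal hqi.2
  set P : ℝ → ℂ := fun t => ∫ a, exp (-(t * Real.log a : ℝ) * I) ∂μ with hP
  have hPeq : ∀ t, P t = ∫ x in Ioi x₀, (q x : ℂ) * exp (-(t * Real.log x : ℝ) * I) := by
    intro t
    rw [hP]
    simp only
    rw [hμ, integral_withDensity_eq_integral_toReal_smul₀ hqm (Eventually.of_forall fun _ => ENNReal.ofReal_lt_top)]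
    refine setIntegral_congr_fun measurableSet_Ioi fun x hx => ?_
    simp only [ENNReal.toReal_ofReal (hq0 x hx), real_smul]
  -- integrals over short intervals against the measure
  have hset : ∀ (a b : ℝ) (f : ℝ → ℝ), x₀ ≤ a → a ≤ b → ∫ x in Ioc a b, f x ∂μ = ∫ x in a..b, q x * f x := by
    intro a b f ha hab
    have hsubset : Ioc a b ⊆ Ioi x₀ := fun x hx => lt_of_le_of_lt ha hx.1
    have hr : (volume.restrict (Ioi x₀)).restrict (Ioc a b) = volume.restrict (Ioc a b) := by
      rw [Measure.restrict_restrict measurableSet_Ioc, inter_eq_left.2 hsubset]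
    rw [hμ, setIntegral_withDensity_eq_setIntegral_toReal_smul₀ (by
      rw [hr]; exact hqm.mono_set hsubset) (Eventually.of_forall fun _ => ENNReal.ofReal_lt_top) _ measurableSet_Ioc,
      hr, intervalIntegral.integral_of_le hab]
    refine setIntegral_congr_fun measurableSet_Ioc fun x hx => ?_
    simp only [ENNReal.toReal_ofReal (hq0 x (hsubset hx)), smul_eq_mul]
  set K : ℝ → ℝ → ℝ := fun x x' => Real.exp (-(τ ^ 2 * (Real.log x - Real.log x') ^ 2 / 4)) with hK
  have hKm : Measurable (Function.uncurry K) := by unfold Function.uncurry; fun_prop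
  have hlow := two_mul_setIntegral_le_integral_prod μ hKm (fun _ _ => (Real.exp_pos _).le)
    (fun x x' => Real.exp_le_one_iff.2 (neg_nonpos.2 (by positivity))) (fun x x' => by simp only [hK]; congr 3; ring) x₁ x₂ H
  have hpars := gaussian_parseval μ (φ := Real.log) Real.measurable_log hτ0
  have hinner : ∀ x ∈ Ioc x₁ x₂, ∫ x' in Ioc x (x + H), K x x' ∂μ = ∫ h in (0 : ℝ)..H, q (x + h) * K x (x + h) := by
    intro x hx
    rw [hset x (x + H) (K x) (hx1.trans hx.1.le) (by linarith),
      intervalIntegral.integral_comp_add_left (fun u => q u * K x u) x, add_zero]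
  have hmain : ∫ x in x₁..x₂, Qk k x 1 ^ 2 * (∫ h in (0 : ℝ)..H, pairF y τ x h) ≤
      ∫ x in Ioc x₁ x₂, ∫ x' in Ioc x (x + H), K x x' ∂μ ∂μ := by
    rw [setIntegral_congr_fun measurableSet_Ioc hinner, hset x₁ x₂ _ hx1 hx12]
    exact integral_sq_mul_pairF_le hx₀ hQ0 hQmono y τ hx1 hx12 hH
  have hfinal := htrunc y τ hτ hy
  simp only [← hq, ← hPeq, hP] at hfinal
  refine le_trans ?_ hfinal
  rw [hpars]
  calc _ = √Real.pi * τ * (2 * ∫ x in x₁..x₂, Qk k x 1 ^ 2 * ∫ h in (0 : ℝ)..H, pairF y τ x h) := by ring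
    _ ≤ _ := by
      gcongr
      exact (mul_le_mul_of_nonneg_left hmain zero_le_two).trans hlow

/-! ### Cancellation of the main term against the polar part -/

lemma integrable_one_add_abs_pow_mul_exp_half (n : ℕ) :
    Integrable fun t : ℝ => (1 + |t|) ^ n * Real.exp (-t ^ 2 / 2) := by
  have h2 : 0 < √(2 : ℝ) := by positivity
  have h1 : 1 ≤ √(2 : ℝ) := Real.one_le_sqrt.2 (by norm_num)
  refine (((integrable_one_add_abs_pow_mul_exp n).comp_div h2.ne').const_mul (√2 ^ n)).mono' (by fun_prop)
    (Eventually.of_forall fun t => ?_)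
  rw [Real.norm_of_nonneg (by positivity)]
  have e : -(t / √2) ^ 2 = -t ^ 2 / 2 := by
    rw [div_pow, Real.sq_sqrt (by norm_num)]; ring
  rw [e, ← mul_assoc, ← mul_pow]
  gcongr
  rw [abs_div, abs_of_pos h2, mul_add, mul_one, mul_div_cancel₀ _ h2.ne']
  linarith

/-- The mean square of the error is the difference of the mean squares, up to a bounded term. -/
lemma exists_meanSq_le_sub (k : ℕ) :
    ∃ C : ℝ, 1 ≤ C ∧ ∀ y τ : ℝ, 0 ≤ y → 0 < τ →
      meanSq k y τ ≤ ENNReal.ofReal ((∫ t : ℝ, ‖dirichletD k y t‖ ^ 2 * Real.exp (-(t / τ) ^ 2)) -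
        (∫ t : ℝ, ‖polarD k y t‖ ^ 2 * Real.exp (-(t / τ) ^ 2)) + C) := by
  obtain ⟨C₁, hC₁, h₁⟩ := exists_norm_critB_le k (le_refl 1)
  obtain ⟨C₂, hC₂, h₂⟩ := exists_norm_polarD_le k (r := 1 / 2) (by norm_num) le_rfl
  set J := ∫ t : ℝ, (1 + |t|) ^ k * Real.exp (-t ^ 2 / 2) with hJ
  refine ⟨max 1 (2 * C₁ * C₂ * J), le_max_left _ _, fun y τ hy hτ => ?_⟩
  rw [meanSq_eq k y hτ]
  refine ENNReal.ofReal_le_ofReal (le_trans ?_ (add_le_add le_rfl (le_max_right _ _)))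
  have hi := (integrable_one_add_abs_pow_mul_exp_half k).const_mul (2 * C₁ * C₂)
  have hd := integrable_dirichletD_sq k y hτ
  have hp := integrable_polarD_sq k y hτ
  rw [hJ, ← integral_const_mul, ← integral_sub hd hp]
  have hs := integral_add (hd.sub hp) hi
  simp only [Pi.sub_apply] at hs
  rw [← hs]
  refine integral_mono (integrable_critB_sq k y hτ) ((hd.sub hp).add hi) fun t => ?_
  set w := Real.exp (-(t / τ) ^ 2) with hw
  have hw1 : w ≤ 1 := weight_le_one t τ
  have hw0 : 0 ≤ w := (Real.exp_pos _).le
  have e : dirichletD k y t = critB k y t + polarD k y t := by rw [critB_eq, sub_add_cancel]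
  set B := critB k y t with hB
  set P := polarD k y t with hP
  -- With D = B + P, expand |D|² in the real inner product of ℂ. Keeping -|P|² exactly is the point:
  -- it cancels the main term.
  have h3 : ‖B‖ ^ 2 ≤ ‖dirichletD k y t‖ ^ 2 - ‖P‖ ^ 2 + 2 * (‖B‖ * ‖P‖) := by
    rw [e, ← real_inner_self_eq_norm_sq, ← real_inner_self_eq_norm_sq, ← real_inner_self_eq_norm_sq, real_inner_add_add_self]
    have := abs_le.1 (abs_real_inner_le_norm B P)
    linarith [this.1]
  -- The factor e^{-y} of B on the line Re z = -1/2 cancels the factor e^y of P on the circle of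
  -- radius 1/2, and the Gaussian decay of P makes the product integrable in t.
  have h4 : ‖B‖ * ‖P‖ ≤ C₁ * C₂ * ((1 + |t|) ^ k * Real.exp (-t ^ 2 / 2)) := by
    have a := h₁ y t
    have b := h₂ y t
    rw [abs_of_nonneg hy] at b
    calc ‖B‖ * ‖P‖ ≤ (C₁ * Real.exp (-((1 : ℕ) * y)) * (1 + |t|) ^ (1 * k)) *
          (C₂ * Real.exp (y / 2 + 1 / 2 * y) * Real.exp (-t ^ 2 / 2)) := by gcongr
      _ = C₁ * C₂ * ((1 + |t|) ^ k * Real.exp (-t ^ 2 / 2)) * (Real.exp (-((1 : ℕ) * y)) * Real.exp (y / 2 + 1 / 2 * y)) := by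
          rw [one_mul]; ring
      _ = _ := by
          rw [← Real.exp_add, show -((1 : ℕ) * y : ℝ) + (y / 2 + 1 / 2 * y) = 0 by push_cast; ring, Real.exp_zero, mul_one]
  calc ‖B‖ ^ 2 * w ≤ (‖dirichletD k y t‖ ^ 2 - ‖P‖ ^ 2 + 2 * (‖B‖ * ‖P‖)) * w := by gcongr
    _ = ‖dirichletD k y t‖ ^ 2 * w - ‖P‖ ^ 2 * w + 2 * (‖B‖ * ‖P‖) * w := by ring
    _ ≤ ‖dirichletD k y t‖ ^ 2 * w - ‖P‖ ^ 2 * w + 2 * (‖B‖ * ‖P‖) := by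
        exact add_le_add le_rfl (mul_le_of_le_one_right (by positivity) hw1)
    _ ≤ ‖dirichletD k y t‖ ^ 2 * w - ‖P‖ ^ 2 * w + 2 * C₁ * C₂ * ((1 + |t|) ^ k * Real.exp (-t ^ 2 / 2)) := by
        linarith

/-- The mean square of the error, from a bound for sums of `Delta` over the shifts. -/
lemma exists_meanSq_le_of_sum_Delta_le {k : ℕ} (hk : 3 ≤ k) {ε η : ℝ} (hε : 0 < ε) (hη : 0 < η) (hη1 : η ≤ 1 / 4) :
    ∃ C x₀ : ℝ, 1 ≤ C ∧ 1 ≤ x₀ ∧ ∀ τ ρ y V : ℝ, 1 ≤ τ → τ ^ ε ≤ ρ → ρ ≤ τ → Real.log τ ≤ y → y ≤ k * Real.log τ →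
      x₀ ≤ Real.exp y / τ ^ (ε / 4) → τ ≤ Real.exp y / τ ^ (ε / 4) * ρ → 0 ≤ V →
      (∀ x ∈ Icc (Real.exp y / τ ^ (ε / 4)) (Real.exp y * τ ^ (ε / 4)), ∀ j : ℕ, 1 ≤ j →
        (j : ℝ) ≤ Real.exp y / τ ^ (ε / 4) * ρ / τ → |∑ h ∈ Finset.Icc 1 j, Delta k x h| ≤ V) →
      meanSq k y τ ≤ ENNReal.ofReal (C * (τ * (ρ ^ 4 * (τ ^ (ε / 4)) ^ 4) *
        ((Real.exp y * τ ^ (ε / 4)) ^ (6 * η) + V * (Real.exp y / τ ^ (ε / 4))⁻¹))) := by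
  obtain ⟨C₁, hC₁, h₁⟩ := exists_meanSq_le_sub k
  obtain ⟨C₂, hC₂, h₂⟩ := exists_integral_dirichletD_sq_le k hε
  obtain ⟨C₃, x₀, hC₃, hx₀, h₃⟩ := exists_le_integral_polarD_sq hk
  obtain ⟨C₄, hC₄, h₄⟩ := exists_tsum_coefD_sq_le k hη
  obtain ⟨C₅, hC₅, h₅⟩ := exists_abs_sum_integral_singularSeries_sub_le k hη hη1
  set s := √Real.pi with hs
  have hs0 : 0 ≤ s := Real.sqrt_nonneg _
  refine ⟨s * (C₄ + 2 * (C₅ + 18)) + (C₁ + C₂ + C₃), x₀, ?_, hx₀, ?_⟩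
  · have : 0 ≤ s * (C₄ + 2 * (C₅ + 18)) := by positivity
    linarith
  intro τ ρ y V hτ hτρ hρτ hy hyk hx1 hH1 hV0 hV
  have hτ0 : 0 < τ := by linarith
  have hy0 : 0 ≤ y := (Real.log_nonneg hτ).trans hy
  refine (h₁ y τ hy0 hτ0).trans (ENNReal.ofReal_le_ofReal ?_)
  have hD := h₂ τ ρ y hτ hτρ hρτ hy0 hyk
  set θ := τ ^ (ε / 4) with hθ
  have hθ1 : 1 ≤ θ := Real.one_le_rpow hτ (by positivity)
  have hθ0 : 0 < θ := by linarith
  have hρ : 1 ≤ ρ := (Real.one_le_rpow hτ hε.le).trans hτρ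
  set x₁ := Real.exp y / θ with hx₁
  set x₂ := Real.exp y * θ with hx₂
  have hx10 : 0 < x₁ := by positivity
  have hx12 : x₁ ≤ x₂ := by
    rw [hx₁, hx₂, div_le_iff₀ hθ0, mul_assoc]
    exact le_mul_of_one_le_right (Real.exp_pos y).le (by nlinarith)
  set H := ⌊x₁ * ρ / τ⌋₊ with hH
  have hHle : (H : ℝ) ≤ x₁ * ρ / τ := Nat.floor_le (by positivity)
  have hH1' : 1 ≤ H := Nat.le_floor (by rw [Nat.cast_one, le_div_iff₀ hτ0, one_mul]; exact hH1)
  have hHτ : τ * H ≤ x₁ * ρ := by rw [mul_comm]; exact (le_div_iff₀ hτ0).1 hHle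
  have herr := abs_sum_errorPart_le (k := k) (y := y) hV0 hρτ hρ hθ1 hHτ fun x hx j hj hjH =>
    hV x hx j hj (le_trans (by exact_mod_cast hjH) hHle)
  have hmain := h₅ y τ ρ θ H hH1' hρ hρτ hθ1 (hx₀.trans hx1) hHτ
  have hpol := h₃ y τ x₁ x₂ H hτ hy hx1 hx12 (Nat.cast_nonneg H)
  set M := ∫ x in x₁..x₂, Qk k x 1 ^ 2 * ∫ u in (0 : ℝ)..H, pairF y τ x u with hM
  have hoff : ∑ n ∈ Finset.Ioc ⌊x₁⌋₊ ⌊x₂⌋₊, ∑ h ∈ Finset.Icc 1 H, coefD k y n * coefD k y (n + h) * offKernel τ n (n + h) =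
      (∑ h ∈ Finset.Icc 1 H, ∫ x in x₁..x₂, pairF y τ x h * singularSeries k x h) +
        ∑ h ∈ Finset.Icc 1 H, errorPart k y τ x₁ x₂ h := by
    rw [Finset.sum_comm, ← Finset.sum_add_distrib]
    refine Finset.sum_congr rfl fun h hh => ?_
    rw [Finset.mem_Icc] at hh
    rw [← sum_pairF_eq k y τ (by omega) hx10 hx12]
    refine Finset.sum_congr rfl fun n hn => ?_
    rw [Finset.mem_Ioc] at hn
    exact coefD_mul_coefD_mul_offKernel k y τ (by omega) h
  rw [hoff] at hD
  set A := ∑ h ∈ Finset.Icc 1 H, ∫ x in x₁..x₂, pairF y τ x h * singularSeries k x h with hA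
  set E := ∑ h ∈ Finset.Icc 1 H, errorPart k y τ x₁ x₂ h with hE
  set X := x₂ ^ (6 * η) with hX
  have hx2exp : Real.exp y ≤ x₂ := le_mul_of_one_le_right (Real.exp_pos y).le hθ1
  have hX1 : 1 ≤ X := Real.one_le_rpow ((Real.one_le_exp hy0).trans hx2exp) (by positivity)
  have hdiag : ∑' n, coefD k y n ^ 2 ≤ C₄ * X := by
    refine (h₄ y).trans ?_
    gcongr
    rw [mul_comm, Real.exp_mul]
    calc _ ≤ x₂ ^ η := by gcongr
      _ ≤ _ := Real.rpow_le_rpow_of_exponent_le ((Real.one_le_exp hy0).trans hx2exp) (by linarith)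
  set R := ρ ^ 4 * θ ^ 4 with hR
  have hR1 : 1 ≤ R := one_le_mul_of_one_le_of_one_le (one_le_pow₀ hρ) (one_le_pow₀ hθ1)
  have hR2 : ρ ^ 2 * θ ^ 3 ≤ R := by
    rw [hR]; gcongr <;> first | assumption | norm_num
  set W := V * x₁⁻¹ with hW
  have hW0 : 0 ≤ W := by positivity
  have hA' : A ≤ M + C₅ * (R * X) := by
    have := (abs_le.1 hmain).2
    have h6 : C₅ * (ρ ^ 2 * θ ^ 3 * X) ≤ C₅ * (R * X) := by gcongr
    linarith
  have hE' : E ≤ 18 * (R * W) := by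
    have := (abs_le.1 herr).2
    calc E ≤ 18 * R * V * x₁⁻¹ := this
      _ = _ := by rw [hW]; ring
  have hXW : X ≤ X + W := by linarith
  have hRX : X ≤ R * (X + W) := hXW.trans (le_mul_of_one_le_left (by linarith) hR1)
  have hone : 1 ≤ τ * R * (X + W) := by
    rw [mul_assoc]; exact one_le_mul_of_one_le_of_one_le hτ (hX1.trans hRX)
  have hsum : ∑' n, coefD k y n ^ 2 + 2 * (A + E) ≤ 2 * M + (C₄ + 2 * (C₅ + 18)) * (R * (X + W)) := by
    have a1 : C₄ * X ≤ C₄ * (R * (X + W)) := by gcongr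
    have a2 : C₅ * (R * X) ≤ C₅ * (R * (X + W)) := by gcongr
    have a3 : R * W ≤ R * (X + W) := by gcongr; linarith
    linarith
  have hD' := hD.trans (add_le_add_left (mul_le_mul_of_nonneg_left hsum (by positivity : 0 ≤ s * τ)) C₂)
  -- The term 2sτM in the mean square of D is removed by the lower bound for the mean square of P.
  calc _ ≤ s * τ * (2 * M + (C₄ + 2 * (C₅ + 18)) * (R * (X + W))) + C₂ - (2 * (s * τ * M) - C₃) + C₁ := by
        linarith
    _ = s * (C₄ + 2 * (C₅ + 18)) * (τ * R * (X + W)) + (C₁ + C₂ + C₃) * 1 := by ring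
    _ ≤ s * (C₄ + 2 * (C₅ + 18)) * (τ * R * (X + W)) + (C₁ + C₂ + C₃) * (τ * R * (X + W)) := by gcongr
    _ = _ := by ring

/-! ### From the hypothesis on `G` to mean squares: choice of parameters -/

lemma exists_le_rpow (B : ℝ) {κ : ℝ} (hκ : 0 < κ) : ∃ τ₀ : ℝ, 1 ≤ τ₀ ∧ ∀ τ, τ₀ ≤ τ → B ≤ τ ^ κ := by
  obtain ⟨τ₀, h⟩ := (((tendsto_rpow_atTop hκ).eventually_ge_atTop B).and (eventually_ge_atTop 1)).exists_forall_of_atTop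
  exact ⟨max 1 τ₀, le_max_left _ _, fun τ hτ => (h τ ((le_max_right _ _).trans hτ)).1⟩

set_option maxHeartbeats 1000000 in
/-- The bound for the mean squares that follows from a bound for `G`. -/
lemma exists_meanSq_le_of_G_le {k : ℕ} (hk : 3 ≤ k) {a b c : ℝ} (hb : 1 ≤ b) (hc : 0 < c)
    (hG : ∃ ε₀ > 0, ∀ ε : ℝ, 0 < ε → ε < ε₀ →
      ∃ K T₀ : ℝ, ∀ T : ℝ, T₀ ≤ T → ∀ M : ℝ,
        T ^ (1 + ε) ≤ M → M ≤ c * T ^ ((k : ℝ) / 2) →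
          G k ε M T ≤ ENNReal.ofReal (K * T ^ (a + ε) * M ^ (b + ε))) {ε κ : ℝ} (hε : 0 < ε) (hκ : 0 < κ) :
    ∃ C τ₀ : ℝ, 1 ≤ C ∧ 1 ≤ τ₀ ∧ ∀ τ y : ℝ, τ₀ ≤ τ → 0 ≤ y → y ≤ (k / 2 - κ) * Real.log τ →
      meanSq k y τ ≤ ENNReal.ofReal (C * (τ ^ (1 + ε) * (1 + τ ^ (a + (k : ℝ) / 2 * (b - 1))))) := by
  obtain ⟨ε₀, hε₀, hG⟩ := hG
  have hk0 : (3 : ℝ) ≤ k := by exact_mod_cast hk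
  have hk' : (0 : ℝ) < k := by linarith
  -- The four conditions: δ < ε₀ makes the hypothesis available; δ ≤ κ leaves room for the factor θ
  -- = τ^{δ/4} below τ^{k/2}; δk ≤ 1 gives ρ ≤ τ, since ρ ≤ τ^{kδ/2}; and δ(3k+3) is the total loss
  -- in the exponent, namely 2kδ from ρ⁴, δ from θ⁴ and (k+2)δ from the last factor.
  obtain ⟨δ, hδ0, hδ1, hδ2, hδ3, hδ4⟩ : ∃ δ : ℝ, 0 < δ ∧ δ < ε₀ ∧ δ ≤ κ ∧ δ * (3 * k + 3) ≤ ε ∧ δ * k ≤ 1 := by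
    refine ⟨min (min (ε₀ / 2) κ) (min (ε / (3 * k + 3)) (1 / k)), by positivity, ?_, ?_, ?_, ?_⟩
    · exact (min_le_left _ _).trans_lt ((min_le_left _ _).trans_lt (by linarith))
    · exact (min_le_left _ _).trans (min_le_right _ _)
    · rw [← le_div_iff₀ (by positivity)]; exact (min_le_right _ _).trans (min_le_left _ _)
    · rw [← le_div_iff₀ hk']; exact (min_le_right _ _).trans (min_le_right _ _)
  have hδle : δ ≤ 1 := by nlinarith
  have hkδ : 0 < k * δ := mul_pos hk' hδ0
  obtain ⟨K, T₀, hG⟩ := hG δ hδ0 hδ1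
  obtain ⟨C₁, hC₁, h₁⟩ := exists_meanSq_le_of_short k hδ0 hδle
  obtain ⟨C₂, x₀, hC₂, hx₀, h₂⟩ := exists_meanSq_le_of_sum_Delta_le hk (η := δ / 4) hδ0 (by positivity) (by linarith)
  -- For τ ≥ τ₁, part of the room κ absorbs the constant c in the upper end of the admissible range.
  obtain ⟨τ₁, hτ₁, hcτ⟩ := exists_le_rpow (1 / c) (κ := κ * (3 / 4)) (by positivity)
  set K' := |K| + 1 with hK'
  have hK0 : 1 ≤ K' := by rw [hK']; linarith [abs_nonneg K]
  refine ⟨C₁ + C₂ * K', max (max T₀ x₀) τ₁, by nlinarith, hτ₁.trans (le_max_right _ _), fun τ y hτ hy hyk => ?_⟩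
  have hττ₁ : τ₁ ≤ τ := (le_max_right _ _).trans hτ
  have hτT : T₀ ≤ τ := (le_max_left _ _).trans ((le_max_left _ _).trans hτ)
  have hτx : x₀ ≤ τ := (le_max_right _ _).trans ((le_max_left _ _).trans hτ)
  have hτ1 : 1 ≤ τ := hτ₁.trans hττ₁
  have hτ0 : 0 < τ := by linarith
  have hlog : 0 ≤ Real.log τ := Real.log_nonneg hτ1
  have hpw : ∀ {u v : ℝ}, u ≤ v → τ ^ u ≤ τ ^ v := fun h => Real.rpow_le_rpow_of_exponent_le hτ1 h
  have hexp_le : ∀ {u : ℝ}, y ≤ u * Real.log τ → Real.exp y ≤ τ ^ u := fun h => by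
    rw [Real.rpow_def_of_pos hτ0, mul_comm]; exact Real.exp_le_exp.2 h
  have hle_exp : ∀ {u : ℝ}, u * Real.log τ ≤ y → τ ^ u ≤ Real.exp y := fun h => by
    rw [Real.rpow_def_of_pos hτ0, mul_comm]; exact Real.exp_le_exp.2 h
  set L := τ ^ (a + (k : ℝ) / 2 * (b - 1)) with hL
  have hL0 : 0 ≤ L := by positivity
  have hyk' : y ≤ k * Real.log τ := hyk.trans (by gcongr; linarith)
  -- The hypothesis says nothing below τ^{1+δ}, so the short range is treated separately. Above it,
  -- the window starts at e^y/θ ≥ τ^{1+δ}.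
  rcases le_total y ((1 + 3 * δ) * Real.log τ) with hcase | hcase
  · refine (h₁ τ y hτ1 hy hcase hyk').trans (ENNReal.ofReal_le_ofReal ?_)
    calc C₁ * τ ^ (1 + 8 * δ) ≤ C₁ * (τ ^ (1 + ε) * 1) := by
          rw [mul_one]; gcongr; nlinarith
      _ ≤ (C₁ + C₂ * K') * (τ ^ (1 + ε) * (1 + L)) := by
          gcongr
          · have : 0 ≤ C₂ * K' := by positivity
            linarith
          · linarith
  set θ := τ ^ (δ / 4) with hθ
  have hθ1 : 1 ≤ θ := Real.one_le_rpow hτ1 (by positivity)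
  have hθ0 : 0 < θ := by linarith
  set x₁ := Real.exp y / θ with hx₁
  set x₂ := Real.exp y * θ with hx₂
  have hx10 : 0 < x₁ := by positivity
  have hx1low : τ ^ (1 + δ) ≤ x₁ := by
    rw [hx₁, le_div_iff₀ hθ0, hθ, ← Real.rpow_add hτ0]
    exact (hpw (by linarith)).trans (hle_exp hcase)
  have hx1τ : τ ≤ x₁ := by
    refine le_trans ?_ hx1low
    calc τ = τ ^ (1 : ℝ) := (Real.rpow_one τ).symm
      _ ≤ _ := hpw (by linarith)
  have hx2up' : x₂ ≤ τ ^ ((k : ℝ) / 2 - κ * (3 / 4)) := by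
    calc x₂ ≤ τ ^ ((k : ℝ) / 2 - κ) * τ ^ (δ / 4) := by rw [hx₂]; gcongr; exact hexp_le hyk
      _ = τ ^ ((k : ℝ) / 2 - κ + δ / 4) := (Real.rpow_add hτ0 _ _).symm
      _ ≤ _ := hpw (by linarith)
  have hx2up : x₂ ≤ τ ^ ((k : ℝ) / 2) := hx2up'.trans (hpw (by linarith))
  have hx2c : x₂ ≤ c * τ ^ ((k : ℝ) / 2) := by
    refine hx2up'.trans ?_
    rw [Real.rpow_sub hτ0, div_le_iff₀ (by positivity)]
    have h1 : 1 ≤ c * τ ^ (κ * (3 / 4)) := by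
      have := hcτ τ hττ₁; rwa [div_le_iff₀' hc] at this
    calc τ ^ ((k : ℝ) / 2) = τ ^ ((k : ℝ) / 2) * 1 := (mul_one _).symm
      _ ≤ τ ^ ((k : ℝ) / 2) * (c * τ ^ (κ * (3 / 4))) := by gcongr
      _ = _ := by ring
  have hx12 : x₁ ≤ x₂ := by
    rw [hx₁, hx₂, div_le_iff₀ hθ0, mul_assoc]
    exact le_mul_of_one_le_right (Real.exp_pos y).le (by nlinarith)
  have hx1up : x₁ ≤ τ ^ ((k : ℝ) / 2) := hx12.trans hx2up
  -- The range of shifts x₁ρ/τ is then x₁^{1+δ}/τ, which lies in the range of t in `G` for every x ≥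
  -- x₁ of the window.
  set ρ := x₁ ^ δ with hρ
  have hρτ : τ ^ δ ≤ ρ := by rw [hρ]; gcongr
  have hρ1 : 1 ≤ ρ := Real.one_le_rpow (hτ1.trans hx1τ) hδ0.le
  have hρle : ρ ≤ τ ^ ((k : ℝ) / 2 * δ) := by
    rw [hρ, Real.rpow_mul hτ0.le]; gcongr
  have hρτ' : ρ ≤ τ := by
    refine hρle.trans ?_
    calc _ ≤ τ ^ (1 : ℝ) := hpw (by linarith)
      _ = τ := Real.rpow_one τ
  have hx20 : 0 < x₂ := by linarith
  set V := K' * τ ^ (a + δ) * x₂ ^ (b + δ) with hV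
  have hbound := h₂ τ ρ y V hτ1 hρτ hρτ' ((le_mul_of_one_le_left hlog (by linarith)).trans hcase) hyk' (hτx.trans hx1τ)
    (hx1τ.trans (le_mul_of_one_le_right hx10.le hρ1)) (by positivity) (fun x hx j hj hjx => by
      have hx0 : 0 < x := hx10.trans_le hx.1
      refine G_le_imp hx0.le (by positivity)
        ((hG τ hτT x (hx1low.trans hx.1) (hx.2.trans hx2c)).trans (ENNReal.ofReal_le_ofReal ?_)) hj (hjx.trans ?_)
      · rw [hV]
        gcongr
        · exact (le_abs_self K).trans (by rw [hK']; linarith)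
        · exact hx.2
      · rw [Real.rpow_add hx0, Real.rpow_one]
        gcongr
        · exact hx.1
        · exact Real.rpow_le_rpow hx10.le hx.1 hδ0.le)
  refine hbound.trans (ENNReal.ofReal_le_ofReal ?_)
  have e1 : ρ ^ 4 ≤ τ ^ (2 * k * δ) := by
    calc ρ ^ 4 ≤ (τ ^ ((k : ℝ) / 2 * δ)) ^ 4 := by gcongr
      _ = _ := by rw [← Real.rpow_natCast, ← Real.rpow_mul hτ0.le]; congr 1; push_cast; ring
  have e2 : θ ^ 4 = τ ^ δ := by
    rw [hθ, ← Real.rpow_natCast, ← Real.rpow_mul hτ0.le]; congr 1; push_cast; ring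
  have e3 : x₂ ^ (6 * (δ / 4)) ≤ τ ^ ((k + 2) * δ) := by
    calc _ ≤ (τ ^ ((k : ℝ) / 2)) ^ (6 * (δ / 4)) := by gcongr
      _ = τ ^ ((k : ℝ) / 2 * (6 * (δ / 4))) := (Real.rpow_mul hτ0.le _ _).symm
      _ ≤ _ := hpw (by linarith)
  have e4 : V * x₁⁻¹ ≤ K' * (τ ^ ((k + 2) * δ) * L) := by
    have hx1inv : x₁⁻¹ = θ ^ 2 * x₂⁻¹ := by rw [hx₁, hx₂]; field_simp
    have hθ2 : θ ^ 2 ≤ τ ^ δ := by rw [← e2]; exact pow_le_pow_right₀ hθ1 (by norm_num)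
    have hx2b : x₂ ^ (b + δ) * x₂⁻¹ ≤ τ ^ ((k : ℝ) / 2 * (b - 1 + δ)) := by
      rw [← Real.rpow_neg_one, ← Real.rpow_add hx20, Real.rpow_mul hτ0.le, show b + δ + -1 = b - 1 + δ by ring]
      gcongr
    calc V * x₁⁻¹ = K' * (τ ^ (a + δ) * (θ ^ 2 * (x₂ ^ (b + δ) * x₂⁻¹))) := by rw [hx1inv, hV]; ring
      _ ≤ K' * (τ ^ (a + δ) * (τ ^ δ * τ ^ ((k : ℝ) / 2 * (b - 1 + δ)))) := by gcongr
      _ = K' * τ ^ (a + δ + (δ + (k : ℝ) / 2 * (b - 1 + δ))) := by rw [Real.rpow_add hτ0 (a + δ), Real.rpow_add hτ0 δ]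
      _ ≤ K' * τ ^ ((k + 2) * δ + (a + (k : ℝ) / 2 * (b - 1))) := by
          gcongr K' * ?_
          exact hpw (by linarith)
      _ = _ := by rw [Real.rpow_add hτ0]
  calc C₂ * (τ * (ρ ^ 4 * θ ^ 4) * (x₂ ^ (6 * (δ / 4)) + V * x₁⁻¹)) ≤
        C₂ * (τ * (τ ^ (2 * k * δ) * τ ^ δ) * (K' * τ ^ ((k + 2) * δ) + K' * (τ ^ ((k + 2) * δ) * L))) := by
        rw [e2]
        gcongr
        exact e3.trans (le_mul_of_one_le_left (by positivity) hK0)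
    _ = C₂ * K' * (τ ^ (1 : ℝ) * (τ ^ (2 * k * δ) * τ ^ δ) * τ ^ ((k + 2) * δ) * (1 + L)) := by rw [Real.rpow_one]; ring
    _ = C₂ * K' * (τ ^ (1 + δ * (3 * k + 3)) * (1 + L)) := by
        rw [← Real.rpow_add hτ0, ← Real.rpow_add hτ0, ← Real.rpow_add hτ0,
          show (1 : ℝ) + (2 * k * δ + δ) + (k + 2) * δ = 1 + δ * (3 * k + 3) by ring]
    _ ≤ (C₁ + C₂ * K') * (τ ^ (1 + ε) * (1 + L)) := by
        gcongr
        · linarith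

/-! ### Dyadic moments of the zeta function and their summation -/

/-- Induction on the number of halvings. Because g at least doubles from T to 2T, the accumulated
error C g(T/2) plus the new one C g(T/2) is at most C g(T), so no logarithm is lost. -/
lemma le_add_of_dyadic {F g : ℝ → ℝ} {C T₀ : ℝ} (hC : 0 ≤ C) (hT₀ : 0 < T₀)
    (hF : ∀ T, T₀ ≤ T → T ≤ 2 * T₀ → F T ≤ F (2 * T₀)) (hg0 : ∀ T, T₀ ≤ T → 0 ≤ g T)
    (hg : ∀ T, T₀ ≤ T → 2 * g T ≤ g (2 * T)) (h : ∀ T, T₀ ≤ T → F (2 * T) ≤ F T + C * g T) {T : ℝ} (hT : T₀ ≤ T) :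
    F T ≤ F (2 * T₀) + C * g T := by
  have key : ∀ n : ℕ, ∀ T, T₀ ≤ T → T ≤ 2 ^ n * (2 * T₀) → F T ≤ F (2 * T₀) + C * g T := by
    intro n
    induction n with
    | zero =>
      intro T h1 h2
      rw [pow_zero, one_mul] at h2
      have := hF T h1 h2
      have := mul_nonneg hC (hg0 T h1)
      linarith
    | succ n ih =>
      intro T h1 h2
      rcases le_total T (2 * T₀) with h3 | h3
      · have := hF T h1 h3
        have := mul_nonneg hC (hg0 T h1)
        linarith
      · have e : 2 * (T / 2) = T := by ring
        have h4 : T₀ ≤ T / 2 := by linarith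
        have h5 := ih (T / 2) h4 (by rw [pow_succ] at h2; linarith)
        have h6 := h (T / 2) h4
        have h7 := mul_le_mul_of_nonneg_left (hg (T / 2) h4) hC
        rw [e] at h6 h7
        linarith
  obtain ⟨n, hn⟩ := pow_unbounded_of_one_lt (T / (2 * T₀)) (one_lt_two (α := ℝ))
  exact key n T hT ((div_le_iff₀ (by positivity)).1 hn.le)

lemma continuous_norm_riemannZeta_half_pow (n : ℕ) :
    Continuous fun t : ℝ => ‖riemannZeta (1 / 2 + (t : ℂ) * I)‖ ^ n := by
  refine (Continuous.norm ?_).pow n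
  refine continuous_iff_continuousAt.2 fun t => ?_
  have h : (1 / 2 + (t : ℂ) * I) ≠ 1 := fun h => by
    have := congrArg re h
    norm_num at this
  exact (differentiableAt_riemannZeta h).continuousAt.comp (f := fun t : ℝ => 1 / 2 + (t : ℂ) * I) (by fun_prop)

lemma intervalIntegral_le_of_lintegral_le {k : ℕ} {T B : ℝ} (hT : 0 ≤ T) (hB : 0 ≤ B)
    (h : ∫⁻ t in Icc T (2 * T), ‖riemannZeta (1 / 2 + t * I) ^ k‖ₑ ^ 2 ≤ ENNReal.ofReal B) :
    ∫ t in T..(2 * T), ‖riemannZeta (1 / 2 + (t : ℂ) * I)‖ ^ (2 * k) ≤ B := by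
  rw [← ENNReal.ofReal_le_ofReal_iff hB, intervalIntegral.integral_of_le (by linarith), ← integral_Icc_eq_integral_Ioc,
    ofReal_integral_eq_lintegral_ofReal (continuous_norm_riemannZeta_half_pow _).continuousOn.integrableOn_Icc
      (Eventually.of_forall fun t => by positivity)]
  refine le_trans (le_of_eq (lintegral_congr fun t => ?_)) h
  rw [enorm_pow, ← pow_mul, mul_comm k 2, ENNReal.ofReal_pow (norm_nonneg _), ofReal_norm]

lemma exists_one_add_log_le {ε : ℝ} (hε : 0 < ε) {B : ℝ} (hB : 0 ≤ B) :
    ∃ D : ℝ, 1 ≤ D ∧ ∀ T : ℝ, 1 ≤ T → (1 + Real.log (1 + 2 * T)) ^ 2 * (1 + B * Real.log T) ^ 2 ≤ D * T ^ (4 * ε) := by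
  set D₁ := 4 + B + (1 + B) / ε with hD₁
  have hD1 : 1 ≤ D₁ := by
    have : 0 ≤ (1 + B) / ε := by positivity
    linarith
  refine ⟨D₁ ^ 2 * D₁ ^ 2, one_le_mul_of_one_le_of_one_le (one_le_pow₀ hD1) (one_le_pow₀ hD1), fun T hT => ?_⟩
  have hT0 : 0 < T := by linarith
  have hTε : 1 ≤ T ^ ε := Real.one_le_rpow hT hε.le
  have hlog : Real.log T ≤ T ^ ε / ε := Real.log_le_rpow_div hT0.le hε
  have hlog0 := Real.log_nonneg hT
  have h3 : Real.log (1 + 2 * T) ≤ 2 + Real.log T := by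
    calc _ ≤ Real.log (3 * T) := Real.log_le_log (by positivity) (by linarith)
      _ = Real.log 3 + Real.log T := Real.log_mul (by norm_num) hT0.ne'
      _ ≤ _ := by
        have := Real.log_le_sub_one_of_pos (show (0 : ℝ) < 3 by norm_num)
        linarith
  have h30 : 0 ≤ Real.log (1 + 2 * T) := Real.log_nonneg (by linarith)
  have hBε : 0 ≤ B / ε * T ^ ε := by positivity
  have hBT : 0 ≤ B * T ^ ε := by positivity
  have hεT : 0 ≤ T ^ ε / ε := by positivity
  have e : D₁ * T ^ ε = 4 * T ^ ε + B * T ^ ε + T ^ ε / ε + B / ε * T ^ ε := by rw [hD₁]; ring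
  have h1 : 1 + Real.log (1 + 2 * T) ≤ D₁ * T ^ ε := by rw [e]; linarith
  have h2 : 1 + B * Real.log T ≤ D₁ * T ^ ε := by
    have : B * Real.log T ≤ B / ε * T ^ ε := by
      calc _ ≤ B * (T ^ ε / ε) := by gcongr
        _ = _ := by ring
    rw [e]; linarith
  calc _ ≤ (D₁ * T ^ ε) ^ 2 * (D₁ * T ^ ε) ^ 2 := by gcongr
    _ = D₁ ^ 2 * D₁ ^ 2 * (T ^ ε) ^ 4 := by ring
    _ = _ := by rw [← Real.rpow_natCast (T ^ ε), ← Real.rpow_mul hT0.le]; congr 2; push_cast; ring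

/-- The bound for a dyadic moment of the zeta function. -/
lemma exists_dyadic_moment_le {k : ℕ} (hk : 3 ≤ k) {a b c : ℝ} (ha : 0 ≤ a) (hb : 1 ≤ b) (hc : 0 < c)
    (hG : ∃ ε₀ > 0, ∀ ε : ℝ, 0 < ε → ε < ε₀ →
      ∃ K T₀ : ℝ, ∀ T : ℝ, T₀ ≤ T → ∀ M : ℝ,
        T ^ (1 + ε) ≤ M → M ≤ c * T ^ ((k : ℝ) / 2) →
          G k ε M T ≤ ENNReal.ofReal (K * T ^ (a + ε) * M ^ (b + ε))) {ε : ℝ} (hε : 0 < ε) :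
    ∃ C T₀ : ℝ, 1 ≤ C ∧ 1 ≤ T₀ ∧ ∀ T : ℝ, T₀ ≤ T →
      ∫ t in T..(2 * T), ‖riemannZeta (1 / 2 + (t : ℂ) * I)‖ ^ (2 * k) ≤
        C * (T ^ (1 + ε) * (1 + T ^ (a + (k : ℝ) / 2 * (b - 1)))) := by
  have hk0 : (3 : ℝ) ≤ k := by exact_mod_cast hk
  set A := a + (k : ℝ) / 2 * (b - 1) with hA
  have hA0 : 0 ≤ A := add_nonneg ha (mul_nonneg (by positivity) (by linarith))
  -- Since σ - 1 ≤ 2κ, the last condition says that replacing the width T by T^σ costs at most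
  -- T^{ε/4}.
  obtain ⟨κ, hκ0, hκ1, hκ2⟩ : ∃ κ : ℝ, 0 < κ ∧ κ ≤ 1 / 2 ∧ 2 * κ * (1 + ε / 4 + A) ≤ ε / 4 := by
    refine ⟨min (1 / 2) (ε / 8 / (1 + ε / 4 + A)), by positivity, min_le_left _ _, ?_⟩
    have := min_le_right (1 / 2) (ε / 8 / (1 + ε / 4 + A))
    rw [le_div_iff₀ (by positivity)] at this
    linarith
  -- With τ = T^σ, the largest y allowed by the mean square bound, (k/2-κ) log τ, equals the length
  -- Y = (k/2+κ) log T required by the functional equation.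
  set σ := ((k : ℝ) / 2 + κ) / (k / 2 - κ) with hσ
  have hden : 1 ≤ (k : ℝ) / 2 - κ := by linarith
  have hσeq : ((k : ℝ) / 2 - κ) * σ = k / 2 + κ := by
    rw [hσ, mul_div_cancel₀ _ (by linarith : 0 < (k : ℝ) / 2 - κ).ne']
  have hσ1 : 1 ≤ σ := by rw [hσ, le_div_iff₀ (by linarith)]; linarith
  have hσ2 : σ - 1 ≤ 2 * κ := by
    rw [hσ, sub_le_iff_le_add, div_le_iff₀ (by linarith)]; nlinarith
  -- The tail condition needs (2m-1)(k/2+κ) ≥ mk + 1, that is, 2mκ ≥ k/2 + κ + 1: the excess κ is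
  -- amplified by moving the line far enough to the left.
  obtain ⟨m₀, hm₀⟩ := exists_nat_ge (((k : ℝ) / 2 + κ + 1) / (2 * κ))
  set m := m₀ + 2 with hm
  have hm2 : (k : ℝ) / 2 + κ + 1 ≤ m * (2 * κ) := by
    rw [div_le_iff₀ (by positivity)] at hm₀
    refine hm₀.trans ?_
    rw [hm]; push_cast; gcongr; linarith
  obtain ⟨C₁, τ₀, hC₁, hτ₀, h₁⟩ := exists_meanSq_le_of_G_le hk hb hc hG (ε := ε / 4) (by positivity) hκ0
  rw [← hA] at h₁
  clear_value A
  obtain ⟨C₂, hC₂, h₂⟩ := exists_moment_le_meanSq k (m := m) (by omega)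
  obtain ⟨D, hD, hlogs⟩ := exists_one_add_log_le (ε := ε / 16) (by positivity) (B := (k : ℝ) / 2 + κ) (by positivity)
  -- The threshold 8(k/2+κ) ensures 2Y ≤ T²/4, and 3^{mk} absorbs the constant in (1+2T)^{mk} ≤
  -- (3T)^{mk} at the cost of one power of T.
  refine ⟨C₂ * D * (1 + C₁), max (max τ₀ 2) (max (8 * (k / 2 + κ)) (3 ^ (m * k))), ?_, ?_, fun T hT => ?_⟩
  · exact one_le_mul_of_one_le_of_one_le (one_le_mul_of_one_le_of_one_le hC₂ hD) (by linarith)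
  · exact hτ₀.trans ((le_max_left _ _).trans (le_max_left _ _))
  have hTτ : τ₀ ≤ T := (le_max_left _ _).trans ((le_max_left _ _).trans hT)
  have hT2 : 2 ≤ T := (le_max_right _ _).trans ((le_max_left _ _).trans hT)
  have hTk : 8 * (k / 2 + κ) ≤ T := (le_max_left _ _).trans ((le_max_right _ _).trans hT)
  have hTm : (3 : ℝ) ^ (m * k) ≤ T := (le_max_right _ _).trans ((le_max_right _ _).trans hT)
  have hT1 : 1 ≤ T := by linarith
  have hT0 : 0 < T := by linarith
  have hpw : ∀ {u v : ℝ}, u ≤ v → T ^ u ≤ T ^ v := fun h => Real.rpow_le_rpow_of_exponent_le hT1 h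
  have hlog0 := Real.log_nonneg hT1
  set τ := T ^ σ with hτ
  have hTτ' : T ≤ τ := by
    calc T = T ^ (1 : ℝ) := (Real.rpow_one T).symm
      _ ≤ _ := hpw hσ1
  set Y := ((k : ℝ) / 2 + κ) * Real.log T with hY
  have hY0 : 0 ≤ Y := by positivity
  have hYτ : Y = (k / 2 - κ) * Real.log τ := by
    rw [hτ, Real.log_rpow hT0, ← mul_assoc, hσeq]
  have hYT : 2 * Y ≤ T ^ 2 / 4 := by
    have : Real.log T ≤ T := Real.log_le_self hT0.le
    calc 2 * Y ≤ 2 * (((k : ℝ) / 2 + κ) * T) := by rw [hY]; gcongr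
      _ = (8 * (k / 2 + κ)) * T / 4 := by ring
      _ ≤ T * T / 4 := by gcongr
      _ = _ := by ring
  have htail : Real.exp (-((2 * m - 1) * Y)) * (1 + 2 * T) ^ (m * k) ≤ 1 := by
    have e1 : Real.exp (-((2 * m - 1) * Y)) = T ^ (-((2 * m - 1) * ((k : ℝ) / 2 + κ))) := by
      rw [Real.rpow_def_of_pos hT0, hY]; congr 1; ring
    calc _ ≤ T ^ (-((2 * m - 1) * ((k : ℝ) / 2 + κ))) * (3 * T) ^ (m * k) := by rw [e1]; gcongr; linarith
      _ = T ^ (-((2 * m - 1) * ((k : ℝ) / 2 + κ))) * (3 ^ (m * k) * T ^ ((m : ℝ) * k)) := by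
          rw [mul_pow, ← Real.rpow_natCast T]; push_cast; rfl
      _ ≤ T ^ (-((2 * m - 1) * ((k : ℝ) / 2 + κ))) * (T ^ (1 : ℝ) * T ^ ((m : ℝ) * k)) := by
          rw [Real.rpow_one]; gcongr
      _ = T ^ (-((2 * m - 1) * ((k : ℝ) / 2 + κ)) + (1 + (m : ℝ) * k)) := by
          rw [← Real.rpow_add hT0, ← Real.rpow_add hT0]
      _ ≤ T ^ (0 : ℝ) := hpw (by nlinarith)
      _ = 1 := Real.rpow_zero T
  set Λ := C₁ * (τ ^ (1 + ε / 4) * (1 + τ ^ A)) with hΛ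
  have hΛ0 : 0 ≤ Λ := by positivity
  have hmom := h₂ T τ Y (ENNReal.ofReal Λ) hT2 hTτ' hY0 hYT htail fun y hy hyY =>
    h₁ τ y (hTτ.trans hTτ') hy (hyY.trans_eq hYτ)
  rw [← ENNReal.ofReal_add hT0.le hΛ0, ← ENNReal.ofReal_mul (by positivity)] at hmom
  refine intervalIntegral_le_of_lintegral_le hT0.le (by positivity) (hmom.trans (ENNReal.ofReal_le_ofReal ?_))
  have hTA : 0 ≤ T ^ A := by positivity
  have hsum : T + Λ ≤ (1 + C₁) * (T ^ (1 + ε / 2) * (1 + T ^ A)) := by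
    have e1 : τ ^ (1 + ε / 4) * (1 + τ ^ A) ≤ T ^ (1 + ε / 2) * (1 + T ^ A) := by
      have f1 : τ ^ (1 + ε / 4) = T ^ (σ * (1 + ε / 4)) := (Real.rpow_mul hT0.le _ _).symm
      have f2 : τ ^ A = T ^ ((σ - 1) * A) * T ^ A := by
        rw [hτ, ← Real.rpow_mul hT0.le, ← Real.rpow_add hT0]; congr 1; ring
      have f3 : 1 ≤ T ^ ((σ - 1) * A) := Real.one_le_rpow hT1 (mul_nonneg (by linarith) hA0)
      have f4 : 1 + T ^ ((σ - 1) * A) * T ^ A ≤ T ^ ((σ - 1) * A) * (1 + T ^ A) := by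
        rw [mul_add, mul_one]; linarith
      calc _ ≤ T ^ (σ * (1 + ε / 4)) * (T ^ ((σ - 1) * A) * (1 + T ^ A)) := by
            rw [f1, f2]; exact mul_le_mul_of_nonneg_left f4 (by positivity)
        _ = T ^ (σ * (1 + ε / 4) + (σ - 1) * A) * (1 + T ^ A) := by rw [Real.rpow_add hT0, mul_assoc]
        _ ≤ _ := by
            gcongr ?_ * _
            refine hpw ?_
            have : (σ - 1) * (1 + ε / 4 + A) ≤ 2 * κ * (1 + ε / 4 + A) := by gcongr
            linarith
    have e2 : T ≤ T ^ (1 + ε / 2) * (1 + T ^ A) := by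
      calc T = T ^ (1 : ℝ) * 1 := by rw [Real.rpow_one, mul_one]
        _ ≤ _ := by
          gcongr
          · linarith
          · linarith
    have e3 : Λ ≤ C₁ * (T ^ (1 + ε / 2) * (1 + T ^ A)) := by rw [hΛ]; gcongr
    linarith
  calc C₂ * (1 + Real.log (1 + 2 * T)) ^ 2 * (1 + Y) ^ 2 * (T + Λ) =
        C₂ * ((1 + Real.log (1 + 2 * T)) ^ 2 * (1 + ((k : ℝ) / 2 + κ) * Real.log T) ^ 2) * (T + Λ) := by rw [hY]; ring
    _ ≤ C₂ * (D * T ^ (4 * (ε / 16))) * ((1 + C₁) * (T ^ (1 + ε / 2) * (1 + T ^ A))) := by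
        exact mul_le_mul (mul_le_mul_of_nonneg_left (hlogs T hT1) (by positivity)) hsum (by positivity) (by positivity)
    _ = C₂ * D * (1 + C₁) * (T ^ (4 * (ε / 16)) * T ^ (1 + ε / 2) * (1 + T ^ A)) := by ring
    _ ≤ _ := by
        rw [← Real.rpow_add hT0]
        exact mul_le_mul_of_nonneg_left (mul_le_mul_of_nonneg_right (hpw (by linarith)) (by positivity)) (by positivity)

end AdditiveDivisor

end

theorem corollary1 (k : ℕ) (hk : 3 ≤ k) (a b : ℝ) (ha : 0 ≤ a) (hb : 1 ≤ b)
    (c : ℝ) (hc : 0 < c)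
    (hG : ∃ ε₀ > 0, ∀ ε : ℝ, 0 < ε → ε < ε₀ →
      ∃ K T₀ : ℝ, ∀ T : ℝ, T₀ ≤ T → ∀ M : ℝ,
        T ^ (1 + ε) ≤ M → M ≤ c * T ^ ((k : ℝ) / 2) →
          AdditiveDivisor.G k ε M T ≤ ENNReal.ofReal (K * T ^ (a + ε) * M ^ (b + ε))) :
    ∀ ε : ℝ, 0 < ε →
      ∃ K T₀ : ℝ, ∀ T : ℝ, T₀ ≤ T →
        ∫ t in (0 : ℝ)..T, ‖riemannZeta (1 / 2 + (t : ℂ) * Complex.I)‖ ^ (2 * k) ≤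
          K * (T ^ (1 + ε) * (1 + T ^ (a + (k : ℝ) / 2 * (b - 1)))) := by
  intro ε hε
  obtain ⟨C, T₀, hC, hT₀, h⟩ := AdditiveDivisor.exists_dyadic_moment_le hk ha hb hc hG hε
  have hA0 : 0 ≤ a + (k : ℝ) / 2 * (b - 1) := add_nonneg ha (mul_nonneg (by positivity) (by linarith))
  set A := a + (k : ℝ) / 2 * (b - 1) with hA
  set f : ℝ → ℝ := fun t => ‖riemannZeta (1 / 2 + (t : ℂ) * Complex.I)‖ ^ (2 * k) with hf
  have hfc : Continuous f := AdditiveDivisor.continuous_norm_riemannZeta_half_pow (2 * k)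
  have hf0 : ∀ t, 0 ≤ f t := fun t => by positivity
  have hfi : ∀ u v : ℝ, IntervalIntegrable f MeasureTheory.volume u v := fun u v => hfc.intervalIntegrable u v
  have hadd : ∀ u v : ℝ, ∫ t in (0 : ℝ)..v, f t = (∫ t in (0 : ℝ)..u, f t) + ∫ t in u..v, f t := fun u v =>
    (intervalIntegral.integral_add_adjacent_intervals (hfi 0 u) (hfi u v)).symm
  refine ⟨(∫ t in (0 : ℝ)..(2 * T₀), f t) + C, T₀, fun T hT => ?_⟩
  have hT1 : 1 ≤ T := hT₀.trans hT
  have hdy := AdditiveDivisor.le_add_of_dyadic (F := fun T => ∫ t in (0 : ℝ)..T, f t)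
    (g := fun T => T ^ (1 + ε) * (1 + T ^ A)) (by linarith : 0 ≤ C) (by linarith : 0 < T₀)
    (fun T _ h2 => by
      simp only [hadd T (2 * T₀), le_add_iff_nonneg_right]
      exact intervalIntegral.integral_nonneg h2 fun t _ => hf0 t)
    (fun T h1 => by
      have : 0 ≤ T := by linarith
      positivity)
    (fun T h1 => by
      have hT0 : 0 ≤ T := by linarith
      simp only [Real.mul_rpow zero_le_two hT0]
      have h2 : (2 : ℝ) ≤ 2 ^ (1 + ε) := by
        calc (2 : ℝ) = 2 ^ (1 : ℝ) := (Real.rpow_one 2).symm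
          _ ≤ _ := Real.rpow_le_rpow_of_exponent_le one_le_two (by linarith)
      have h3 : (1 : ℝ) ≤ 2 ^ A := Real.one_le_rpow one_le_two hA0
      calc 2 * (T ^ (1 + ε) * (1 + T ^ A)) = 2 * T ^ (1 + ε) * (1 + 1 * T ^ A) := by ring
        _ ≤ 2 ^ (1 + ε) * T ^ (1 + ε) * (1 + 2 ^ A * T ^ A) := by gcongr)
    (fun T h1 => by
      simp only [hadd T (2 * T)]
      exact add_le_add le_rfl (h T h1)) hT
  have hone : 1 ≤ T ^ (1 + ε) * (1 + T ^ A) :=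
    one_le_mul_of_one_le_of_one_le (Real.one_le_rpow hT1 (by linarith))
      (le_add_of_nonneg_right (Real.rpow_nonneg (by linarith) _))
  have hF0 : 0 ≤ ∫ t in (0 : ℝ)..(2 * T₀), f t := intervalIntegral.integral_nonneg (by linarith) fun t _ => hf0 t
  calc ∫ t in (0 : ℝ)..T, f t ≤ (∫ t in (0 : ℝ)..(2 * T₀), f t) + C * (T ^ (1 + ε) * (1 + T ^ A)) := hdy
    _ ≤ (∫ t in (0 : ℝ)..(2 * T₀), f t) * (T ^ (1 + ε) * (1 + T ^ A)) + C * (T ^ (1 + ε) * (1 + T ^ A)) := by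
        gcongr
        exact le_mul_of_one_le_right hF0 hone
    _ = _ := by ring
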